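/- Let $k$ be a commutative ring, $A$ a $k$-algebra and $H$ a Hopf algebra over $k$ (Sweedler notation $\Delta(h)=h^{(1)}\otimes h^{(2)}$; $\otimes=\otimes_k$). Let $(h,a)\mapsto a^h$ be a weak action of $H$ on $A$, i.e. a bilinear map $H\times A\to A$ with $(ab)^h=a^{h^{(1)}}b^{h^{(2)}}$, $1^h=\epsilon(h)1$ and $a^1=a$, and let $f\colon H\otimes H\to A$ be a $k$-linear map such that $E=A\#_fH$, that is $A\otimes H$ with the multiplication $$(a\# h)(b\# l)=a\,b^{h^{(1)}}f(h^{(2)},l^{(1)})\# h^{(3)}l^{(2)},$$ is associative with identity $1\#1$ (so $E$ is a crossed product). Identify $a\in A$ with $a\#1\in E$. Let $M$ be an $E$-bimodule (symmetric over $k$). *Notation.* For a $k$-algebra $B$ put $\overline B=B/k$ and let $\overline B^{\,n}$ be its $n$-fold tensor power. Write $\mathbf h_{ij}=h_i\otimes\cdots\otimes h_j$ and $\mathfrak h_{ij}=h_i\cdots h_j$, and likewise $\mathbf a_{ij}$; $\mathbf h^{(1)}\otimes\mathbf h^{(2)}\otimes\cdots$ is the factorwise comultiplication. For $\mathbf h=h_1\otimes\cdots\otimes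 h_s$ put $a^{\overline{\mathbf h}}=(\cdots(a^{h_s})^{h_{s-1}}\cdots)^{h_1}$, and let $\overline{\mathbf h}$ or $h\in H$ act on $\mathbf a=a_1\otimes\cdots\otimes a_r$ through the comultiplication: $\mathbf a^{\overline{\mathbf h}}=a_1^{\overline{\mathbf h^{(1)}}}\otimes\cdots\otimes a_r^{\overline{\mathbf h^{(r)}}}$. Define $F_r^{(l)}\colon\overline H^{\,l}\otimes\overline A^{\,r}\to\overline A^{\,r+l-1}$ for $l\ge2$, $r\ge 0$ by $$F_r^{(2)}(\mathbf h_{12}\otimes\mathbf a)=\sum_{i=0}^r(-1)^{i+1}\,\mathbf a_{1i}^{\overline{\mathbf h_{12}^{(1)}}}\otimes f(h_1^{(2)},h_2^{(2)})\otimes\mathbf a_{i+1,r}^{\mathfrak h_{12}^{(3)}},$$ $$F_r^{(l+1)}(\mathbf h_{1,l+1}\otimes\mathbf a)=\sum_{j=1}^l\sum_{i=0}^r(-1)^{il+j}\,\mathbf a_{1i}^{\overline{\mathbf h_{1,l+1}^{(1)}}}\otimes f(h_j^{(2)},h_{j+1}^{(2)})^{\overline{\mathbf h_{1,j-1}^{(2)}}}\otimes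 F_{r-i}^{(l)}\bigl(\mathbf h_{1,j-1}^{(3)}\otimes h_j^{(3)}h_{j+1}^{(3)}\otimes\mathbf h_{j+2,l+1}^{(2)}\otimes\mathbf a_{i+1,r}\bigr),$$ where an empty tensor $\mathbf a_{10}$ or $\mathbf a_{r+1,r}$ is $1\in k$. *The complex $\widehat X$.* Let $\widehat X_n=\bigoplus_{r+s=n}M\otimes\overline H^{\,s}\otimes\overline A^{\,r}$ and let $\widehat d_n\colon\widehat X_n\to\widehat X_{n-1}$ be the sum of the maps $\widehat d^{\,l}_{rs}\colon M\otimes\overline H^{\,s}\otimes\overline A^{\,r}\to M\otimes\overline H^{\,s-l}\otimes\overline A^{\,r+l-1}$ ($0\le l\le s$, $r+l>0$, $r+s=n$) given, on $\mathbf x=m\otimes\mathbf h\otimes\mathbf a$ with $\mathbf h=\mathbf h_{1s}$, $\mathbf a=\mathbf a_{1r}$, by $$\widehat d^{\,0}_{rs}(\mathbf x)=m\,a_1^{\overline{\mathbf h^{(1)}}}\otimes\mathbf h^{(2)}\otimes\mathbf a_{2r}+\sum_{i=1}^{r-1}(-1)^i m\otimes\mathbf h\otimes\mathbf a_{1,i-1}\otimes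 a_ia_{i+1}\otimes\mathbf a_{i+2,r}+(-1)^r a_rm\otimes\mathbf h\otimes\mathbf a_{1,r-1},$$ $$\widehat d^{\,1}_{rs}(\mathbf x)=(-1)^r m(1\#h_1)\otimes\mathbf h_{2s}\otimes\mathbf a+\sum_{i=1}^{s-1}(-1)^{r+i}m\,f(h_i^{(1)},h_{i+1}^{(1)})^{\overline{\mathbf h_{1,i-1}^{(1)}}}\otimes\mathbf h_{1,i-1}^{(2)}\otimes h_i^{(2)}h_{i+1}^{(2)}\otimes\mathbf h_{i+2,s}\otimes\mathbf a+(-1)^{r+s}(1\#h_s^{(2)})m\otimes\mathbf h_{1,s-1}\otimes\mathbf a^{h_s^{(1)}},$$ and, for $l\ge2$, $$\widehat d^{\,l}_{rs}(\mathbf x)=(-1)^{l(r+s)}(1\#\mathfrak h_{s-l+1,s}^{(2)})m\otimes\mathbf h_{1,s-l}\otimes F_r^{(l)}(\mathbf h_{s-l+1,s}^{(1)}\otimes\mathbf a).$$ Filter $\widehat X$ by $F^p(\widehat X_n)=\bigoplus_{s\le p}M\otimes\overline H^{\,s}\otimes\overline A^{\,n-s}$. *The Hochschild complex.* Let $(M\otimes\overline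 E^{\,*},b_*)$ be the normalized Hochschild complex of $E$ with coefficients in $M$, and let $F^p(M\otimes\overline E^{\,n})$ be the submodule generated by the $m\otimes x_1\otimes\cdots\otimes x_n$ such that at least $n-p$ of the $x_j$ belong to $A$. The spectral sequence of this filtration is the homological Hochschild–Serre spectral sequence of $E$ with coefficients in $M$. **Theorem.** (1) $\widehat d\,\widehat d=0$, so $(\widehat X_*,\widehat d_*)$ with the filtration $F^p$ is a filtered complex. Its spectral sequence has $$E^1_{rs}\simeq \mathrm H_r(A,M\otimes\overline H^{\,s})\qquad(r,s\ge0;\ s\text{ the filtration degree, }r+s\text{ the total degree}),$$ where $M\otimes\overline H^{\,s}$ is an $A$-bimodule by $a(m\otimes\mathbf h)a'=a\,m\,a'^{\,\overline{\mathbf h^{(1)}}}\otimes\mathbf h^{(2)}$ and Hochschild homology is that of the normalized complex. (2) The homological Hochschild–Serre spectral sequence is isomorphic to the spectral sequence of the filtered complex $\widehat X$, as convergent spectral sequences from the page $E^1$ on: there are isomorphisms of all the pages $E^r$, $r\ge1$, that commute with the differentials and with the identifications of $\mathrm H(E^r)$ with $E^{r+1}$, and there are isomorphisms $\mathrm H_n(E,M)\simeq\mathrm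 H_n(\widehat X_*)$ of the abutments that, in both directions, preserve the filtrations and are compatible with the isomorphisms of the pages (a class represented by a cycle $z\in F^p$ goes to the class of a cycle $y\in F^p$ such that, on each page $E^r$, $r\ge1$, the class of $z$ in filtration degree $p$ goes to the class of $y$). In particular both spectral sequences converge to $\mathrm H_{*}(E,M)$. -/

import Mathlib

set_option linter.unusedSectionVars false

open CategoryTheory TensorProduct

universe u w

/-- A chain complex of `k`-modules in nonnegative degrees with an increasing filtration by
subcomplexes `F p`, `p ∈ ℤ`. -/
structure FilteredComplex (k : Type u) [CommRing k] where
  /-- the underlying chain complex -/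
  K : ChainComplex (ModuleCat.{w} k) ℕ
  /-- `F p n` is the `p`-th filtration submodule of the chains of degree `n` -/
  F : ℤ → ∀ n : ℕ, Submodule k (K.X n)
  mono : ∀ (p q : ℤ) (n : ℕ), p ≤ q → F p n ≤ F q n
  d_mem : ∀ (p : ℤ) (i j : ℕ) (x : K.X i), x ∈ F p i → (K.d i j).hom x ∈ F p j

/-- If `φ : P → S.X₂` has for image the cycles of `S`, and `N` is the inverse image of the
boundaries, then `φ` identifies `P ⧸ N` with the homology of `S`. -/
noncomputable def homologyIsoOfCycles {k : Type u} [CommRing k]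
    (S : ShortComplex (ModuleCat.{w} k)) {P : Type w} [AddCommGroup P] [Module k P]
    (φ : P →ₗ[k] S.X₂) (hφ : ∀ x, S.g.hom x = 0 ↔ ∃ z, φ z = x) (N : Submodule k P)
    (hN : ∀ z, z ∈ N ↔ ∃ y, S.f.hom y = φ z) :
    S.homology ≅ ModuleCat.of k (P ⧸ N) :=
  let ψ : P →ₗ[k] (LinearMap.ker S.g.hom ⧸ LinearMap.range S.moduleCatToCycles) :=
    (LinearMap.range S.moduleCatToCycles).mkQ ∘ₗ
      φ.codRestrict (LinearMap.ker S.g.hom) fun z => (hφ _).2 ⟨z, rfl⟩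
  have hψ : Function.Surjective ψ := fun y => by
    obtain ⟨⟨y, hy⟩, rfl⟩ := Submodule.Quotient.mk_surjective _ y
    obtain ⟨z, rfl⟩ := (hφ y).1 hy
    exact ⟨z, rfl⟩
  have hker : N = LinearMap.ker ψ := by
    ext z
    refine (hN z).trans (Iff.trans ?_ (Submodule.Quotient.mk_eq_zero _).symm)
    exact ⟨fun ⟨y, hy⟩ => ⟨y, Subtype.ext hy⟩, fun ⟨y, hy⟩ => ⟨y, congrArg Subtype.val hy⟩⟩
  S.moduleCatHomologyIso ≪≫
    ((Submodule.quotEquivOfEq _ _ hker).trans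
      (ψ.quotKerEquivOfSurjective hψ)).symm.toModuleIso

namespace FilteredComplex

variable {k : Type u} [CommRing k] (C : FilteredComplex.{u, w} k)

/-- `Z r p n`: the chains `x ∈ F_p C_n` with `d x ∈ F_{p-r}`. -/
def Z (r p : ℤ) (n : ℕ) : Submodule k (C.K.X n) :=
  C.F p n ⊓ ⨅ j : ℕ, (C.F (p - r) j).comap (C.K.d n j).hom

/-- `B r p n = Z_{p-1}^{r-1} + d Z_{p+r-1}^{r-1}`. -/
def B (r p : ℤ) (n : ℕ) : Submodule k (C.K.X n) :=
  C.Z (r - 1) (p - 1) n ⊔ ⨆ i : ℕ, (C.Z (r - 1) (p + r - 1) i).map (C.K.d i n).hom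

/-- The term of the spectral sequence on the page `r`, in filtration degree `p` and total degree
`n`, i.e. the term with bidegree `(p, n - p)`:
`Z_p^r / (Z_{p-1}^{r-1} + d Z_{p+r-1}^{r-1})`. -/
abbrev E (r p : ℤ) (n : ℕ) : Type w :=
  C.Z r p n ⧸ (C.B r p n).comap (C.Z r p n).subtype

variable {C}

lemma mem_Z {r p : ℤ} {n : ℕ} {x : C.K.X n} :
    x ∈ C.Z r p n ↔ x ∈ C.F p n ∧ ∀ j, (C.K.d n j).hom x ∈ C.F (p - r) j := by
  simp [Z]

lemma dd_apply (a b c : ℕ) (x : C.K.X a) : (C.K.d b c).hom ((C.K.d a b).hom x) = 0 := by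
  exact congrArg (fun f => f.hom x) (C.K.d_comp_d a b c)

lemma d_mem_Z {r r' p p' : ℤ} {n : ℕ} (n' : ℕ) (h : p' = p - r) {x : C.K.X n}
    (hx : x ∈ C.Z r p n) : (C.K.d n n').hom x ∈ C.Z r' p' n' := by
  subst h
  rw [mem_Z] at hx ⊢
  exact ⟨hx.2 n', fun j => by rw [dd_apply]; exact Submodule.zero_mem _⟩

/-- Every element of the sum of the images of the differentials into degree `n` is the image of an
element of degree `n + 1`. -/
lemma mem_B {r p : ℤ} {n : ℕ} {x : C.K.X n} :
    x ∈ C.B r p n ↔ ∃ z ∈ C.Z (r - 1) (p - 1) n, ∃ y ∈ C.Z (r - 1) (p + r - 1) (n + 1),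
      x = z + (C.K.d (n + 1) n).hom y := by
  have key : (⨆ i : ℕ, (C.Z (r - 1) (p + r - 1) i).map (C.K.d i n).hom) =
      (C.Z (r - 1) (p + r - 1) (n + 1)).map (C.K.d (n + 1) n).hom := by
    apply le_antisymm
    · refine iSup_le fun i => ?_
      by_cases hi : n + 1 = i
      · subst hi; exact le_rfl
      · rw [C.K.shape i n (by simpa using hi)]
        rintro _ ⟨y, -, rfl⟩
        exact Submodule.zero_mem _
    · exact le_iSup (fun i => (C.Z (r - 1) (p + r - 1) i).map (C.K.d i n).hom) (n + 1)
  rw [B, key, Submodule.mem_sup]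
  constructor
  · rintro ⟨z, hz, _, ⟨y, hy, rfl⟩, rfl⟩
    exact ⟨z, hz, y, hy, rfl⟩
  · rintro ⟨z, hz, y, hy, rfl⟩
    exact ⟨z, hz, _, ⟨y, hy, rfl⟩, rfl⟩

lemma d_mem_B {r p p' : ℤ} {n : ℕ} (n' : ℕ) (h : p' = p - r) {x : C.K.X n}
    (hx : x ∈ C.B r p n) : (C.K.d n n').hom x ∈ C.B r p' n' := by
  subst h
  obtain ⟨z, hz, y, -, rfl⟩ := mem_B.1 hx
  rw [map_add, dd_apply, add_zero]
  refine Submodule.mem_sup_right (Submodule.mem_iSup_of_mem n ⟨z, ?_, rfl⟩)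
  rwa [show p - r + r - 1 = p - 1 by ring]

variable (C)

/-- The differential of the page `r`: it sends the class of `x` to the class of `d x`. -/
noncomputable def dE (r p p' : ℤ) (n n' : ℕ) (h : p' = p - r) : C.E r p n →ₗ[k] C.E r p' n' :=
  Submodule.mapQ _ _ ((C.K.d n n').hom.restrict fun _ hx => d_mem_Z n' h hx)
    fun _ hx => d_mem_B n' h hx

variable {C}

lemma Z_le_Z {r r' p p' : ℤ} {n : ℕ} (h : p ≤ p') (h' : p - r ≤ p' - r') :
    C.Z r p n ≤ C.Z r' p' n := fun x hx => by
  rw [mem_Z] at hx ⊢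
  exact ⟨C.mono _ _ _ h hx.1, fun j => C.mono _ _ _ h' (hx.2 j)⟩

lemma dE_mk_eq_zero_iff {r p p' : ℤ} {n n' : ℕ} (h : p' = p - r) (x : C.Z r p n) :
    C.dE r p p' n n' h (Submodule.Quotient.mk x) = 0 ↔ (C.K.d n n').hom x.1 ∈ C.B r p' n' :=
  (Submodule.Quotient.mk_eq_zero _)

lemma dE_mk_eq_mk_iff {r p p' : ℤ} {n n' : ℕ} (h : p' = p - r) (x : C.Z r p n)
    (y : C.Z r p' n') :
    C.dE r p p' n n' h (Submodule.Quotient.mk x) = Submodule.Quotient.mk y ↔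
      (C.K.d n n').hom x.1 - y.1 ∈ C.B r p' n' :=
  (Submodule.Quotient.eq _)

lemma dE_dE {r p p' p'' : ℤ} {n n' n'' : ℕ} (h : p' = p - r) (h' : p'' = p' - r)
    (x : C.E r p n) : C.dE r p' p'' n' n'' h' (C.dE r p p' n n' h x) = 0 := by
  obtain ⟨x, rfl⟩ := Submodule.Quotient.mk_surjective _ x
  refine (Submodule.Quotient.mk_eq_zero _).2 ?_
  change (C.K.d n' n'').hom ((C.K.d n n').hom x.1) ∈ C.B r p'' n''
  rw [dd_apply]
  exact Submodule.zero_mem _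

/-- The class of `x` on the page `r` is a cycle if and only if it is represented by an element of
`Z (r + 1)`. -/
lemma dE_eq_zero_iff {r p p' : ℤ} {n : ℕ} (h : p' = p - r) (x : C.Z r p (n + 1)) :
    C.dE r p p' (n + 1) n h (Submodule.Quotient.mk x) = 0 ↔
      ∃ z : C.Z (r + 1) p (n + 1), x.1 - z.1 ∈ C.B r p (n + 1) := by
  subst h
  rw [dE_mk_eq_zero_iff]
  have hx := mem_Z.1 x.2
  constructor
  · intro h
    obtain ⟨z, hz, y, hy, e⟩ := mem_B.1 h
    have hy' : y ∈ C.Z (r - 1) (p - 1) (n + 1) := by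
      rwa [show p - r + r - 1 = p - 1 by ring] at hy
    refine ⟨⟨x.1 - y, mem_Z.2 ⟨Submodule.sub_mem _ hx.1
      (C.mono _ _ _ (by lia) (mem_Z.1 hy').1), fun j => ?_⟩⟩, ?_⟩
    · by_cases hj : j = n
      · subst hj
        rw [map_sub, e, add_sub_cancel_right]
        exact C.mono _ _ _ (by lia) (mem_Z.1 hz).1
      · rw [C.K.shape (n + 1) j (fun h => hj (Nat.succ_injective h))]
        exact Submodule.zero_mem _
    · rw [sub_sub_cancel]
      exact Submodule.mem_sup_left hy'
  · rintro ⟨z, hz⟩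
    obtain ⟨b, hb, y, hy, e⟩ := mem_B.1 hz
    have e' : x.1 = z.1 + b + (C.K.d (n + 1 + 1) (n + 1)).hom y := by
      rw [add_assoc, ← e]; abel
    rw [e', map_add, map_add, dd_apply, add_zero]
    refine mem_B.2 ⟨_, ?_, b, ?_, rfl⟩
    · exact Z_le_Z (r := r) (by lia) (by lia) (d_mem_Z (r := r + 1) (p' := p - r - 1)
        n (by ring) z.2)
    · rwa [show p - r + r - 1 = p - 1 by ring]

/-- The class on the page `r` of an element of `Z (r + 1)` is a boundary if and only if this
element is in `B (r + 1)`. -/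
lemma exists_dE_eq_iff {r p p' : ℤ} {n : ℕ} (h : p = p' - r)
    (z : C.Z (r + 1) p n) (hz : z.1 ∈ C.Z r p n) :
    (∃ y, C.dE r p' p (n + 1) n h y = (Submodule.Quotient.mk ⟨z.1, hz⟩ : C.E r p n)) ↔
      z.1 ∈ C.B (r + 1) p n := by
  have hz' := mem_Z.1 z.2
  constructor
  · rintro ⟨y, hy⟩
    obtain ⟨y, rfl⟩ := Submodule.Quotient.mk_surjective _ y
    rw [dE_mk_eq_mk_iff] at hy
    obtain ⟨b, hb, v, hv, e⟩ := mem_B.1 hy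
    have hyZ := mem_Z.1 y.2
    have hvZ := mem_Z.1 hv
    have e' : z.1 = -b + (C.K.d (n + 1) n).hom (y.1 - v) := by
      rw [map_sub, sub_eq_iff_eq_add.1 e]; dsimp only; abel
    refine mem_B.2 ⟨-b, ?_, y.1 - v, ?_, e'⟩
    · have hb' := mem_Z.1 hb
      refine mem_Z.2 ⟨Submodule.neg_mem _ (C.mono _ _ _ (by lia) hb'.1), fun j => ?_⟩
      have : -b = z.1 - (C.K.d (n + 1) n).hom (y.1 - v) := by rw [e']; abel
      rw [this, map_sub, dd_apply, sub_zero]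
      exact C.mono _ _ _ (by lia) (hz'.2 j)
    · refine mem_Z.2 ⟨Submodule.sub_mem _ (C.mono _ _ _ (by lia) hyZ.1)
        (C.mono _ _ _ (by lia) hvZ.1), fun j => ?_⟩
      rw [map_sub]
      exact Submodule.sub_mem _ (C.mono _ _ _ (by lia) (hyZ.2 j))
        (C.mono _ _ _ (by lia) (hvZ.2 j))
  · intro h'
    obtain ⟨b, hb, y, hy, e⟩ := mem_B.1 h'
    have hy' : y ∈ C.Z r p' (n + 1) := Z_le_Z (by lia) (by lia) hy
    refine ⟨Submodule.Quotient.mk ⟨y, hy'⟩, ?_⟩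
    rw [dE_mk_eq_mk_iff]
    have : (C.K.d (n + 1) n).hom y - z.1 = -b := by rw [e]; abel
    dsimp only
    rw [this]
    exact Submodule.mem_sup_left (Submodule.neg_mem _ (Z_le_Z (by lia) (by lia) hb))

variable (C)

/-- The differential of the page `r` has degree `-r` for the filtration degree and degree `-1` for
the total degree. -/
def pageShape (r : ℤ) : ComplexShape (ℤ × ℕ) where
  Rel a b := b.1 = a.1 - r ∧ a.2 = b.2 + 1
  next_eq h h' := by ext <;> lia
  prev_eq h h' := by ext <;> lia

open Classical in
/-- The page `r` of the spectral sequence of a filtered complex. -/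
noncomputable def page (r : ℤ) : HomologicalComplex (ModuleCat.{w} k) (pageShape r) where
  X a := ModuleCat.of k (C.E r a.1 a.2)
  d a b := if h : b.1 = a.1 - r ∧ a.2 = b.2 + 1 then
    ModuleCat.ofHom (C.dE r a.1 b.1 a.2 b.2 h.1) else 0
  shape a b h := dif_neg h
  d_comp_d' a b c hab hbc := by
    rw [dif_pos (show b.1 = a.1 - r ∧ a.2 = b.2 + 1 from hab),
      dif_pos (show c.1 = b.1 - r ∧ b.2 = c.2 + 1 from hbc)]
    exact ModuleCat.hom_ext (LinearMap.ext fun x => dE_dE hab.1 hbc.1 x)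

lemma page_d {r : ℤ} {a b : ℤ × ℕ} (h : b.1 = a.1 - r) (h' : a.2 = b.2 + 1) :
    (C.page r).d a b = ModuleCat.ofHom (C.dE r a.1 b.1 a.2 b.2 h) := dif_pos ⟨h, h'⟩

/-- The linear map sending `z ∈ Z (r + 1)` to the class of `z` on the page `r`. -/
noncomputable def toE (r p : ℤ) (n : ℕ) : C.Z (r + 1) p n →ₗ[k] C.E r p n :=
  Submodule.mkQ _ ∘ₗ Submodule.inclusion (Z_le_Z le_rfl (by lia))

lemma toE_apply {r p : ℤ} {n : ℕ} (z : C.Z (r + 1) p n) :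
    C.toE r p n z = Submodule.Quotient.mk ⟨z.1, Z_le_Z le_rfl (by lia) z.2⟩ := rfl

lemma mk_eq_toE_iff {r p : ℤ} {n : ℕ} (x : C.Z r p n) (z : C.Z (r + 1) p n) :
    Submodule.Quotient.mk x = C.toE r p n z ↔ x.1 - z.1 ∈ C.B r p n := by
  rw [toE_apply, Submodule.Quotient.eq, Submodule.mem_comap, Submodule.subtype_apply,
    AddSubgroupClass.coe_sub]

lemma exists_toE_eq_iff {r p : ℤ} {n : ℕ} (x : C.Z r p n) :
    (∃ z, C.toE r p n z = Submodule.Quotient.mk x) ↔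
      ∃ z : C.Z (r + 1) p n, x.1 - z.1 ∈ C.B r p n :=
  exists_congr fun z => eq_comm.trans (C.mk_eq_toE_iff x z)

lemma toE_surjective_zero (r p : ℤ) (x : C.E r p 0) : ∃ z, C.toE r p 0 z = x := by
  obtain ⟨x, rfl⟩ := Submodule.Quotient.mk_surjective _ x
  rw [exists_toE_eq_iff]
  refine ⟨⟨x.1, ?_⟩, ?_⟩
  · refine mem_Z.2 ⟨(mem_Z.1 x.2).1, fun j => ?_⟩
    rw [C.K.shape 0 j (fun h => Nat.succ_ne_zero _ h)]
    exact Submodule.zero_mem _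
  · rw [sub_self]
    exact Submodule.zero_mem _

lemma dE_eq_zero_iff_toE {r p p' : ℤ} {n : ℕ} (h : p' = p - r) (x : C.E r p (n + 1)) :
    C.dE r p p' (n + 1) n h x = 0 ↔ ∃ z, C.toE r p (n + 1) z = x := by
  obtain ⟨x, rfl⟩ := Submodule.Quotient.mk_surjective _ x
  rw [exists_toE_eq_iff, dE_eq_zero_iff]

lemma toE_spec (r p : ℤ) (n : ℕ) (x : C.E r p n) :
    ((C.page r).sc (p, n)).g.hom x = 0 ↔ ∃ z, C.toE r p n z = x := by
  rcases n with _ | n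
  · have hrel : ¬ (pageShape r).Rel (p, 0) ((pageShape r).next (p, 0)) :=
      fun h => absurd h.2 (Nat.succ_ne_zero _).symm
    have hg : ((C.page r).sc (p, 0)).g = 0 := (C.page r).shape _ _ hrel
    rw [hg]
    exact iff_of_true rfl (C.toE_surjective_zero r p x)
  · have hrel : (pageShape r).Rel (p, n + 1) (p - r, n) := ⟨rfl, rfl⟩
    rw [← C.dE_eq_zero_iff_toE rfl]
    change ((C.page r).d (p, n + 1) ((pageShape r).next (p, n + 1))).hom x = 0 ↔ _
    rw [(pageShape r).next_eq' hrel, C.page_d (a := (p, n + 1)) (b := (p - r, n)) rfl rfl]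
    rfl

lemma exists_dE_eq_iff_toE {r p p' : ℤ} {n : ℕ} (h : p = p' - r) (z : C.Z (r + 1) p n) :
    (∃ y, C.dE r p' p (n + 1) n h y = C.toE r p n z) ↔ z.1 ∈ C.B (r + 1) p n :=
  exists_dE_eq_iff h z (Z_le_Z le_rfl (by lia) z.2)

lemma toE_boundary (r p : ℤ) (n : ℕ) (z : C.Z (r + 1) p n) :
    z ∈ (C.B (r + 1) p n).comap (C.Z (r + 1) p n).subtype ↔
      ∃ y, ((C.page r).sc (p, n)).f.hom y = C.toE r p n z := by
  have h : p = (p + r) - r := (add_sub_cancel_right _ _).symm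
  have hrel : (pageShape r).Rel (p + r, n + 1) (p, n) := ⟨h, rfl⟩
  rw [Submodule.mem_comap, Submodule.subtype_apply, ← C.exists_dE_eq_iff_toE h z]
  change _ ↔ ∃ y, ((C.page r).d ((pageShape r).prev (p, n)) (p, n)).hom y = _
  rw [(pageShape r).prev_eq' hrel, C.page_d (a := (p + r, n + 1)) (b := (p, n)) h rfl]
  rfl

/-- The homology of the page `r` is the page `r + 1`: the homology class of the class of
`z ∈ Z (r + 1)` corresponds to the class of `z`. -/
noncomputable def pageIso (r p : ℤ) (n : ℕ) :
    (C.page r).homology (p, n) ≅ (C.page (r + 1)).X (p, n) :=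
  homologyIsoOfCycles ((C.page r).sc (p, n)) (C.toE r p n) (C.toE_spec r p n) _
    (C.toE_boundary r p n)

/-- The spectral sequence of a filtered complex, from the page `E¹` on. -/
noncomputable def spectralSequence : SpectralSequence (ModuleCat.{w} k) pageShape 1 where
  page r _ := C.page r
  iso r r' pn h _ := C.pageIso r pn.1 pn.2 ≪≫ eqToIso (by subst h; rfl)

end FilteredComplex

/-! ### tensor powers and the quotient `B / k` -/

namespace HochschildSerre

section Tensor

variable (k : Type*) [CommRing k] (V : Type*) [AddCommGroup V] [Module k V]

/-- Splitting off the first tensor factor: `V ⊗ V^n ≃ V^(n+1)`. -/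
noncomputable def cons (n : ℕ) : V ⊗[k] (⨂[k]^n V) ≃ₗ[k] (⨂[k]^(n + 1) V) :=
  (TensorProduct.congr (PiTensorProduct.subsingletonEquiv (s := fun _ => V) (0 : Fin 1)).symm
    (LinearEquiv.refl k (⨂[k]^n V))).trans
    (TensorPower.mulEquiv.trans (TensorPower.cast k V (Nat.add_comm 1 n)))

lemma cons_tmul_tprod {n : ℕ} (v : V) (x : Fin n → V) :
    cons k V n (v ⊗ₜ PiTensorProduct.tprod k x) =
      PiTensorProduct.tprod k (Fin.cons v x : Fin (n + 1) → V) := by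
  have h1 : (PiTensorProduct.subsingletonEquiv (R := k) (s := fun _ => V) (0 : Fin 1)).symm v =
      PiTensorProduct.tprod k (fun _ : Fin 1 => v) := by
    rw [LinearEquiv.symm_apply_eq, PiTensorProduct.subsingletonEquiv_apply_tprod]
  simp only [cons, LinearEquiv.trans_apply, TensorProduct.congr_tmul, LinearEquiv.refl_apply, h1]
  have h2 := TensorPower.tprod_mul_tprod k (M := V) (fun _ : Fin 1 => v) x
  rw [TensorPower.gMul_def] at h2
  rw [h2, TensorPower.cast_tprod]
  congr 1
  funext i
  refine Fin.cases ?_ (fun j => ?_) i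
  · simp [Fin.append, Fin.addCases]
  · simp only [Function.comp, Fin.cons_succ]
    have : Fin.cast (Nat.add_comm 1 n).symm j.succ = Fin.natAdd 1 j := by
      ext; simp [Nat.add_comm]
    rw [this, Fin.append_right]

variable {k} in
/-- Passing `u` through `V ⊗ W`, given the ways to pass it through `V` and through `W`:
if `β (v ⊗ a) = ∑ a' ⊗ v'` and `g (w ⊗ a) = ∑ a' ⊗ w'`, then `(v ⊗ w) ⊗ a` is sent to
`∑ a'' ⊗ (v' ⊗ w')`. -/
noncomputable def passL {V W C : Type*} [AddCommGroup V] [Module k V] [AddCommGroup W] [Module k W]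
    [AddCommGroup C] [Module k C] (β : V ⊗[k] C →ₗ[k] C ⊗[k] V) (g : W ⊗[k] C →ₗ[k] C ⊗[k] W) :
    (V ⊗[k] W) ⊗[k] C →ₗ[k] C ⊗[k] (V ⊗[k] W) :=
  (TensorProduct.assoc k C V W).toLinearMap ∘ₗ β.rTensor W ∘ₗ
    (TensorProduct.assoc k V C W).symm.toLinearMap ∘ₗ g.lTensor V ∘ₗ
      (TensorProduct.assoc k V W C).toLinearMap


/-- Passing `u ∈ U` from left to right through `V ⊗ W`. -/
noncomputable def passR {V W U : Type*} [AddCommGroup V] [Module k V] [AddCommGroup W] [Module k W]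
    [AddCommGroup U] [Module k U] (β : U ⊗[k] V →ₗ[k] V ⊗[k] U) (g : U ⊗[k] W →ₗ[k] W ⊗[k] U) :
    U ⊗[k] (V ⊗[k] W) →ₗ[k] (V ⊗[k] W) ⊗[k] U :=
  (TensorProduct.assoc k V W U).symm.toLinearMap ∘ₗ g.lTensor V ∘ₗ
    (TensorProduct.assoc k V U W).toLinearMap ∘ₗ β.rTensor W ∘ₗ
      (TensorProduct.assoc k U V W).symm.toLinearMap

variable {k V}

/-- Iteration of `β : V ⊗ C → C ⊗ V`: an element of `C` is passed through `v₁ ⊗ ⋯ ⊗ vₙ`, from the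
right to the left. -/
noncomputable def iterL {C : Type*} [AddCommGroup C] [Module k C]
    (β : V ⊗[k] C →ₗ[k] C ⊗[k] V) : ∀ n : ℕ, (⨂[k]^n V) ⊗[k] C →ₗ[k] C ⊗[k] (⨂[k]^n V)
  | 0 => (TensorProduct.comm k (⨂[k]^0 V) C).toLinearMap
  | n + 1 => (cons k V n).toLinearMap.lTensor C ∘ₗ passL β (iterL β n) ∘ₗ
      (cons k V n).symm.toLinearMap.rTensor C

/-- Iteration of `β : U ⊗ V → V ⊗ U`: an element of `U` is passed through `v₁ ⊗ ⋯ ⊗ vₙ`, from the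
left to the right. -/
noncomputable def iterR {U : Type*} [AddCommGroup U] [Module k U]
    (β : U ⊗[k] V →ₗ[k] V ⊗[k] U) : ∀ n : ℕ, U ⊗[k] (⨂[k]^n V) →ₗ[k] (⨂[k]^n V) ⊗[k] U
  | 0 => (TensorProduct.comm k U (⨂[k]^0 V)).toLinearMap
  | n + 1 => (cons k V n).toLinearMap.rTensor U ∘ₗ passR k β (iterR β n) ∘ₗ
      (cons k V n).symm.toLinearMap.lTensor U

end Tensor

section Bar

variable (k : Type*) [CommRing k] (B : Type*) [Ring B] [Algebra k B]

/-- The `k`-module `B / k`. -/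
def Bar : Type _ := B ⧸ LinearMap.range (Algebra.linearMap k B)

noncomputable instance : AddCommGroup (Bar k B) :=
  inferInstanceAs (AddCommGroup (B ⧸ LinearMap.range (Algebra.linearMap k B)))

noncomputable instance : Module k (Bar k B) :=
  inferInstanceAs (Module k (B ⧸ LinearMap.range (Algebra.linearMap k B)))

/-- The class in `B / k` of an element of `B`. -/
noncomputable def bar : B →ₗ[k] Bar k B := (LinearMap.range (Algebra.linearMap k B)).mkQ

lemma bar_surjective : Function.Surjective (bar k B) := Submodule.mkQ_surjective _

lemma bar_algebraMap (c : k) : bar k B (algebraMap k B c) = 0 :=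
  (Submodule.Quotient.mk_eq_zero _).2 ⟨c, rfl⟩

lemma bar_one : bar k B 1 = 0 := by
  rw [← map_one (algebraMap k B), bar_algebraMap]

variable {k B}

/-- A linear map on `B ⊗ W` that vanishes on `1 ⊗ W` induces a linear map on `(B / k) ⊗ W`. -/
noncomputable def liftBar {W X : Type*} [AddCommGroup W] [Module k W] [AddCommGroup X] [Module k X]
    (g : B ⊗[k] W →ₗ[k] X) (hg : ∀ w, g (1 ⊗ₜ w) = 0) : Bar k B ⊗[k] W →ₗ[k] X :=
  TensorProduct.lift ((LinearMap.range (Algebra.linearMap k B)).liftQ (TensorProduct.curry g) (by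
    rintro _ ⟨c, rfl⟩
    rw [LinearMap.mem_ker]
    ext w
    rw [Algebra.linearMap_apply, Algebra.algebraMap_eq_smul_one]
    simp [hg]))

@[simp]
lemma liftBar_tmul {W X : Type*} [AddCommGroup W] [Module k W] [AddCommGroup X] [Module k X]
    (g : B ⊗[k] W →ₗ[k] X) (hg : ∀ w, g (1 ⊗ₜ w) = 0) (b : B) (w : W) :
    liftBar g hg (bar k B b ⊗ₜ w) = g (b ⊗ₜ w) := rfl

/-- A linear map on `W ⊗ B` that vanishes on `W ⊗ 1` induces a linear map on `W ⊗ (B / k)`. -/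
noncomputable def liftBar' {W X : Type*} [AddCommGroup W] [Module k W] [AddCommGroup X] [Module k X]
    (g : W ⊗[k] B →ₗ[k] X) (hg : ∀ w, g (w ⊗ₜ 1) = 0) : W ⊗[k] Bar k B →ₗ[k] X :=
  liftBar (g ∘ₗ (TensorProduct.comm k B W).toLinearMap) (fun w => by simpa using hg w) ∘ₗ
    (TensorProduct.comm k W (Bar k B)).toLinearMap

@[simp]
lemma liftBar'_tmul {W X : Type*} [AddCommGroup W] [Module k W] [AddCommGroup X] [Module k X]
    (g : W ⊗[k] B →ₗ[k] X) (hg : ∀ w, g (w ⊗ₜ 1) = 0) (w : W) (b : B) :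
    liftBar' g hg (w ⊗ₜ bar k B b) = g (w ⊗ₜ b) := rfl

end Bar

section Hochschild

variable {k : Type*} [CommRing k] {B : Type*} [Ring B] [Algebra k B]

/-- For `γ : B ⊗ B̄^n → B̄^n ⊗ B`, the map `B ⊗ (B ⊗ B̄^n) → B̄^(n+1) ⊗ B` given by
`b ⊗ (x ⊗ w) ↦ (b x ⊗ w) ⊗ 1 - b ⊗ γ (x ⊗ w)`. -/
noncomputable def gammaStep {n : ℕ}
    (γ : B ⊗[k] (⨂[k]^n (Bar k B)) →ₗ[k] (⨂[k]^n (Bar k B)) ⊗[k] B) :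
    B ⊗[k] (B ⊗[k] (⨂[k]^n (Bar k B))) →ₗ[k] (⨂[k]^(n + 1) (Bar k B)) ⊗[k] B :=
  (TensorProduct.mk k (⨂[k]^(n + 1) (Bar k B)) B).flip 1 ∘ₗ (cons k (Bar k B) n).toLinearMap ∘ₗ
      (bar k B ∘ₗ LinearMap.mul' k B).rTensor _ ∘ₗ (TensorProduct.assoc k _ _ _).symm.toLinearMap -
    (cons k (Bar k B) n).toLinearMap.rTensor B ∘ₗ
      (TensorProduct.assoc k _ _ _).symm.toLinearMap ∘ₗ TensorProduct.map (bar k B) γ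

lemma gammaStep_tmul {n : ℕ} (γ : B ⊗[k] (⨂[k]^n (Bar k B)) →ₗ[k] (⨂[k]^n (Bar k B)) ⊗[k] B)
    (b x : B) (w : ⨂[k]^n (Bar k B)) :
    gammaStep γ (b ⊗ₜ (x ⊗ₜ w)) = cons k (Bar k B) n (bar k B (b * x) ⊗ₜ w) ⊗ₜ 1 -
      (cons k (Bar k B) n).toLinearMap.rTensor B
        ((TensorProduct.assoc k _ _ _).symm (bar k B b ⊗ₜ γ (x ⊗ₜ w))) := by
  simp [gammaStep]

/-- The maps `γₙ : B ⊗ B̄^n → B̄^n ⊗ B` given by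
`b ⊗ x₁ ⊗ ⋯ ⊗ xₙ ↦ (b x₁ ⊗ x₂ ⊗ ⋯ ⊗ xₙ) ⊗ 1 + ∑ (-1)^i (b ⊗ x₁ ⊗ ⋯ ⊗ xᵢ xᵢ₊₁ ⊗ ⋯ ⊗ xₙ) ⊗ 1
  + (-1)^n (b ⊗ x₁ ⊗ ⋯ ⊗ xₙ₋₁) ⊗ xₙ`. They satisfy `γ₀ (b) = b` and
`γₙ₊₁ (b ⊗ x ⊗ w) = (b x ⊗ w) ⊗ 1 - b ⊗ γₙ (x ⊗ w)`. -/
noncomputable def gamma : ∀ n : ℕ,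
    {γ : B ⊗[k] (⨂[k]^n (Bar k B)) →ₗ[k] (⨂[k]^n (Bar k B)) ⊗[k] B // ∀ w, γ (1 ⊗ₜ w) = w ⊗ₜ 1}
  | 0 => ⟨(TensorProduct.comm k B _).toLinearMap, fun _ => rfl⟩
  | n + 1 => ⟨liftBar (gammaStep (gamma n).1 ∘ₗ (TensorProduct.leftComm k B B _).toLinearMap)
      (fun w => by
        induction w using TensorProduct.induction_on with
        | zero => simp
        | add x y hx hy => rw [TensorProduct.tmul_add, map_add, hx, hy, add_zero]
        | tmul b w => simp [gammaStep_tmul, (gamma n).2]) ∘ₗ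
      (TensorProduct.leftComm k B (Bar k B) _).toLinearMap ∘ₗ
        (cons k (Bar k B) n).symm.toLinearMap.lTensor B, fun w => by
          obtain ⟨w, rfl⟩ := (cons k (Bar k B) n).surjective w
          induction w using TensorProduct.induction_on with
          | zero => simp
          | add x y hx hy =>
            rw [map_add, TensorProduct.tmul_add, map_add, hx, hy, TensorProduct.add_tmul]
          | tmul b w =>
            obtain ⟨b, rfl⟩ := bar_surjective k B b
            simp [gammaStep_tmul, bar_one]⟩

lemma gamma_succ (n : ℕ) (b x : B) (w : ⨂[k]^n (Bar k B)) :
    (gamma (n + 1)).1 (b ⊗ₜ cons k (Bar k B) n (bar k B x ⊗ₜ w)) =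
      cons k (Bar k B) n (bar k B (b * x) ⊗ₜ w) ⊗ₜ 1 -
        (cons k (Bar k B) n).toLinearMap.rTensor B
          ((TensorProduct.assoc k _ _ _).symm (bar k B b ⊗ₜ (gamma n).1 (x ⊗ₜ w))) := by
  rw [← gammaStep_tmul]
  simp [gamma]

/-- For `λ : B ⊗ N → N`, the map `n ⊗ (w ⊗ y) ↦ λ (y ⊗ n) ⊗ w`. -/
noncomputable def wrap {N W : Type*} [AddCommGroup N] [Module k N] [AddCommGroup W] [Module k W]
    (lam : B ⊗[k] N →ₗ[k] N) : N ⊗[k] (W ⊗[k] B) →ₗ[k] N ⊗[k] W :=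
  (TensorProduct.comm k W N).toLinearMap ∘ₗ lam.lTensor W ∘ₗ
    (TensorProduct.assoc k W B N).toLinearMap ∘ₗ (TensorProduct.comm k N (W ⊗[k] B)).toLinearMap

@[simp]
lemma wrap_tmul {N W : Type*} [AddCommGroup N] [Module k N] [AddCommGroup W] [Module k W]
    (lam : B ⊗[k] N →ₗ[k] N) (n : N) (w : W) (y : B) :
    wrap lam (n ⊗ₜ (w ⊗ₜ y)) = lam (y ⊗ₜ n) ⊗ₜ w := rfl

variable {N : Type*} [AddCommGroup N] [Module k N]

/-- The differential of the normalized Hochschild complex of the algebra `B` with coefficients in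
`N`, for a right action `ρ` and a left action `λ` of `B` on `N`:
`n ⊗ x₁ ⊗ ⋯ ⊗ xᵣ₊₁ ↦ n x₁ ⊗ x₂ ⊗ ⋯ ⊗ xᵣ₊₁ + ∑ (-1)^i n ⊗ x₁ ⊗ ⋯ ⊗ xᵢ xᵢ₊₁ ⊗ ⋯ ⊗ xᵣ₊₁
  + (-1)^(r+1) xᵣ₊₁ n ⊗ x₁ ⊗ ⋯ ⊗ xᵣ`.
In terms of the maps `γ` it is `n ⊗ x ⊗ w ↦ n x ⊗ w - ∑ y n ⊗ w'` with `γ (x ⊗ w) = ∑ w' ⊗ y`. -/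
noncomputable def hochD (rho : N ⊗[k] B →ₗ[k] N) (lam : B ⊗[k] N →ₗ[k] N)
    (h1 : ∀ n, rho (n ⊗ₜ 1) = n) (h2 : ∀ n, lam (1 ⊗ₜ n) = n) (r : ℕ) :
    N ⊗[k] (⨂[k]^(r + 1) (Bar k B)) →ₗ[k] N ⊗[k] (⨂[k]^r (Bar k B)) :=
  liftBar ((rho.rTensor (⨂[k]^r (Bar k B)) ∘ₗ (TensorProduct.assoc k _ _ _).symm.toLinearMap -
      wrap lam ∘ₗ (gamma r).1.lTensor N) ∘ₗ (TensorProduct.leftComm k B N _).toLinearMap)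
    (fun w => by
      induction w using TensorProduct.induction_on with
      | zero => simp
      | add x y hx hy => rw [TensorProduct.tmul_add, map_add, hx, hy, add_zero]
      | tmul b w => simp [(gamma r).2, h1, h2]) ∘ₗ
  (TensorProduct.leftComm k N (Bar k B) _).toLinearMap ∘ₗ
    (cons k (Bar k B) r).symm.toLinearMap.lTensor N

lemma hochD_tmul (rho : N ⊗[k] B →ₗ[k] N) (lam : B ⊗[k] N →ₗ[k] N)
    (h1 : ∀ n, rho (n ⊗ₜ 1) = n) (h2 : ∀ n, lam (1 ⊗ₜ n) = n) (r : ℕ) (n : N) (x : B)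
    (w : ⨂[k]^r (Bar k B)) :
    hochD rho lam h1 h2 r (n ⊗ₜ cons k (Bar k B) r (bar k B x ⊗ₜ w)) =
      rho (n ⊗ₜ x) ⊗ₜ w - wrap lam (n ⊗ₜ (gamma r).1 (x ⊗ₜ w)) := by
  simp [hochD]

end Hochschild

section Square

variable {k : Type*} [CommRing k] {B : Type*} [Ring B] [Algebra k B]

/-- Right multiplication on `W ⊗ B`: `(w ⊗ x) ⊗ y ↦ w ⊗ x y`. -/
noncomputable def mulRight (W : Type*) [AddCommGroup W] [Module k W] :
    (W ⊗[k] B) ⊗[k] B →ₗ[k] W ⊗[k] B :=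
  (LinearMap.mul' k B).lTensor W ∘ₗ (TensorProduct.assoc k W B B).toLinearMap

/-- `w ⊗ z ↦ γ (b ⊗ w) z`. -/
noncomputable def gammaMul (n : ℕ) (b : B) :
    (⨂[k]^n (Bar k B)) ⊗[k] B →ₗ[k] (⨂[k]^n (Bar k B)) ⊗[k] B :=
  mulRight _ ∘ₗ ((gamma n).1 ∘ₗ TensorProduct.mk k B _ b).rTensor B

lemma gammaMul_tmul (n : ℕ) (b : B) (w : ⨂[k]^n (Bar k B)) (z : B) :
    gammaMul n b (w ⊗ₜ z) = mulRight _ ((gamma n).1 (b ⊗ₜ w) ⊗ₜ z) := rfl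

lemma mulRight_one {W : Type*} [AddCommGroup W] [Module k W] (x : W ⊗[k] B) :
    mulRight W (x ⊗ₜ 1) = x := by
  induction x using TensorProduct.induction_on with
  | zero => simp
  | add x y hx hy => rw [TensorProduct.add_tmul, map_add, hx, hy]
  | tmul b w => simp [mulRight]

variable (k B) in
/-- `v ⊗ (w ⊗ z) ↦ (v ⊗ w) ⊗ z`. -/
noncomputable def consB (n : ℕ) : Bar k B ⊗[k] ((⨂[k]^n (Bar k B)) ⊗[k] B) →ₗ[k]
    (⨂[k]^(n + 1) (Bar k B)) ⊗[k] B :=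
  (cons k (Bar k B) n).toLinearMap.rTensor B ∘ₗ (TensorProduct.assoc k _ _ _).symm.toLinearMap

@[simp]
lemma consB_tmul (n : ℕ) (v : Bar k B) (w : ⨂[k]^n (Bar k B)) (z : B) :
    consB k B n (v ⊗ₜ (w ⊗ₜ z)) = cons k (Bar k B) n (v ⊗ₜ w) ⊗ₜ z := rfl

lemma gamma_succ' (n : ℕ) (b x : B) (w : ⨂[k]^n (Bar k B)) :
    (gamma (n + 1)).1 (b ⊗ₜ cons k (Bar k B) n (bar k B x ⊗ₜ w)) =
      cons k (Bar k B) n (bar k B (b * x) ⊗ₜ w) ⊗ₜ 1 -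
        consB k B n (bar k B b ⊗ₜ (gamma n).1 (x ⊗ₜ w)) := gamma_succ n b x w

lemma mulRight_consB (n : ℕ) (v : Bar k B) (t : (⨂[k]^n (Bar k B)) ⊗[k] B) (z : B) :
    mulRight _ (consB k B n (v ⊗ₜ t) ⊗ₜ z) = consB k B n (v ⊗ₜ mulRight _ (t ⊗ₜ z)) := by
  induction t using TensorProduct.induction_on with
  | zero => simp
  | add x y hx hy => simp only [TensorProduct.tmul_add, map_add, TensorProduct.add_tmul, hx, hy]
  | tmul b w => simp [mulRight]

/-- Induction principle for `B̄^(n+1)`, which is generated by the elements `x ⊗ w`. -/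
lemma induction_cons {n : ℕ} {p : (⨂[k]^(n + 1) (Bar k B)) → Prop} (w : ⨂[k]^(n + 1) (Bar k B))
    (h0 : p 0) (hadd : ∀ x y, p x → p y → p (x + y))
    (h : ∀ x w, p (cons k (Bar k B) n (bar k B x ⊗ₜ w))) : p w := by
  obtain ⟨w, rfl⟩ := (cons k (Bar k B) n).surjective w
  induction w using TensorProduct.induction_on with
  | zero => simpa using h0
  | add x y hx hy => rw [map_add]; exact hadd _ _ hx hy
  | tmul b w =>
    obtain ⟨b, rfl⟩ := bar_surjective k B b
    exact h b w

lemma gammaMul_consB (n : ℕ) (b x : B) (t : (⨂[k]^n (Bar k B)) ⊗[k] B) :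
    gammaMul (n + 1) b (consB k B n (bar k B x ⊗ₜ t)) =
      consB k B n (bar k B (b * x) ⊗ₜ t) - consB k B n (bar k B b ⊗ₜ gammaMul n x t) := by
  induction t using TensorProduct.induction_on with
  | zero => simp
  | add x y hx hy => simp only [TensorProduct.tmul_add, map_add, hx, hy]; abel
  | tmul w z =>
    rw [consB_tmul, gammaMul_tmul, gamma_succ', TensorProduct.sub_tmul, map_sub, mulRight_consB,
      gammaMul_tmul]
    simp [mulRight]

lemma gamma_mul (n : ℕ) (b c : B) (w : ⨂[k]^n (Bar k B)) :
    (gamma n).1 ((b * c) ⊗ₜ w) = gammaMul n b ((gamma n).1 (c ⊗ₜ w)) := by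
  induction n generalizing b c with
  | zero => simp [gammaMul, gamma, mulRight]
  | succ n ih =>
    induction w using induction_cons with
    | h0 => simp
    | hadd x y hx hy => rw [TensorProduct.tmul_add, map_add, hx, hy, TensorProduct.tmul_add,
        map_add, map_add]
    | h x w =>
      rw [gamma_succ', gamma_succ', map_sub, gammaMul_consB, gammaMul_tmul, mulRight_one,
        gamma_succ', ih, mul_assoc]
      abel

variable {N : Type*} [AddCommGroup N] [Module k N]

/-- The Hochschild differential squares to zero if the two actions make `N` a bimodule. -/
lemma hochD_comp (rho : N ⊗[k] B →ₗ[k] N) (lam : B ⊗[k] N →ₗ[k] N)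
    (h1 : ∀ n, rho (n ⊗ₜ 1) = n) (h2 : ∀ n, lam (1 ⊗ₜ n) = n)
    (hr : ∀ n a b, rho (rho (n ⊗ₜ a) ⊗ₜ b) = rho (n ⊗ₜ (a * b)))
    (hl : ∀ n a b, lam (a ⊗ₜ lam (b ⊗ₜ n)) = lam ((a * b) ⊗ₜ n))
    (hlr : ∀ n a b, lam (a ⊗ₜ rho (n ⊗ₜ b)) = rho (lam (a ⊗ₜ n) ⊗ₜ b)) (r : ℕ) :
    hochD rho lam h1 h2 r ∘ₗ hochD rho lam h1 h2 (r + 1) = 0 := by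
  have key1 : ∀ (n : N) (x : B) (t : (⨂[k]^r (Bar k B)) ⊗[k] B),
      hochD rho lam h1 h2 r (wrap lam (n ⊗ₜ consB k B r (bar k B x ⊗ₜ t))) =
        wrap lam (rho (n ⊗ₜ x) ⊗ₜ t) - wrap lam (n ⊗ₜ gammaMul r x t) := by
    intro n x t
    induction t using TensorProduct.induction_on with
    | zero => simp
    | add x y hx hy => simp only [TensorProduct.tmul_add, map_add, hx, hy]; abel
    | tmul w z =>
      rw [consB_tmul, wrap_tmul, hochD_tmul, wrap_tmul, hlr, gammaMul_tmul]
      congr 1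
      generalize (gamma r).1 (x ⊗ₜ w) = u
      induction u using TensorProduct.induction_on with
      | zero => simp
      | add x y hx hy => simp only [TensorProduct.tmul_add, TensorProduct.add_tmul, map_add, hx, hy]
      | tmul w y => simp [mulRight, hl]
  refine TensorProduct.ext' fun n w => ?_
  rw [LinearMap.comp_apply, LinearMap.zero_apply]
  induction w using induction_cons with
  | h0 => simp
  | hadd x y hx hy => rw [TensorProduct.tmul_add, map_add, map_add, hx, hy, add_zero]
  | h x w =>
    induction w using induction_cons with
    | h0 => simp
    | hadd y z hx hy =>
      rw [TensorProduct.tmul_add, map_add, TensorProduct.tmul_add, map_add, map_add, hx, hy,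
        add_zero]
    | h y w =>
      rw [hochD_tmul, gamma_succ', TensorProduct.tmul_sub, map_sub, map_sub, map_sub, key1,
        hochD_tmul, wrap_tmul, h2, hochD_tmul, hr, gamma_mul]
      abel

end Square

section Coefficients

variable (k : Type*) [CommRing k] (B : Type*) [Ring B] [Algebra k B]
  (M : Type*) [AddCommGroup M] [Module k M]

/-- The left action `b ⊗ m ↦ b m` of the algebra `B` on a left `B`-module `M`. -/
noncomputable def leftAct [Module B M] [IsScalarTower k B M] : B ⊗[k] M →ₗ[k] M :=
  TensorProduct.lift (Algebra.lsmul k k M).toLinearMap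

/-- The right action `m ⊗ b ↦ m b` of the algebra `B` on a right `B`-module `M`. -/
noncomputable def rightAct [Module Bᵐᵒᵖ M] [IsScalarTower k Bᵐᵒᵖ M] : M ⊗[k] B →ₗ[k] M :=
  TensorProduct.lift ((Algebra.lsmul k k M).toLinearMap ∘ₗ
    (MulOpposite.opLinearEquiv k : B ≃ₗ[k] Bᵐᵒᵖ).toLinearMap).flip

@[simp]
lemma leftAct_tmul [Module B M] [IsScalarTower k B M] (b : B) (m : M) :
    leftAct k B M (b ⊗ₜ m) = b • m := rfl

@[simp]
lemma rightAct_tmul [Module Bᵐᵒᵖ M] [IsScalarTower k Bᵐᵒᵖ M] (b : B) (m : M) :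
    rightAct k B M (m ⊗ₜ b) = MulOpposite.op b • m := rfl

variable [Module B M] [IsScalarTower k B M] [Module Bᵐᵒᵖ M] [IsScalarTower k Bᵐᵒᵖ M]

/-- The differential of the normalized Hochschild complex of `B` with coefficients in the bimodule
`M`. -/
noncomputable def hochDiff (r : ℕ) :
    M ⊗[k] (⨂[k]^(r + 1) (Bar k B)) →ₗ[k] M ⊗[k] (⨂[k]^r (Bar k B)) :=
  hochD (rightAct k B M) (leftAct k B M) (by simp) (by simp) r

lemma hochDiff_comp [SMulCommClass B Bᵐᵒᵖ M] (r : ℕ) :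
    hochDiff k B M r ∘ₗ hochDiff k B M (r + 1) = 0 :=
  hochD_comp _ _ _ _ (fun n a b => by simp [mul_smul]) (fun n a b => by simp [mul_smul])
    (fun n a b => by simp [smul_comm]) r

end Coefficients

section Filtration

variable {k : Type*} [CommRing k] {B : Type*} [Ring B] [Algebra k B] (A : Submodule k B)

open Classical in
/-- The number of entries of the tuple `x` that belong to `A`. -/
noncomputable def countIn {n : ℕ} (x : Fin n → B) : ℕ :=
  (Finset.univ.filter fun j => x j ∈ A).card

lemma countIn_cons {n : ℕ} (b : B) (x : Fin n → B) [Decidable (b ∈ A)] :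
    countIn A (Fin.cons b x : Fin (n + 1) → B) = countIn A x + if b ∈ A then 1 else 0 := by
  simp only [countIn, Fin.card_filter_univ_succ, Fin.cons_zero, Fin.cons_succ]
  split_ifs <;> simp_all <;> rfl

/-- The submodule of `B̄^n` spanned by the `x₁ ⊗ ⋯ ⊗ xₙ` such that at least `c` of the `xⱼ` belong
to `A`. -/
noncomputable def atLeast (n : ℕ) (c : ℤ) : Submodule k (⨂[k]^n (Bar k B)) :=
  Submodule.span k {t | ∃ x : Fin n → B, c ≤ countIn A x ∧
    t = PiTensorProduct.tprod k fun j => bar k B (x j)}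

variable (k B) in
lemma cons_bar_tprod {n : ℕ} (b : B) (x : Fin n → B) :
    cons k (Bar k B) n (bar k B b ⊗ₜ PiTensorProduct.tprod k fun j => bar k B (x j)) =
      PiTensorProduct.tprod k fun j => bar k B ((Fin.cons b x : Fin (n + 1) → B) j) := by
  rw [cons_tmul_tprod]
  congr 1
  funext i
  refine Fin.cases ?_ (fun j => ?_) i <;> simp

variable {A}

lemma atLeast_anti {n : ℕ} {c c' : ℤ} (h : c ≤ c') : atLeast A n c' ≤ atLeast A n c :=
  Submodule.span_mono fun _ ⟨x, hx, e⟩ => ⟨x, h.trans hx, e⟩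

lemma cons_mem_atLeast {n : ℕ} {c : ℤ} (b : B) {w : ⨂[k]^n (Bar k B)} (hw : w ∈ atLeast A n c) :
    cons k (Bar k B) n (bar k B b ⊗ₜ w) ∈ atLeast A (n + 1) c := by
  classical
  induction hw using Submodule.span_induction with
  | mem w h =>
    obtain ⟨x, hx, rfl⟩ := h
    refine Submodule.subset_span ⟨Fin.cons b x, ?_, cons_bar_tprod k B b x⟩
    rw [countIn_cons]
    push_cast
    split_ifs <;> lia
  | zero => simp
  | add x y _ _ hx hy => rw [TensorProduct.tmul_add, map_add]; exact Submodule.add_mem _ hx hy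
  | smul a x _ hx => rw [TensorProduct.tmul_smul, map_smul]; exact Submodule.smul_mem _ _ hx

lemma cons_mem_atLeast' {n : ℕ} {c : ℤ} {b : B} (hb : b ∈ A) {w : ⨂[k]^n (Bar k B)}
    (hw : w ∈ atLeast A n (c - 1)) :
    cons k (Bar k B) n (bar k B b ⊗ₜ w) ∈ atLeast A (n + 1) c := by
  classical
  induction hw using Submodule.span_induction with
  | mem w h =>
    obtain ⟨x, hx, rfl⟩ := h
    refine Submodule.subset_span ⟨Fin.cons b x, ?_, cons_bar_tprod k B b x⟩
    rw [countIn_cons, if_pos hb]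
    push_cast
    lia
  | zero => simp
  | add x y _ _ hx hy => rw [TensorProduct.tmul_add, map_add]; exact Submodule.add_mem _ hx hy
  | smul a x _ hx => rw [TensorProduct.tmul_smul, map_smul]; exact Submodule.smul_mem _ _ hx

lemma atLeast_induction {n : ℕ} {c : ℤ} {p : (⨂[k]^(n + 1) (Bar k B)) → Prop}
    {w : ⨂[k]^(n + 1) (Bar k B)} (hw : w ∈ atLeast A (n + 1) c)
    (h0 : p 0) (hadd : ∀ x y, p x → p y → p (x + y)) (hsmul : ∀ (a : k) x, p x → p (a • x))
    (h1 : ∀ x w, x ∈ A → w ∈ atLeast A n (c - 1) → p (cons k (Bar k B) n (bar k B x ⊗ₜ w)))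
    (h2 : ∀ x w, w ∈ atLeast A n c → p (cons k (Bar k B) n (bar k B x ⊗ₜ w))) : p w := by
  classical
  induction hw using Submodule.span_induction with
  | mem w h =>
    obtain ⟨x, hx, rfl⟩ := h
    rw [← Fin.cons_self_tail x, countIn_cons] at hx
    rw [← Fin.cons_self_tail x, ← cons_bar_tprod]
    by_cases h : x 0 ∈ A
    · rw [if_pos h] at hx
      push_cast at hx
      exact h1 _ _ h (Submodule.subset_span ⟨_, by lia, rfl⟩)
    · rw [if_neg h] at hx
      exact h2 _ _ (Submodule.subset_span ⟨_, by lia, rfl⟩)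
  | zero => exact h0
  | add x y _ _ hx hy => exact hadd _ _ hx hy
  | smul a x _ hx => exact hsmul _ _ hx

variable (A) in
/-- The submodule of `B̄^n ⊗ B` spanned by the `w ⊗ z` with `w ∈ atLeast A n c`. -/
noncomputable def atLeastB (n : ℕ) (c : ℤ) : Submodule k ((⨂[k]^n (Bar k B)) ⊗[k] B) :=
  LinearMap.range ((atLeast A n c).subtype.rTensor B)

lemma tmul_mem_atLeastB {n : ℕ} {c : ℤ} {w : ⨂[k]^n (Bar k B)} (hw : w ∈ atLeast A n c) (z : B) :
    w ⊗ₜ z ∈ atLeastB A n c := ⟨⟨w, hw⟩ ⊗ₜ z, rfl⟩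

lemma atLeastB_induction {n : ℕ} {c : ℤ} {p : (⨂[k]^n (Bar k B)) ⊗[k] B → Prop}
    {t : (⨂[k]^n (Bar k B)) ⊗[k] B} (ht : t ∈ atLeastB A n c)
    (h0 : p 0) (hadd : ∀ x y, p x → p y → p (x + y))
    (h : ∀ w z, w ∈ atLeast A n c → p (w ⊗ₜ z)) : p t := by
  obtain ⟨t, rfl⟩ := ht
  induction t using TensorProduct.induction_on with
  | zero => simpa using h0
  | add x y hx hy => rw [map_add]; exact hadd _ _ hx hy
  | tmul w z => exact h _ _ w.2

lemma atLeastB_anti {n : ℕ} {c c' : ℤ} (h : c ≤ c') : atLeastB A n c' ≤ atLeastB A n c :=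
  fun _ ht => atLeastB_induction ht (Submodule.zero_mem _) (fun _ _ => Submodule.add_mem _)
    fun _ _ hw => tmul_mem_atLeastB (atLeast_anti h hw) _

lemma consB_mem {n : ℕ} {c : ℤ} (b : B) {t : (⨂[k]^n (Bar k B)) ⊗[k] B}
    (ht : t ∈ atLeastB A n c) : consB k B n (bar k B b ⊗ₜ t) ∈ atLeastB A (n + 1) c := by
  refine atLeastB_induction (p := fun t => consB k B n (bar k B b ⊗ₜ t) ∈ atLeastB A (n + 1) c)
    ht (by simp) (fun x y hx hy => ?_) fun w z hw => ?_
  · rw [TensorProduct.tmul_add, map_add]; exact Submodule.add_mem _ hx hy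
  · exact tmul_mem_atLeastB (cons_mem_atLeast _ hw) z

lemma consB_mem' {n : ℕ} {c : ℤ} {b : B} (hb : b ∈ A) {t : (⨂[k]^n (Bar k B)) ⊗[k] B}
    (ht : t ∈ atLeastB A n (c - 1)) : consB k B n (bar k B b ⊗ₜ t) ∈ atLeastB A (n + 1) c := by
  refine atLeastB_induction (p := fun t => consB k B n (bar k B b ⊗ₜ t) ∈ atLeastB A (n + 1) c)
    ht (by simp) (fun x y hx hy => ?_) fun w z hw => ?_
  · rw [TensorProduct.tmul_add, map_add]; exact Submodule.add_mem _ hx hy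
  · exact tmul_mem_atLeastB (cons_mem_atLeast' hb hw) z

lemma gamma_mem (hA : ∀ a b, a ∈ A → b ∈ A → a * b ∈ A) (n : ℕ) :
    ∀ (c : ℤ) (w : ⨂[k]^n (Bar k B)), w ∈ atLeast A n c → ∀ b,
      (gamma n).1 (b ⊗ₜ w) ∈ atLeastB A n (c - 1) ∧
      (b ∈ A → (gamma n).1 (b ⊗ₜ w) ∈ atLeastB A n c) := by
  induction n with
  | zero =>
    intro c w hw b
    have h : (gamma 0).1 (b ⊗ₜ w) = w ⊗ₜ b := rfl
    rw [h]
    exact ⟨tmul_mem_atLeastB (atLeast_anti (by lia) hw) _, fun _ => tmul_mem_atLeastB hw _⟩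
  | succ n ih =>
    intro c w hw b
    refine atLeast_induction (p := fun w => (gamma (n + 1)).1 (b ⊗ₜ w) ∈ atLeastB A (n + 1) (c - 1) ∧
      (b ∈ A → (gamma (n + 1)).1 (b ⊗ₜ w) ∈ atLeastB A (n + 1) c)) hw (by simp)
      (fun x y hx hy => ?_) (fun a x hx => ?_) (fun x w hx hw => ?_) (fun x w hw => ?_)
    · rw [TensorProduct.tmul_add, map_add]
      exact ⟨Submodule.add_mem _ hx.1 hy.1, fun h => Submodule.add_mem _ (hx.2 h) (hy.2 h)⟩
    · rw [TensorProduct.tmul_smul, map_smul]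
      exact ⟨Submodule.smul_mem _ _ hx.1, fun h => Submodule.smul_mem _ _ (hx.2 h)⟩
    · rw [gamma_succ']
      exact ⟨Submodule.sub_mem _ (tmul_mem_atLeastB (cons_mem_atLeast _ hw) _)
          (consB_mem _ ((ih _ _ hw x).2 hx)),
        fun hb => Submodule.sub_mem _ (tmul_mem_atLeastB (cons_mem_atLeast' (hA _ _ hb hx) hw) _)
          (consB_mem' hb ((ih _ _ hw x).2 hx))⟩
    · rw [gamma_succ']
      exact ⟨Submodule.sub_mem _ (tmul_mem_atLeastB (atLeast_anti (by lia)
          (cons_mem_atLeast _ hw)) _) (consB_mem _ (ih _ _ hw x).1),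
        fun hb => Submodule.sub_mem _ (tmul_mem_atLeastB (cons_mem_atLeast _ hw) _)
          (consB_mem' hb (ih _ _ hw x).1)⟩

variable (A) (M : Type*) [AddCommGroup M] [Module k M]

/-- The submodule `F_p (M ⊗ B̄^n)` spanned by the tensors `m ⊗ x₁ ⊗ ⋯ ⊗ xₙ` such that at least
`n - p` of the `xⱼ` belong to `A`. -/
noncomputable def hochFilt (p : ℤ) (n : ℕ) : Submodule k (M ⊗[k] (⨂[k]^n (Bar k B))) :=
  Submodule.span k {t | ∃ (m : M) (x : Fin n → B), (n : ℤ) - p ≤ countIn A x ∧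
    t = m ⊗ₜ PiTensorProduct.tprod k fun j => bar k B (x j)}

variable {A M}

lemma hochFilt_mono {p q : ℤ} {n : ℕ} (h : p ≤ q) : hochFilt A M p n ≤ hochFilt A M q n :=
  Submodule.span_mono fun _ ⟨m, x, hx, e⟩ => ⟨m, x, by lia, e⟩

lemma tmul_mem_hochFilt {p : ℤ} {n : ℕ} (m : M) {w : ⨂[k]^n (Bar k B)}
    (hw : w ∈ atLeast A n (n - p)) : m ⊗ₜ w ∈ hochFilt A M p n := by
  induction hw using Submodule.span_induction with
  | mem w h =>
    obtain ⟨x, hx, rfl⟩ := h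
    exact Submodule.subset_span ⟨m, x, hx, rfl⟩
  | zero => simp
  | add x y _ _ hx hy => rw [TensorProduct.tmul_add]; exact Submodule.add_mem _ hx hy
  | smul a x _ hx => rw [TensorProduct.tmul_smul]; exact Submodule.smul_mem _ _ hx

lemma wrap_mem_hochFilt (lam : B ⊗[k] M →ₗ[k] M) {p : ℤ} {n : ℕ} (m : M)
    {t : (⨂[k]^n (Bar k B)) ⊗[k] B}
    (ht : t ∈ atLeastB A n (n - p)) : wrap lam (m ⊗ₜ t) ∈ hochFilt A M p n := by
  refine atLeastB_induction (p := fun t => wrap lam (m ⊗ₜ t) ∈ hochFilt A M p n)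
    ht (by simp) (fun x y hx hy => ?_) fun w z hw => ?_
  · rw [TensorProduct.tmul_add, map_add]; exact Submodule.add_mem _ hx hy
  · exact tmul_mem_hochFilt _ hw

lemma hochD_mem (hA : ∀ a b, a ∈ A → b ∈ A → a * b ∈ A)
    (rho : M ⊗[k] B →ₗ[k] M) (lam : B ⊗[k] M →ₗ[k] M)
    (h1 : ∀ n, rho (n ⊗ₜ 1) = n) (h2 : ∀ n, lam (1 ⊗ₜ n) = n) (p : ℤ) (r : ℕ)
    (t : M ⊗[k] (⨂[k]^(r + 1) (Bar k B))) (ht : t ∈ hochFilt A M p (r + 1)) :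
    hochD rho lam h1 h2 r t ∈ hochFilt A M p r := by
  induction ht using Submodule.span_induction with
  | mem t h =>
    obtain ⟨m, x, hx, rfl⟩ := h
    have hw : (PiTensorProduct.tprod k fun j => bar k B (x j)) ∈ atLeast A (r + 1)
        (((r + 1 : ℕ) : ℤ) - p) := Submodule.subset_span ⟨x, hx, rfl⟩
    refine atLeast_induction (p := fun w => hochD rho lam h1 h2 r (m ⊗ₜ w) ∈ hochFilt A M p r) hw
      (by simp) (fun x y hx hy => ?_) (fun a x hx => ?_)
      (fun x w hx hw => ?_) (fun x w hw => ?_)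
    · rw [TensorProduct.tmul_add, map_add]; exact Submodule.add_mem _ hx hy
    · rw [TensorProduct.tmul_smul, map_smul]; exact Submodule.smul_mem _ _ hx
    · have hw' : w ∈ atLeast A r (r - p) := atLeast_anti (by push_cast; lia) hw
      rw [hochD_tmul]
      exact Submodule.sub_mem _ (tmul_mem_hochFilt _ hw')
        (wrap_mem_hochFilt _ _ ((gamma_mem hA r _ _ hw' x).2 hx))
    · rw [hochD_tmul]
      exact Submodule.sub_mem _ (tmul_mem_hochFilt _ (atLeast_anti (by push_cast; lia) hw))
        (wrap_mem_hochFilt _ _ (atLeastB_anti (by push_cast; lia) (gamma_mem hA r _ _ hw x).1))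
  | zero => simp
  | add x y _ _ hx hy => rw [map_add]; exact Submodule.add_mem _ hx hy
  | smul a x _ hx => rw [map_smul]; exact Submodule.smul_mem _ _ hx

end Filtration

/-- A weak action `(h, a) ↦ a^h` of a Hopf algebra `H` on an algebra `A`, together with a linear
map `f : H ⊗ H → A`. -/
structure CrossedData (k A H : Type*) [CommRing k] [Ring A] [Algebra k A] [Ring H]
    [HopfAlgebra k H] where
  /-- the weak action, `act h a = a^h` -/
  act : H →ₗ[k] A →ₗ[k] A
  /-- the map `f` -/
  f : H ⊗[k] H →ₗ[k] A
  /-- `(a b)^h = ∑ a^(h₁) b^(h₂)` -/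
  act_mul : ∀ (h : H) (a b : A), act h (a * b) = LinearMap.mul' k A
    (TensorProduct.map (act.flip a) (act.flip b) (Coalgebra.comul (R := k) h))
  /-- `1^h = ε(h) 1` -/
  act_one : ∀ h : H, act h 1 = algebraMap k A (Coalgebra.counit (R := k) h)
  /-- `a^1 = a` -/
  one_act : ∀ a : A, act 1 a = a

namespace CrossedData

variable {k A H : Type*} [CommRing k] [Ring A] [Algebra k A] [Ring H] [HopfAlgebra k H]
  (S : CrossedData k A H)

/-- The map `χ : H ⊗ A → A ⊗ H`, `h ⊗ a ↦ ∑ a^(h₁) ⊗ h₂`. -/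
noncomputable def chi : H ⊗[k] A →ₗ[k] A ⊗[k] H :=
  (TensorProduct.lift S.act).rTensor H ∘ₗ (TensorProduct.rightComm k H H A).toLinearMap ∘ₗ
    (Coalgebra.comul (R := k) (A := H)).rTensor A

/-- The map `𝓕 : H ⊗ H → A ⊗ H`, `h ⊗ l ↦ ∑ f(h₁, l₁) ⊗ h₂ l₂`. -/
noncomputable def ff : H ⊗[k] H →ₗ[k] A ⊗[k] H :=
  TensorProduct.map S.f (LinearMap.mul' k H) ∘ₗ
    (TensorProduct.tensorTensorTensorComm k H H H H).toLinearMap ∘ₗ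
      TensorProduct.map (Coalgebra.comul (R := k) (A := H)) (Coalgebra.comul (R := k) (A := H))

variable (k A H) in
/-- The left multiplication `a ⊗ (b ⊗ h) ↦ a b ⊗ h`. -/
noncomputable def mulLeft : A ⊗[k] (A ⊗[k] H) →ₗ[k] A ⊗[k] H :=
  (LinearMap.mul' k A).rTensor H ∘ₗ (TensorProduct.assoc k A A H).symm.toLinearMap

/-- The multiplication of `A #_f H`:
`(a ⊗ h) (b ⊗ l) = ∑ a b^(h₁) f(h₂, l₁) ⊗ h₃ l₂`, that is `a b' 𝓕 (h' ⊗ l)` with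
`χ (h ⊗ b) = ∑ b' ⊗ h'`. -/
noncomputable def mul : (A ⊗[k] H) ⊗[k] (A ⊗[k] H) →ₗ[k] A ⊗[k] H :=
  mulLeft k A H ∘ₗ (mulLeft k A H ∘ₗ S.ff.lTensor A ∘ₗ (TensorProduct.assoc k A H H).toLinearMap ∘ₗ
    S.chi.rTensor H ∘ₗ (TensorProduct.assoc k H A H).symm.toLinearMap).lTensor A ∘ₗ
      (TensorProduct.assoc k A H (A ⊗[k] H)).toLinearMap

lemma mul_tmul (a b : A) (h l : H) : S.mul ((a ⊗ₜ h) ⊗ₜ (b ⊗ₜ l)) =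
    mulLeft k A H (a ⊗ₜ mulLeft k A H (S.ff.lTensor A
      (TensorProduct.assoc k A H H (S.chi (h ⊗ₜ b) ⊗ₜ l)))) := rfl

lemma mulLeft_one (x : A ⊗[k] H) : mulLeft k A H (1 ⊗ₜ x) = x := by
  induction x using TensorProduct.induction_on with
  | zero => simp
  | add x y hx hy => rw [TensorProduct.tmul_add, map_add, hx, hy]
  | tmul b w => simp [mulLeft]

lemma chi_one_tmul (a : A) : S.chi (1 ⊗ₜ a) = a ⊗ₜ 1 := by
  simp [chi, Bialgebra.comul_one, Algebra.TensorProduct.one_def, S.one_act]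

lemma chi_tmul_one (h : H) : S.chi (h ⊗ₜ 1) = 1 ⊗ₜ h := by
  have key : ∀ t : H ⊗[k] H, (TensorProduct.lift S.act).rTensor H
      ((TensorProduct.rightComm k H H A) (t ⊗ₜ (1 : A))) =
        (Algebra.linearMap k A).rTensor H ((Coalgebra.counit (R := k) (A := H)).rTensor H t) := by
    intro t
    induction t using TensorProduct.induction_on with
    | zero => simp
    | add x y hx hy => rw [TensorProduct.add_tmul, map_add, map_add, hx, hy, map_add, map_add]
    | tmul x y => simp [S.act_one]
  have h2 : S.chi (h ⊗ₜ 1) = (TensorProduct.lift S.act).rTensor H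
      ((TensorProduct.rightComm k H H A) (Coalgebra.comul (R := k) h ⊗ₜ (1 : A))) := rfl
  rw [h2, key, Coalgebra.rTensor_counit_comul]
  simp

end CrossedData

/-- A crossed product `A #_f H`: a weak action and a map `f` such that the multiplication
`(a ⊗ h) (b ⊗ l) = ∑ a b^(h₁) f(h₂, l₁) ⊗ h₃ l₂` of `A ⊗ H` is associative with identity
`1 ⊗ 1`. -/
structure CrossedSystem (k A H : Type*) [CommRing k] [Ring A] [Algebra k A] [Ring H]
    [HopfAlgebra k H] extends CrossedData k A H where
  mul_assoc : ∀ x y z : A ⊗[k] H, toCrossedData.mul (toCrossedData.mul (x ⊗ₜ y) ⊗ₜ z) =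
    toCrossedData.mul (x ⊗ₜ toCrossedData.mul (y ⊗ₜ z))
  one_mul : ∀ x : A ⊗[k] H, toCrossedData.mul ((1 ⊗ₜ 1) ⊗ₜ x) = x
  mul_one : ∀ x : A ⊗[k] H, toCrossedData.mul (x ⊗ₜ (1 ⊗ₜ 1)) = x

namespace CrossedSystem

variable {k A H : Type*} [CommRing k] [Ring A] [Algebra k A] [Ring H] [HopfAlgebra k H]
  (S : CrossedSystem k A H)

lemma ff_one_tmul (l : H) : S.ff (1 ⊗ₜ l) = 1 ⊗ₜ l := by
  have h := S.one_mul (1 ⊗ₜ l)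
  rw [CrossedData.mul_tmul, S.chi_one_tmul] at h
  simpa [CrossedData.mulLeft_one] using h

lemma ff_tmul_one (h : H) : S.ff (h ⊗ₜ 1) = 1 ⊗ₜ h := by
  have h := S.mul_one (1 ⊗ₜ h)
  rw [CrossedData.mul_tmul, S.chi_tmul_one] at h
  simpa [CrossedData.mulLeft_one] using h

/-- The crossed product `E = A #_f H`; its underlying module is `A ⊗ H`. -/
def E (_ : CrossedSystem k A H) : Type _ := A ⊗[k] H

lemma add_tmul_mul (x y z : A ⊗[k] H) : S.mul ((x + y) ⊗ₜ z) = S.mul (x ⊗ₜ z) + S.mul (y ⊗ₜ z) := by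
  rw [TensorProduct.add_tmul, map_add]

lemma tmul_add_mul (x y z : A ⊗[k] H) : S.mul (x ⊗ₜ (y + z)) = S.mul (x ⊗ₜ y) + S.mul (x ⊗ₜ z) := by
  rw [TensorProduct.tmul_add, map_add]

lemma zero_tmul_mul (x : A ⊗[k] H) : S.mul (0 ⊗ₜ x) = 0 := by
  rw [TensorProduct.zero_tmul, map_zero]

lemma tmul_zero_mul (x : A ⊗[k] H) : S.mul (x ⊗ₜ 0) = 0 := by
  rw [TensorProduct.tmul_zero, map_zero]

lemma smul_tmul_mul (c : k) (x y : A ⊗[k] H) : S.mul ((c • x) ⊗ₜ y) = c • S.mul (x ⊗ₜ y) := by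
  rw [← TensorProduct.smul_tmul', map_smul]

lemma tmul_smul_mul (c : k) (x y : A ⊗[k] H) : S.mul (x ⊗ₜ (c • y)) = c • S.mul (x ⊗ₜ y) := by
  rw [TensorProduct.tmul_smul, map_smul]

noncomputable instance : Ring S.E where
  __ := (inferInstance : AddCommGroup (A ⊗[k] H))
  mul x y := S.mul (x ⊗ₜ y)
  one := ((1 : A) ⊗ₜ[k] (1 : H) : A ⊗[k] H)
  mul_assoc := S.mul_assoc
  one_mul := S.one_mul
  mul_one := S.mul_one
  left_distrib := S.tmul_add_mul
  right_distrib := S.add_tmul_mul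
  zero_mul := S.zero_tmul_mul
  mul_zero := S.tmul_zero_mul

noncomputable instance : Algebra k S.E :=
  letI : Module k S.E := (inferInstance : Module k (A ⊗[k] H))
  Algebra.ofModule S.smul_tmul_mul S.tmul_smul_mul

/-- The identity of `A ⊗ H`, as a linear equivalence onto the algebra `E`. -/
noncomputable def toE : A ⊗[k] H ≃ₗ[k] S.E where
  toFun x := x
  invFun x := x
  map_add' _ _ := rfl
  map_smul' _ _ := rfl

lemma toE_mul (x y : A ⊗[k] H) : S.toE x * S.toE y = S.toE (S.mul (x ⊗ₜ y)) := rfl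

lemma toE_one : S.toE (1 ⊗ₜ 1) = 1 := rfl

/-- The inclusion `a ↦ a # 1` of `A` in `E`. -/
noncomputable def inA : A →ₗ[k] S.E :=
  S.toE.toLinearMap ∘ₗ (TensorProduct.mk k A H).flip 1

/-- The map `h ↦ 1 # h` from `H` to `E`. -/
noncomputable def inH : H →ₗ[k] S.E := S.toE.toLinearMap ∘ₗ TensorProduct.mk k A H 1

@[simp] lemma inA_one : S.inA 1 = 1 := rfl

@[simp] lemma inH_one : S.inH 1 = 1 := rfl

lemma inA_mul (a b : A) : S.inA a * S.inA b = S.inA (a * b) := by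
  refine (S.toE_mul (a ⊗ₜ 1) (b ⊗ₜ 1)).trans (congrArg S.toE ?_)
  rw [CrossedData.mul_tmul, S.chi_one_tmul]
  simp [S.ff_one_tmul, CrossedData.mulLeft]
  rfl

end CrossedSystem

section Iter

variable {k : Type*} [CommRing k] {V : Type*} [AddCommGroup V] [Module k V]

lemma iterL_of_comm {C : Type*} [AddCommGroup C] [Module k C] (β : V ⊗[k] C →ₗ[k] C ⊗[k] V) (c : C)
    (h : ∀ v, β (v ⊗ₜ c) = c ⊗ₜ v) (n : ℕ) (w : ⨂[k]^n V) : iterL β n (w ⊗ₜ c) = c ⊗ₜ w := by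
  induction n with
  | zero => rfl
  | succ n ih =>
    obtain ⟨w, rfl⟩ := (cons k V n).surjective w
    induction w using TensorProduct.induction_on with
    | zero => simp
    | add x y hx hy => rw [map_add, TensorProduct.add_tmul, map_add, hx, hy, TensorProduct.tmul_add]
    | tmul v w => simp [iterL, passL, ih, h]

lemma iterR_of_comm {U : Type*} [AddCommGroup U] [Module k U] (β : U ⊗[k] V →ₗ[k] V ⊗[k] U) (u : U)
    (h : ∀ v, β (u ⊗ₜ v) = v ⊗ₜ u) (n : ℕ) (w : ⨂[k]^n V) : iterR β n (u ⊗ₜ w) = w ⊗ₜ u := by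
  induction n with
  | zero => rfl
  | succ n ih =>
    obtain ⟨w, rfl⟩ := (cons k V n).surjective w
    induction w using TensorProduct.induction_on with
    | zero => simp
    | add x y hx hy => rw [map_add, TensorProduct.tmul_add, map_add, hx, hy, TensorProduct.add_tmul]
    | tmul v w => simp [iterR, passR, ih, h]

end Iter

namespace CrossedSystem

variable {k A H : Type*} [CommRing k] [Ring A] [Algebra k A] [Ring H] [HopfAlgebra k H]
  (S : CrossedSystem k A H)

/-- `χ : H̄ ⊗ A → A ⊗ H̄`, `h ⊗ a ↦ ∑ a^(h₁) ⊗ h₂`. -/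
noncomputable def chiHb : Bar k H ⊗[k] A →ₗ[k] A ⊗[k] Bar k H :=
  liftBar ((bar k H).lTensor A ∘ₗ S.chi) fun a => by simp [S.chi_one_tmul, bar_one]

/-- `χ : H ⊗ Ā → Ā ⊗ H`, `h ⊗ a ↦ ∑ a^(h₁) ⊗ h₂`. -/
noncomputable def chiAb : H ⊗[k] Bar k A →ₗ[k] Bar k A ⊗[k] H :=
  liftBar' ((bar k A).rTensor H ∘ₗ S.chi) fun h => by simp [S.chi_tmul_one, bar_one]

lemma chiAb_one_tmul (a : Bar k A) : S.chiAb (1 ⊗ₜ a) = a ⊗ₜ 1 := by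
  obtain ⟨a, rfl⟩ := bar_surjective k A a
  simp [chiAb, S.chi_one_tmul]

/-- `χ : H̄ ⊗ Ā → Ā ⊗ H̄`, `h ⊗ a ↦ ∑ a^(h₁) ⊗ h₂`. -/
noncomputable def chiBb : Bar k H ⊗[k] Bar k A →ₗ[k] Bar k A ⊗[k] Bar k H :=
  liftBar ((bar k H).lTensor (Bar k A) ∘ₗ S.chiAb) fun a => by simp [S.chiAb_one_tmul, bar_one]

lemma chiHb_tmul_one (h : Bar k H) : S.chiHb (h ⊗ₜ 1) = 1 ⊗ₜ h := by
  obtain ⟨h, rfl⟩ := bar_surjective k H h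
  simp [chiHb, S.chi_tmul_one]

/-- `H ⊗ H̄ → Ā ⊗ H`, `h ⊗ l ↦ ∑ f(h₁, l₁) ⊗ h₂ l₂`. -/
noncomputable def ffAux : H ⊗[k] Bar k H →ₗ[k] Bar k A ⊗[k] H :=
  liftBar' ((bar k A).rTensor H ∘ₗ S.ff) fun h => by simp [S.ff_tmul_one, bar_one]

/-- `𝓕 : H̄ ⊗ H̄ → Ā ⊗ H`, `h ⊗ l ↦ ∑ f(h₁, l₁) ⊗ h₂ l₂`. -/
noncomputable def ffb : Bar k H ⊗[k] Bar k H →ₗ[k] Bar k A ⊗[k] H :=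
  liftBar S.ffAux fun l => by
    obtain ⟨l, rfl⟩ := bar_surjective k H l
    simp [ffAux, S.ff_one_tmul, bar_one]

section Gamma

/-- `c ⊗ q ⊗ w ↦ c ⊗ ((q ⊗ w) ⊗ 1)`. -/
noncomputable def hhA (k A H : Type*) [CommRing k] [Ring A] [Algebra k A] [Ring H]
    [HopfAlgebra k H] (n : ℕ) :
    (A ⊗[k] H) ⊗[k] (⨂[k]^n (Bar k H)) →ₗ[k] A ⊗[k] ((⨂[k]^(n + 1) (Bar k H)) ⊗[k] H) :=
  ((TensorProduct.mk k (⨂[k]^(n + 1) (Bar k H)) H).flip 1 ∘ₗ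
    (cons k (Bar k H) n).toLinearMap ∘ₗ (bar k H).rTensor _).lTensor A ∘ₗ
      (TensorProduct.assoc k A H _).toLinearMap

/-- `c ⊗ q ⊗ (w ⊗ y) ↦ c ⊗ ((q ⊗ w) ⊗ y)`. -/
noncomputable def hhB (k A H : Type*) [CommRing k] [Ring A] [Algebra k A] [Ring H]
    [HopfAlgebra k H] (n : ℕ) :
    (A ⊗[k] H) ⊗[k] ((⨂[k]^n (Bar k H)) ⊗[k] H) →ₗ[k] A ⊗[k] ((⨂[k]^(n + 1) (Bar k H)) ⊗[k] H) :=
  (consB k H n ∘ₗ (bar k H).rTensor _).lTensor A ∘ₗ (TensorProduct.assoc k A H _).toLinearMap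

lemma hhA_tmul (n : ℕ) (c : A) (q : H) (w : ⨂[k]^n (Bar k H)) :
    hhA k A H n ((c ⊗ₜ q) ⊗ₜ w) = c ⊗ₜ (cons k (Bar k H) n (bar k H q ⊗ₜ w) ⊗ₜ 1) := rfl

lemma hhB_tmul (n : ℕ) (c : A) (q : H) (t : (⨂[k]^n (Bar k H)) ⊗[k] H) :
    hhB k A H n ((c ⊗ₜ q) ⊗ₜ t) = c ⊗ₜ consB k H n (bar k H q ⊗ₜ t) := rfl

/-- `h ⊗ c ⊗ t ↦ ∑ c^(h₁) ⊗ h₂ ⊗ t`. -/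
noncomputable def chiT (T : Type*) [AddCommGroup T] [Module k T] :
    H ⊗[k] (A ⊗[k] T) →ₗ[k] (A ⊗[k] H) ⊗[k] T :=
  S.chi.rTensor _ ∘ₗ (TensorProduct.assoc k H A _).symm.toLinearMap

lemma chiT_tmul (T : Type*) [AddCommGroup T] [Module k T] (h : H) (c : A) (t : T) :
    S.chiT T (h ⊗ₜ (c ⊗ₜ t)) = S.chi (h ⊗ₜ c) ⊗ₜ t := rfl

/-- `H ⊗ (H ⊗ W) → A ⊗ (W' ⊗ H)`, for `W = H̄^n` and `W' = H̄^(n+1)`: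
`h ⊗ (l ⊗ w) ↦ ∑ f(h₁, l₁) ⊗ ((h₂ l₂ ⊗ w) ⊗ 1) - ∑ c^(h₁) ⊗ ((h₂ ⊗ w') ⊗ y)`, where
`G (l ⊗ w) = ∑ c ⊗ (w' ⊗ y)`. -/
noncomputable def hhStep {n : ℕ}
    (G : H ⊗[k] (⨂[k]^n (Bar k H)) →ₗ[k] A ⊗[k] ((⨂[k]^n (Bar k H)) ⊗[k] H)) :
    H ⊗[k] (H ⊗[k] (⨂[k]^n (Bar k H))) →ₗ[k] A ⊗[k] ((⨂[k]^(n + 1) (Bar k H)) ⊗[k] H) :=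
  hhA k A H n ∘ₗ S.ff.rTensor _ ∘ₗ (TensorProduct.assoc k H H _).symm.toLinearMap -
    hhB k A H n ∘ₗ S.chiT _ ∘ₗ G.lTensor H

lemma hhStep_tmul {n : ℕ}
    (G : H ⊗[k] (⨂[k]^n (Bar k H)) →ₗ[k] A ⊗[k] ((⨂[k]^n (Bar k H)) ⊗[k] H)) (h l : H)
    (w : ⨂[k]^n (Bar k H)) :
    S.hhStep G (h ⊗ₜ (l ⊗ₜ w)) = hhA k A H n (S.ff (h ⊗ₜ l) ⊗ₜ w) -
      hhB k A H n (S.chiT _ (h ⊗ₜ G (l ⊗ₜ w))) := rfl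

lemma hhB_one {n : ℕ} (x : A ⊗[k] ((⨂[k]^n (Bar k H)) ⊗[k] H)) :
    hhB k A H n (S.chiT _ (1 ⊗ₜ x)) = 0 := by
  induction x using TensorProduct.induction_on with
  | zero => rw [TensorProduct.tmul_zero, map_zero, map_zero]
  | add x y hx hy => rw [TensorProduct.tmul_add, map_add, map_add, hx, hy, add_zero]
  | tmul c t =>
    rw [chiT_tmul, S.chi_one_tmul, hhB_tmul, bar_one, TensorProduct.zero_tmul, map_zero,
      TensorProduct.tmul_zero]

lemma hhStep_one_tmul {n : ℕ}
    (G : H ⊗[k] (⨂[k]^n (Bar k H)) →ₗ[k] A ⊗[k] ((⨂[k]^n (Bar k H)) ⊗[k] H)) (l : H)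
    (w : ⨂[k]^n (Bar k H)) :
    S.hhStep G (1 ⊗ₜ (l ⊗ₜ w)) = 1 ⊗ₜ (cons k (Bar k H) n (bar k H l ⊗ₜ w) ⊗ₜ 1) := by
  rw [hhStep_tmul, hhB_one, S.ff_one_tmul, hhA_tmul, sub_zero]

lemma hhStep_tmul_one {n : ℕ}
    (G : H ⊗[k] (⨂[k]^n (Bar k H)) →ₗ[k] A ⊗[k] ((⨂[k]^n (Bar k H)) ⊗[k] H))
    (hG : ∀ w, G (1 ⊗ₜ w) = 1 ⊗ₜ (w ⊗ₜ 1)) (x : H ⊗[k] (⨂[k]^n (Bar k H))) :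
    (S.hhStep G ∘ₗ (TensorProduct.leftComm k H H _).toLinearMap) (1 ⊗ₜ x) = 0 := by
  induction x using TensorProduct.induction_on with
  | zero => rw [TensorProduct.tmul_zero, map_zero]
  | add x y hx hy => rw [TensorProduct.tmul_add, map_add, hx, hy, add_zero]
  | tmul h w =>
    refine (S.hhStep_tmul G h 1 w).trans ?_
    rw [hG, S.ff_tmul_one, chiT_tmul, S.chi_tmul_one, hhA_tmul, hhB_tmul, consB_tmul, sub_self]

/-- The map `H ⊗ H̄^(n+1) → A ⊗ (H̄^(n+1) ⊗ H)` induced by `hhStep`. -/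
noncomputable def hhNext {n : ℕ}
    (G : H ⊗[k] (⨂[k]^n (Bar k H)) →ₗ[k] A ⊗[k] ((⨂[k]^n (Bar k H)) ⊗[k] H))
    (hG : ∀ w, G (1 ⊗ₜ w) = 1 ⊗ₜ (w ⊗ₜ 1)) :
    H ⊗[k] (⨂[k]^(n + 1) (Bar k H)) →ₗ[k] A ⊗[k] ((⨂[k]^(n + 1) (Bar k H)) ⊗[k] H) :=
  liftBar (S.hhStep G ∘ₗ (TensorProduct.leftComm k H H _).toLinearMap) (S.hhStep_tmul_one G hG) ∘ₗ
    (TensorProduct.leftComm k H (Bar k H) _).toLinearMap ∘ₗ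
      (cons k (Bar k H) n).symm.toLinearMap.lTensor H

lemma hhNext_tmul {n : ℕ}
    (G : H ⊗[k] (⨂[k]^n (Bar k H)) →ₗ[k] A ⊗[k] ((⨂[k]^n (Bar k H)) ⊗[k] H))
    (hG : ∀ w, G (1 ⊗ₜ w) = 1 ⊗ₜ (w ⊗ₜ 1)) (h l : H) (w : ⨂[k]^n (Bar k H)) :
    S.hhNext G hG (h ⊗ₜ cons k (Bar k H) n (bar k H l ⊗ₜ w)) = S.hhStep G (h ⊗ₜ (l ⊗ₜ w)) := by
  rw [hhNext, LinearMap.comp_apply, LinearMap.comp_apply, LinearMap.lTensor_tmul,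
    LinearEquiv.coe_coe, LinearEquiv.coe_coe, LinearEquiv.symm_apply_apply]
  rfl

/-- The maps `Γₙ : H ⊗ H̄^n → A ⊗ (H̄^n ⊗ H)` given by `Γ₀ (h) = 1 ⊗ h` and
`Γₙ₊₁ (h ⊗ l ⊗ w) = ∑ f(h₁, l₁) ⊗ ((h₂ l₂ ⊗ w) ⊗ 1) - ∑ c^(h₁) ⊗ ((h₂ ⊗ w') ⊗ y)` where
`Γₙ (l ⊗ w) = ∑ c ⊗ (w' ⊗ y)`. Explicitly, `Γₙ (h₀ ⊗ ⋯ ⊗ hₙ)` is the sum of the terms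
`(-1)^(i-1) f(hᵢ₋₁, hᵢ)^(h₀ ⊗ ⋯ ⊗ hᵢ₋₂) ⊗ (h₀ ⊗ ⋯ ⊗ hᵢ₋₁ hᵢ ⊗ ⋯ ⊗ hₙ) ⊗ 1`, `1 ≤ i ≤ n` (with
the comultiplications understood), and of `(-1)^n 1 ⊗ (h₀ ⊗ ⋯ ⊗ hₙ₋₁) ⊗ hₙ`. -/
noncomputable def hhGamma : ∀ n : ℕ,
    {G : H ⊗[k] (⨂[k]^n (Bar k H)) →ₗ[k] A ⊗[k] ((⨂[k]^n (Bar k H)) ⊗[k] H) //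
      ∀ w, G (1 ⊗ₜ w) = 1 ⊗ₜ (w ⊗ₜ 1)}
  | 0 => ⟨TensorProduct.mk k A _ 1 ∘ₗ (TensorProduct.comm k H _).toLinearMap, fun _ => rfl⟩
  | n + 1 => ⟨S.hhNext (hhGamma n).1 (hhGamma n).2, fun w => by
      induction w using induction_cons with
      | h0 => rw [TensorProduct.tmul_zero, map_zero, TensorProduct.zero_tmul,
          TensorProduct.tmul_zero]
      | hadd x y hx hy =>
        rw [TensorProduct.tmul_add, map_add, hx, hy, TensorProduct.add_tmul,
          TensorProduct.tmul_add]
      | h l w => rw [hhNext_tmul, hhStep_one_tmul]⟩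

end Gamma

section FMaps

/-- `H̄^(n+2) → Ā ⊗ H̄^(n+1)`, `h ⊗ l ⊗ w ↦ ∑ f(h₁, l₁) ⊗ (h₂ l₂ ⊗ w)`. -/
noncomputable def ttFirst (n : ℕ) :
    (⨂[k]^(n + 2) (Bar k H)) →ₗ[k] Bar k A ⊗[k] (⨂[k]^(n + 1) (Bar k H)) :=
  ((cons k (Bar k H) n).toLinearMap ∘ₗ (bar k H).rTensor _).lTensor (Bar k A) ∘ₗ
    (TensorProduct.assoc k (Bar k A) H _).toLinearMap ∘ₗ S.ffb.rTensor _ ∘ₗ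
      (TensorProduct.assoc k (Bar k H) (Bar k H) _).symm.toLinearMap ∘ₗ
        (cons k (Bar k H) n).symm.toLinearMap.lTensor (Bar k H) ∘ₗ
          (cons k (Bar k H) (n + 1)).symm.toLinearMap

/-- The maps `Tₙ : H̄^(n+2) → Ā ⊗ H̄^(n+1)`,
`h₁ ⊗ ⋯ ⊗ hₙ₊₂ ↦ ∑_{j=1}^{n+1} (-1)^j f(hⱼ, hⱼ₊₁)^(h₁ ⊗ ⋯ ⊗ hⱼ₋₁) ⊗ (h₁ ⊗ ⋯ ⊗ hⱼ hⱼ₊₁ ⊗ ⋯ ⊗ hₙ₊₂)`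
(with the comultiplications understood). They satisfy
`Tₙ₊₁ (h ⊗ w) = - ∑ f(h₁, l₁) ⊗ (h₂ l₂ ⊗ w'') - ∑ a^(h₁) ⊗ (h₂ ⊗ w')` where `w = l ⊗ w''` and
`Tₙ (w) = ∑ a ⊗ w'`. -/
noncomputable def tt : ∀ n : ℕ,
    (⨂[k]^(n + 2) (Bar k H)) →ₗ[k] Bar k A ⊗[k] (⨂[k]^(n + 1) (Bar k H))
  | 0 => -S.ttFirst 0
  | n + 1 => -S.ttFirst (n + 1) -
      (cons k (Bar k H) (n + 1)).toLinearMap.lTensor (Bar k A) ∘ₗ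
        (TensorProduct.assoc k (Bar k A) (Bar k H) _).toLinearMap ∘ₗ S.chiBb.rTensor _ ∘ₗ
          (TensorProduct.assoc k (Bar k H) (Bar k A) _).symm.toLinearMap ∘ₗ
            (tt n).lTensor (Bar k H) ∘ₗ (cons k (Bar k H) (n + 2)).symm.toLinearMap

/-- `Ā ⊗ (Ā^m ⊗ H) → Ā^(m+1) ⊗ H`. -/
noncomputable def consAH (k A H : Type*) [CommRing k] [Ring A] [Algebra k A] [Ring H]
    [HopfAlgebra k H] (m : ℕ) :
    Bar k A ⊗[k] ((⨂[k]^m (Bar k A)) ⊗[k] H) →ₗ[k] (⨂[k]^(m + 1) (Bar k A)) ⊗[k] H :=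
  (cons k (Bar k A) m).toLinearMap.rTensor H ∘ₗ (TensorProduct.assoc k _ _ _).symm.toLinearMap

/-- Given maps `g r : H̄^(n+2) ⊗ Ā^r → Ā^(r+n+1) ⊗ H`, the maps
`h ⊗ a₁ ⊗ ⋯ ⊗ aᵣ ↦ ∑_{i=0}^r (-1)^((n+1)i) (a₁ ⊗ ⋯ ⊗ aᵢ)^(h₁) ⊗ g (h₂ ⊗ aᵢ₊₁ ⊗ ⋯ ⊗ aᵣ)`. -/
noncomputable def passSum (n : ℕ)
    (g : ∀ r : ℕ, (⨂[k]^(n + 2) (Bar k H)) ⊗[k] (⨂[k]^r (Bar k A)) →ₗ[k]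
      (⨂[k]^(r + (n + 1)) (Bar k A)) ⊗[k] H) :
    ∀ r : ℕ, (⨂[k]^(n + 2) (Bar k H)) ⊗[k] (⨂[k]^r (Bar k A)) →ₗ[k]
      (⨂[k]^(r + (n + 1)) (Bar k A)) ⊗[k] H
  | 0 => g 0
  | r + 1 => g (r + 1) + (-1 : k) ^ (n + 1) •
      ((TensorPower.cast k (Bar k A) (Nat.add_right_comm r (n + 1) 1)).toLinearMap.rTensor H ∘ₗ
        consAH k A H (r + (n + 1)) ∘ₗ (passSum n g r).lTensor (Bar k A) ∘ₗ
          (TensorProduct.assoc k (Bar k A) _ _).toLinearMap ∘ₗ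
            (iterL S.chiBb (n + 2)).rTensor _ ∘ₗ
              (TensorProduct.assoc k _ (Bar k A) _).symm.toLinearMap ∘ₗ
                (cons k (Bar k A) r).symm.toLinearMap.lTensor _)

/-- The maps `H̄^(n+2) ⊗ Ā^r → Ā^(r+n+1) ⊗ H`,
`h₁ ⊗ ⋯ ⊗ hₙ₊₂ ⊗ a ↦ F_r^(n+2) (h₁' ⊗ ⋯ ⊗ hₙ₊₂' ⊗ a) ⊗ h₁'' ⋯ hₙ₊₂''`, where the maps
`F_r^(l) : H̄^l ⊗ Ā^r → Ā^(r+l-1)` are defined by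
`F_r^(2) (h ⊗ a) = ∑_{i=0}^r (-1)^(i+1) (a₁ ⊗ ⋯ ⊗ aᵢ)^(h₁ ⊗ h₂) ⊗ f(h₁, h₂) ⊗
  (aᵢ₊₁ ⊗ ⋯ ⊗ aᵣ)^(h₁ h₂)` and
`F_r^(l+1) (h ⊗ a) = ∑_{j=1}^l ∑_{i=0}^r (-1)^(il+j) (a₁ ⊗ ⋯ ⊗ aᵢ)^(h₁ ⊗ ⋯ ⊗ hₗ₊₁) ⊗
  f(hⱼ, hⱼ₊₁)^(h₁ ⊗ ⋯ ⊗ hⱼ₋₁) ⊗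
  F_{r-i}^(l) (h₁ ⊗ ⋯ ⊗ hⱼ hⱼ₊₁ ⊗ ⋯ ⊗ hₗ₊₁ ⊗ aᵢ₊₁ ⊗ ⋯ ⊗ aᵣ)`
(with the comultiplications understood). -/
noncomputable def gg : ∀ n r : ℕ, (⨂[k]^(n + 2) (Bar k H)) ⊗[k] (⨂[k]^r (Bar k A)) →ₗ[k]
      (⨂[k]^(r + (n + 1)) (Bar k A)) ⊗[k] H
  | 0 => S.passSum 0 fun r => -(consAH k A H r ∘ₗ (iterR S.chiAb r).lTensor (Bar k A) ∘ₗ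
      (TensorProduct.assoc k (Bar k A) H _).toLinearMap ∘ₗ
        (S.ffb ∘ₗ (TensorProduct.rid k (Bar k H)).toLinearMap.lTensor (Bar k H) ∘ₗ
          ((PiTensorProduct.isEmptyEquiv (R := k) (s := fun _ => Bar k H)
            (Fin 0)).toLinearMap.lTensor (Bar k H)).lTensor (Bar k H) ∘ₗ
          (cons k (Bar k H) 0).symm.toLinearMap.lTensor (Bar k H) ∘ₗ
            (cons k (Bar k H) 1).symm.toLinearMap).rTensor _)
  | n + 1 => S.passSum (n + 1) fun r => consAH k A H (r + (n + 1)) ∘ₗ (gg n r).lTensor (Bar k A) ∘ₗ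
      (TensorProduct.assoc k (Bar k A) _ _).toLinearMap ∘ₗ (S.tt (n + 1)).rTensor _

end FMaps

section Complex

variable (M : Type*) [AddCommGroup M] [Module k M] [Module S.E M] [IsScalarTower k S.E M]
  [Module S.Eᵐᵒᵖ M] [IsScalarTower k S.Eᵐᵒᵖ M]

/-- The right action of `A` on `M ⊗ H̄^s`: `(m ⊗ h) a = ∑ m a^(h₁) ⊗ h₂`. -/
noncomputable def rhoA (s : ℕ) :
    (M ⊗[k] (⨂[k]^s (Bar k H))) ⊗[k] A →ₗ[k] M ⊗[k] (⨂[k]^s (Bar k H)) :=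
  (rightAct k S.E M ∘ₗ S.inA.lTensor M).rTensor _ ∘ₗ
    (TensorProduct.assoc k M A _).symm.toLinearMap ∘ₗ (iterL S.chiHb s).lTensor M ∘ₗ
      (TensorProduct.assoc k M _ A).toLinearMap

/-- The left action of `A` on `M ⊗ H̄^s`: `a (m ⊗ h) = a m ⊗ h`. -/
noncomputable def lamA (s : ℕ) :
    A ⊗[k] (M ⊗[k] (⨂[k]^s (Bar k H))) →ₗ[k] M ⊗[k] (⨂[k]^s (Bar k H)) :=
  (leftAct k S.E M ∘ₗ S.inA.rTensor M).rTensor _ ∘ₗ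
    (TensorProduct.assoc k A M _).symm.toLinearMap

/-- `h ⊗ (m ⊗ w) ↦ (1 # h) m ⊗ w`. -/
noncomputable def lamH (s : ℕ) :
    H ⊗[k] (M ⊗[k] (⨂[k]^s (Bar k H))) →ₗ[k] M ⊗[k] (⨂[k]^s (Bar k H)) :=
  (leftAct k S.E M ∘ₗ S.inH.rTensor M).rTensor _ ∘ₗ
    (TensorProduct.assoc k H M _).symm.toLinearMap

lemma rhoA_one (s : ℕ) (n : M ⊗[k] (⨂[k]^s (Bar k H))) : S.rhoA M s (n ⊗ₜ 1) = n := by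
  induction n using TensorProduct.induction_on with
  | zero => simp
  | add x y hx hy => rw [TensorProduct.add_tmul, map_add, hx, hy]
  | tmul m w => simp [rhoA, iterL_of_comm S.chiHb 1 S.chiHb_tmul_one s w]

lemma lamA_one (s : ℕ) (n : M ⊗[k] (⨂[k]^s (Bar k H))) : S.lamA M s (1 ⊗ₜ n) = n := by
  induction n using TensorProduct.induction_on with
  | zero => simp
  | add x y hx hy => rw [TensorProduct.tmul_add, map_add, hx, hy]
  | tmul m w => simp [lamA]

lemma lamH_one (s : ℕ) (n : M ⊗[k] (⨂[k]^s (Bar k H))) : S.lamH M s (1 ⊗ₜ n) = n := by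
  induction n using TensorProduct.induction_on with
  | zero => simp
  | add x y hx hy => rw [TensorProduct.tmul_add, map_add, hx, hy]
  | tmul m w => simp [lamH]

/-- The module `M ⊗ H̄^s ⊗ Ā^r`. -/
abbrev X (_ : CrossedSystem k A H) (M : Type*) [AddCommGroup M] [Module k M] (s r : ℕ) : Type _ :=
  (M ⊗[k] (⨂[k]^s (Bar k H))) ⊗[k] (⨂[k]^r (Bar k A))

/-- `d̂⁰ : M ⊗ H̄^s ⊗ Ā^(r+1) → M ⊗ H̄^s ⊗ Ā^r`, the differential of the normalized Hochschild complex
of `A` with coefficients in `M ⊗ H̄^s`. -/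
noncomputable def d0 (s r : ℕ) : S.X M s (r + 1) →ₗ[k] S.X M s r :=
  hochD (S.rhoA M s) (S.lamA M s) (S.rhoA_one M s) (S.lamA_one M s) r

/-- `(m ⊗ w) ⊗ (v ⊗ y) ↦ ((1 # y) m ⊗ w) ⊗ v`. -/
noncomputable def absorb (s r : ℕ) :
    (M ⊗[k] (⨂[k]^s (Bar k H))) ⊗[k] ((⨂[k]^r (Bar k A)) ⊗[k] H) →ₗ[k] S.X M s r :=
  wrap (S.lamH M s)

lemma absorb_one (s r : ℕ) (n : M ⊗[k] (⨂[k]^s (Bar k H))) (v : ⨂[k]^r (Bar k A)) :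
    S.absorb M s r (n ⊗ₜ (v ⊗ₜ 1)) = n ⊗ₜ v := by
  simp [absorb, S.lamH_one]

/-- `h ⊗ m ⊗ w ⊗ v ↦ m (1 # h) ⊗ w ⊗ v`. -/
noncomputable def d1Head (s r : ℕ) : H ⊗[k] S.X M s r →ₗ[k] S.X M s r :=
  ((rightAct k S.E M ∘ₗ S.inH.lTensor M ∘ₗ (TensorProduct.comm k H M).toLinearMap).rTensor _ ∘ₗ
    (TensorProduct.assoc k H M _).symm.toLinearMap).rTensor _ ∘ₗ
      (TensorProduct.assoc k H _ _).symm.toLinearMap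

lemma d1Head_tmul (s r : ℕ) (h : H) (m : M) (w : ⨂[k]^s (Bar k H)) (v : ⨂[k]^r (Bar k A)) :
    S.d1Head M s r (h ⊗ₜ ((m ⊗ₜ w) ⊗ₜ v)) = ((MulOpposite.op (S.inH h) • m) ⊗ₜ w) ⊗ₜ v := rfl

/-- `m ⊗ c ⊗ w ⊗ y ⊗ v ↦ (1 # y₂) m c ⊗ w ⊗ v^(y₁)`. -/
noncomputable def d1TailAux (s r : ℕ) :
    (M ⊗[k] (A ⊗[k] ((⨂[k]^s (Bar k H)) ⊗[k] H))) ⊗[k] (⨂[k]^r (Bar k A)) →ₗ[k] S.X M s r :=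
  S.absorb M s r ∘ₗ (iterR S.chiAb r).lTensor _ ∘ₗ (TensorProduct.assoc k _ H _).toLinearMap ∘ₗ
    ((TensorProduct.assoc k M _ H).symm.toLinearMap ∘ₗ
      (rightAct k S.E M ∘ₗ S.inA.lTensor M).rTensor _ ∘ₗ
        (TensorProduct.assoc k M A _).symm.toLinearMap).rTensor _

lemma d1TailAux_tmul (s r : ℕ) (m : M) (c : A) (w : ⨂[k]^s (Bar k H)) (y : H)
    (v : ⨂[k]^r (Bar k A)) :
    S.d1TailAux M s r ((m ⊗ₜ (c ⊗ₜ (w ⊗ₜ y))) ⊗ₜ v) = S.absorb M s r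
      (((MulOpposite.op (S.inA c) • m) ⊗ₜ w) ⊗ₜ iterR S.chiAb r (y ⊗ₜ v)) := rfl

/-- `h ⊗ m ⊗ w ⊗ v ↦ ∑ (1 # y₂) m c ⊗ w' ⊗ v^(y₁)` where `Γ (h ⊗ w) = ∑ c ⊗ w' ⊗ y`. -/
noncomputable def d1Tail (s r : ℕ) : H ⊗[k] S.X M s r →ₗ[k] S.X M s r :=
  S.d1TailAux M s r ∘ₗ
    ((S.hhGamma s).1.lTensor M ∘ₗ (TensorProduct.leftComm k H M _).toLinearMap).rTensor _ ∘ₗ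
      (TensorProduct.assoc k H _ _).symm.toLinearMap

lemma d1Tail_tmul (s r : ℕ) (h : H) (m : M) (w : ⨂[k]^s (Bar k H)) (v : ⨂[k]^r (Bar k A)) :
    S.d1Tail M s r (h ⊗ₜ ((m ⊗ₜ w) ⊗ₜ v)) =
      S.d1TailAux M s r ((m ⊗ₜ (S.hhGamma s).1 (h ⊗ₜ w)) ⊗ₜ v) := rfl

/-- `d̂¹ : M ⊗ H̄^(s+1) ⊗ Ā^r → M ⊗ H̄^s ⊗ Ā^r`, which sends `m ⊗ h₁ ⊗ ⋯ ⊗ hₛ₊₁ ⊗ a` to the sum of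
`(-1)^r m (1 # h₁) ⊗ (h₂ ⊗ ⋯ ⊗ hₛ₊₁) ⊗ a`, of the terms
`(-1)^(r+i) m f(hᵢ, hᵢ₊₁)^(h₁ ⊗ ⋯ ⊗ hᵢ₋₁) ⊗ (h₁ ⊗ ⋯ ⊗ hᵢ hᵢ₊₁ ⊗ ⋯ ⊗ hₛ₊₁) ⊗ a`, `1 ≤ i ≤ s`
(with the comultiplications understood), and of
`(-1)^(r+s+1) (1 # hₛ₊₁'') m ⊗ (h₁ ⊗ ⋯ ⊗ hₛ) ⊗ a^(hₛ₊₁')`. -/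
noncomputable def d1 (s r : ℕ) : S.X M (s + 1) r →ₗ[k] S.X M s r :=
  (-1 : k) ^ r • (liftBar (S.d1Head M s r - S.d1Tail M s r) (fun x => by
      rw [LinearMap.sub_apply, sub_eq_zero]
      induction x using TensorProduct.induction_on with
      | zero => simp
      | add x y hx hy => rw [TensorProduct.tmul_add, map_add, map_add, hx, hy]
      | tmul n v =>
        induction n using TensorProduct.induction_on with
        | zero => simp
        | add x y hx hy =>
          rw [TensorProduct.add_tmul, TensorProduct.tmul_add, map_add, map_add, hx, hy]
        | tmul m w =>
          rw [d1Head_tmul, d1Tail_tmul, (S.hhGamma s).2, d1TailAux_tmul,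
            iterR_of_comm S.chiAb 1 S.chiAb_one_tmul, absorb_one]
          simp) ∘ₗ
    (TensorProduct.assoc k (Bar k H) _ _).toLinearMap ∘ₗ
      ((TensorProduct.leftComm k M (Bar k H) _).toLinearMap ∘ₗ
        (cons k (Bar k H) s).symm.toLinearMap.lTensor M).rTensor _)

/-- `d̂^l : M ⊗ H̄^t ⊗ Ā^r → M ⊗ H̄^s ⊗ Ā^(r+l-1)` for `l = n + 2` and `t = s + l`, which sends
`m ⊗ h₁ ⊗ ⋯ ⊗ hₜ ⊗ a` to
`(-1)^(l(r+t)) (1 # hₛ₊₁'' ⋯ hₜ'') m ⊗ (h₁ ⊗ ⋯ ⊗ hₛ) ⊗ F_r^(l) (hₛ₊₁' ⊗ ⋯ ⊗ hₜ' ⊗ a)`. -/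
noncomputable def dl (n s t r : ℕ) (h : s + (n + 2) = t) :
    S.X M t r →ₗ[k] S.X M s (r + (n + 1)) :=
  (-1 : k) ^ ((n + 2) * (r + t)) • (S.absorb M s (r + (n + 1)) ∘ₗ (S.gg n r).lTensor _ ∘ₗ
    (TensorProduct.assoc k _ (⨂[k]^(n + 2) (Bar k H)) _).toLinearMap ∘ₗ
      ((TensorProduct.assoc k M _ _).symm.toLinearMap ∘ₗ
        (TensorPower.mulEquiv.symm.toLinearMap ∘ₗ
          (TensorPower.cast k (Bar k H) h.symm).toLinearMap).lTensor M).rTensor _)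

end Complex

end CrossedSystem

end HochschildSerre

namespace FilteredComplex

variable {k : Type u} [CommRing k]

/-- The filtered complex given by modules `X n`, differentials `X (n + 1) → X n` and
submodules `F p n` of `X n`. -/
noncomputable def ofModules (X : ℕ → Type w) [∀ n, AddCommGroup (X n)] [∀ n, Module k (X n)]
    (d : ∀ n, X (n + 1) →ₗ[k] X n) (hd : ∀ n, d n ∘ₗ d (n + 1) = 0)
    (F : ℤ → ∀ n, Submodule k (X n)) (mono : ∀ (p q : ℤ) (n : ℕ), p ≤ q → F p n ≤ F q n)
    (hF : ∀ (p : ℤ) (n : ℕ) (x : X (n + 1)), x ∈ F p (n + 1) → d n x ∈ F p n) :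
    FilteredComplex.{u, w} k where
  K := ChainComplex.of (fun n => ModuleCat.of k (X n)) (fun n => ModuleCat.ofHom (d n))
    fun n => ModuleCat.hom_ext (hd n)
  F := F
  mono := mono
  d_mem p i j x hx := by
    by_cases h : i = j + 1
    · subst h
      have e : (ChainComplex.of (fun n => ModuleCat.of k (X n)) (fun n => ModuleCat.ofHom (d n))
          fun n => ModuleCat.hom_ext (hd n)).d (j + 1) j = ModuleCat.ofHom (d j) :=
        ChainComplex.of_d (fun n => ModuleCat.of k (X n)) (fun n => ModuleCat.ofHom (d n)) j
      rw [e]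
      exact hF p j x hx
    · rw [HomologicalComplex.shape _ i j fun h' => h (Eq.symm h')]
      exact Submodule.zero_mem (F p j)

variable (C D : FilteredComplex.{u, w} k)

variable {C} in
/-- The class, on the page `r`, of a cycle of `F_p C_n`. -/
noncomputable def cls (r p : ℤ) {n : ℕ} (z : C.K.cycles n)
    (hz : (C.K.iCycles n).hom z ∈ C.F p n) : C.E r p n :=
  Submodule.Quotient.mk ⟨(C.K.iCycles n).hom z, mem_Z.2 ⟨hz, fun j => by
    have h : (C.K.d n j).hom ((C.K.iCycles n).hom z) = 0 :=
      congrArg (fun f => f.hom z) (C.K.iCycles_d n j)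
    rw [h]
    exact Submodule.zero_mem _⟩⟩

/-- An isomorphism between the convergent spectral sequences of two filtered complexes: an
isomorphism of spectral sequences (from the page `E¹` on) together with an isomorphism between the
homologies that preserves the filtrations and is compatible with the isomorphism of spectral
sequences: the isomorphisms, in both directions, send a homology class of filtration `≤ p`, given by
a cycle in `F_p`, to the class of a cycle in `F_p` which also represents the image, on each page,
of the class of the first cycle. -/
structure ConvergentIso where
  /-- the isomorphism of spectral sequences -/
  ss : C.spectralSequence ≅ D.spectralSequence
  /-- the isomorphism of abutments -/
  hom : ∀ n, C.K.homology n ≅ D.K.homology n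
  compat : ∀ (p : ℤ) (n : ℕ) (z : C.K.cycles n) (hz : (C.K.iCycles n).hom z ∈ C.F p n),
    ∃ (y : D.K.cycles n) (hy : (D.K.iCycles n).hom y ∈ D.F p n),
      (hom n).hom.hom ((C.K.homologyπ n).hom z) = (D.K.homologyπ n).hom y ∧
      ∀ (r : ℤ) (hr : 1 ≤ r), ((ss.hom.hom r hr).f (p, n)).hom (cls r p z hz) = cls r p y hy
  compat_inv : ∀ (p : ℤ) (n : ℕ) (y : D.K.cycles n) (hy : (D.K.iCycles n).hom y ∈ D.F p n),
    ∃ (z : C.K.cycles n) (hz : (C.K.iCycles n).hom z ∈ C.F p n),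
      (hom n).inv.hom ((D.K.homologyπ n).hom y) = (C.K.homologyπ n).hom z ∧
      ∀ (r : ℤ) (hr : 1 ≤ r), ((ss.inv.hom r hr).f (p, n)).hom (cls r p y hy) = cls r p z hz

end FilteredComplex

namespace HochschildSerre

universe uk uA uH uM

section Homology

variable {k : Type*} [CommRing k] {X : ℕ → Type*} [∀ n, AddCommGroup (X n)] [∀ n, Module k (X n)]

/-- The cycles of a sequence of maps `X (n + 1) → X n`. -/
def cyclesOf (d : ∀ n, X (n + 1) →ₗ[k] X n) : ∀ n, Submodule k (X n)
  | 0 => ⊤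
  | n + 1 => LinearMap.ker (d n)

/-- The homology of a sequence of maps `X (n + 1) → X n`: the cycles modulo the boundaries. -/
abbrev HomologyOf (d : ∀ n, X (n + 1) →ₗ[k] X n) (n : ℕ) : Type _ :=
  cyclesOf d n ⧸ (LinearMap.range (d n)).comap (cyclesOf d n).subtype

end Homology

namespace CrossedSystem

variable {k : Type uk} {A : Type uA} {H : Type uH} [CommRing k] [Ring A] [Algebra k A] [Ring H]
  [HopfAlgebra k H] (S : CrossedSystem k A H)

section XHat

variable (M : Type uM) [AddCommGroup M] [Module k M]

/-- The module `X̂_n = ⨁_{s + r = n} M ⊗ H̄^s ⊗ Ā^r`. -/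
abbrev XHat (n : ℕ) : Type (max uM uk uA uH) :=
  DirectSum {p : ℕ × ℕ // p.1 + p.2 = n} fun p => S.X M p.1.1 p.1.2

/-- The inclusion of the summand `M ⊗ H̄^s ⊗ Ā^r` in `X̂_n`, `n = s + r`. -/
noncomputable def inX (n s r : ℕ) (h : s + r = n) : S.X M s r →ₗ[k] S.XHat M n :=
  DirectSum.lof k {p : ℕ × ℕ // p.1 + p.2 = n} (fun p => S.X M p.1.1 p.1.2) ⟨(s, r), h⟩

/-- The submodule `F_p X̂_n = ⨁_{s ≤ p} M ⊗ H̄^s ⊗ Ā^(n-s)`. -/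
def filtX (p : ℤ) (n : ℕ) : Submodule k (S.XHat M n) where
  carrier := {x | ∀ i, p < (i.1.1 : ℤ) → x i = 0}
  add_mem' hx hy i hi := by rw [DirectSum.add_apply, hx i hi, hy i hi, add_zero]
  zero_mem' _ _ := rfl
  smul_mem' c x hx i hi := by rw [DirectSum.smul_apply, hx i hi, smul_zero]

lemma filtX_mono (p q : ℤ) (n : ℕ) (h : p ≤ q) : S.filtX M p n ≤ S.filtX M q n :=
  fun _ hx i hi => hx i (h.trans_lt hi)

lemma inX_mem (p : ℤ) (n s r : ℕ) (h : s + r = n) (hs : (s : ℤ) ≤ p) (x : S.X M s r) :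
    S.inX M n s r h x ∈ S.filtX M p n := by
  classical
  intro i hi
  refine DFinsupp.single_eq_of_ne ?_
  rintro rfl
  exact absurd hs (not_le.2 hi)

variable [Module S.E M] [IsScalarTower k S.E M] [Module S.Eᵐᵒᵖ M] [IsScalarTower k S.Eᵐᵒᵖ M]

/-- The part of the differential of `X̂` that comes from `d̂⁰` on `M ⊗ H̄^s ⊗ Ā^r`. -/
noncomputable def part0 (n : ℕ) : ∀ s r : ℕ, s + r = n + 1 → (S.X M s r →ₗ[k] S.XHat M n)
  | _, 0, _ => 0
  | s, r + 1, h => S.inX M n s r (by omega) ∘ₗ S.d0 M s r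

/-- The part of the differential of `X̂` that comes from `d̂¹` on `M ⊗ H̄^s ⊗ Ā^r`. -/
noncomputable def part1 (n : ℕ) : ∀ s r : ℕ, s + r = n + 1 → (S.X M s r →ₗ[k] S.XHat M n)
  | 0, _, _ => 0
  | s + 1, r, h => S.inX M n s r (by omega) ∘ₗ S.d1 M s r

/-- The part of the differential of `X̂` that comes from the maps `d̂^l`, `2 ≤ l ≤ s`, on
`M ⊗ H̄^s ⊗ Ā^r`; here `l = i + 2`. -/
noncomputable def part2 (n s r : ℕ) (h : s + r = n + 1) : S.X M s r →ₗ[k] S.XHat M n :=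
  ∑ i : Fin (s - 1), S.inX M n (s - (i + 2)) (r + (i + 1)) (by omega) ∘ₗ
    S.dl M i (s - (i + 2)) s r (by omega)

/-- The differential `X̂_{n+1} → X̂_n`: on `M ⊗ H̄^s ⊗ Ā^r` it is the sum of the `d̂^l` for `0 ≤ l ≤ s`
and `r + l > 0`. -/
noncomputable def dHat (n : ℕ) : S.XHat M (n + 1) →ₗ[k] S.XHat M n :=
  DirectSum.toModule k _ _ fun p =>
    S.part0 M n p.1.1 p.1.2 p.2 + S.part1 M n p.1.1 p.1.2 p.2 + S.part2 M n p.1.1 p.1.2 p.2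

lemma part0_mem (p : ℤ) (n s r : ℕ) (h : s + r = n + 1) (hs : (s : ℤ) ≤ p) (x : S.X M s r) :
    S.part0 M n s r h x ∈ S.filtX M p n := by
  cases r with
  | zero => exact Submodule.zero_mem _
  | succ r => exact S.inX_mem M p n s r _ hs _

lemma part1_mem (p : ℤ) (n s r : ℕ) (h : s + r = n + 1) (hs : (s : ℤ) ≤ p) (x : S.X M s r) :
    S.part1 M n s r h x ∈ S.filtX M p n := by
  cases s with
  | zero => exact Submodule.zero_mem _
  | succ s => exact S.inX_mem M p n s r _ (by push_cast at hs; lia) _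

lemma part2_mem (p : ℤ) (n s r : ℕ) (h : s + r = n + 1) (hs : (s : ℤ) ≤ p) (x : S.X M s r) :
    S.part2 M n s r h x ∈ S.filtX M p n := by
  rw [part2, LinearMap.sum_apply]
  exact Submodule.sum_mem _ fun i _ => S.inX_mem M p n _ _ _ (by lia) _

lemma dHat_mem (p : ℤ) (n : ℕ) (x : S.XHat M (n + 1)) (hx : x ∈ S.filtX M p (n + 1)) :
    S.dHat M n x ∈ S.filtX M p n := by
  classical
  rw [← DirectSum.sum_support_of x, map_sum]
  refine Submodule.sum_mem _ fun i _ => ?_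
  have h : S.dHat M n (DirectSum.of _ i (x i)) = S.part0 M n i.1.1 i.1.2 i.2 (x i) +
      S.part1 M n i.1.1 i.1.2 i.2 (x i) + S.part2 M n i.1.1 i.1.2 i.2 (x i) :=
    DirectSum.toModule_lof k (φ := fun p : {p : ℕ × ℕ // p.1 + p.2 = n + 1} =>
      S.part0 M n p.1.1 p.1.2 p.2 + S.part1 M n p.1.1 p.1.2 p.2 + S.part2 M n p.1.1 p.1.2 p.2)
      i (x i)
  rw [h]
  by_cases hi : p < (i.1.1 : ℤ)
  · rw [hx i hi]
    simp only [map_zero, add_zero]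
    exact Submodule.zero_mem _
  · exact Submodule.add_mem _ (Submodule.add_mem _ (S.part0_mem M p n _ _ _ (not_lt.1 hi) _)
      (S.part1_mem M p n _ _ _ (not_lt.1 hi) _)) (S.part2_mem M p n _ _ _ (not_lt.1 hi) _)

/-- The complex `X̂` with its filtration, once it is known that `d̂ d̂ = 0`. -/
noncomputable def filteredXHat (hd : ∀ n, S.dHat M n ∘ₗ S.dHat M (n + 1) = 0) :
    FilteredComplex.{uk, max uM uk uA uH} k :=
  FilteredComplex.ofModules (S.XHat M) (S.dHat M) hd (S.filtX M) (S.filtX_mono M) (S.dHat_mem M)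

/-- The Hochschild homology `H_r (A, M ⊗ H̄^s)`, where `M ⊗ H̄^s` is an `A`-bimodule by
`a (m ⊗ h) b = ∑ a m b^(h₁) ⊗ h₂`. -/
abbrev HochA (s r : ℕ) : Type _ := HomologyOf (X := fun r => S.X M s r) (fun r => S.d0 M s r) r

variable [SMulCommClass S.E S.Eᵐᵒᵖ M]

/-- The normalized Hochschild complex `M ⊗ Ē^n` of `E` with coefficients in `M`, with its
filtration: `F_p (M ⊗ Ē^n)` is spanned by the `m ⊗ x₁ ⊗ ⋯ ⊗ xₙ` such that at least `n - p` of the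
`xⱼ` belong to `A`. -/
noncomputable def filteredHochschild : FilteredComplex.{uk, max uM uk uA uH} k :=
  FilteredComplex.ofModules (fun n => M ⊗[k] (⨂[k]^n (Bar k S.E))) (hochDiff k S.E M)
    (hochDiff_comp k S.E M) (hochFilt (LinearMap.range S.inA) M) (fun _ _ _ h => hochFilt_mono h)
    (fun p n x hx => hochD_mem (by
      rintro _ _ ⟨a, rfl⟩ ⟨b, rfl⟩
      exact ⟨a * b, (S.inA_mul a b).symm⟩) _ _ _ _ p n x hx)

end XHat

end CrossedSystem

end HochschildSerre

/-! The whole argument takes place with left `E`-modules and explicit contractions; the right action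
of `E` on `M` enters only at the end. The bar resolution of the left module `M` is `E ⊗ Ē^n ⊗ M`,
and sending `e ⊗ w ⊗ m` to `w ⊗ m e` turns its differential into the Hochschild one. In the same way
`X̂` comes from a second resolution `E ⊗ W` of `M`, where `W = ⨁ H̄^s ⊗ Ā^r ⊗ M`. It is then enough
to compare these two resolutions by filtered maps that are natural in `M`, because right
multiplications are endomorphisms of the left module `M`.

The second resolution is governed by two contractions. Put `P = ⨁ Ā^r ⊗ M`, and let `A ⊗ P` carry
the bar differential of `A`. The map `s` (`sMap`), `(a # h) ⊗ y ↦ (a # 1) ⊗ (h · y)`, contracts `E ⊗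
W` onto the copy `ι(A ⊗ P)` (`iotaA`), up to a projection `ρ : E ⊗ W → A ⊗ P` (`rhoE`): `d s + s d +
ι ρ = 1` (`dE_sMap`). This identity determines the differential recursively once `ρ` is known
(`dW_cons`). Conversely `ρ` must be a chain map, and the contraction of the bar complex of `A` then
dictates `ρ` from `d`. The central point is `rhoH_eq`: the `ρ` written with the explicit maps
`F_r^(l)` satisfies this second recursion. Expanding both sides gives the recursive definition of
the `F_r^(l)`. Afterwards `d d = 0` and `d ρ = ρ d` follow together by induction on the degree
(`dE_dW_of_mem`).

Composing the two contractions gives a contraction `σ` (`sigma`) of `E ⊗ W` (`dE_sigma`). Standard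
recursions with the contractions define comparison maps `ψ` from the bar resolution and `φ` back.
Because `σ σ = 0` and `σ` inverts `d` on `1 ⊗ W` up to the augmentation, `ψ φ = 1` holds strictly
(`psi_phi`), while `φ ψ` is homotopic to `1` through `ω` (`barD_omega_succ`). If elements of `A` are
given weight 0 and general elements of `E` weight 1 (`EF`), every map involved preserves the
filtration.

Two things remain. The closed form of the differential is found by unrolling its recursion
(`dW_inc_succ`); its three parts are `d̂⁰`, `d̂¹` and the `d̂^l` with `l ≥ 2`, up to the sign
`(-1)^(rs)` on `M ⊗ H̄^s ⊗ Ā^r` (`ofXHat_dHat`), which also yields `d̂ d̂ = 0`. Finally, a homotopy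
that preserves the filtration acts as zero on all pages `E^r`, `r ≥ 1` (`sub_mem_B`), so the
filtered homotopy equivalence gives the isomorphism of convergent spectral sequences. The first page
is computed from the fact that `d̂^l` lowers the filtration degree by `l`, so that only `d̂⁰`
survives on the graded pieces (`compX_dHat`). -/

namespace HochschildSerre

/-! ### Total tensor modules `⨁ V^n ⊗ N`, handled as lists with `nil` and `cons`. -/

section Tot

variable (k : Type*) [CommRing k] (V : Type*) [AddCommGroup V] [Module k V]
  (N : Type*) [AddCommGroup N] [Module k N]

/-- The total module `⨁ₙ V^n ⊗ N`. -/
def Tot : Type _ := DirectSum ℕ fun n => (⨂[k]^n V) ⊗[k] N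

noncomputable instance : AddCommGroup (Tot k V N) :=
  inferInstanceAs (AddCommGroup (DirectSum ℕ fun n => (⨂[k]^n V) ⊗[k] N))

noncomputable instance : Module k (Tot k V N) :=
  inferInstanceAs (Module k (DirectSum ℕ fun n => (⨂[k]^n V) ⊗[k] N))

namespace Tot

/-- The inclusion of `V^n ⊗ N`. -/
noncomputable def inc (n : ℕ) : (⨂[k]^n V) ⊗[k] N →ₗ[k] Tot k V N :=
  DirectSum.lof k ℕ (fun n => (⨂[k]^n V) ⊗[k] N) n

/-- The projection onto `V^n ⊗ N`. -/
noncomputable def comp (n : ℕ) : Tot k V N →ₗ[k] (⨂[k]^n V) ⊗[k] N :=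
  DirectSum.component k ℕ (fun n => (⨂[k]^n V) ⊗[k] N) n

@[simp]
lemma comp_inc (n : ℕ) (x : (⨂[k]^n V) ⊗[k] N) : comp k V N n (inc k V N n x) = x :=
  DirectSum.component.lof_self k (M := fun n => (⨂[k]^n V) ⊗[k] N) n x

variable {k V N}

/-- The linear map on the total module given by linear maps on the components. -/
noncomputable def ofFam {X : Type*} [AddCommGroup X] [Module k X]
    (f : ∀ n, (⨂[k]^n V) ⊗[k] N →ₗ[k] X) : Tot k V N →ₗ[k] X :=
  DirectSum.toModule k ℕ X f

@[simp]
lemma ofFam_inc {X : Type*} [AddCommGroup X] [Module k X]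
    (f : ∀ n, (⨂[k]^n V) ⊗[k] N →ₗ[k] X) (n : ℕ) (x : (⨂[k]^n V) ⊗[k] N) :
    ofFam f (inc k V N n x) = f n x :=
  DirectSum.toModule_lof k (φ := f) n x

lemma induction_inc {p : Tot k V N → Prop} (x : Tot k V N) (h0 : p 0)
    (hadd : ∀ x y, p x → p y → p (x + y)) (h : ∀ n w x, p (inc k V N n (w ⊗ₜ x))) : p x := by
  refine DirectSum.induction_on (β := fun n => (⨂[k]^n V) ⊗[k] N) x h0 (fun n x => ?_) hadd
  change p (inc k V N n x)
  induction x using TensorProduct.induction_on with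
  | zero => rw [map_zero]; exact h0
  | add x y hx hy => rw [map_add]; exact hadd _ _ hx hy
  | tmul w x => exact h n w x

variable (k V N) in
/-- The inclusion of `N` in the total module. -/
noncomputable def nil : N →ₗ[k] Tot k V N :=
  inc k V N 0 ∘ₗ TensorProduct.mk k _ N (PiTensorProduct.tprod k ![])

variable (k V N) in
/-- Adding a first tensor factor. -/
noncomputable def cons : V →ₗ[k] Tot k V N →ₗ[k] Tot k V N :=
  LinearMap.flip (ofFam fun n => LinearMap.flip (TensorProduct.curry
    (inc k V N (n + 1) ∘ₗ (HochschildSerre.cons k V n).toLinearMap.rTensor N ∘ₗ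
      (TensorProduct.assoc k V _ N).symm.toLinearMap)))

lemma nil_apply (x : N) : nil k V N x = inc k V N 0 (PiTensorProduct.tprod k ![] ⊗ₜ x) := rfl

@[simp]
lemma cons_inc (v : V) (n : ℕ) (w : ⨂[k]^n V) (x : N) :
    cons k V N v (inc k V N n (w ⊗ₜ x)) =
      inc k V N (n + 1) (HochschildSerre.cons k V n (v ⊗ₜ w) ⊗ₜ x) := by
  rw [cons, LinearMap.flip_apply, ofFam_inc]
  rfl

lemma zero_tensor_eq (w : ⨂[k]^0 V) :
    w = (PiTensorProduct.isEmptyEquiv (R := k) (s := fun _ => V) (Fin 0) w) •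
      PiTensorProduct.tprod k ![] := by
  apply (PiTensorProduct.isEmptyEquiv (R := k) (s := fun _ => V) (Fin 0)).injective
  rw [map_smul]
  erw [PiTensorProduct.isEmptyEquiv_apply_tprod]
  simp

lemma inc_zero (w : ⨂[k]^0 V) (x : N) : inc k V N 0 (w ⊗ₜ x) =
    nil k V N (PiTensorProduct.isEmptyEquiv (R := k) (s := fun _ => V) (Fin 0) w • x) := by
  rw [nil_apply, ← TensorProduct.smul_tmul, ← zero_tensor_eq]

lemma cons_induction {n : ℕ} {p : (⨂[k]^(n + 1) V) → Prop} (w : ⨂[k]^(n + 1) V)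
    (h0 : p 0) (hadd : ∀ x y, p x → p y → p (x + y))
    (h : ∀ v w, p (HochschildSerre.cons k V n (v ⊗ₜ w))) : p w := by
  obtain ⟨w, rfl⟩ := (HochschildSerre.cons k V n).surjective w
  induction w using TensorProduct.induction_on with
  | zero => simpa using h0
  | add x y hx hy => rw [map_add]; exact hadd _ _ hx hy
  | tmul b w => exact h b w

/-- List induction, without a case for `0`, which is `nil` of `0`. It hides the indices of the
tensor powers, so that most identities are checked on `nil` and `cons` only. -/
lemma induction {p : Tot k V N → Prop} (x : Tot k V N)
    (hadd : ∀ x y, p x → p y → p (x + y)) (hnil : ∀ x, p (nil k V N x))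
    (hcons : ∀ v y, p y → p (cons k V N v y)) : p x := by
  have h0 : p 0 := by simpa using hnil 0
  refine induction_inc x h0 hadd fun n => ?_
  induction n with
  | zero => intro w x; rw [inc_zero]; exact hnil _
  | succ n ih =>
    intro w x
    induction w using cons_induction with
    | h0 => simpa using h0
    | hadd y z hy hz => rw [TensorProduct.add_tmul, map_add]; exact hadd _ _ hy hz
    | h v w => rw [← cons_inc]; exact hcons _ _ (ih w x)

/-- Two linear maps on the total module are equal if they agree on `N` and if their agreement is
preserved by `cons`. -/
lemma hom_ext {X : Type*} [AddCommGroup X] [Module k X] {f g : Tot k V N →ₗ[k] X}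
    (hnil : ∀ x, f (nil k V N x) = g (nil k V N x))
    (hcons : ∀ v y, f y = g y → f (cons k V N v y) = g (cons k V N v y)) : f = g :=
  LinearMap.ext fun x => induction x (fun x y hx hy => by rw [map_add, map_add, hx, hy]) hnil hcons

section Para

variable {X : Type*} [AddCommGroup X] [Module k X] (b : N →ₗ[k] X)
  (s : V →ₗ[k] Tot k V N →ₗ[k] X) (t : V →ₗ[k] X →ₗ[k] X)

/-- The components of the linear map on the total module defined by primitive recursion. -/
noncomputable def paraAux : ∀ n, (⨂[k]^n V) ⊗[k] N →ₗ[k] X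
  | 0 => b ∘ₗ (TensorProduct.lid k N).toLinearMap ∘ₗ
      (PiTensorProduct.isEmptyEquiv (R := k) (s := fun _ => V) (Fin 0)).toLinearMap.rTensor N
  | n + 1 => TensorProduct.lift (LinearMap.lcomp k X (inc k V N n) ∘ₗ s +
      LinearMap.lcomp k X (paraAux n) ∘ₗ t) ∘ₗ (TensorProduct.assoc k V _ N).toLinearMap ∘ₗ
        (HochschildSerre.cons k V n).symm.toLinearMap.rTensor N

/-- The linear map on the total module defined by primitive recursion. -/
noncomputable def para : Tot k V N →ₗ[k] X := ofFam (paraAux b s t)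

lemma para_nil (x : N) : para b s t (nil k V N x) = b x := by
  rw [para, nil_apply, ofFam_inc]
  simp only [paraAux, LinearMap.comp_apply, LinearMap.rTensor_tmul, LinearEquiv.coe_coe]
  erw [PiTensorProduct.isEmptyEquiv_apply_tprod]
  simp

/-- The step sees the tail `y` and not only the value at `y`. The differential `dW` and the map
`higher` need this, since some of their terms are functions of the tail itself. -/
lemma para_cons (v : V) (y : Tot k V N) :
    para b s t (cons k V N v y) = s v y + t v (para b s t y) := by
  induction y using induction_inc with
  | h0 => simp
  | hadd x y hx hy => rw [map_add, map_add, map_add, hx, hy, map_add, map_add]; abel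
  | h n w x =>
    rw [cons_inc, para, ofFam_inc, ofFam_inc]
    simp [paraAux]

end Para

section Fold

variable {X : Type*} [AddCommGroup X] [Module k X] (b : N →ₗ[k] X) (t : V →ₗ[k] X →ₗ[k] X)

/-- The linear map on the total module defined by iteration. -/
noncomputable def fold : Tot k V N →ₗ[k] X := para b 0 t

@[simp]
lemma fold_nil (x : N) : fold b t (nil k V N x) = b x := para_nil _ _ _ _

@[simp]
lemma fold_cons (v : V) (y : Tot k V N) : fold b t (cons k V N v y) = t v (fold b t y) := by
  rw [fold, para_cons]; simp

end Fold

section Map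

variable {N' N'' : Type*} [AddCommGroup N'] [Module k N'] [AddCommGroup N''] [Module k N'']

variable (V) in
/-- The linear map between total modules induced by a map of the coefficients. -/
noncomputable def map (u : N →ₗ[k] N') : Tot k V N →ₗ[k] Tot k V N' :=
  ofFam fun n => inc k V N' n ∘ₗ u.lTensor _

@[simp]
lemma map_inc (u : N →ₗ[k] N') (n : ℕ) (w : ⨂[k]^n V) (x : N) :
    map V u (inc k V N n (w ⊗ₜ x)) = inc k V N' n (w ⊗ₜ u x) := by
  rw [map, ofFam_inc]; rfl

@[simp]
lemma map_nil (u : N →ₗ[k] N') (x : N) : map V u (nil k V N x) = nil k V N' (u x) := map_inc _ _ _ _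

@[simp]
lemma map_cons (u : N →ₗ[k] N') (v : V) (y : Tot k V N) :
    map V u (cons k V N v y) = cons k V N' v (map V u y) := by
  induction y using induction_inc with
  | h0 => simp
  | hadd x y hx hy => rw [map_add, map_add, map_add, hx, hy, map_add]
  | h n w x =>
    rw [cons_inc, map_inc, map_inc, cons_inc]

lemma map_map (u : N →ₗ[k] N') (u' : N' →ₗ[k] N'') (y : Tot k V N) :
    map V u' (map V u y) = map V (u' ∘ₗ u) y := by
  induction y using induction with
  | hadd x y hx hy => simp only [map_add, hx, hy]
  | hnil x => simp
  | hcons v y hy => simp [hy]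

lemma map_id (y : Tot k V N) : map V LinearMap.id y = y := by
  induction y using induction with
  | hadd x y hx hy => simp only [map_add, hx, hy]
  | hnil x => simp
  | hcons v y hy => simp [hy]

variable (k V N N') in
/-- The map `map V` as a linear map. -/
noncomputable def mapLin : (N →ₗ[k] N') →ₗ[k] Tot k V N →ₗ[k] Tot k V N' where
  toFun := map V
  map_add' u u' := hom_ext (fun x => by simp) fun v y hy => by
    simp only [map_cons, LinearMap.add_apply] at hy ⊢; rw [hy, map_add]
  map_smul' c u := hom_ext (fun x => by simp) fun v y hy => by
    simp only [map_cons, LinearMap.smul_apply, RingHom.id_apply] at hy ⊢; rw [hy, map_smul]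

end Map

section Aug

variable (k V N) in
/-- The projection of the total module onto `N`. -/
noncomputable def aug : Tot k V N →ₗ[k] N := fold LinearMap.id 0

@[simp]
lemma aug_nil (x : N) : aug k V N (nil k V N x) = x := by simp [aug]

@[simp]
lemma aug_cons (v : V) (y : Tot k V N) : aug k V N (cons k V N v y) = 0 := by simp [aug]

lemma aug_map {N' : Type*} [AddCommGroup N'] [Module k N'] (u : N →ₗ[k] N') (y : Tot k V N) :
    aug k V N' (map V u y) = u (aug k V N y) := by
  induction y using induction with
  | hadd x y hx hy => simp only [map_add, hx, hy]
  | hnil x => simp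
  | hcons v y hy => simp

end Aug

end Tot

end Tot

/-! ### Descent to `B / k` and `B`-linear extension. -/

section Bar

variable {k : Type*} [CommRing k] {B : Type*} [Ring B] [Algebra k B]
  {X : Type*} [AddCommGroup X] [Module k X]

/-- A linear map on `B` that vanishes at `1` induces a linear map on `B / k`. -/
noncomputable def barLift (g : B →ₗ[k] X) (hg : g 1 = 0) : Bar k B →ₗ[k] X :=
  (LinearMap.range (Algebra.linearMap k B)).liftQ g (by
    rintro _ ⟨c, rfl⟩
    rw [LinearMap.mem_ker, Algebra.linearMap_apply, Algebra.algebraMap_eq_smul_one, map_smul, hg,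
      smul_zero])

@[simp]
lemma barLift_bar (g : B →ₗ[k] X) (hg : g 1 = 0) (b : B) : barLift g hg (bar k B b) = g b := rfl

end Bar

section Ext

variable {k : Type*} [CommRing k] {B : Type*} [Ring B] [Algebra k B]
  {Z : Type*} [AddCommGroup Z] [Module k Z]
  {X : Type*} [AddCommGroup X] [Module k X] [Module B X] [IsScalarTower k B X]

variable (B) in
/-- The extension of a linear map `Z → X` to a `B`-linear map `B ⊗ Z → X`. -/
noncomputable def ext (f : Z →ₗ[k] X) : B ⊗[k] Z →ₗ[k] X :=
  TensorProduct.lift (LinearMap.lcomp k X f ∘ₗ (Algebra.lsmul k k X).toLinearMap)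

@[simp]
lemma ext_tmul (f : Z →ₗ[k] X) (b : B) (z : Z) : ext B f (b ⊗ₜ z) = b • f z := rfl

@[simp]
lemma ext_smul (f : Z →ₗ[k] X) (b : B) (x : B ⊗[k] Z) : ext B f (b • x) = b • ext B f x := by
  induction x using TensorProduct.induction_on with
  | zero => simp
  | add x y hx hy => rw [smul_add, map_add, hx, hy, map_add, smul_add]
  | tmul c z => rw [TensorProduct.smul_tmul', ext_tmul, ext_tmul, smul_eq_mul, mul_smul]

lemma lTensor_smul {Z' : Type*} [AddCommGroup Z'] [Module k Z'] (f : Z →ₗ[k] Z') (b : B)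
    (x : B ⊗[k] Z) : f.lTensor B (b • x) = b • f.lTensor B x := by
  induction x using TensorProduct.induction_on with
  | zero => simp
  | add x y hx hy => rw [smul_add, map_add, hx, hy, map_add, smul_add]
  | tmul c z => simp [TensorProduct.smul_tmul']

end Ext

end HochschildSerre

namespace HochschildSerre

/-! ### The normalized bar resolution `B ⊗ B̄^n ⊗ M` and its contraction. -/

section ConsExt

variable {k : Type*} [CommRing k] {B : Type*} [Ring B] [Algebra k B]
  {M : Type*} [AddCommGroup M] [Module k M]

variable (k B M) in
/-- `b ⊗ u ↦ b · u` for the bar construction. -/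
noncomputable def consExt : B ⊗[k] Tot k (Bar k B) M →ₗ[k] Tot k (Bar k B) M :=
  TensorProduct.lift (Tot.cons k (Bar k B) M ∘ₗ bar k B)

@[simp]
lemma consExt_tmul (b : B) (u : Tot k (Bar k B) M) :
    consExt k B M (b ⊗ₜ u) = Tot.cons k (Bar k B) M (bar k B b) u := rfl

lemma consExt_one_tmul (u : Tot k (Bar k B) M) : consExt k B M (1 ⊗ₜ u) = 0 := by
  rw [consExt_tmul, bar_one, map_zero, LinearMap.zero_apply]

lemma aug_consExt (ξ : B ⊗[k] Tot k (Bar k B) M) :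
    Tot.aug k (Bar k B) M (consExt k B M ξ) = 0 := by
  induction ξ using TensorProduct.induction_on with
  | zero => simp
  | add x y hx hy => simp only [map_add, hx, hy, add_zero]
  | tmul x u => simp

end ConsExt

section BarComplex

variable {k : Type*} [CommRing k] {B : Type*} [Ring B] [Algebra k B]
  {M : Type*} [AddCommGroup M] [Module k M] [Module B M] [IsScalarTower k B M]

/-- `w ⊗ y ↦ w ⊗ y m`. -/
noncomputable def absorbTail (n : ℕ) (m : M) :
    (⨂[k]^n (Bar k B)) ⊗[k] B →ₗ[k] Tot k (Bar k B) M :=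
  Tot.inc k (Bar k B) M n ∘ₗ ((Algebra.lsmul k k M).toLinearMap.flip m).lTensor _

@[simp]
lemma absorbTail_tmul (n : ℕ) (m : M) (w : ⨂[k]^n (Bar k B)) (y : B) :
    absorbTail n m (w ⊗ₜ y) = Tot.inc k (Bar k B) M n (w ⊗ₜ (y • m)) := rfl

lemma absorbTail_consB (n : ℕ) (m : M) (v : Bar k B) (t : (⨂[k]^n (Bar k B)) ⊗[k] B) :
    absorbTail (n + 1) m (consB k B n (v ⊗ₜ t)) = Tot.cons k (Bar k B) M v (absorbTail n m t) := by
  induction t using TensorProduct.induction_on with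
  | zero => simp
  | add x y hx hy => simp only [TensorProduct.tmul_add, map_add, hx, hy]
  | tmul w z => simp

variable (k B M) in
/-- The right action of `B` on the bimodule `B ⊗ M`. -/
noncomputable def freeRho : (B ⊗[k] M) ⊗[k] B →ₗ[k] B ⊗[k] M :=
  (LinearMap.mul' k B).rTensor M ∘ₗ (TensorProduct.rightComm k B M B).toLinearMap

variable (k B M) in
/-- The left action of `B` on the bimodule `B ⊗ M`. -/
noncomputable def freeLam : B ⊗[k] (B ⊗[k] M) →ₗ[k] B ⊗[k] M :=
  (TensorProduct.lift (Algebra.lsmul k k M).toLinearMap).lTensor B ∘ₗ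
    (TensorProduct.leftComm k B B M).toLinearMap

@[simp]
lemma freeRho_tmul (b x : B) (m : M) : freeRho k B M ((b ⊗ₜ m) ⊗ₜ x) = (b * x) ⊗ₜ m := rfl

@[simp]
lemma freeLam_tmul (b x : B) (m : M) : freeLam k B M (x ⊗ₜ (b ⊗ₜ m)) = b ⊗ₜ (x • m) := rfl

lemma freeRho_one (n : B ⊗[k] M) : freeRho k B M (n ⊗ₜ 1) = n := by
  induction n using TensorProduct.induction_on with
  | zero => simp
  | add x y hx hy => rw [TensorProduct.add_tmul, map_add, hx, hy]
  | tmul b m => simp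

lemma freeLam_one (n : B ⊗[k] M) : freeLam k B M (1 ⊗ₜ n) = n := by
  induction n using TensorProduct.induction_on with
  | zero => simp
  | add x y hx hy => rw [TensorProduct.tmul_add, map_add, hx, hy]
  | tmul b m => simp

variable (k B M) in
/-- `(b ⊗ m) ⊗ w ↦ b ⊗ (w ⊗ m)`. -/
noncomputable def freeOut (n : ℕ) :
    (B ⊗[k] M) ⊗[k] (⨂[k]^n (Bar k B)) →ₗ[k] B ⊗[k] Tot k (Bar k B) M :=
  (Tot.inc k (Bar k B) M n ∘ₗ (TensorProduct.comm k M _).toLinearMap).lTensor B ∘ₗ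
    (TensorProduct.assoc k B M _).toLinearMap

@[simp]
lemma freeOut_tmul (n : ℕ) (b : B) (m : M) (w : ⨂[k]^n (Bar k B)) :
    freeOut k B M n ((b ⊗ₜ m) ⊗ₜ w) = b ⊗ₜ Tot.inc k (Bar k B) M n (w ⊗ₜ m) := rfl

lemma freeOut_wrap (n : ℕ) (b : B) (m : M) (t : (⨂[k]^n (Bar k B)) ⊗[k] B) :
    freeOut k B M n (wrap (freeLam k B M) ((b ⊗ₜ m) ⊗ₜ t)) = b ⊗ₜ absorbTail n m t := by
  induction t using TensorProduct.induction_on with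
  | zero => simp
  | add x y hx hy => simp only [TensorProduct.tmul_add, map_add, hx, hy]
  | tmul w z => simp

variable (k B M) in
/-- The differential of the bar complex: `w ⊗ m ↦ ∑ x ⊗ (w' ⊗ y m)`, where the Hochschild
differential of `w` is `∑ x ⊗ w' ⊗ y`. -/
noncomputable def barD : Tot k (Bar k B) M →ₗ[k] B ⊗[k] Tot k (Bar k B) M :=
  Tot.ofFam fun
    | 0 => 0
    | n + 1 => freeOut k B M n ∘ₗ
        hochD (freeRho k B M) (freeLam k B M) freeRho_one freeLam_one n ∘ₗ
          (TensorProduct.mk k B M 1).rTensor _ ∘ₗ (TensorProduct.comm k _ M).toLinearMap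

@[simp]
lemma barD_nil (m : M) : barD k B M (Tot.nil k (Bar k B) M m) = 0 := by
  rw [barD, Tot.nil_apply, Tot.ofFam_inc]; rfl

lemma barD_cons_inc (x : B) (n : ℕ) (w : ⨂[k]^n (Bar k B)) (m : M) :
    barD k B M (Tot.cons k (Bar k B) M (bar k B x) (Tot.inc k (Bar k B) M n (w ⊗ₜ m))) =
      x ⊗ₜ Tot.inc k (Bar k B) M n (w ⊗ₜ m) -
        1 ⊗ₜ absorbTail n m ((gamma n).1 (x ⊗ₜ w)) := by
  rw [barD, Tot.cons_inc, Tot.ofFam_inc]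
  simp only [LinearMap.comp_apply, LinearEquiv.coe_coe, TensorProduct.comm_tmul,
    LinearMap.rTensor_tmul, TensorProduct.mk_apply, hochD_tmul, map_sub, freeOut_wrap,
    freeRho_tmul, freeOut_tmul, _root_.one_mul]

/-- The maps `gamma` collect all faces but the first. Multiplying the differential of the tail by
`x` and prepending produces the same faces, by the recursion of `gamma`; for an empty tail only the
action on `m` is left. -/
lemma absorbTail_gamma (x : B) (n : ℕ) (w : ⨂[k]^n (Bar k B)) (m : M) :
    absorbTail n m ((gamma n).1 (x ⊗ₜ w)) =
      consExt k B M (x • barD k B M (Tot.inc k (Bar k B) M n (w ⊗ₜ m))) +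
        Tot.nil k (Bar k B) M (x • Tot.aug k (Bar k B) M (Tot.inc k (Bar k B) M n (w ⊗ₜ m))) := by
  cases n with
  | zero =>
    have h : (gamma 0).1 (x ⊗ₜ w) = w ⊗ₜ x := rfl
    rw [h, absorbTail_tmul, Tot.inc_zero, Tot.inc_zero, barD_nil, Tot.aug_nil, smul_zero, map_zero,
      zero_add, smul_comm]
  | succ n =>
    induction w using induction_cons with
    | h0 => simp
    | hadd y z hy hz =>
      simp only [TensorProduct.tmul_add, TensorProduct.add_tmul, map_add, smul_add] at hy hz ⊢
      rw [hy, hz]; abel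
    | h y w =>
      rw [gamma_succ', map_sub, absorbTail_consB, absorbTail_tmul, one_smul, ← Tot.cons_inc,
        ← Tot.cons_inc (bar k B y), barD_cons_inc, Tot.aug_cons, smul_zero, map_zero, add_zero,
        smul_sub, TensorProduct.smul_tmul',
        TensorProduct.smul_tmul', map_sub, consExt_tmul, consExt_tmul, smul_eq_mul,
        smul_eq_mul, _root_.mul_one]

/-- This recursion is the identity `d s = 1 - s d - η ε` read at `x ⊗ u`, where `s` is `consExt`.
From here on the bar differential is used only through it, and the differential of `E ⊗ W` is
modelled on it. -/
lemma barD_cons (x : B) (u : Tot k (Bar k B) M) :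
    barD k B M (Tot.cons k (Bar k B) M (bar k B x) u) = x ⊗ₜ u -
      1 ⊗ₜ consExt k B M (x • barD k B M u) -
        1 ⊗ₜ Tot.nil k (Bar k B) M (x • Tot.aug k (Bar k B) M u) := by
  induction u using Tot.induction_inc with
  | h0 => simp
  | hadd y z hy hz =>
    simp only [TensorProduct.tmul_add, map_add, smul_add] at hy hz ⊢
    rw [hy, hz]; abel
  | h n w m =>
    rw [barD_cons_inc, absorbTail_gamma, TensorProduct.tmul_add, sub_sub]

/-- The contraction property of the bar complex. -/
lemma barD_consExt (ξ : B ⊗[k] Tot k (Bar k B) M) :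
    barD k B M (consExt k B M ξ) = ξ - 1 ⊗ₜ consExt k B M (ext B (barD k B M) ξ) -
      1 ⊗ₜ Tot.nil k (Bar k B) M (ext B (Tot.aug k (Bar k B) M) ξ) := by
  induction ξ using TensorProduct.induction_on with
  | zero => simp
  | add x y hx hy => simp only [TensorProduct.tmul_add, map_add, hx, hy]; abel
  | tmul x u => rw [consExt_tmul, barD_cons, ext_tmul, ext_tmul]

/-- The contraction kills `1 ⊗ -`, and in the differential of `x · u` every term except `x ⊗ u` has
first factor `1`. -/
lemma consExt_barD (u : Tot k (Bar k B) M) :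
    consExt k B M (barD k B M u) + Tot.nil k (Bar k B) M (Tot.aug k (Bar k B) M u) = u := by
  induction u using Tot.induction with
  | hadd x y hx hy =>
    simp only [map_add]
    nth_rewrite 3 [← hx]; nth_rewrite 3 [← hy]; abel
  | hnil x => simp
  | hcons v y hy =>
    obtain ⟨x, rfl⟩ := bar_surjective k B v
    rw [barD_cons, map_sub, map_sub, consExt_one_tmul, consExt_one_tmul, consExt_tmul,
      Tot.aug_cons, map_zero, sub_zero, sub_zero, add_zero]

lemma aug_barD (u : Tot k (Bar k B) M) :
    ext B (Tot.aug k (Bar k B) M) (barD k B M u) = 0 := by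
  induction u using Tot.induction with
  | hadd x y hx hy => simp only [map_add, hx, hy, add_zero]
  | hnil x => simp
  | hcons v y hy =>
    obtain ⟨x, rfl⟩ := bar_surjective k B v
    rw [barD_cons]
    simp [aug_consExt]

/-- A formal consequence of the contraction: `d d s = d - d s d - d η ε` reduces to `s d d` and `η ε
d`, and these vanish by induction and by `aug_barD`. -/
lemma barD_barD (u : Tot k (Bar k B) M) : ext B (barD k B M) (barD k B M u) = 0 := by
  induction u using Tot.induction with
  | hadd x y hx hy => simp only [map_add, hx, hy, add_zero]
  | hnil x => simp
  | hcons v y hy =>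
    obtain ⟨x, rfl⟩ := bar_surjective k B v
    rw [barD_cons, map_sub, map_sub, ext_tmul, ext_tmul, ext_tmul, barD_nil, barD_consExt, ext_smul,
      ext_smul, hy, aug_barD]
    simp

lemma barD_map (r : M →ₗ[k] M) (hr : ∀ (b : B) (m : M), r (b • m) = b • r m)
    (u : Tot k (Bar k B) M) : barD k B M (Tot.map (Bar k B) r u) =
      (Tot.map (Bar k B) r).lTensor B (barD k B M u) := by
  have key : ∀ ξ : B ⊗[k] Tot k (Bar k B) M, Tot.map (Bar k B) r (consExt k B M ξ) =
      consExt k B M ((Tot.map (Bar k B) r).lTensor B ξ) := fun ξ => by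
    induction ξ using TensorProduct.induction_on with
    | zero => simp
    | add x y hx hy => simp only [map_add, hx, hy]
    | tmul x u => simp
  induction u using Tot.induction with
  | hadd x y hx hy => simp only [map_add, hx, hy]
  | hnil x => simp
  | hcons v y hy =>
    obtain ⟨x, rfl⟩ := bar_surjective k B v
    rw [Tot.map_cons, barD_cons, barD_cons, hy, map_sub, map_sub, LinearMap.lTensor_tmul,
      LinearMap.lTensor_tmul, LinearMap.lTensor_tmul, key, lTensor_smul, Tot.map_nil, hr,
      Tot.aug_map]

end BarComplex

end HochschildSerre

namespace HochschildSerre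

namespace CrossedSystem

variable {k A H : Type*} [CommRing k] [Ring A] [Algebra k A] [Ring H] [HopfAlgebra k H]
  (S : CrossedSystem k A H)

/-! ### Products in the crossed product, in terms of `χ` and `𝓕`. -/

section Multiplication

lemma inA_mul_toE (a b : A) (h : H) : S.inA a * S.toE (b ⊗ₜ h) = S.toE ((a * b) ⊗ₜ h) := by
  refine (S.toE_mul (a ⊗ₜ 1) (b ⊗ₜ h)).trans (congrArg S.toE ?_)
  rw [CrossedData.mul_tmul, S.chi_one_tmul]
  simp [S.ff_one_tmul, CrossedData.mulLeft]

lemma toE_eq (a : A) (h : H) : S.toE (a ⊗ₜ h) = S.inA a * S.inH h := by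
  refine Eq.trans ?_ (S.inA_mul_toE a 1 h).symm
  rw [_root_.mul_one]

lemma inH_eq (h : H) : S.inH h = S.toE (1 ⊗ₜ h) := rfl

lemma inH_mul_inA (h : H) (a : A) : S.inH h * S.inA a = S.toE (S.chi (h ⊗ₜ a)) := by
  refine (S.toE_mul (1 ⊗ₜ h) (a ⊗ₜ 1)).trans (congrArg S.toE ?_)
  rw [CrossedData.mul_tmul, CrossedData.mulLeft_one]
  generalize S.chi (h ⊗ₜ a) = t
  induction t using TensorProduct.induction_on with
  | zero => simp
  | add x y hx hy => simp only [TensorProduct.add_tmul, map_add, hx, hy]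
  | tmul b l => simp [S.ff_tmul_one, CrossedData.mulLeft]

lemma inH_mul_inH (h l : H) : S.inH h * S.inH l = S.toE (S.ff (h ⊗ₜ l)) := by
  refine (S.toE_mul (1 ⊗ₜ h) (1 ⊗ₜ l)).trans (congrArg S.toE ?_)
  rw [CrossedData.mul_tmul, S.chi_tmul_one, CrossedData.mulLeft_one]
  simp [CrossedData.mulLeft_one]

lemma inA_mul' (a b : A) : S.inA (a * b) = S.inA a * S.inA b := (S.inA_mul a b).symm

end Multiplication

section Head

variable {Z Z' Z'' : Type*} [AddCommGroup Z] [Module k Z] [AddCommGroup Z'] [Module k Z']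
  [AddCommGroup Z''] [Module k Z'']

lemma E_induction {p : S.E ⊗[k] Z → Prop} (ξ : S.E ⊗[k] Z)
    (hadd : ∀ x y, p x → p y → p (x + y)) (h : ∀ a h z, p (S.toE (a ⊗ₜ h) ⊗ₜ z)) : p ξ := by
  have h0 : p 0 := by simpa using h 0 0 0
  induction ξ using TensorProduct.induction_on with
  | zero => exact h0
  | add x y hx hy => exact hadd _ _ hx hy
  | tmul e z =>
    obtain ⟨t, rfl⟩ := S.toE.surjective e
    induction t using TensorProduct.induction_on with
    | zero => simpa using h0
    | add x y hx hy => rw [map_add, TensorProduct.add_tmul]; exact hadd _ _ hx hy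
    | tmul a l => exact h a l z

/-- For `g : H ⊗ Z → Z'`, the map `E ⊗ Z → A ⊗ Z'`, `(a # h) ⊗ z ↦ a ⊗ g (h ⊗ z)`. -/
noncomputable def hd (g : H ⊗[k] Z →ₗ[k] Z') : S.E ⊗[k] Z →ₗ[k] A ⊗[k] Z' :=
  g.lTensor A ∘ₗ (TensorProduct.assoc k A H Z).toLinearMap ∘ₗ S.toE.symm.toLinearMap.rTensor Z

@[simp]
lemma hd_toE (g : H ⊗[k] Z →ₗ[k] Z') (a : A) (h : H) (z : Z) :
    S.hd g (S.toE (a ⊗ₜ h) ⊗ₜ z) = a ⊗ₜ g (h ⊗ₜ z) := rfl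

@[simp]
lemma hd_inA (g : H ⊗[k] Z →ₗ[k] Z') (a : A) (z : Z) :
    S.hd g (S.inA a ⊗ₜ z) = a ⊗ₜ g (1 ⊗ₜ z) := rfl

@[simp]
lemma hd_smul (g : H ⊗[k] Z →ₗ[k] Z') (a : A) (ξ : S.E ⊗[k] Z) :
    S.hd g (S.inA a • ξ) = a • S.hd g ξ := by
  induction ξ using S.E_induction with
  | hadd x y hx hy => rw [smul_add, map_add, hx, hy, map_add, smul_add]
  | h b h z => rw [TensorProduct.smul_tmul', smul_eq_mul, S.inA_mul_toE, hd_toE, hd_toE,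
      TensorProduct.smul_tmul', smul_eq_mul]

/-- The inclusion `A ⊗ Z → E ⊗ Z`. -/
noncomputable def jA (Z : Type*) [AddCommGroup Z] [Module k Z] : A ⊗[k] Z →ₗ[k] S.E ⊗[k] Z :=
  S.inA.rTensor Z

@[simp]
lemma jA_tmul (a : A) (z : Z) : S.jA Z (a ⊗ₜ z) = S.inA a ⊗ₜ z := rfl

@[simp]
lemma jA_smul (a : A) (ξ : A ⊗[k] Z) : S.jA Z (a • ξ) = S.inA a • S.jA Z ξ := by
  induction ξ using TensorProduct.induction_on with
  | zero => simp
  | add x y hx hy => simp only [smul_add, map_add, hx, hy]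
  | tmul b z => simp [TensorProduct.smul_tmul', S.inA_mul']

/-- Two linear maps on `E ⊗ Z` that are `A`-linear agree if they agree on the `(1 # h) ⊗ z`. -/
lemma hom_ext_inH {f g : S.E ⊗[k] Z →ₗ[k] S.E ⊗[k] Z'}
    (hf : ∀ a ξ, f (S.inA a • ξ) = S.inA a • f ξ) (hg : ∀ a ξ, g (S.inA a • ξ) = S.inA a • g ξ)
    (h : ∀ h z, f (S.inH h ⊗ₜ z) = g (S.inH h ⊗ₜ z)) (ξ : S.E ⊗[k] Z) : f ξ = g ξ := by
  induction ξ using S.E_induction with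
  | hadd x y hx hy => rw [map_add, hx, hy, map_add]
  | h a l z =>
    have e : S.toE (a ⊗ₜ l) ⊗ₜ[k] z = S.inA a • (S.inH l ⊗ₜ[k] z) := by
      rw [S.toE_eq, TensorProduct.smul_tmul', smul_eq_mul]
    rw [e, hf, hg, h]

end Head

/-! ### The actions of `H` and of the maps `F` on `P = ⨁ Ā^r ⊗ M`. -/

section Actions

variable (M : Type*) [AddCommGroup M] [Module k M]

/-- The total module of the bar construction of `A` with coefficients in `M`. -/
abbrev TotA (_ : CrossedSystem k A H) (M : Type*) [AddCommGroup M] [Module k M] : Type _ :=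
  Tot k (Bar k A) M

/-- The total module `⨁ H̄^s ⊗ Ā^r ⊗ M`. -/
abbrev TotHA (_ : CrossedSystem k A H) (M : Type*) [AddCommGroup M] [Module k M] : Type _ :=
  Tot k (Bar k H) (Tot k (Bar k A) M)

/-- `v ⊗ u ↦ v · u`. -/
noncomputable def consA : Bar k A ⊗[k] S.TotA M →ₗ[k] S.TotA M :=
  TensorProduct.lift (Tot.cons k (Bar k A) M)

@[simp]
lemma consA_tmul (v : Bar k A) (u : S.TotA M) :
    S.consA M (v ⊗ₜ u) = Tot.cons k (Bar k A) M v u := rfl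

variable [Module S.E M] [IsScalarTower k S.E M]

/-- `w ⊗ y ↦ w ⊗ (1 # y) m`. -/
noncomputable def absorbH (n : ℕ) (m : M) : (⨂[k]^n (Bar k A)) ⊗[k] H →ₗ[k] S.TotA M :=
  Tot.inc k (Bar k A) M n ∘ₗ ((Algebra.lsmul k k M).toLinearMap.flip m ∘ₗ S.inH).lTensor _

variable {M}

@[simp]
lemma absorbH_tmul (n : ℕ) (m : M) (w : ⨂[k]^n (Bar k A)) (y : H) :
    S.absorbH M n m (w ⊗ₜ y) = Tot.inc k (Bar k A) M n (w ⊗ₜ (S.inH y • m)) := rfl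

lemma absorbH_add (n : ℕ) (m m' : M) (t : (⨂[k]^n (Bar k A)) ⊗[k] H) :
    S.absorbH M n (m + m') t = S.absorbH M n m t + S.absorbH M n m' t := by
  induction t using TensorProduct.induction_on with
  | zero => simp
  | add x y hx hy => simp only [map_add, hx, hy]; abel
  | tmul w y => simp [TensorProduct.tmul_add]

lemma absorbH_smul (n : ℕ) (c : k) (m : M) (t : (⨂[k]^n (Bar k A)) ⊗[k] H) :
    S.absorbH M n (c • m) t = c • S.absorbH M n m t := by
  induction t using TensorProduct.induction_on with
  | zero => simp
  | add x y hx hy => simp only [map_add, hx, hy, smul_add]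
  | tmul w y => simp [smul_comm (S.inH y) c m]

lemma absorbH_cast {i j : ℕ} (h : i = j) (m : M) (t : (⨂[k]^i (Bar k A)) ⊗[k] H) :
    S.absorbH M j m ((TensorPower.cast k (Bar k A) h).toLinearMap.rTensor H t) =
      S.absorbH M i m t := by
  subst h
  have e : (TensorPower.cast k (Bar k A) (rfl : i = i)).toLinearMap = LinearMap.id := by
    rw [TensorPower.cast_refl]; rfl
  rw [e, LinearMap.rTensor_id, LinearMap.id_apply]

lemma absorbH_consAH (n : ℕ) (m : M) (v : Bar k A) (t : (⨂[k]^n (Bar k A)) ⊗[k] H) :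
    S.absorbH M (n + 1) m (consAH k A H n (v ⊗ₜ t)) =
      Tot.cons k (Bar k A) M v (S.absorbH M n m t) := by
  induction t using TensorProduct.induction_on with
  | zero => simp
  | add x y hx hy => simp only [TensorProduct.tmul_add, map_add, hx, hy]
  | tmul w z => rw [absorbH_tmul, Tot.cons_inc]; rfl

/-- A linear map `V ⊗ Ā^r → Ā^(r') ⊗ H`, depending on `r`, as an action on the total module. -/
noncomputable def actOf {V : Type*} [AddCommGroup V] [Module k V] {e : ℕ → ℕ}
    (g : ∀ r : ℕ, V ⊗[k] (⨂[k]^r (Bar k A)) →ₗ[k] (⨂[k]^(e r) (Bar k A)) ⊗[k] H) :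
    V →ₗ[k] S.TotA M →ₗ[k] S.TotA M :=
  LinearMap.flip (Tot.ofFam fun r => TensorProduct.lift
    (LinearMap.mk₂ k (fun v m => S.absorbH M (e r) m ∘ₗ g r ∘ₗ (TensorProduct.mk k V _).flip v)
      (fun v v' m => LinearMap.ext fun w => by simp)
      (fun c v m => LinearMap.ext fun w => by simp)
      (fun v m m' => LinearMap.ext fun w => by simp [S.absorbH_add])
      (fun c v m => LinearMap.ext fun w => by simp [S.absorbH_smul])))

lemma actOf_inc {V : Type*} [AddCommGroup V] [Module k V] {e : ℕ → ℕ}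
    (g : ∀ r : ℕ, V ⊗[k] (⨂[k]^r (Bar k A)) →ₗ[k] (⨂[k]^(e r) (Bar k A)) ⊗[k] H) (w : V) (r : ℕ)
    (v : ⨂[k]^r (Bar k A)) (m : M) :
    S.actOf g w (Tot.inc k (Bar k A) M r (v ⊗ₜ m)) = S.absorbH M (e r) m (g r (w ⊗ₜ v)) := by
  rw [actOf, LinearMap.flip_apply, Tot.ofFam_inc]; rfl

variable (M) in
/-- The action `h ⊗ (v ⊗ m) ↦ v^(h₁) ⊗ (1 # h₂) m`. -/
noncomputable def actH : H →ₗ[k] S.TotA M →ₗ[k] S.TotA M := S.actOf (e := id) (iterR S.chiAb)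

lemma actH_nil (h : H) (m : M) :
    S.actH M h (Tot.nil k (Bar k A) M m) = Tot.nil k (Bar k A) M (S.inH h • m) := by
  rw [Tot.nil_apply, actH, actOf_inc]; rfl

/-- The common step of all the recursions for actions: an operator `a ⊗ x` on `P` lets `x` act on
the rest and then prepends `a`. It serves for `actH`, for both forms of `actKHead` and for `actK`.
-/
lemma absorbH_consAH_lTensor {V : Type*} [AddCommGroup V] [Module k V] {r e : ℕ}
    (g : V ⊗[k] (⨂[k]^r (Bar k A)) →ₗ[k] (⨂[k]^e (Bar k A)) ⊗[k] H) (v : ⨂[k]^r (Bar k A)) (m : M)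
    (F : V →ₗ[k] S.TotA M) (hF : ∀ x, F x = S.absorbH M e m (g (x ⊗ₜ v))) (t : Bar k A ⊗[k] V) :
    S.absorbH M (e + 1) m (consAH k A H e (g.lTensor (Bar k A)
      (TensorProduct.assoc k (Bar k A) V _ (t ⊗ₜ v)))) = S.consA M (F.lTensor _ t) := by
  induction t using TensorProduct.induction_on with
  | zero => simp
  | add x y hx hy =>
    simp only [TensorProduct.add_tmul, map_add] at hx hy ⊢
    rw [hx, hy]
  | tmul a l => rw [TensorProduct.assoc_tmul, LinearMap.lTensor_tmul, absorbH_consAH,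
      LinearMap.lTensor_tmul, consA_tmul, hF]

lemma actH_cons (h : H) (v : Bar k A) (p : S.TotA M) :
    S.actH M h (Tot.cons k (Bar k A) M v p) =
      S.consA M (((S.actH M).flip p).lTensor _ (S.chiAb (h ⊗ₜ v))) := by
  induction p using Tot.induction_inc with
  | h0 => simp
  | hadd x y hx hy => simp only [map_add, hx, hy, LinearMap.lTensor_add, LinearMap.add_apply]
  | h n w m =>
    rw [Tot.cons_inc, actH, actOf_inc]
    have e1 : iterR S.chiAb (n + 1) (h ⊗ₜ[k] cons k (Bar k A) n (v ⊗ₜ w)) =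
        consAH k A H n ((iterR S.chiAb n).lTensor _ (TensorProduct.assoc k _ _ _
          (S.chiAb (h ⊗ₜ v) ⊗ₜ w))) := by
      simp [iterR, passR, consAH]
    rw [e1]
    exact S.absorbH_consAH_lTensor _ _ _ _ (fun x => S.actOf_inc (e := id) _ _ _ _ _) _

end Actions

/-! ### The maps `F_r^(l)` as actions on `P`, and their sum `actR`. -/

section Higher

variable {M : Type*} [AddCommGroup M] [Module k M] [Module S.E M] [IsScalarTower k S.E M]

/-- `h ⊗ l ↦ ∑ f(h₁, l₁) ⊗ h₂ l₂` on `H̄^2`. -/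
noncomputable def ffTwo : (⨂[k]^2 (Bar k H)) →ₗ[k] Bar k A ⊗[k] H :=
  S.ffb ∘ₗ (TensorProduct.rid k (Bar k H)).toLinearMap.lTensor (Bar k H) ∘ₗ
    ((PiTensorProduct.isEmptyEquiv (R := k) (s := fun _ => Bar k H)
      (Fin 0)).toLinearMap.lTensor (Bar k H)).lTensor (Bar k H) ∘ₗ
    (cons k (Bar k H) 0).symm.toLinearMap.lTensor (Bar k H) ∘ₗ
      (cons k (Bar k H) 1).symm.toLinearMap

lemma ffTwo_cons (h l : Bar k H) (w : ⨂[k]^0 (Bar k H)) :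
    S.ffTwo (cons k (Bar k H) 1 (h ⊗ₜ cons k (Bar k H) 0 (l ⊗ₜ w))) =
      (PiTensorProduct.isEmptyEquiv (R := k) (s := fun _ => Bar k H) (Fin 0) w) •
        S.ffb (h ⊗ₜ l) := by
  simp [ffTwo]

/-- The terms of `gg n` in which the first factor is a value of `f`. -/
noncomputable def ggHead : ∀ n r : ℕ, (⨂[k]^(n + 2) (Bar k H)) ⊗[k] (⨂[k]^r (Bar k A)) →ₗ[k]
      (⨂[k]^(r + (n + 1)) (Bar k A)) ⊗[k] H
  | 0, r => -(consAH k A H r ∘ₗ (iterR S.chiAb r).lTensor (Bar k A) ∘ₗ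
      (TensorProduct.assoc k (Bar k A) H _).toLinearMap ∘ₗ S.ffTwo.rTensor _)
  | n + 1, r => consAH k A H (r + (n + 1)) ∘ₗ (S.gg n r).lTensor (Bar k A) ∘ₗ
      (TensorProduct.assoc k (Bar k A) _ _).toLinearMap ∘ₗ (S.tt (n + 1)).rTensor _

lemma gg_eq (n : ℕ) : S.gg n = S.passSum n (S.ggHead n) := by
  cases n <;> rfl

variable (M) in
/-- The action of `H̄^(n+2)` on the total module given by `gg n`. -/
noncomputable def actK (n : ℕ) : (⨂[k]^(n + 2) (Bar k H)) →ₗ[k] S.TotA M →ₗ[k] S.TotA M :=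
  S.actOf (e := fun r => r + (n + 1)) (S.gg n)

variable (M) in
/-- The part of `actK` that comes from `ggHead`. -/
noncomputable def actKHead (n : ℕ) : (⨂[k]^(n + 2) (Bar k H)) →ₗ[k] S.TotA M →ₗ[k] S.TotA M :=
  S.actOf (e := fun r => r + (n + 1)) (S.ggHead n)

lemma actKHead_zero (w : ⨂[k]^2 (Bar k H)) (p : S.TotA M) :
    S.actKHead M 0 w p = -S.consA M (((S.actH M).flip p).lTensor _ (S.ffTwo w)) := by
  induction p using Tot.induction_inc with
  | h0 => simp
  | hadd x y hx hy =>
    simp only [map_add, hx, hy, LinearMap.lTensor_add, LinearMap.add_apply]; abel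
  | h r v m =>
    rw [actKHead, actOf_inc]
    refine Eq.trans (map_neg (S.absorbH M (r + 1) m) _) (congrArg _ ?_)
    exact S.absorbH_consAH_lTensor _ _ _ _ (fun x => S.actOf_inc (e := id) _ _ _ _ _) _

lemma actKHead_succ (n : ℕ) (w : ⨂[k]^(n + 3) (Bar k H)) (p : S.TotA M) :
    S.actKHead M (n + 1) w p = S.consA M (((S.actK M n).flip p).lTensor _ (S.tt (n + 1) w)) := by
  induction p using Tot.induction_inc with
  | h0 => simp
  | hadd x y hx hy => simp only [map_add, hx, hy, LinearMap.lTensor_add, LinearMap.add_apply]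
  | h r v m =>
    rw [actKHead, actOf_inc]
    exact S.absorbH_consAH_lTensor _ _ _ _
      (fun x => S.actOf_inc (e := fun r => r + (n + 1)) _ _ _ _ _) _

lemma actK_nil (n : ℕ) (w : ⨂[k]^(n + 2) (Bar k H)) (m : M) :
    S.actK M n w (Tot.nil k (Bar k A) M m) = S.actKHead M n w (Tot.nil k (Bar k A) M m) := by
  rw [Tot.nil_apply, actK, actKHead, actOf_inc, actOf_inc, gg_eq]
  rfl

/-- In `F_r^(l)` the term `i = 0` begins with a value of `f`; in the terms `i > 0` the first entry
of `Ā^r` has been carried across `H̄^l`. Peeling off that entry leaves the same sum for `r - 1`,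
with the sign `(-1)^(l-1)`, `l = n + 2`. -/
lemma actK_cons (n : ℕ) (w : ⨂[k]^(n + 2) (Bar k H)) (v : Bar k A) (p : S.TotA M) :
    S.actK M n w (Tot.cons k (Bar k A) M v p) = S.actKHead M n w (Tot.cons k (Bar k A) M v p) +
      (-1 : k) ^ (n + 1) • S.consA M (((S.actK M n).flip p).lTensor _
        (iterL S.chiBb (n + 2) (w ⊗ₜ v))) := by
  induction p using Tot.induction_inc with
  | h0 => simp
  | hadd x y hx hy =>
    simp only [map_add, hx, hy, LinearMap.lTensor_add, LinearMap.add_apply, smul_add]; abel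
  | h r u m =>
    rw [Tot.cons_inc, actK, actKHead, actOf_inc, actOf_inc]
    have e : S.gg n (r + 1) (w ⊗ₜ cons k (Bar k A) r (v ⊗ₜ u)) =
        S.ggHead n (r + 1) (w ⊗ₜ cons k (Bar k A) r (v ⊗ₜ u)) + (-1 : k) ^ (n + 1) •
          (TensorPower.cast k (Bar k A) (Nat.add_right_comm r (n + 1) 1)).toLinearMap.rTensor H
            (consAH k A H (r + (n + 1)) ((S.gg n r).lTensor (Bar k A)
              (TensorProduct.assoc k (Bar k A) _ _ (iterL S.chiBb (n + 2) (w ⊗ₜ v) ⊗ₜ u)))) := by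
      rw [gg_eq]
      simp [passSum]
    rw [e, map_add, map_smul]
    congr 2
    refine (S.absorbH_cast (Nat.add_right_comm r (n + 1) 1) m _).trans ?_
    exact S.absorbH_consAH_lTensor _ _ _ _
      (fun x => S.actOf_inc (e := fun r => r + (n + 1)) _ _ _ _ _) _

variable (M) in
/-- The sum of the actions of the `H̄^(n+2)`, with signs. -/
noncomputable def actR : S.TotHA M →ₗ[k] S.TotA M :=
  Tot.ofFam fun
    | 0 => 0
    | 1 => 0
    -- With `l = n + 2` this is the sign `(-1)^(l-1)` for which `rhoH_eq` holds. There is no `F^(l)`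
    -- with `l < 2`, hence the zeros above.
    | n + 2 => (-1 : k) ^ (n + 1) • TensorProduct.lift (S.actK M n)

@[simp]
lemma actR_zero (w : ⨂[k]^0 (Bar k H)) (p : S.TotA M) :
    S.actR M (Tot.inc k (Bar k H) (S.TotA M) 0 (w ⊗ₜ p)) = 0 := by
  rw [actR, Tot.ofFam_inc]; rfl

@[simp]
lemma actR_one (w : ⨂[k]^1 (Bar k H)) (p : S.TotA M) :
    S.actR M (Tot.inc k (Bar k H) (S.TotA M) 1 (w ⊗ₜ p)) = 0 := by
  rw [actR, Tot.ofFam_inc]; rfl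

@[simp]
lemma actR_add_two (n : ℕ) (w : ⨂[k]^(n + 2) (Bar k H)) (p : S.TotA M) :
    S.actR M (Tot.inc k (Bar k H) (S.TotA M) (n + 2) (w ⊗ₜ p)) =
      (-1 : k) ^ (n + 1) • S.actK M n w p := by
  rw [actR, Tot.ofFam_inc]; rfl

lemma actR_cons_nil (h : Bar k H) (p : S.TotA M) :
    S.actR M (Tot.cons k (Bar k H) _ h (Tot.nil k (Bar k H) (S.TotA M) p)) = 0 := by
  rw [Tot.nil_apply, Tot.cons_inc, actR_one]

variable (M) in
/-- The map `H ⊗ W → P` of the total modules `W = ⨁ H̄^s ⊗ P` and `P = ⨁ Ā^r ⊗ M`, which is the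
action of `H` on `P`, and is given by `actR` on `H̄^s ⊗ P`, `s > 0`. -/
noncomputable def rhoH : H →ₗ[k] S.TotHA M →ₗ[k] S.TotA M :=
  LinearMap.lcomp k (S.TotA M) (Tot.aug k (Bar k H) (S.TotA M)) ∘ₗ S.actH M +
    (Tot.cons k (Bar k H) (S.TotA M) ∘ₗ bar k H).compr₂ (S.actR M)

lemma rhoH_apply (h : H) (y : S.TotHA M) :
    S.rhoH M h y = S.actH M h (Tot.aug k (Bar k H) (S.TotA M) y) +
      S.actR M (Tot.cons k (Bar k H) (S.TotA M) (bar k H h) y) := rfl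

lemma actH_one (p : S.TotA M) : S.actH M 1 p = p := by
  induction p using Tot.induction with
  | hadd x y hx hy => rw [map_add, hx, hy]
  | hnil m => rw [actH_nil, inH_one, one_smul]
  | hcons v y hy => rw [actH_cons, S.chiAb_one_tmul]; simp [hy]

/-- On `A ⊗ W` the projection `ρ` is therefore the augmentation `W → P`. The same value makes the
formula for `dW` vanish at `h = 1`. -/
lemma rhoH_one (y : S.TotHA M) : S.rhoH M 1 y = Tot.aug k (Bar k H) (S.TotA M) y := by
  rw [rhoH_apply, actH_one, bar_one]; simp

end Higher

end CrossedSystem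

end HochschildSerre

namespace HochschildSerre

namespace CrossedSystem

variable {k A H : Type*} [CommRing k] [Ring A] [Algebra k A] [Ring H] [HopfAlgebra k H]
  (S : CrossedSystem k A H)

/-! ### The contraction `s` of `E ⊗ W` onto the copy of `A ⊗ P`. -/

section Contraction

variable {M : Type*} [AddCommGroup M] [Module k M]

variable (M) in
/-- The map `(a # h) ⊗ y ↦ a ⊗ (h · y)`. -/
noncomputable def consE : S.E ⊗[k] S.TotHA M →ₗ[k] A ⊗[k] S.TotHA M :=
  S.hd (consExt k H (S.TotA M))

variable (M) in
/-- The contraction `(a # h) ⊗ y ↦ (a # 1) ⊗ (h · y)`. -/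
noncomputable def sMap : S.E ⊗[k] S.TotHA M →ₗ[k] S.E ⊗[k] S.TotHA M :=
  S.jA _ ∘ₗ S.consE M

variable (M) in
/-- The inclusion `a ⊗ p ↦ (a # 1) ⊗ p`. -/
noncomputable def iotaA : A ⊗[k] S.TotA M →ₗ[k] S.E ⊗[k] S.TotHA M :=
  S.jA _ ∘ₗ (Tot.nil k (Bar k H) (S.TotA M)).lTensor A

lemma consE_jA (ξ : A ⊗[k] S.TotHA M) : S.consE M (S.jA _ ξ) = 0 := by
  induction ξ using TensorProduct.induction_on with
  | zero => simp
  | add x y hx hy => simp only [map_add, hx, hy, add_zero]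
  | tmul a u => rw [jA_tmul, consE, hd_inA, consExt_one_tmul, TensorProduct.tmul_zero]

lemma consE_inA_smul (a : A) (ξ : S.E ⊗[k] S.TotHA M) :
    S.consE M (S.inA a • ξ) = a • S.consE M ξ := S.hd_smul _ a ξ

lemma sMap_inA_smul (a : A) (ξ : S.E ⊗[k] S.TotHA M) :
    S.sMap M (S.inA a • ξ) = S.inA a • S.sMap M ξ := by
  rw [sMap, LinearMap.comp_apply, consE_inA_smul, jA_smul]; rfl

lemma sMap_jA (ξ : A ⊗[k] S.TotHA M) : S.sMap M (S.jA _ ξ) = 0 := by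
  rw [sMap, LinearMap.comp_apply, consE_jA, map_zero]

lemma sMap_sMap (ξ : S.E ⊗[k] S.TotHA M) : S.sMap M (S.sMap M ξ) = 0 := S.sMap_jA _

lemma sMap_iotaA (ξ : A ⊗[k] S.TotA M) : S.sMap M (S.iotaA M ξ) = 0 := S.sMap_jA _

lemma sMap_inH_tmul (h : H) (y : S.TotHA M) :
    S.sMap M (S.inH h ⊗ₜ y) = 1 ⊗ₜ Tot.cons k (Bar k H) _ (bar k H h) y := rfl

lemma sMap_one_tmul (y : S.TotHA M) : S.sMap M (1 ⊗ₜ y) = 0 := by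
  rw [← S.inH_one, sMap_inH_tmul, bar_one, map_zero, LinearMap.zero_apply,
    TensorProduct.tmul_zero]

@[simp]
lemma iotaA_tmul (a : A) (p : S.TotA M) :
    S.iotaA M (a ⊗ₜ p) = S.inA a ⊗ₜ Tot.nil k (Bar k H) _ p := rfl

lemma iotaA_smul (a : A) (ξ : A ⊗[k] S.TotA M) :
    S.iotaA M (a • ξ) = S.inA a • S.iotaA M ξ := by
  rw [iotaA, LinearMap.comp_apply, lTensor_smul, jA_smul]; rfl

end Contraction

variable (k H) in
/-- The section `h ↦ h - ε(h) 1` of the projection `H → H / k`. -/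
noncomputable def redLift : Bar k H →ₗ[k] H :=
  barLift (LinearMap.id - Algebra.linearMap k H ∘ₗ Coalgebra.counit) (by simp)

lemma redLift_bar (h : H) :
    redLift k H (bar k H h) = h - Coalgebra.counit (R := k) h • (1 : H) := by
  rw [redLift, barLift_bar]; simp [Algebra.algebraMap_eq_smul_one]

lemma bar_redLift (v : Bar k H) : bar k H (redLift k H v) = v := by
  obtain ⟨h, rfl⟩ := bar_surjective k H v
  rw [redLift_bar, map_sub, map_smul, bar_one, smul_zero, sub_zero]

/-! ### The differential of `E ⊗ W`, defined by recursion on the factors of `H̄`. -/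

section Differential

variable {M : Type*} [AddCommGroup M] [Module k M] [Module S.E M] [IsScalarTower k S.E M]

variable (M) in
/-- The map `(a # h) ⊗ y ↦ a ⊗ ρ(h, y)`. -/
noncomputable def rhoE : S.E ⊗[k] S.TotHA M →ₗ[k] A ⊗[k] S.TotA M :=
  S.hd (TensorProduct.lift (S.rhoH M))

lemma rhoE_inA_smul (a : A) (ξ : S.E ⊗[k] S.TotHA M) :
    S.rhoE M (S.inA a • ξ) = a • S.rhoE M ξ := S.hd_smul _ a ξ

@[simp]
lemma rhoE_inH_tmul (h : H) (y : S.TotHA M) :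
    S.rhoE M (S.inH h ⊗ₜ y) = 1 ⊗ₜ S.rhoH M h y := rfl

@[simp]
lemma rhoE_inA_tmul (a : A) (y : S.TotHA M) :
    S.rhoE M (S.inA a ⊗ₜ y) = a ⊗ₜ Tot.aug k (Bar k H) _ y := by
  rw [rhoE, hd_inA, TensorProduct.lift.tmul, rhoH_one]

/-- The image of `s` consists of elements `a ⊗ (h · y)` with `a ∈ A`; on these `ρ` is the
augmentation, which kills `cons`. -/
lemma rhoE_sMap (ξ : S.E ⊗[k] S.TotHA M) : S.rhoE M (S.sMap M ξ) = 0 := by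
  induction ξ using S.E_induction with
  | hadd x y hx hy => simp only [map_add, hx, hy, add_zero]
  | h a h z =>
    have e : S.sMap M (S.toE (a ⊗ₜ h) ⊗ₜ z) = S.inA a ⊗ₜ Tot.cons k (Bar k H) _ (bar k H h) z := rfl
    rw [e, rhoE_inA_tmul, Tot.aug_cons, TensorProduct.tmul_zero]

variable [Module A M] [IsScalarTower k A M]

variable (M) in
/-- The differential of `X̂`, for free coefficients. -/
noncomputable def dW : S.TotHA M →ₗ[k] S.E ⊗[k] S.TotHA M :=
  -- The recursion has to be linear in `H̄`, and the vanishing of the rule at `h = 1` involves the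
  -- value at the tail, which is being defined. The section `redLift` avoids the circularity;
  -- `dW_cons` shows afterwards that it plays no role.
  Tot.para (S.iotaA M ∘ₗ barD k A M)
    (TensorProduct.curry (S.inH.rTensor _ -
      S.iotaA M ∘ₗ TensorProduct.mk k A _ 1 ∘ₗ TensorProduct.lift (S.rhoH M)) ∘ₗ redLift k H)
    (((Algebra.lsmul k k (S.E ⊗[k] S.TotHA M)).toLinearMap.compr₂ (-S.sMap M) ∘ₗ S.inH) ∘ₗ
      redLift k H)

@[simp]
lemma dW_nil (p : S.TotA M) : S.dW M (Tot.nil k (Bar k H) _ p) = S.iotaA M (barD k A M p) :=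
  Tot.para_nil _ _ _ _

lemma dW_cons_redLift (v : Bar k H) (y : S.TotHA M) :
    S.dW M (Tot.cons k (Bar k H) _ v y) = S.inH (redLift k H v) ⊗ₜ y -
      S.sMap M (S.inH (redLift k H v) • S.dW M y) -
        S.iotaA M (1 ⊗ₜ S.rhoH M (redLift k H v) y) := by
  have e : ∀ a b c : S.E ⊗[k] S.TotHA M, a - c + -b = a - b - c := fun a b c => by abel
  refine (Tot.para_cons _ _ _ _ _).trans (Eq.trans ?_ (e _ _ _))
  rfl

/-- Since `s s = 0` and `s ι = 0`, only the leading term `(1 # h) ⊗ y` of the differential of `h ·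
y` survives under `s`, and it returns `1 ⊗ (h · y)`. -/
lemma sMap_dW (y : S.TotHA M) : S.sMap M (S.dW M y) =
    1 ⊗ₜ y - 1 ⊗ₜ Tot.nil k (Bar k H) _ (Tot.aug k (Bar k H) _ y) := by
  induction y using Tot.induction with
  | hadd x y hx hy => simp only [map_add, hx, hy, TensorProduct.tmul_add]; abel
  | hnil p => rw [dW_nil, sMap_iotaA, Tot.aug_nil, sub_self]
  | hcons v y hy =>
    rw [dW_cons_redLift, map_sub, map_sub, sMap_sMap, sMap_iotaA, sMap_inH_tmul, bar_redLift,
      Tot.aug_cons, map_zero, TensorProduct.tmul_zero, sub_zero, sub_zero]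

/-- The right-hand side vanishes for `h = 1`: by `sMap_dW` the middle term is `1 ⊗ y` minus the
augmentation, and by `rhoH_one` the last one is that augmentation. Hence `h` and `redLift` of its
class give the same value. -/
lemma dW_cons (h : H) (y : S.TotHA M) :
    S.dW M (Tot.cons k (Bar k H) _ (bar k H h) y) = S.inH h ⊗ₜ y -
      S.sMap M (S.inH h • S.dW M y) - S.iotaA M (1 ⊗ₜ S.rhoH M h y) := by
  rw [dW_cons_redLift, redLift_bar]
  generalize (Coalgebra.counit (R := k) h) = c
  have h1 : S.inH (h - c • 1) = S.inH h - c • 1 := by rw [map_sub, map_smul, inH_one]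
  have h2 : S.rhoH M (h - c • 1) y = S.rhoH M h y - c • Tot.aug k (Bar k H) _ y := by
    rw [map_sub, map_smul, LinearMap.sub_apply, LinearMap.smul_apply, rhoH_one]
  have h3 : (S.inH h - c • 1) • S.dW M y = S.inH h • S.dW M y - c • S.dW M y := by
    refine (sub_smul (S.inH h) (c • (1 : S.E)) (S.dW M y)).trans ?_
    rw [smul_assoc, one_smul]
  have h4 : S.sMap M (c • S.dW M y) = c • (1 ⊗ₜ y) -
      c • (1 ⊗ₜ Tot.nil k (Bar k H) _ (Tot.aug k (Bar k H) _ y)) := by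
    rw [LinearMap.map_smul, sMap_dW, smul_sub]
  have h5 : S.iotaA M (1 ⊗ₜ (c • Tot.aug k (Bar k H) _ y)) =
      c • (1 ⊗ₜ Tot.nil k (Bar k H) _ (Tot.aug k (Bar k H) _ y)) := by
    rw [TensorProduct.tmul_smul, LinearMap.map_smul, iotaA_tmul, inA_one]
  rw [h1, h2, h3, map_sub, h4, TensorProduct.sub_tmul, TensorProduct.tmul_sub,
    map_sub (S.iotaA M), h5, ← TensorProduct.smul_tmul']
  abel

variable (M) in
/-- The `E`-linear extension of the differential. -/
noncomputable def dE : S.E ⊗[k] S.TotHA M →ₗ[k] S.E ⊗[k] S.TotHA M := ext S.E (S.dW M)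

@[simp]
lemma dE_tmul (e : S.E) (y : S.TotHA M) : S.dE M (e ⊗ₜ y) = e • S.dW M y := rfl

@[simp]
lemma dE_smul (e : S.E) (ξ : S.E ⊗[k] S.TotHA M) : S.dE M (e • ξ) = e • S.dE M ξ :=
  ext_smul _ _ _

/-- The identity `d s + s d + ι ρ = 1`. All its terms are `A`-linear, although `s` and `ρ` are not
`E`-linear, so it may be tested on `(1 # h) ⊗ y`, where it is `dW_cons`. -/
lemma dE_sMap (ξ : S.E ⊗[k] S.TotHA M) :
    S.dE M (S.sMap M ξ) = ξ - S.sMap M (S.dE M ξ) - S.iotaA M (S.rhoE M ξ) := by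
  refine S.hom_ext_inH (f := S.dE M ∘ₗ S.sMap M)
    (g := LinearMap.id - S.sMap M ∘ₗ S.dE M - S.iotaA M ∘ₗ S.rhoE M) (fun a ξ => ?_)
    (fun a ξ => ?_) (fun h y => ?_) ξ
  · simp only [LinearMap.comp_apply, sMap_inA_smul, dE_smul]
  · simp only [LinearMap.comp_apply, LinearMap.sub_apply, sMap_inA_smul, dE_smul, rhoE_inA_smul,
      iotaA_smul, LinearMap.id_apply, smul_sub]
  · simp only [LinearMap.comp_apply, LinearMap.sub_apply, LinearMap.id_apply]
    rw [sMap_inH_tmul, dE_tmul, one_smul, dW_cons, dE_tmul, rhoE_inH_tmul]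

lemma dE_iotaA (ξ : A ⊗[k] S.TotA M) :
    S.dE M (S.iotaA M ξ) = S.iotaA M (ext A (barD k A M) ξ) := by
  induction ξ using TensorProduct.induction_on with
  | zero => simp
  | add x y hx hy => simp only [map_add, hx, hy]
  | tmul a u => rw [iotaA_tmul, dE_tmul, dW_nil, ext_tmul, iotaA_smul]

end Differential

end CrossedSystem

end HochschildSerre

namespace HochschildSerre

/-! ### Towards `rhoH_eq`: the part of `(1 # h) d y` that the contractions see. -/

section CrossPass

variable {k : Type*} [CommRing k] {V C : Type*} [AddCommGroup V] [Module k V] [AddCommGroup C]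
  [Module k C] {Z Z' Y Y' : Type*} [AddCommGroup Z] [Module k Z] [AddCommGroup Z'] [Module k Z']
  [AddCommGroup Y] [Module k Y] [AddCommGroup Y'] [Module k Y'] (β : V ⊗[k] C →ₗ[k] C ⊗[k] V)

/-- The map `v ⊗ (c ⊗ z) ↦ ∑ c' ⊗ g (v' ⊗ z)`, where `β (v ⊗ c) = ∑ c' ⊗ v'`. -/
noncomputable def crossPass (g : V ⊗[k] Z →ₗ[k] Z') : V ⊗[k] (C ⊗[k] Z) →ₗ[k] C ⊗[k] Z' :=
  g.lTensor _ ∘ₗ (TensorProduct.assoc k C V Z).toLinearMap ∘ₗ β.rTensor Z ∘ₗ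
    (TensorProduct.assoc k V C Z).symm.toLinearMap

lemma crossPass_tmul (g : V ⊗[k] Z →ₗ[k] Z') (v : V) (c : C) (z : Z) :
    crossPass β g (v ⊗ₜ (c ⊗ₜ z)) =
      g.lTensor _ (TensorProduct.assoc k C V Z (β (v ⊗ₜ c) ⊗ₜ z)) := rfl

/-- Carrying `c` across `v` is natural in the spectator module. This lets `H̄^n` be replaced by its
image in `W`. -/
lemma lTensor_crossPass (g : V ⊗[k] Z →ₗ[k] Z') (g' : V ⊗[k] Y →ₗ[k] Y')
    (f : Z →ₗ[k] Y) (f' : Z' →ₗ[k] Y') (hf : ∀ v z, f' (g (v ⊗ₜ z)) = g' (v ⊗ₜ f z)) (v : V)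
    (t : C ⊗[k] Z) :
    f'.lTensor _ (crossPass β g (v ⊗ₜ t)) = crossPass β g' (v ⊗ₜ f.lTensor _ t) := by
  induction t using TensorProduct.induction_on with
  | zero => simp
  | add x y hx hy => simp only [TensorProduct.tmul_add, map_add, hx, hy]
  | tmul c z =>
    rw [LinearMap.lTensor_tmul, crossPass_tmul, crossPass_tmul]
    generalize β (v ⊗ₜ c) = u
    induction u using TensorProduct.induction_on with
    | zero => simp
    | add x y hx hy => simp only [TensorProduct.add_tmul, map_add, hx, hy]
    | tmul b l => simp [hf]

lemma iterL_cons (n : ℕ) (v : V) (w : ⨂[k]^n V) (c : C) :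
    iterL β (n + 1) (cons k V n (v ⊗ₜ w) ⊗ₜ c) =
      crossPass β (cons k V n).toLinearMap (v ⊗ₜ iterL β n (w ⊗ₜ c)) := by
  simp [iterL, passL, crossPass]

end CrossPass

namespace CrossedSystem

variable {k A H : Type*} [CommRing k] [Ring A] [Algebra k A] [Ring H] [HopfAlgebra k H]
  (S : CrossedSystem k A H)

lemma tt_succ_cons (n : ℕ) (h : Bar k H) (w : ⨂[k]^(n + 2) (Bar k H)) :
    S.tt (n + 1) (cons k (Bar k H) (n + 2) (h ⊗ₜ w)) =
      -S.ttFirst (n + 1) (cons k (Bar k H) (n + 2) (h ⊗ₜ w)) -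
        crossPass S.chiBb (cons k (Bar k H) (n + 1)).toLinearMap (h ⊗ₜ S.tt n w) := by
  simp [tt, crossPass]

section Heads

variable {M : Type*} [AddCommGroup M] [Module k M]

/-- `h ⊗ (a ⊗ z) ↦ ∑ a^(h₁) ⊗ h₂ · z`. -/
noncomputable def crossW (M : Type*) [AddCommGroup M] [Module k M] :
    Bar k H ⊗[k] (Bar k A ⊗[k] S.TotHA M) →ₗ[k] Bar k A ⊗[k] S.TotHA M :=
  crossPass S.chiBb (TensorProduct.lift (Tot.cons k (Bar k H) (S.TotA M)))

/-- `a ⊗ w ↦ a ⊗ (w ⊗ p)`. -/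
noncomputable def incA (n : ℕ) (p : S.TotA M) :
    Bar k A ⊗[k] (⨂[k]^n (Bar k H)) →ₗ[k] Bar k A ⊗[k] S.TotHA M :=
  (Tot.inc k (Bar k H) (S.TotA M) n ∘ₗ (TensorProduct.mk k _ (S.TotA M)).flip p).lTensor _

@[simp]
lemma incA_tmul (n : ℕ) (p : S.TotA M) (a : Bar k A) (w : ⨂[k]^n (Bar k H)) :
    S.incA n p (a ⊗ₜ w) = a ⊗ₜ Tot.inc k (Bar k H) (S.TotA M) n (w ⊗ₜ p) := rfl

lemma incA_chiPass (n : ℕ) (p : S.TotA M) (h : Bar k H) (t : Bar k A ⊗[k] (⨂[k]^n (Bar k H))) :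
    S.incA (n + 1) p (crossPass S.chiBb (cons k (Bar k H) n).toLinearMap (h ⊗ₜ t)) =
      S.crossW M (h ⊗ₜ S.incA n p t) :=
  lTensor_crossPass S.chiBb _ _ _ _ (fun h z => (Tot.cons_inc h n z p).symm) h t

/-- `q ↦ q · y`. -/
noncomputable def consF (y : S.TotHA M) : H →ₗ[k] S.TotHA M :=
  (Tot.cons k (Bar k H) (S.TotA M)).flip y ∘ₗ bar k H

@[simp]
lemma consF_apply (y : S.TotHA M) (q : H) :
    S.consF y q = Tot.cons k (Bar k H) (S.TotA M) (bar k H q) y := rfl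

lemma incA_ttFirst (n : ℕ) (p : S.TotA M) (h l : Bar k H) (w : ⨂[k]^n (Bar k H)) :
    S.incA (n + 1) p (S.ttFirst n (cons k (Bar k H) (n + 1) (h ⊗ₜ
      cons k (Bar k H) n (l ⊗ₜ w)))) =
      (S.consF (Tot.inc k (Bar k H) (S.TotA M) n (w ⊗ₜ p))).lTensor _ (S.ffb (h ⊗ₜ l)) := by
  have e : S.ttFirst n (cons k (Bar k H) (n + 1) (h ⊗ₜ cons k (Bar k H) n (l ⊗ₜ w))) =
      ((cons k (Bar k H) n).toLinearMap ∘ₗ (bar k H).rTensor _).lTensor (Bar k A)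
        (TensorProduct.assoc k (Bar k A) H _ (S.ffb (h ⊗ₜ l) ⊗ₜ w)) := by
    simp [ttFirst]
  rw [e]
  generalize S.ffb (h ⊗ₜ l) = u
  induction u using TensorProduct.induction_on with
  | zero => simp
  | add x y hx hy => simp only [TensorProduct.add_tmul, map_add, hx, hy]
  | tmul b l => simp

/-- The class in `Ā ⊗ W` of the contraction. -/
noncomputable def consEb (M : Type*) [AddCommGroup M] [Module k M] :
    S.E ⊗[k] S.TotHA M →ₗ[k] Bar k A ⊗[k] S.TotHA M :=
  (bar k A).rTensor _ ∘ₗ S.consE M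

@[simp]
lemma consEb_toE (a : A) (h : H) (z : S.TotHA M) : S.consEb M (S.toE (a ⊗ₜ h) ⊗ₜ z) =
    bar k A a ⊗ₜ Tot.cons k (Bar k H) _ (bar k H h) z := rfl

lemma ffb_bar (h l : H) :
    S.ffb (bar k H h ⊗ₜ bar k H l) = (bar k A).rTensor H (S.ff (h ⊗ₜ l)) := rfl

lemma chiAb_bar (h : H) (a : A) :
    S.chiAb (h ⊗ₜ bar k A a) = (bar k A).rTensor H (S.chi (h ⊗ₜ a)) := rfl

lemma chiBb_bar (h : H) (a : Bar k A) :
    S.chiBb (bar k H h ⊗ₜ a) = (bar k H).lTensor _ (S.chiAb (h ⊗ₜ a)) := rfl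

lemma consEb_inH_mul_inH (h l : H) (y : S.TotHA M) :
    S.consEb M ((S.inH h * S.inH l) ⊗ₜ y) =
      (S.consF y).lTensor _ (S.ffb (bar k H h ⊗ₜ bar k H l)) := by
  rw [inH_mul_inH, ffb_bar]
  generalize S.ff (h ⊗ₜ l) = u
  induction u using TensorProduct.induction_on with
  | zero => simp
  | add x y hx hy => simp only [TensorProduct.add_tmul, map_add, hx, hy]
  | tmul b l => simp

/-- In `E` the product `(1 # h)(a # 1)` is `χ(h ⊗ a)`, so multiplying by `1 # h` and contracting
amounts to carrying `a` across `h` and prepending what is left of `h`. -/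
lemma consEb_inH_smul_jA (h : H) (ξ : A ⊗[k] S.TotHA M) :
    S.consEb M (S.inH h • S.jA _ ξ) = S.crossW M (bar k H h ⊗ₜ (bar k A).rTensor _ ξ) := by
  induction ξ using TensorProduct.induction_on with
  | zero => simp
  | add x y hx hy => simp only [TensorProduct.tmul_add, smul_add, map_add, hx, hy]
  | tmul a z =>
    rw [jA_tmul, TensorProduct.smul_tmul', smul_eq_mul, inH_mul_inA, LinearMap.rTensor_tmul,
      crossW, crossPass_tmul, chiBb_bar, chiAb_bar]
    generalize S.chi (h ⊗ₜ a) = u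
    induction u using TensorProduct.induction_on with
    | zero => simp
    | add x y hx hy => simp only [TensorProduct.add_tmul, map_add, hx, hy]
    | tmul b l => simp

variable [Module S.E M] [IsScalarTower k S.E M]

/-- `(a # h) ⊗ p ↦ a · p^h`. -/
noncomputable def actE (M : Type*) [AddCommGroup M] [Module k M] [Module S.E M]
    [IsScalarTower k S.E M] : S.E ⊗[k] S.TotA M →ₗ[k] S.TotA M :=
  consExt k A M ∘ₗ S.hd (TensorProduct.lift (S.actH M))

lemma actE_toE (a : A) (h : H) (p : S.TotA M) : S.actE M (S.toE (a ⊗ₜ h) ⊗ₜ p) =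
    Tot.cons k (Bar k A) M (bar k A a) (S.actH M h p) := rfl

lemma actE_inH (h : H) (p : S.TotA M) : S.actE M (S.inH h ⊗ₜ p) = 0 := by
  rw [inH_eq, actE_toE, bar_one, map_zero, LinearMap.zero_apply]

lemma actE_inH_mul_inH (h l : H) (p : S.TotA M) : S.actE M ((S.inH h * S.inH l) ⊗ₜ p) =
    S.consA M (((S.actH M).flip p).lTensor _ (S.ffb (bar k H h ⊗ₜ bar k H l))) := by
  rw [inH_mul_inH, ffb_bar]
  generalize S.ff (h ⊗ₜ l) = u
  induction u using TensorProduct.induction_on with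
  | zero => simp
  | add x y hx hy => simp only [TensorProduct.add_tmul, map_add, hx, hy]
  | tmul b l => simp [actE_toE]

lemma actE_inH_smul_jA (h : H) (ξ : A ⊗[k] S.TotA M) :
    S.actE M (S.inH h • S.jA _ ξ) = S.actH M h (consExt k A M ξ) := by
  induction ξ using TensorProduct.induction_on with
  | zero => simp
  | add x y hx hy => simp only [smul_add, map_add, hx, hy]
  | tmul a p =>
    rw [jA_tmul, TensorProduct.smul_tmul', smul_eq_mul, inH_mul_inA, consExt_tmul, actH_cons,
      chiAb_bar]
    generalize S.chi (h ⊗ₜ a) = u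
    induction u using TensorProduct.induction_on with
    | zero => simp
    | add x y hx hy => simp only [TensorProduct.add_tmul, map_add, hx, hy]
    | tmul b l => simp [actE_toE]

/-- `ρ` is the action of `H` on the part of `W` without factors `H̄`, plus `actR` after prepending
`h`. The second part depends only on the class `consEb` in `Ā ⊗ W`, because `consExt` kills scalars.
-/
lemma consExt_rhoE (ξ : S.E ⊗[k] S.TotHA M) : consExt k A M (S.rhoE M ξ) =
    S.actE M ((Tot.aug k (Bar k H) (S.TotA M)).lTensor _ ξ) +
      S.consA M ((S.actR M).lTensor _ (S.consEb M ξ)) := by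
  induction ξ using S.E_induction with
  | hadd x y hx hy => simp only [map_add, hx, hy]; abel
  | h a h z => simp [rhoE, actE_toE, rhoH_apply]

variable [Module A M] [IsScalarTower k A M]

lemma consEb_dW_nil (h : H) (p : S.TotA M) :
    S.consEb M (S.inH h • S.dW M (Tot.nil k (Bar k H) _ p)) =
      S.crossW M (bar k H h ⊗ₜ (Tot.nil k (Bar k H) (S.TotA M)).lTensor _
        ((bar k A).rTensor _ (barD k A M p))) := by
  rw [dW_nil, iotaA, LinearMap.comp_apply, consEb_inH_smul_jA]
  congr 2
  generalize barD k A M p = u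
  induction u using TensorProduct.induction_on with
  | zero => simp
  | add x y hx hy => simp only [map_add, hx, hy]
  | tmul b l => simp

/-- The first term is `(1 # h)(1 # l)`, which brings in `f`; the second is the `s`-term of
`dW_cons`, by which the same quantity for `l` is carried across `h`. The `ι`-term lies in `1 ⊗ W`
and, multiplied by `1 # h`, has trivial class in `Ā`. -/
lemma consEb_dW_cons (h l : H) (y : S.TotHA M) :
    S.consEb M (S.inH h • S.dW M (Tot.cons k (Bar k H) _ (bar k H l) y)) =
      (S.consF y).lTensor _ (S.ffb (bar k H h ⊗ₜ bar k H l)) -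
        S.crossW M (bar k H h ⊗ₜ S.consEb M (S.inH l • S.dW M y)) := by
  rw [dW_cons, smul_sub, smul_sub, map_sub, map_sub, TensorProduct.smul_tmul', smul_eq_mul,
    consEb_inH_mul_inH, iotaA_tmul, inA_one, TensorProduct.smul_tmul', smul_eq_mul,
    _root_.mul_one]
  have e1 : S.consEb M (S.inH h ⊗ₜ Tot.nil k (Bar k H) _ (S.rhoH M l y)) = 0 := by
    rw [inH_eq, consEb_toE, bar_one, TensorProduct.zero_tmul]
  have e2 : S.consEb M (S.inH h • S.sMap M (S.inH l • S.dW M y)) = _ :=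
    S.consEb_inH_smul_jA h (S.consE M (S.inH l • S.dW M y))
  rw [e1, e2, sub_zero]
  rfl

/-- The contraction of the bar complex of `A` recovers `p` from its differential, up to the
augmentation, and `H` then acts on the result. -/
lemma actE_aug_dW_nil (h : H) (p : S.TotA M) :
    S.actE M ((Tot.aug k (Bar k H) (S.TotA M)).lTensor _
      (S.inH h • S.dW M (Tot.nil k (Bar k H) _ p))) =
      S.actH M h p - Tot.nil k (Bar k A) M (S.inH h • Tot.aug k (Bar k A) M p) := by
  have e : (Tot.aug k (Bar k H) (S.TotA M)).lTensor _
      (S.inH h • S.dW M (Tot.nil k (Bar k H) _ p)) = S.inH h • S.jA _ (barD k A M p) := by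
    rw [lTensor_smul, dW_nil]
    congr 1
    generalize barD k A M p = u
    induction u using TensorProduct.induction_on with
    | zero => simp
    | add x y hx hy => simp only [map_add, hx, hy]
    | tmul b l => simp
  rw [e, actE_inH_smul_jA, eq_sub_of_add_eq (consExt_barD p), map_sub, actH_nil]

lemma aug_sMap (ξ : S.E ⊗[k] S.TotHA M) :
    (Tot.aug k (Bar k H) (S.TotA M)).lTensor S.E (S.sMap M ξ) = 0 := by
  induction ξ using S.E_induction with
  | hadd x y hx hy => simp only [map_add, hx, hy, add_zero]
  | h a h z =>
    have e : S.sMap M (S.toE (a ⊗ₜ h) ⊗ₜ z) = S.inA a ⊗ₜ Tot.cons k (Bar k H) _ (bar k H h) z := rfl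
    rw [e, LinearMap.lTensor_tmul, Tot.aug_cons, TensorProduct.tmul_zero]

lemma actE_aug_dW_cons (h l : H) (y : S.TotHA M) :
    S.actE M ((Tot.aug k (Bar k H) (S.TotA M)).lTensor _
      (S.inH h • S.dW M (Tot.cons k (Bar k H) _ (bar k H l) y))) =
      S.consA M (((S.actH M).flip (Tot.aug k (Bar k H) (S.TotA M) y)).lTensor _
        (S.ffb (bar k H h ⊗ₜ bar k H l))) := by
  rw [lTensor_smul, dW_cons, map_sub, map_sub, aug_sMap, sub_zero, smul_sub, map_sub,
    LinearMap.lTensor_tmul, iotaA_tmul, inA_one, LinearMap.lTensor_tmul, Tot.aug_nil,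
    TensorProduct.smul_tmul', TensorProduct.smul_tmul', smul_eq_mul, smul_eq_mul, _root_.mul_one,
    actE_inH, sub_zero, actE_inH_mul_inH]

end Heads

end CrossedSystem

end HochschildSerre

namespace HochschildSerre

namespace CrossedSystem

variable {k A H : Type*} [CommRing k] [Ring A] [Algebra k A] [Ring H] [HopfAlgebra k H]
  (S : CrossedSystem k A H)

/-- The map `tt n`, extended by zero to `H̄ → Ā ⊗ H̄^0`. -/
noncomputable def ttA : ∀ n : ℕ,
    (⨂[k]^(n + 1) (Bar k H)) →ₗ[k] Bar k A ⊗[k] (⨂[k]^n (Bar k H))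
  | 0 => 0
  | n + 1 => S.tt n

lemma ttA_succ_cons (n : ℕ) (h : Bar k H) (w : ⨂[k]^(n + 1) (Bar k H)) :
    S.ttA (n + 1) (cons k (Bar k H) (n + 1) (h ⊗ₜ w)) =
      -S.ttFirst n (cons k (Bar k H) (n + 1) (h ⊗ₜ w)) -
        crossPass S.chiBb (cons k (Bar k H) n).toLinearMap (h ⊗ₜ S.ttA n w) := by
  cases n with
  | zero => simp [ttA, tt]
  | succ n => exact S.tt_succ_cons n h w

variable {M : Type*} [AddCommGroup M] [Module k M] [Module S.E M] [IsScalarTower k S.E M]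

/-- `w ↦ ∑ a' ⊗ (w' ⊗ p)`, where `w ⊗ a ↦ ∑ a' ⊗ w'` is the passage of `a`. -/
noncomputable def passA (n : ℕ) (v : Bar k A) (p : S.TotA M) :
    (⨂[k]^n (Bar k H)) →ₗ[k] Bar k A ⊗[k] S.TotHA M :=
  S.incA n p ∘ₗ iterL S.chiBb n ∘ₗ (TensorProduct.mk k _ (Bar k A)).flip v

lemma passA_apply (n : ℕ) (v : Bar k A) (p : S.TotA M) (w : ⨂[k]^n (Bar k H)) :
    S.passA n v p w = S.incA n p (iterL S.chiBb n (w ⊗ₜ v)) := rfl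

lemma passA_cons (n : ℕ) (v : Bar k A) (p : S.TotA M) (h : Bar k H) (w : ⨂[k]^n (Bar k H)) :
    S.passA (n + 1) v p (cons k (Bar k H) n (h ⊗ₜ w)) = S.crossW M (h ⊗ₜ S.passA n v p w) := by
  rw [passA_apply, iterL_cons, incA_chiPass, passA_apply]

lemma passA_zero (v : Bar k A) (p : S.TotA M) (w : ⨂[k]^0 (Bar k H)) :
    S.passA 0 v p w = v ⊗ₜ Tot.inc k (Bar k H) (S.TotA M) 0 (w ⊗ₜ p) := rfl

variable [Module A M] [IsScalarTower k A M]

/-- Solves the recursion `consEb_dW_cons` in the number of factors `H̄`. The values of `f` add up to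
the maps `tt`, up to sign, because these obey the same recursion; `D` is the initial value, the bar
differential of `p`, carried across the factors, each of which changes the sign. Two instances
occur: `D = 0` for `p` in `M`, and `passA` for `p = v · p'`. -/
lemma consEb_dW_inc (p : S.TotA M) (D : ∀ n, (⨂[k]^n (Bar k H)) →ₗ[k] Bar k A ⊗[k] S.TotHA M)
    (hD : ∀ n h w, D (n + 1) (cons k (Bar k H) n (h ⊗ₜ w)) = S.crossW M (h ⊗ₜ D n w))
    (hD0 : ∀ w, D 0 w = (Tot.nil k (Bar k H) (S.TotA M)).lTensor _ ((bar k A).rTensor _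
      (barD k A M (PiTensorProduct.isEmptyEquiv (R := k) (s := fun _ => Bar k H) (Fin 0) w • p))))
    (n : ℕ) (h : H) (w : ⨂[k]^n (Bar k H)) :
    S.consEb M (S.inH h • S.dW M (Tot.inc k (Bar k H) (S.TotA M) n (w ⊗ₜ p))) =
      -S.incA n p (S.ttA n (cons k (Bar k H) n (bar k H h ⊗ₜ w))) +
        (-1 : k) ^ n • D (n + 1) (cons k (Bar k H) n (bar k H h ⊗ₜ w)) := by
  induction n generalizing h with
  | zero => rw [Tot.inc_zero, consEb_dW_nil, hD, hD0]; simp [ttA]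
  | succ n ih =>
    induction w using Tot.cons_induction with
    | h0 => simp
    | hadd x y hx hy =>
      simp only [TensorProduct.add_tmul, TensorProduct.tmul_add, map_add, smul_add, hx, hy]; abel
    | h l w =>
      obtain ⟨l, rfl⟩ := bar_surjective k H l
      rw [← Tot.cons_inc, consEb_dW_cons, ih, ttA_succ_cons, map_sub, map_neg, incA_ttFirst,
        incA_chiPass, hD (n + 1)]
      simp only [TensorProduct.tmul_add, TensorProduct.tmul_neg, TensorProduct.tmul_smul, map_add,
        map_neg, map_smul, pow_succ, mul_neg_one, neg_smul]
      abel

/-- All terms of the bar differential except the first begin with `1`, which is zero in `Ā`. -/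
lemma rTensor_bar_barD_cons (v : Bar k A) (p : S.TotA M) :
    (bar k A).rTensor _ (barD k A M (Tot.cons k (Bar k A) M v p)) = v ⊗ₜ p := by
  obtain ⟨a, rfl⟩ := bar_surjective k A v
  simp [barD_cons, bar_one]

lemma consEb_dW_inc_nil (m : M) (n : ℕ) (h : H) (w : ⨂[k]^n (Bar k H)) :
    S.consEb M (S.inH h • S.dW M (Tot.inc k (Bar k H) (S.TotA M) n
      (w ⊗ₜ Tot.nil k (Bar k A) M m))) =
      -S.incA n (Tot.nil k (Bar k A) M m)
        (S.ttA n (cons k (Bar k H) n (bar k H h ⊗ₜ w))) := by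
  rw [S.consEb_dW_inc _ (fun n => 0) (by simp) (by simp)]
  simp

lemma consEb_dW_inc_cons (v : Bar k A) (p : S.TotA M) (n : ℕ) (h : H) (w : ⨂[k]^n (Bar k H)) :
    S.consEb M (S.inH h • S.dW M (Tot.inc k (Bar k H) (S.TotA M) n
      (w ⊗ₜ Tot.cons k (Bar k A) M v p))) =
      -S.incA n (Tot.cons k (Bar k A) M v p) (S.ttA n (cons k (Bar k H) n (bar k H h ⊗ₜ w))) +
        (-1 : k) ^ n • S.passA (n + 1) v p (cons k (Bar k H) n (bar k H h ⊗ₜ w)) := by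
  refine S.consEb_dW_inc _ (fun n => S.passA n v p) (fun n => S.passA_cons n v p)
    (fun w => ?_) n h w
  rw [passA_zero, Tot.inc_zero, map_smul (barD k A M), map_smul ((bar k A).rTensor (S.TotA M)),
    S.rTensor_bar_barD_cons]
  simp

lemma actR_incA (n : ℕ) (p : S.TotA M) (t : Bar k A ⊗[k] (⨂[k]^(n + 2) (Bar k H))) :
    (S.actR M).lTensor _ (S.incA (n + 2) p t) =
      (-1 : k) ^ (n + 1) • ((S.actK M n).flip p).lTensor _ t := by
  induction t using TensorProduct.induction_on with
  | zero => simp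
  | add x y hx hy => simp only [map_add, smul_add, hx, hy]
  | tmul a w => simp

lemma actR_incA_one (p : S.TotA M) (t : Bar k A ⊗[k] (⨂[k]^1 (Bar k H))) :
    (S.actR M).lTensor _ (S.incA 1 p t) = 0 := by
  induction t using TensorProduct.induction_on with
  | zero => simp
  | add x y hx hy => simp only [map_add, hx, hy, add_zero]
  | tmul a w => simp

/-- Treats `F^(2)` and the higher `F^(l)` together. For `n = 0` the second term vanishes, since
`actR` is zero on `H̄^1 ⊗ P`; for `n > 0` the first vanishes, since the augmentation kills `H̄^n ⊗
P`. -/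
lemma actKHead_eq (n : ℕ) (h l : H) (w : ⨂[k]^n (Bar k H)) (p : S.TotA M) :
    (-1 : k) ^ (n + 1) • S.actKHead M n (cons k (Bar k H) (n + 1) (bar k H h ⊗ₜ
        cons k (Bar k H) n (bar k H l ⊗ₜ w))) p =
      S.consA M (((S.actH M).flip (Tot.aug k (Bar k H) (S.TotA M)
        (Tot.inc k (Bar k H) (S.TotA M) n (w ⊗ₜ p)))).lTensor _
          (S.ffb (bar k H h ⊗ₜ bar k H l))) -
        S.consA M ((S.actR M).lTensor _ (S.incA (n + 1) p (S.ttA (n + 1)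
          (cons k (Bar k H) (n + 1) (bar k H h ⊗ₜ cons k (Bar k H) n (bar k H l ⊗ₜ w)))))) := by
  cases n with
  | zero =>
    rw [actR_incA_one, map_zero, sub_zero, actKHead_zero, ffTwo_cons, Tot.inc_zero, Tot.aug_nil]
    simp only [map_smul, LinearMap.lTensor_smul, LinearMap.smul_apply]
    simp
  | succ n =>
    have e : Tot.aug k (Bar k H) (S.TotA M) (Tot.inc k (Bar k H) (S.TotA M) (n + 1) (w ⊗ₜ p)) =
        0 := by
      induction w using Tot.cons_induction with
      | h0 => simp
      | hadd x y hx hy => simp only [TensorProduct.add_tmul, map_add, hx, hy, add_zero]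
      | h l w => rw [← Tot.cons_inc, Tot.aug_cons]
    rw [actR_incA, e, map_zero, LinearMap.lTensor_zero, LinearMap.zero_apply, map_zero, zero_sub,
      actKHead_succ, map_smul, pow_succ, mul_neg_one, neg_smul]
    rfl

lemma rhoH_inc (n : ℕ) (h l : H) (w : ⨂[k]^n (Bar k H)) (p : S.TotA M) :
    S.rhoH M h (Tot.cons k (Bar k H) _ (bar k H l) (Tot.inc k (Bar k H) (S.TotA M) n (w ⊗ₜ p))) =
      (-1 : k) ^ (n + 1) • S.actK M n (cons k (Bar k H) (n + 1) (bar k H h ⊗ₜ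
        cons k (Bar k H) n (bar k H l ⊗ₜ w))) p := by
  rw [rhoH_apply, Tot.aug_cons, map_zero, zero_add, Tot.cons_inc, Tot.cons_inc, actR_add_two]

/-- The maps `F_r^(l)` are the solution of the recursion that a chain map `ρ` has to satisfy, the
contraction of the bar complex of `A` being applied to `ρ((1 # h) d y)`. The terms `i = 0` of `F`
come from the values of `f` in `consEb_dW_inc`, the terms `i > 0` from the first entry of `Ā^r`
carried across `H̄^l`. -/
theorem rhoH_eq (h : H) (y : S.TotHA M) :
    S.rhoH M h y = consExt k A M (S.rhoE M (S.inH h • S.dW M y)) +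
      Tot.nil k (Bar k A) M (S.inH h • Tot.aug k (Bar k A) M (Tot.aug k (Bar k H) _ y)) := by
  induction y using Tot.induction with
  | hadd x y hx hy => simp only [map_add, hx, hy, smul_add]; abel
  | hnil p =>
    rw [consExt_rhoE, actE_aug_dW_nil, rhoH_apply, Tot.aug_nil, actR_cons_nil, add_zero]
    have e : (S.actR M).lTensor (Bar k A)
        (S.consEb M (S.inH h • S.dW M (Tot.nil k (Bar k H) _ p))) = 0 := by
      rw [consEb_dW_nil]
      generalize (bar k A).rTensor _ (barD k A M p) = u
      induction u using TensorProduct.induction_on with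
      | zero => simp
      | add x y hx hy => simp only [TensorProduct.tmul_add, map_add, hx, hy, add_zero]
      | tmul v p =>
        rw [LinearMap.lTensor_tmul, crossW, crossPass_tmul]
        generalize S.chiBb (bar k H h ⊗ₜ v) = u
        induction u using TensorProduct.induction_on with
        | zero => simp
        | add x y hx hy => simp only [TensorProduct.add_tmul, map_add, hx, hy, add_zero]
        | tmul v l => simp [actR_cons_nil]
    rw [e, map_zero, add_zero, sub_add_cancel]
  | hcons l y ih =>
    -- No induction on `y` is needed: `consEb_dW_inc` has already solved the recursion in the number
    -- of factors `H̄`.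
    clear ih
    obtain ⟨l, rfl⟩ := bar_surjective k H l
    rw [Tot.aug_cons, map_zero, smul_zero, map_zero, add_zero, consExt_rhoE, actE_aug_dW_cons]
    induction y using Tot.induction_inc with
    | h0 => simp
    | hadd x y hx hy =>
      simp only [map_add, hx, hy, smul_add, LinearMap.lTensor_add, LinearMap.add_apply]; abel
    | h n w p =>
      rw [rhoH_inc]
      induction p using Tot.induction with
      | hadd x y hx hy =>
        simp only [map_add, hx, hy, smul_add, LinearMap.lTensor_add, LinearMap.add_apply,
          TensorProduct.tmul_add]
        abel
      | hnil m =>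
        rw [actK_nil, Tot.cons_inc, consEb_dW_inc_nil, map_neg, map_neg, actKHead_eq, sub_eq_add_neg]
      | hcons v p _ =>
        -- Both sides split into the same two parts: the values of `f`, and the entry `v` carried
        -- across all the factors `H̄`.
        rw [actK_cons, smul_add, actKHead_eq, Tot.cons_inc, consEb_dW_inc_cons, map_add, map_add,
          map_neg, map_neg, map_smul, map_smul, passA_apply, actR_incA, map_smul]
        abel

end CrossedSystem

end HochschildSerre

namespace HochschildSerre

/-! ### Degrees and filtrations on `E ⊗ W`. -/

section Tens

variable {k : Type*} [CommRing k] {B : Type*} [Ring B] [Algebra k B]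
  {Z : Type*} [AddCommGroup Z] [Module k Z] {X : Type*} [AddCommGroup X] [Module k X]

variable (B) in
/-- The submodule of `B ⊗ Z` generated by the `b ⊗ z` with `z ∈ G`. -/
noncomputable def tens (G : Submodule k Z) : Submodule k (B ⊗[k] Z) :=
  LinearMap.range (G.subtype.lTensor B)

lemma tmul_mem_tens {G : Submodule k Z} (b : B) {z : Z} (hz : z ∈ G) : b ⊗ₜ z ∈ tens B G :=
  ⟨b ⊗ₜ ⟨z, hz⟩, rfl⟩

lemma apply_mem_of_mem_tens {G : Submodule k Z} (f : B ⊗[k] Z →ₗ[k] X) {L : Submodule k X}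
    (h : ∀ b z, z ∈ G → f (b ⊗ₜ z) ∈ L) {ξ : B ⊗[k] Z} (hξ : ξ ∈ tens B G) : f ξ ∈ L := by
  obtain ⟨ξ, rfl⟩ := hξ
  induction ξ using TensorProduct.induction_on with
  | zero => simp
  | add x y hx hy => rw [map_add, map_add]; exact L.add_mem hx hy
  | tmul b z => exact h b z z.2

lemma tens_le {G : Submodule k Z} {L : Submodule k (B ⊗[k] Z)}
    (h : ∀ b z, z ∈ G → b ⊗ₜ z ∈ L) : tens B G ≤ L :=
  fun _ hξ => apply_mem_of_mem_tens LinearMap.id h hξ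

lemma tens_mono {G G' : Submodule k Z} (h : G ≤ G') : tens B G ≤ tens B G' :=
  tens_le fun b _ hz => tmul_mem_tens b (h hz)

lemma smul_mem_tens {G : Submodule k Z} (b : B) {ξ : B ⊗[k] Z} (hξ : ξ ∈ tens B G) :
    b • ξ ∈ tens B G :=
  apply_mem_of_mem_tens ((Algebra.lsmul k k (B ⊗[k] Z)) b) (fun c _ hz =>
    tmul_mem_tens (b * c) hz) hξ

lemma tens_bot : tens B (⊥ : Submodule k Z) = ⊥ :=
  le_bot_iff.1 (tens_le fun b z hz => by
    rw [(Submodule.mem_bot k).1 hz, TensorProduct.tmul_zero]; exact Submodule.zero_mem _)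

end Tens

namespace Tot

variable (k : Type*) [CommRing k] (V : Type*) [AddCommGroup V] [Module k V]
  (N : Type*) [AddCommGroup N] [Module k N]

/-- The component of degree `n` of the total module. -/
noncomputable def deg : ℕ → Submodule k (Tot k V N)
  | 0 => LinearMap.range (nil k V N)
  | n + 1 => Submodule.map₂ (cons k V N) ⊤ (deg n)

variable {k V N}

lemma nil_mem_deg (x : N) : nil k V N x ∈ deg k V N 0 := ⟨x, rfl⟩

lemma cons_mem_deg {n : ℕ} (v : V) {y : Tot k V N} (hy : y ∈ deg k V N n) :
    cons k V N v y ∈ deg k V N (n + 1) := Submodule.apply_mem_map₂ _ trivial hy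

lemma inc_mem_deg (n : ℕ) (x : (⨂[k]^n V) ⊗[k] N) : inc k V N n x ∈ deg k V N n := by
  induction x using TensorProduct.induction_on with
  | zero => simp
  | add x y hx hy => rw [map_add]; exact Submodule.add_mem _ hx hy
  | tmul w x =>
    induction n with
    | zero => rw [inc_zero]; exact nil_mem_deg _
    | succ n ih =>
      induction w using cons_induction with
      | h0 => simp
      | hadd x y hx hy => rw [TensorProduct.add_tmul, map_add]; exact Submodule.add_mem _ hx hy
      | h v w => rw [← cons_inc]; exact cons_mem_deg v (ih w)

lemma deg_succ_le {n : ℕ} {L : Submodule k (Tot k V N)}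
    (h : ∀ v, ∀ y ∈ deg k V N n, cons k V N v y ∈ L) : deg k V N (n + 1) ≤ L :=
  Submodule.map₂_le.2 fun v _ y hy => h v y hy

lemma aug_of_mem_deg_succ {n : ℕ} {y : Tot k V N} (hy : y ∈ deg k V N (n + 1)) :
    aug k V N y = 0 := by
  have h : deg k V N (n + 1) ≤ LinearMap.ker (aug k V N) :=
    deg_succ_le fun v y _ => by rw [LinearMap.mem_ker, aug_cons]
  exact h hy

/-- The degree is defined through `nil` and `cons` for the sake of induction; this recovers an
honest tensor when the concrete complexes are compared. -/
lemma exists_inc_of_mem_deg {n : ℕ} {y : Tot k V N} (hy : y ∈ deg k V N n) :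
    ∃ x, inc k V N n x = y := by
  rw [← LinearMap.mem_range]
  revert y
  change deg k V N n ≤ LinearMap.range (inc k V N n)
  induction n with
  | zero => rintro _ ⟨x, rfl⟩; exact ⟨_, rfl⟩
  | succ n ih =>
    refine deg_succ_le fun v y hy => ?_
    obtain ⟨x, rfl⟩ := ih hy
    clear hy
    induction x using TensorProduct.induction_on with
    | zero => simp
    | add x y hx hy => rw [map_add, map_add]; exact Submodule.add_mem _ hx hy
    | tmul w x => exact ⟨_, (cons_inc v n w x).symm⟩

end Tot

section BarDegree

variable {k : Type*} [CommRing k] {B : Type*} [Ring B] [Algebra k B]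
  {M : Type*} [AddCommGroup M] [Module k M]

lemma consExt_mem_deg {n : ℕ} {ξ : B ⊗[k] Tot k (Bar k B) M}
    (hξ : ξ ∈ tens B (Tot.deg k (Bar k B) M n)) :
    consExt k B M ξ ∈ Tot.deg k (Bar k B) M (n + 1) :=
  apply_mem_of_mem_tens _ (fun _ _ => Tot.cons_mem_deg _) hξ

variable [Module B M] [IsScalarTower k B M]

lemma barD_mem_tens {n : ℕ} {y : Tot k (Bar k B) M} (hy : y ∈ Tot.deg k (Bar k B) M (n + 1)) :
    barD k B M y ∈ tens B (Tot.deg k (Bar k B) M n) := by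
  have key : ∀ n, Tot.deg k (Bar k B) M (n + 1) ≤
      (tens B (Tot.deg k (Bar k B) M n)).comap (barD k B M) := fun n => by
    induction n with
    | zero =>
      refine Tot.deg_succ_le fun v y hy => ?_
      obtain ⟨x, rfl⟩ := bar_surjective k B v
      obtain ⟨m, rfl⟩ := hy
      rw [Submodule.mem_comap, barD_cons, barD_nil, smul_zero, map_zero, TensorProduct.tmul_zero,
        sub_zero]
      exact Submodule.sub_mem _ (tmul_mem_tens _ (Tot.nil_mem_deg _))
        (tmul_mem_tens _ (Tot.nil_mem_deg _))
    | succ n ih =>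
      refine Tot.deg_succ_le fun v y hy => ?_
      obtain ⟨x, rfl⟩ := bar_surjective k B v
      rw [Submodule.mem_comap, barD_cons, Tot.aug_of_mem_deg_succ hy, smul_zero, map_zero,
        TensorProduct.tmul_zero, sub_zero]
      exact Submodule.sub_mem _ (tmul_mem_tens _ hy)
        (tmul_mem_tens _ (consExt_mem_deg (smul_mem_tens x (ih hy))))
  exact key n hy

end BarDegree

namespace CrossedSystem

variable {k A H : Type*} [CommRing k] [Ring A] [Algebra k A] [Ring H] [HopfAlgebra k H]
  (S : CrossedSystem k A H)

section EF

variable {Z : Type*} [AddCommGroup Z] [Module k Z] {X : Type*} [AddCommGroup X] [Module k X]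

/-- For a filtration `G` of `Z`, the filtration of `E ⊗ Z` in which the elements of `A` have
filtration degree `0`, and those of `E` have filtration degree `1`. -/
noncomputable def EF (G : ℤ → Submodule k Z) (p : ℤ) : Submodule k (S.E ⊗[k] Z) :=
  (tens A (G p)).map (S.jA Z) ⊔ tens S.E (G (p - 1))

variable {S}

lemma inA_tmul_mem_EF {G : ℤ → Submodule k Z} {p : ℤ} (a : A) {z : Z} (hz : z ∈ G p) :
    S.inA a ⊗ₜ z ∈ S.EF G p :=
  Submodule.mem_sup_left ⟨a ⊗ₜ z, tmul_mem_tens a hz, rfl⟩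

lemma one_tmul_mem_EF {G : ℤ → Submodule k Z} {p : ℤ} {z : Z} (hz : z ∈ G p) :
    1 ⊗ₜ z ∈ S.EF G p := by
  rw [← S.inA_one]; exact inA_tmul_mem_EF 1 hz

lemma jA_mem_EF {G : ℤ → Submodule k Z} {p : ℤ} {ξ : A ⊗[k] Z} (hξ : ξ ∈ tens A (G p)) :
    S.jA Z ξ ∈ S.EF G p := Submodule.mem_sup_left ⟨ξ, hξ, rfl⟩

lemma tens_le_EF {G : ℤ → Submodule k Z} {p q : ℤ} (h : q = p - 1) :
    tens S.E (G q) ≤ S.EF G p := by subst h; exact le_sup_right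

lemma apply_mem_of_mem_EF {G : ℤ → Submodule k Z} {p : ℤ} (f : S.E ⊗[k] Z →ₗ[k] X)
    {L : Submodule k X} (h1 : ∀ a z, z ∈ G p → f (S.inA a ⊗ₜ z) ∈ L)
    (h2 : ∀ e z, z ∈ G (p - 1) → f (e ⊗ₜ z) ∈ L) {ξ : S.E ⊗[k] Z} (hξ : ξ ∈ S.EF G p) :
    f ξ ∈ L := by
  have h : S.EF G p ≤ L.comap f := by
    refine sup_le ?_ fun ξ hξ => apply_mem_of_mem_tens f h2 hξ
    rintro _ ⟨ξ, hξ, rfl⟩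
    exact apply_mem_of_mem_tens (f ∘ₗ S.jA Z) h1 hξ
  exact h hξ

lemma inA_smul_mem_EF {G : ℤ → Submodule k Z} {p : ℤ} (a : A) {ξ : S.E ⊗[k] Z}
    (hξ : ξ ∈ S.EF G p) : S.inA a • ξ ∈ S.EF G p := by
  refine apply_mem_of_mem_EF ((Algebra.lsmul k k (S.E ⊗[k] Z)) (S.inA a)) (fun b z hz => ?_)
    (fun e z hz => ?_) hξ
  · change (S.inA a * S.inA b) ⊗ₜ z ∈ _
    rw [← S.inA_mul']
    exact inA_tmul_mem_EF _ hz
  · exact tens_le_EF rfl (tmul_mem_tens (S.inA a * e) hz)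

lemma EF_le_tens {G : ℤ → Submodule k Z} (hG : Monotone G) {p : ℤ} :
    S.EF G p ≤ tens S.E (G p) := fun _ hξ =>
  apply_mem_of_mem_EF LinearMap.id (fun _ _ hz => tmul_mem_tens _ hz)
    (fun _ _ hz => tmul_mem_tens _ (hG (by lia) hz)) hξ

lemma EF_mono {G : ℤ → Submodule k Z} (hG : Monotone G) : Monotone (S.EF G) := fun _ _ h =>
  sup_le_sup (Submodule.map_mono (tens_mono (hG h))) (tens_mono (hG (by lia)))

lemma lTensor_mem_EF {G : ℤ → Submodule k Z} {G' : ℤ → Submodule k X} (f : Z →ₗ[k] X)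
    (hf : ∀ p z, z ∈ G p → f z ∈ G' p) {p : ℤ} {ξ : S.E ⊗[k] Z} (hξ : ξ ∈ S.EF G p) :
    f.lTensor S.E ξ ∈ S.EF G' p :=
  apply_mem_of_mem_EF _ (fun _ _ hz => inA_tmul_mem_EF _ (hf _ _ hz))
    (fun _ _ hz => tens_le_EF rfl (tmul_mem_tens _ (hf _ _ hz))) hξ

/-- Multiplication by `A` keeps `EF G' p`, and multiplication by `E` sends `EF G' (p - 1)`, which
lies in `E ⊗ G' (p - 1)`, into `EF G' p`. -/
lemma ext_mem_EF {G : ℤ → Submodule k Z} {G' : ℤ → Submodule k X} (hG : Monotone G')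
    (f : Z →ₗ[k] S.E ⊗[k] X)
    (hf : ∀ p z, z ∈ G p → f z ∈ S.EF G' p) {p : ℤ} {ξ : S.E ⊗[k] Z} (hξ : ξ ∈ S.EF G p) :
    ext S.E f ξ ∈ S.EF G' p :=
  apply_mem_of_mem_EF _ (fun _ _ hz => inA_smul_mem_EF _ (hf _ _ hz))
    (fun e _ hz => tens_le_EF rfl (smul_mem_tens e (EF_le_tens hG (hf _ _ hz)))) hξ

end EF

section Filtration

variable (M : Type*) [AddCommGroup M] [Module k M]

/-- The component of degree `n` of `P = ⨁ Ā^r ⊗ M`. -/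
noncomputable abbrev degA (_ : CrossedSystem k A H) (M : Type*) [AddCommGroup M] [Module k M]
    (n : ℕ) : Submodule k (Tot k (Bar k A) M) :=
  Tot.deg k (Bar k A) M n

open Classical in
/-- The part of filtration degree `p` and degree `n` of `P ⊆ W`. -/
noncomputable def baseX (p : ℤ) (n : ℕ) : Submodule k (S.TotHA M) :=
  if 0 ≤ p then (S.degA M n).map (Tot.nil k (Bar k H) (S.TotA M)) else ⊥

/-- The part of filtration degree `p` and degree `n` of `W = ⨁ H̄^s ⊗ Ā^r ⊗ M`. -/
noncomputable def GX (n : ℕ) (p : ℤ) : Submodule k (S.TotHA M) := match n with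
  | 0 => S.baseX M p 0
  | n + 1 => S.baseX M p (n + 1) ⊔ Submodule.map₂ (Tot.cons k (Bar k H) (S.TotA M)) ⊤ (GX n (p - 1))

variable {M}

lemma nil_mem_baseX {p : ℤ} (hp : 0 ≤ p) {n : ℕ} {x : S.TotA M} (hx : x ∈ S.degA M n) :
    Tot.nil k (Bar k H) (S.TotA M) x ∈ S.baseX M p n := by
  rw [baseX, if_pos hp]; exact ⟨x, hx, rfl⟩

lemma baseX_le_GX (n : ℕ) (p : ℤ) : S.baseX M p n ≤ S.GX M n p := by
  cases n with
  | zero => exact le_rfl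
  | succ n => exact le_sup_left

lemma nil_mem_GX {p : ℤ} (hp : 0 ≤ p) {n : ℕ} {x : S.TotA M} (hx : x ∈ S.degA M n) :
    Tot.nil k (Bar k H) (S.TotA M) x ∈ S.GX M n p := S.baseX_le_GX n p (S.nil_mem_baseX hp hx)

lemma cons_mem_GX {p q : ℤ} (hq : q = p - 1) {n : ℕ} (h : Bar k H) {y : S.TotHA M}
    (hy : y ∈ S.GX M n q) : Tot.cons k (Bar k H) (S.TotA M) h y ∈ S.GX M (n + 1) p := by
  subst hq
  exact Submodule.mem_sup_right (Submodule.apply_mem_map₂ _ trivial hy)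

lemma baseX_le {n : ℕ} {p : ℤ} {L : Submodule k (S.TotHA M)}
    (h1 : 0 ≤ p → ∀ x ∈ S.degA M n, Tot.nil k (Bar k H) (S.TotA M) x ∈ L) :
    S.baseX M p n ≤ L := by
  rw [baseX]
  split_ifs with hp
  · rintro _ ⟨x, hx, rfl⟩
    exact h1 hp x hx
  · exact bot_le

lemma GX_succ_le {n : ℕ} {p : ℤ} {L : Submodule k (S.TotHA M)}
    (h1 : 0 ≤ p → ∀ x ∈ S.degA M (n + 1), Tot.nil k (Bar k H) (S.TotA M) x ∈ L)
    (h2 : ∀ h, ∀ y ∈ S.GX M n (p - 1), Tot.cons k (Bar k H) (S.TotA M) h y ∈ L) :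
    S.GX M (n + 1) p ≤ L :=
  sup_le (S.baseX_le h1) (Submodule.map₂_le.2 fun h _ y hy => h2 h y hy)

/-- The terms `ι(1 ⊗ -)` have filtration degree 0, so they are harmless only for `p ≥ 0`; in
negative degrees their argument is zero. -/
lemma GX_neg (n : ℕ) {p : ℤ} (hp : p < 0) : S.GX M n p = ⊥ := by
  induction n generalizing p with
  | zero => exact if_neg (not_le.2 hp)
  | succ n ih =>
    refine le_bot_iff.1 (S.GX_succ_le (fun h => absurd h (not_le.2 hp)) fun h y hy => ?_)
    rw [ih (by lia), Submodule.mem_bot] at hy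
    rw [hy, map_zero]
    exact Submodule.zero_mem _

lemma GX_mono (n : ℕ) : Monotone (S.GX M n) := by
  induction n with
  | zero => exact fun p q hpq => S.baseX_le fun h x hx => S.nil_mem_GX (h.trans hpq) hx
  | succ n ih =>
    exact fun p q hpq => S.GX_succ_le (fun h x hx => S.nil_mem_GX (h.trans hpq) hx)
      fun h y hy => S.cons_mem_GX rfl h (ih (by lia) hy)

/-- The filtration is balanced for `s`: it kills `A ⊗ W`, and on `E ⊗ GX (p - 1)` the weight of the
element of `E` becomes the weight of the new factor `H̄`. -/
lemma sMap_mem_EF {n : ℕ} {p : ℤ} {ξ : S.E ⊗[k] S.TotHA M} (hξ : ξ ∈ S.EF (S.GX M n) p) :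
    S.sMap M ξ ∈ S.EF (S.GX M (n + 1)) p := by
  refine apply_mem_of_mem_EF (S.sMap M) (fun a z hz => ?_) (fun e z hz => ?_) hξ
  · have e : S.sMap M (S.inA a ⊗ₜ z) = 0 := S.sMap_jA (a ⊗ₜ z)
    rw [e]; exact Submodule.zero_mem _
  · refine S.jA_mem_EF ?_
    obtain ⟨t, rfl⟩ := S.toE.surjective e
    induction t using TensorProduct.induction_on with
    | zero => simp
    | add x y hx hy => rw [map_add, TensorProduct.add_tmul, map_add]; exact Submodule.add_mem _ hx hy
    | tmul a h => exact tmul_mem_tens a (S.cons_mem_GX rfl _ hz)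

lemma iotaA_mem_EF {n : ℕ} {p : ℤ} (hp : 0 ≤ p) {ξ : A ⊗[k] S.TotA M}
    (hξ : ξ ∈ tens A (S.degA M n)) : S.iotaA M ξ ∈ S.EF (S.GX M n) p :=
  S.jA_mem_EF (apply_mem_of_mem_tens _ (fun a _ hz => tmul_mem_tens a (S.nil_mem_GX hp hz)) hξ)

variable [Module S.E M] [IsScalarTower k S.E M]

lemma rhoE_mem_tens {n : ℕ} {G : Submodule k (S.TotHA M)}
    (h : ∀ h, ∀ y ∈ G, S.rhoH M h y ∈ S.degA M n) {ξ : S.E ⊗[k] S.TotHA M}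
    (hξ : ξ ∈ tens S.E G) : S.rhoE M ξ ∈ tens A (S.degA M n) := by
  refine apply_mem_of_mem_tens (S.rhoE M) (fun e z hz => ?_) hξ
  obtain ⟨t, rfl⟩ := S.toE.surjective e
  induction t using TensorProduct.induction_on with
  | zero => simp
  | add x y hx hy => rw [map_add, TensorProduct.add_tmul, map_add]; exact Submodule.add_mem _ hx hy
  | tmul a l => exact tmul_mem_tens a (h l z hz)

variable [Module A M] [IsScalarTower k A M]

lemma dW_GX_zero {p : ℤ} {y : S.TotHA M} (hy : y ∈ S.GX M 0 p) : S.dW M y = 0 := by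
  have h : S.GX M 0 p ≤ LinearMap.ker (S.dW M) := S.baseX_le fun _ x hx => by
    obtain ⟨m, rfl⟩ := hx
    rw [LinearMap.mem_ker, dW_nil, barD_nil, map_zero]
  exact h hy

lemma aug_GX_succ {n : ℕ} {p : ℤ} {y : S.TotHA M} (hy : y ∈ S.GX M (n + 1) p) :
    Tot.aug k (Bar k A) M (Tot.aug k (Bar k H) (S.TotA M) y) = 0 := by
  have h : S.GX M (n + 1) p ≤
      (LinearMap.ker (Tot.aug k (Bar k A) M)).comap (Tot.aug k (Bar k H) (S.TotA M)) := by
    refine S.GX_succ_le (fun _ x hx => ?_) fun h y hy => ?_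
    · rw [Submodule.mem_comap, LinearMap.mem_ker, Tot.aug_nil]
      exact Tot.aug_of_mem_deg_succ hx
    · rw [Submodule.mem_comap, LinearMap.mem_ker, Tot.aug_cons, map_zero]
  exact h hy

/-- A joint induction: by `rhoH_eq` the degree of `ρ` on elements of degree `n + 1` depends on `d`
there and on `ρ` in degree `n`, while by `dW_cons` the differential of `h · y` involves `d` and `ρ`
on `y`. -/
lemma dW_rhoH_mem (n : ℕ) : (∀ (p : ℤ), ∀ y ∈ S.GX M (n + 1) p, S.dW M y ∈ S.EF (S.GX M n) p) ∧
    ∀ (p : ℤ), ∀ y ∈ S.GX M n p, ∀ h, S.rhoH M h y ∈ S.degA M n := by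
  induction n with
  | zero =>
    have h2 : ∀ (p : ℤ), ∀ y ∈ S.GX M 0 p, ∀ h, S.rhoH M h y ∈ S.degA M 0 := fun p y hy h => by
      rw [rhoH_eq, S.dW_GX_zero hy, smul_zero, map_zero, map_zero, zero_add]
      exact Tot.nil_mem_deg _
    refine ⟨fun p => ?_, h2⟩
    change S.GX M 1 p ≤ (S.EF (S.GX M 0) p).comap (S.dW M)
    refine S.GX_succ_le (fun hp x hx => ?_) fun h y hy => ?_
    · rw [Submodule.mem_comap, dW_nil]
      exact S.iotaA_mem_EF hp (barD_mem_tens hx)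
    · obtain ⟨h, rfl⟩ := bar_surjective k H h
      rw [Submodule.mem_comap, dW_cons, S.dW_GX_zero hy, smul_zero, map_zero, sub_zero]
      refine Submodule.sub_mem _ (tens_le_EF rfl (tmul_mem_tens _ hy)) ?_
      by_cases hp : 0 ≤ p
      · exact S.iotaA_mem_EF hp (tmul_mem_tens _ (h2 _ _ hy h))
      · rw [S.GX_neg _ (by lia), Submodule.mem_bot] at hy
        rw [hy, map_zero, TensorProduct.tmul_zero, map_zero]
        exact Submodule.zero_mem _
  | succ n ih =>
    have h2 : ∀ (p : ℤ), ∀ y ∈ S.GX M (n + 1) p, ∀ h, S.rhoH M h y ∈ S.degA M (n + 1) :=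
      fun p y hy h => by
        rw [rhoH_eq, S.aug_GX_succ hy, smul_zero, map_zero, add_zero]
        exact consExt_mem_deg (S.rhoE_mem_tens (fun h y hy => ih.2 p y hy h)
          (smul_mem_tens _ (EF_le_tens (S.GX_mono n) (ih.1 p y hy))))
    refine ⟨fun p => ?_, h2⟩
    change S.GX M (n + 2) p ≤ (S.EF (S.GX M (n + 1)) p).comap (S.dW M)
    refine S.GX_succ_le (fun hp x hx => ?_) fun h y hy => ?_
    · rw [Submodule.mem_comap, dW_nil]
      exact S.iotaA_mem_EF hp (barD_mem_tens hx)
    · obtain ⟨h, rfl⟩ := bar_surjective k H h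
      rw [Submodule.mem_comap, dW_cons]
      refine Submodule.sub_mem _ (Submodule.sub_mem _ (tens_le_EF rfl (tmul_mem_tens _ hy))
        (S.sMap_mem_EF (tens_le_EF rfl (smul_mem_tens _ (EF_le_tens (S.GX_mono n)
          (ih.1 _ y hy)))))) ?_
      by_cases hp : 0 ≤ p
      · exact S.iotaA_mem_EF hp (tmul_mem_tens _ (h2 _ _ hy h))
      · rw [S.GX_neg _ (by lia), Submodule.mem_bot] at hy
        rw [hy, map_zero, TensorProduct.tmul_zero, map_zero]
        exact Submodule.zero_mem _

lemma dW_mem_EF {n : ℕ} {p : ℤ} {y : S.TotHA M} (hy : y ∈ S.GX M (n + 1) p) :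
    S.dW M y ∈ S.EF (S.GX M n) p := (S.dW_rhoH_mem n).1 p y hy

lemma rhoH_mem_deg {n : ℕ} {p : ℤ} {y : S.TotHA M} (hy : y ∈ S.GX M n p) (h : H) :
    S.rhoH M h y ∈ S.degA M n := (S.dW_rhoH_mem n).2 p y hy h

end Filtration

/-! ### The differential squares to zero and `ρ` is a chain map. -/

section Square

variable {M : Type*} [AddCommGroup M] [Module k M] [Module S.E M] [IsScalarTower k S.E M]

variable (M) in
/-- The augmentation `e ⊗ y ↦ e ε(y)`. -/
noncomputable def augE : S.E ⊗[k] S.TotHA M →ₗ[k] M :=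
  ext S.E (Tot.aug k (Bar k A) M ∘ₗ Tot.aug k (Bar k H) (S.TotA M))

@[simp]
lemma augE_tmul (e : S.E) (y : S.TotHA M) : S.augE M (e ⊗ₜ y) =
    e • Tot.aug k (Bar k A) M (Tot.aug k (Bar k H) (S.TotA M) y) := rfl

lemma augE_smul (e : S.E) (ξ : S.E ⊗[k] S.TotHA M) : S.augE M (e • ξ) = e • S.augE M ξ :=
  ext_smul _ _ _

lemma augE_sMap (ξ : S.E ⊗[k] S.TotHA M) : S.augE M (S.sMap M ξ) = 0 := by
  induction ξ using S.E_induction with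
  | hadd x y hx hy => simp only [map_add, hx, hy, add_zero]
  | h a h z =>
    have e : S.sMap M (S.toE (a ⊗ₜ h) ⊗ₜ z) = S.inA a ⊗ₜ Tot.cons k (Bar k H) _ (bar k H h) z := rfl
    rw [e, augE_tmul, Tot.aug_cons, map_zero, smul_zero]

variable [Module A M] [IsScalarTower k A M]

lemma aug_rhoH (h : H) (y : S.TotHA M) : Tot.aug k (Bar k A) M (S.rhoH M h y) =
    S.inH h • Tot.aug k (Bar k A) M (Tot.aug k (Bar k H) (S.TotA M) y) := by
  rw [rhoH_eq, map_add, aug_consExt, zero_add, Tot.aug_nil]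

lemma augE_iotaA (hA : ∀ (a : A) (m : M), a • m = S.inA a • m)
    (ξ : A ⊗[k] S.TotA M) :
    S.augE M (S.iotaA M ξ) = ext A (Tot.aug k (Bar k A) M) ξ := by
  induction ξ using TensorProduct.induction_on with
  | zero => simp
  | add x y hx hy => simp only [map_add, hx, hy]
  | tmul a u => rw [iotaA_tmul, augE_tmul, Tot.aug_nil, ext_tmul, hA]

lemma aug_rhoE (hA : ∀ (a : A) (m : M), a • m = S.inA a • m)
    (ξ : S.E ⊗[k] S.TotHA M) :
    ext A (Tot.aug k (Bar k A) M) (S.rhoE M ξ) = S.augE M ξ := by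
  induction ξ using S.E_induction with
  | hadd x y hx hy => simp only [map_add, hx, hy]
  | h a h z =>
    have e : S.rhoE M (S.toE (a ⊗ₜ h) ⊗ₜ z) = a ⊗ₜ S.rhoH M h z := rfl
    rw [e, ext_tmul, aug_rhoH, augE_tmul, hA, S.toE_eq, mul_smul]

/-- The terms `(1 # h) ⊗ y` and `ι(1 ⊗ ρ(h, y))` have the same augmentation, and `s` has none. The
two structures on `M` must agree here: the bar differential of `A` uses one, multiplication in `E`
the other. -/
lemma augE_dW (hA : ∀ (a : A) (m : M), a • m = S.inA a • m)
    (y : S.TotHA M) : S.augE M (S.dW M y) = 0 := by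
  induction y using Tot.induction with
  | hadd x y hx hy => simp only [map_add, hx, hy, add_zero]
  | hnil p => rw [dW_nil, S.augE_iotaA hA, aug_barD]
  | hcons h y _ =>
    obtain ⟨h, rfl⟩ := bar_surjective k H h
    rw [dW_cons, map_sub, map_sub, augE_sMap, S.augE_iotaA hA, ext_tmul, one_smul, aug_rhoH,
      augE_tmul, sub_zero, sub_self]

/-- Again a joint induction on the degree. For `h · y`, applying `dE_sMap` to the `s`-term of the
differential leaves `ι ρ((1 # h) d y)`, which cancels against `ι d ρ(h, y)` exactly when `ρ` is a
chain map at `y`. In turn `ρ` is the bar contraction of a cycle, by `rhoH_eq`, so its differential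
is that cycle. -/
lemma dE_dW_of_mem (hA : ∀ (a : A) (m : M), a • m = S.inA a • m)
    (n : ℕ) (p : ℤ) {y : S.TotHA M} (hy : y ∈ S.GX M n p) :
    S.dE M (S.dW M y) = 0 ∧ ∀ h, barD k A M (S.rhoH M h y) = S.rhoE M (S.inH h • S.dW M y) := by
  induction n generalizing p y with
  | zero =>
    rw [S.dW_GX_zero hy, map_zero]
    refine ⟨rfl, fun h => ?_⟩
    rw [rhoH_eq, S.dW_GX_zero hy, smul_zero, map_zero, map_zero, zero_add, barD_nil]
  | succ n ih =>
    have hdd : ∀ (p : ℤ) {y : S.TotHA M}, y ∈ S.GX M (n + 1) p → S.dE M (S.dW M y) = 0 := by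
      intro p
      change S.GX M (n + 1) p ≤ LinearMap.ker (S.dE M ∘ₗ S.dW M)
      refine S.GX_succ_le (fun _ x hx => ?_) fun h y hy => ?_
      · rw [LinearMap.mem_ker, LinearMap.comp_apply, dW_nil, dE_iotaA, barD_barD, map_zero]
      · obtain ⟨h, rfl⟩ := bar_surjective k H h
        rw [LinearMap.mem_ker, LinearMap.comp_apply, dW_cons, map_sub, map_sub, dE_sMap, dE_iotaA,
          dE_smul, (ih _ hy).1, smul_zero, map_zero, ext_tmul, one_smul, (ih _ hy).2, dE_tmul]
        abel
    refine ⟨hdd p hy, fun h => ?_⟩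
    -- `ξ` is a cycle whose `W`-part has degree `n`; so the induction hypothesis lets `ρ` commute
    -- with the differential on it, and `ρ ξ` is a cycle of augmentation zero.
    set ξ := S.inH h • S.dW M y with hξ
    have h0 : S.dE M ξ = 0 := by rw [hξ, dE_smul, hdd p hy, smul_zero]
    have h1 : ξ ∈ tens S.E (S.GX M n p) :=
      smul_mem_tens _ (EF_le_tens (S.GX_mono n) (S.dW_mem_EF hy))
    have h2 : ext A (barD k A M) (S.rhoE M ξ) = S.rhoE M (S.dE M ξ) := by
      rw [← sub_eq_zero]
      refine (Submodule.mem_bot k).1 (apply_mem_of_mem_tens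
        (ext A (barD k A M) ∘ₗ S.rhoE M - S.rhoE M ∘ₗ S.dE M) (fun e z hz => ?_) h1)
      rw [Submodule.mem_bot]
      obtain ⟨t, rfl⟩ := S.toE.surjective e
      induction t using TensorProduct.induction_on with
      | zero => simp
      | add x y hx hy => rw [map_add, TensorProduct.add_tmul, map_add, hx, hy, add_zero]
      | tmul a l =>
        have e1 : S.rhoE M (S.toE (a ⊗ₜ l) ⊗ₜ z) = a ⊗ₜ S.rhoH M l z := rfl
        rw [LinearMap.sub_apply, LinearMap.comp_apply, LinearMap.comp_apply, e1, ext_tmul,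
          (ih _ hz).2, dE_tmul, S.toE_eq, mul_smul, rhoE_inA_smul, sub_self]
    rw [rhoH_eq, map_add, barD_nil, add_zero, barD_consExt, h2, h0, map_zero, map_zero,
      S.aug_rhoE hA, hξ, augE_smul, S.augE_dW hA, smul_zero, map_zero, TensorProduct.tmul_zero,
      sub_zero, sub_zero]

/-- Removes the degree from the inductions: `W` is spanned by homogeneous elements, each lying in
some `GX`. -/
lemma exists_mem_GX (p : S.TotHA M → Prop) (hadd : ∀ x y, p x → p y → p (x + y))
    (h : ∀ n q, ∀ y ∈ S.GX M n q, p y) (y : S.TotHA M) : p y := by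
  have h0 : p 0 := h 0 0 0 (Submodule.zero_mem _)
  have hP : ∀ x : S.TotA M, ∀ s : ℕ, ∀ w : ⨂[k]^s (Bar k H),
      p (Tot.inc k (Bar k H) _ s (w ⊗ₜ x)) := by
    intro x s w
    induction x using Tot.induction_inc with
    | h0 => simpa using h0
    | hadd x y hx hy => rw [TensorProduct.tmul_add, map_add]; exact hadd _ _ hx hy
    | h r v m =>
      refine h (r + s) s _ ?_
      induction s with
      | zero =>
        rw [Tot.inc_zero]
        exact S.nil_mem_GX le_rfl (Submodule.smul_mem _ _ (Tot.inc_mem_deg _ _))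
      | succ s ih =>
        induction w using Tot.cons_induction with
        | h0 => simp
        | hadd x y hx hy => rw [TensorProduct.add_tmul, map_add]; exact Submodule.add_mem _ hx hy
        | h l w => rw [← Tot.cons_inc]; exact S.cons_mem_GX (by push_cast; ring) l (ih w)
  induction y using Tot.induction_inc with
  | h0 => exact h0
  | hadd x y hx hy => exact hadd _ _ hx hy
  | h s w x => exact hP x s w

theorem dE_dW (hA : ∀ (a : A) (m : M), a • m = S.inA a • m)
    (y : S.TotHA M) : S.dE M (S.dW M y) = 0 := by
  refine S.exists_mem_GX (fun y => S.dE M (S.dW M y) = 0) (fun x y hx hy => ?_)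
    (fun n q y hy => (S.dE_dW_of_mem hA n q hy).1) y
  rw [map_add, map_add, hx, hy, add_zero]

theorem barD_rhoH (hA : ∀ (a : A) (m : M), a • m = S.inA a • m)
    (h : H) (y : S.TotHA M) :
    barD k A M (S.rhoH M h y) = S.rhoE M (S.inH h • S.dW M y) := by
  refine S.exists_mem_GX (fun y => barD k A M (S.rhoH M h y) = S.rhoE M (S.inH h • S.dW M y))
    (fun x y hx hy => ?_) (fun n q y hy => (S.dE_dW_of_mem hA n q hy).2 h) y
  simp only [map_add, hx, hy, smul_add]

end Square

end CrossedSystem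

end HochschildSerre

namespace HochschildSerre

namespace CrossedSystem

variable {k A H : Type*} [CommRing k] [Ring A] [Algebra k A] [Ring H] [HopfAlgebra k H]
  (S : CrossedSystem k A H)

/-- The total module of the bar construction of `E` with coefficients in `M`. -/
abbrev TotE (M : Type*) [AddCommGroup M] [Module k M] : Type _ := Tot k (Bar k S.E) M

/-- The part of filtration degree `p` of the component of degree `n` of the bar construction. -/
noncomputable def GB (M : Type*) [AddCommGroup M] [Module k M] (n : ℕ) (p : ℤ) :
    Submodule k (S.TotE M) := match n with
  | 0 => ⨆ _ : 0 ≤ p, LinearMap.range (Tot.nil k (Bar k S.E) M)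
  | n + 1 => (S.EF (GB M n) p).map (consExt k S.E M)

/-! ### The contraction `σ` of `E ⊗ W`, and the comparison with the bar resolution of `E`. -/

section Contraction

variable {M : Type*} [AddCommGroup M] [Module k M] [Module S.E M] [IsScalarTower k S.E M]

variable (M) in
/-- The contraction of `X̂`. -/
noncomputable def sigma : S.E ⊗[k] S.TotHA M →ₗ[k] S.E ⊗[k] S.TotHA M :=
  S.sMap M + S.iotaA M ∘ₗ TensorProduct.mk k A _ 1 ∘ₗ consExt k A M ∘ₗ S.rhoE M

lemma sigma_apply (ξ : S.E ⊗[k] S.TotHA M) :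
    S.sigma M ξ = S.sMap M ξ + S.iotaA M (1 ⊗ₜ consExt k A M (S.rhoE M ξ)) := rfl

lemma sigma_one_tmul (y : S.TotHA M) : S.sigma M (1 ⊗ₜ y) = 0 := by
  rw [sigma_apply, sMap_one_tmul, ← S.inA_one, rhoE_inA_tmul, consExt_one_tmul,
    TensorProduct.tmul_zero, map_zero, add_zero]

/-- A value of `σ` is a value of `s` plus an element of `1 ⊗ W`. The latter is killed by
normalization, the former because `s s = 0` and `ρ s = 0`. -/
lemma sigma_sigma (ξ : S.E ⊗[k] S.TotHA M) : S.sigma M (S.sigma M ξ) = 0 := by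
  rw [S.sigma_apply ξ, map_add, iotaA_tmul, inA_one, sigma_one_tmul, add_zero, sigma_apply,
    sMap_sMap, rhoE_sMap, map_zero, TensorProduct.tmul_zero, map_zero, add_zero]

lemma augE_sigma (ξ : S.E ⊗[k] S.TotHA M) : S.augE M (S.sigma M ξ) = 0 := by
  rw [sigma_apply, map_add, augE_sMap, zero_add, iotaA_tmul, augE_tmul, Tot.aug_nil, aug_consExt,
    smul_zero]

lemma sigma_mem_EF {n : ℕ} {p : ℤ} {ξ : S.E ⊗[k] S.TotHA M} [Module A M] [IsScalarTower k A M]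
    (hξ : ξ ∈ S.EF (S.GX M n) p) : S.sigma M ξ ∈ S.EF (S.GX M (n + 1)) p := by
  refine Submodule.add_mem _ (S.sMap_mem_EF hξ) ?_
  have h1 := EF_le_tens (S.GX_mono n) hξ
  by_cases hp : 0 ≤ p
  · exact S.iotaA_mem_EF hp (tmul_mem_tens _ (consExt_mem_deg
      (S.rhoE_mem_tens (fun h y hy => S.rhoH_mem_deg hy h) h1)))
  · rw [S.GX_neg _ (by lia), tens_bot, Submodule.mem_bot] at h1
    rw [h1, map_zero]
    exact Submodule.zero_mem _

variable (M) in
/-- The map `e ⊗ ξ ↦ σ (e ξ) - e σ (ξ)`. -/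
noncomputable def sigmaComm : S.E →ₗ[k] S.E ⊗[k] S.TotHA M →ₗ[k] S.E ⊗[k] S.TotHA M :=
  LinearMap.mk₂ k (fun e ξ => S.sigma M (e • ξ) - e • S.sigma M ξ)
    (fun e e' ξ => by rw [add_smul, map_add, add_smul]; abel)
    (fun c e ξ => by rw [smul_assoc, map_smul, smul_assoc, smul_sub])
    (fun e ξ ξ' => by rw [smul_add, map_add, map_add, smul_add]; abel)
    (fun c e ξ => by rw [smul_algebra_smul_comm, LinearMap.map_smul, LinearMap.map_smul,
      smul_algebra_smul_comm, smul_sub])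

variable (M) in
/-- The comparison map from the bar complex of `E` to `X̂`. -/
noncomputable def psi : S.TotE M →ₗ[k] S.E ⊗[k] S.TotHA M :=
  -- The intended rule `e · u ↦ σ(e ψ(u))` is not known to vanish at `e = 1` before `σ ψ = 0` is
  -- proved. Subtracting `e σ(ψ(u))` makes it vanish at once and changes nothing in the end.
  Tot.fold (TensorProduct.mk k S.E _ 1 ∘ₗ Tot.nil k (Bar k H) _ ∘ₗ Tot.nil k (Bar k A) M)
    (TensorProduct.curry (liftBar (TensorProduct.lift (S.sigmaComm M)) fun ξ => by
      change S.sigma M ((1 : S.E) • ξ) - (1 : S.E) • S.sigma M ξ = 0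
      rw [one_smul, one_smul, sub_self]))

@[simp]
lemma psi_nil (m : M) : S.psi M (Tot.nil k (Bar k S.E) M m) =
    1 ⊗ₜ Tot.nil k (Bar k H) _ (Tot.nil k (Bar k A) M m) := Tot.fold_nil _ _ _

lemma psi_cons_sub (e : S.E) (u : S.TotE M) :
    S.psi M (Tot.cons k (Bar k S.E) M (bar k S.E e) u) =
      S.sigma M (e • S.psi M u) - e • S.sigma M (S.psi M u) := Tot.fold_cons _ _ _ _

lemma sigma_psi (u : S.TotE M) : S.sigma M (S.psi M u) = 0 := by
  induction u using Tot.induction with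
  | hadd x y hx hy => rw [map_add, map_add, hx, hy, add_zero]
  | hnil m => rw [psi_nil, sigma_one_tmul]
  | hcons v u hu =>
    obtain ⟨e, rfl⟩ := bar_surjective k S.E v
    rw [psi_cons_sub, hu, smul_zero, sub_zero, sigma_sigma]

/-- The intended recursion for `ψ`: `σ ψ = 0`, which rests on `σ σ = 0`, makes the correction term
of the definition disappear. -/
lemma psi_cons (e : S.E) (u : S.TotE M) :
    S.psi M (Tot.cons k (Bar k S.E) M (bar k S.E e) u) = S.sigma M (e • S.psi M u) := by
  rw [psi_cons_sub, sigma_psi, smul_zero, sub_zero]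

lemma psi_consExt (ξ : S.E ⊗[k] S.TotE M) :
    S.psi M (consExt k S.E M ξ) = S.sigma M (ext S.E (S.psi M) ξ) := by
  induction ξ using TensorProduct.induction_on with
  | zero => simp
  | add x y hx hy => simp only [map_add, hx, hy]
  | tmul e u => rw [consExt_tmul, psi_cons, ext_tmul]

lemma augE_psi (u : S.TotE M) : S.augE M (S.psi M u) = Tot.aug k (Bar k S.E) M u := by
  induction u using Tot.induction with
  | hadd x y hx hy => simp only [map_add, hx, hy]
  | hnil m => rw [psi_nil, augE_tmul, Tot.aug_nil, Tot.aug_nil, Tot.aug_nil, one_smul]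
  | hcons v u hu =>
    obtain ⟨e, rfl⟩ := bar_surjective k S.E v
    rw [psi_cons, augE_sigma, Tot.aug_cons]

variable [Module A M] [IsScalarTower k A M]

variable (M) in
/-- The comparison map from `X̂` to the bar complex of `E`, on the component of degree `n`. -/
noncomputable def phi : ℕ → (S.TotHA M →ₗ[k] S.TotE M)
  | 0 => Tot.nil k (Bar k S.E) M ∘ₗ Tot.aug k (Bar k A) M ∘ₗ Tot.aug k (Bar k H) _
  -- The usual lifting `φ(y) = s_E(φ(d y))`. The differential is no structural recursion on `W`, so
  -- the degree is the recursion variable, and `phi n` has a meaning only on elements of degree `n`.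
  | n + 1 => consExt k S.E M ∘ₗ (phi n).lTensor S.E ∘ₗ S.dW M

lemma phi_zero (y : S.TotHA M) : S.phi M 0 y =
    Tot.nil k (Bar k S.E) M (Tot.aug k (Bar k A) M (Tot.aug k (Bar k H) _ y)) := rfl

lemma phi_succ (n : ℕ) (y : S.TotHA M) : S.phi M (n + 1) y =
    consExt k S.E M ((S.phi M n).lTensor S.E (S.dW M y)) := rfl

variable (M) in
/-- The homotopy on the bar complex of `E`, on the component of degree `n`. -/
noncomputable def omega : ℕ → (S.TotE M →ₗ[k] S.TotE M)
  | 0 => 0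
  -- The equation `d ω = φ ψ - 1 - ω d`, solved with the contraction of the bar complex; the term `1
  -- ⊗ u` is omitted because the contraction kills it.
  | n + 1 => consExt k S.E M ∘ₗ ((S.phi M (n + 1)).lTensor S.E ∘ₗ S.psi M -
      (omega n).lTensor S.E ∘ₗ barD k S.E M)

lemma omega_succ (n : ℕ) (u : S.TotE M) : S.omega M (n + 1) u =
    consExt k S.E M ((S.phi M (n + 1)).lTensor S.E (S.psi M u) -
      (S.omega M n).lTensor S.E (barD k S.E M u)) := rfl

section Identities

lemma ext_barD_rhoE (hA : ∀ (a : A) (m : M), a • m = S.inA a • m) (ξ : S.E ⊗[k] S.TotHA M) :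
    ext A (barD k A M) (S.rhoE M ξ) = S.rhoE M (S.dE M ξ) := by
  induction ξ using S.E_induction with
  | hadd x y hx hy => simp only [map_add, hx, hy]
  | h a l z =>
    have e1 : S.rhoE M (S.toE (a ⊗ₜ l) ⊗ₜ z) = a ⊗ₜ S.rhoH M l z := rfl
    rw [e1, ext_tmul, S.barD_rhoH hA, dE_tmul, S.toE_eq, mul_smul, rhoE_inA_smul]

/-- By `dE_sMap`, contracting with `s` leaves the error `ι ρ`. Since `ι` and `ρ` are chain maps, the
contraction of the bar complex of `A` reduces this error to the augmentation. -/
lemma dE_sigma (hA : ∀ (a : A) (m : M), a • m = S.inA a • m) (ξ : S.E ⊗[k] S.TotHA M) :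
    S.dE M (S.sigma M ξ) = ξ - S.sigma M (S.dE M ξ) -
      1 ⊗ₜ Tot.nil k (Bar k H) _ (Tot.nil k (Bar k A) M (S.augE M ξ)) := by
  rw [sigma_apply, map_add, dE_sMap, dE_iotaA, ext_tmul, one_smul, barD_consExt,
    S.ext_barD_rhoE hA, S.aug_rhoE hA, map_sub, map_sub, S.sigma_apply (S.dE M ξ), iotaA_tmul,
    iotaA_tmul, inA_one]
  abel

lemma dE_psi (hA : ∀ (a : A) (m : M), a • m = S.inA a • m) (u : S.TotE M) :
    S.dE M (S.psi M u) = ext S.E (S.psi M) (barD k S.E M u) := by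
  induction u using Tot.induction with
  | hadd x y hx hy => simp only [map_add, hx, hy]
  | hnil m => rw [psi_nil, dE_tmul, dW_nil, barD_nil, barD_nil, map_zero, smul_zero, map_zero]
  | hcons v u hu =>
    obtain ⟨e, rfl⟩ := bar_surjective k S.E v
    rw [psi_cons, S.dE_sigma hA, dE_smul, hu, barD_cons, map_sub, map_sub, ext_tmul, ext_tmul,
      ext_tmul, one_smul, one_smul, psi_consExt, ext_smul, psi_nil, augE_smul, augE_psi]

/-- `ρ(d y)` is the bar differential of the component of `y` in `P`, by the chain map property at `h
= 1`. Its contraction restores the component that `s` misses in `sMap_dW`. -/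
lemma sigma_dW (hA : ∀ (a : A) (m : M), a • m = S.inA a • m) (y : S.TotHA M) :
    S.sigma M (S.dW M y) = 1 ⊗ₜ y - 1 ⊗ₜ Tot.nil k (Bar k H) _
      (Tot.nil k (Bar k A) M (Tot.aug k (Bar k A) M (Tot.aug k (Bar k H) _ y))) := by
  have e : S.rhoE M (S.dW M y) = barD k A M (Tot.aug k (Bar k H) _ y) := by
    rw [← rhoH_one, S.barD_rhoH hA, inH_one, one_smul]
  rw [sigma_apply, sMap_dW, e, eq_sub_of_add_eq (consExt_barD (Tot.aug k (Bar k H) _ y)),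
    iotaA_tmul, inA_one, map_sub, TensorProduct.tmul_sub]
  abel

lemma eq_of_mem_tens {Z X : Type*} [AddCommGroup Z] [Module k Z] [AddCommGroup X] [Module k X]
    {G : Submodule k Z} (f g : S.E ⊗[k] Z →ₗ[k] X)
    (h : ∀ e z, z ∈ G → f (e ⊗ₜ z) = g (e ⊗ₜ z)) {ξ : S.E ⊗[k] Z} (hξ : ξ ∈ tens S.E G) :
    f ξ = g ξ := by
  rw [← sub_eq_zero]
  refine (Submodule.mem_bot k).1 (apply_mem_of_mem_tens (f - g) (fun e z hz => ?_) hξ)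
  rw [Submodule.mem_bot, LinearMap.sub_apply, h e z hz, sub_self]

/-- `φ` is a chain map: `φ(d y)` is a cycle, by induction and `d d = 0`, and has augmentation zero,
so the contraction that defines `φ(y)` is a preimage of it. -/
lemma barD_phi_succ (hA : ∀ (a : A) (m : M), a • m = S.inA a • m) (n : ℕ) {p : ℤ}
    {y : S.TotHA M} (hy : y ∈ S.GX M (n + 1) p) :
    barD k S.E M (S.phi M (n + 1) y) = (S.phi M n).lTensor S.E (S.dW M y) := by
  induction n generalizing p y with
  | zero =>
    have e : ∀ ξ : S.E ⊗[k] S.TotHA M, ext S.E (Tot.aug k (Bar k S.E) M)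
        ((S.phi M 0).lTensor S.E ξ) = S.augE M ξ := fun ξ => by
      induction ξ using TensorProduct.induction_on with
      | zero => simp
      | add x y hx hy => simp only [map_add, hx, hy]
      | tmul e u => rw [LinearMap.lTensor_tmul, phi_zero, ext_tmul, Tot.aug_nil, augE_tmul]
    have e' : ∀ ξ : S.E ⊗[k] S.TotHA M, ext S.E (barD k S.E M)
        ((S.phi M 0).lTensor S.E ξ) = 0 := fun ξ => by
      induction ξ using TensorProduct.induction_on with
      | zero => simp
      | add x y hx hy => simp only [map_add, hx, hy, add_zero]
      | tmul e u => rw [LinearMap.lTensor_tmul, phi_zero, ext_tmul, barD_nil, smul_zero]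
    rw [phi_succ, barD_consExt, e, e', S.augE_dW hA, map_zero, map_zero, TensorProduct.tmul_zero,
      sub_zero, sub_zero]
  | succ n ih =>
    have e : ∀ ξ : S.E ⊗[k] S.TotHA M, ext S.E (Tot.aug k (Bar k S.E) M)
        ((S.phi M (n + 1)).lTensor S.E ξ) = 0 := fun ξ => by
      induction ξ using TensorProduct.induction_on with
      | zero => simp
      | add x y hx hy => simp only [map_add, hx, hy, add_zero]
      | tmul e u => rw [LinearMap.lTensor_tmul, phi_succ, ext_tmul, aug_consExt, smul_zero]
    have e' : ext S.E (barD k S.E M) ((S.phi M (n + 1)).lTensor S.E (S.dW M y)) =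
        (S.phi M n).lTensor S.E (S.dE M (S.dW M y)) := by
      refine S.eq_of_mem_tens (ext S.E (barD k S.E M) ∘ₗ (S.phi M (n + 1)).lTensor S.E)
        ((S.phi M n).lTensor S.E ∘ₗ S.dE M) (fun e z hz => ?_)
        (EF_le_tens (S.GX_mono (n + 1)) (S.dW_mem_EF hy))
      rw [LinearMap.comp_apply, LinearMap.lTensor_tmul, ext_tmul, ih hz, LinearMap.comp_apply,
        dE_tmul, lTensor_smul]
    rw [phi_succ, barD_consExt, e, e', S.dE_dW hA, map_zero, map_zero, map_zero,
      TensorProduct.tmul_zero, sub_zero, sub_zero]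

/-- Strict, not merely up to homotopy: `ψ(φ(y)) = σ(ψ(φ(d y))) = σ(d y)` by induction, and
`sigma_dW` evaluates this. -/
lemma psi_phi (hA : ∀ (a : A) (m : M), a • m = S.inA a • m) (n : ℕ) {p : ℤ}
    {y : S.TotHA M} (hy : y ∈ S.GX M n p) : S.psi M (S.phi M n y) = 1 ⊗ₜ y := by
  induction n generalizing p y with
  | zero =>
    have h : S.GX M 0 p ≤ LinearMap.ker (S.psi M ∘ₗ S.phi M 0 - TensorProduct.mk k S.E _ 1) :=
      S.baseX_le fun _ x hx => by
        obtain ⟨m, rfl⟩ := hx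
        rw [LinearMap.mem_ker, LinearMap.sub_apply, LinearMap.comp_apply, phi_zero, Tot.aug_nil,
          Tot.aug_nil, psi_nil, TensorProduct.mk_apply, sub_self]
    exact sub_eq_zero.1 (h hy)
  | succ n ih =>
    have e : ext S.E (S.psi M) ((S.phi M n).lTensor S.E (S.dW M y)) = S.dW M y := by
      refine S.eq_of_mem_tens (ext S.E (S.psi M) ∘ₗ (S.phi M n).lTensor S.E) LinearMap.id
        (fun e z hz => ?_) (EF_le_tens (S.GX_mono n) (S.dW_mem_EF hy))
      rw [LinearMap.comp_apply, LinearMap.lTensor_tmul, ext_tmul, ih hz, TensorProduct.smul_tmul',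
        smul_eq_mul, _root_.mul_one, LinearMap.id_apply]
    rw [phi_succ, psi_consExt, e, S.sigma_dW hA, S.aug_GX_succ hy, map_zero, map_zero,
      TensorProduct.tmul_zero, sub_zero]

end Identities

section FiltrationE

lemma GB_zero_le {p : ℤ} {L : Submodule k (S.TotE M)}
    (h : 0 ≤ p → ∀ m, Tot.nil k (Bar k S.E) M m ∈ L) : S.GB M 0 p ≤ L :=
  iSup_le fun hp => by rintro _ ⟨m, rfl⟩; exact h hp m

lemma nil_mem_GB {p : ℤ} (hp : 0 ≤ p) (m : M) : Tot.nil k (Bar k S.E) M m ∈ S.GB M 0 p :=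
  (le_iSup (fun _ : 0 ≤ p => LinearMap.range (Tot.nil k (Bar k S.E) M)) hp) ⟨m, rfl⟩

lemma consExt_mem_GB {n : ℕ} {p : ℤ} {ξ : S.E ⊗[k] S.TotE M} (hξ : ξ ∈ S.EF (S.GB M n) p) :
    consExt k S.E M ξ ∈ S.GB M (n + 1) p := ⟨ξ, hξ, rfl⟩

lemma GB_mono (n : ℕ) : Monotone (S.GB M n) := by
  induction n with
  | zero => exact fun p q h => S.GB_zero_le fun hp m => S.nil_mem_GB (hp.trans h) m
  | succ n ih => exact fun p q h => Submodule.map_mono (EF_mono ih h)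

lemma GB_neg (n : ℕ) {p : ℤ} (hp : p < 0) : S.GB M n p = ⊥ := by
  induction n generalizing p with
  | zero => exact le_bot_iff.1 (S.GB_zero_le fun h => absurd h (not_le.2 hp))
  | succ n ih =>
    change (S.EF (S.GB M n) p).map (consExt k S.E M) = ⊥
    rw [EF, ih hp, ih (by lia), tens_bot, tens_bot, Submodule.map_bot, sup_bot_eq,
      Submodule.map_bot]

lemma aug_GB_succ {n : ℕ} {p : ℤ} {u : S.TotE M} (hu : u ∈ S.GB M (n + 1) p) :
    Tot.aug k (Bar k S.E) M u = 0 := by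
  obtain ⟨ξ, -, rfl⟩ := hu
  exact aug_consExt ξ

lemma barD_GB_zero {p : ℤ} {u : S.TotE M} (hu : u ∈ S.GB M 0 p) : barD k S.E M u = 0 := by
  have h : S.GB M 0 p ≤ LinearMap.ker (barD k S.E M) := S.GB_zero_le fun _ m => barD_nil m
  exact h hu

/-- An element of `GB M (n + 1) p` is by definition the contraction of some `ξ` in `EF (GB M n) p`;
the contraction identity expresses its differential by `ξ`, a contraction of `d ξ`, and in lowest
degree an augmentation term. -/
lemma barD_mem_EF (n : ℕ) {p : ℤ} {u : S.TotE M} (hu : u ∈ S.GB M (n + 1) p) :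
    barD k S.E M u ∈ S.EF (S.GB M n) p := by
  induction n generalizing p u with
  | zero =>
    obtain ⟨ξ, hξ, rfl⟩ := hu
    have e : ext S.E (barD k S.E M) ξ = 0 := S.eq_of_mem_tens (ext S.E (barD k S.E M)) 0
      (fun e z hz => by rw [ext_tmul, S.barD_GB_zero hz, smul_zero, LinearMap.zero_apply])
      (EF_le_tens (S.GB_mono 0) hξ)
    rw [barD_consExt, e, map_zero, TensorProduct.tmul_zero, sub_zero]
    by_cases hp : 0 ≤ p
    · exact Submodule.sub_mem _ hξ (one_tmul_mem_EF (S.nil_mem_GB hp _))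
    · have h1 := EF_le_tens (S.GB_mono 0) hξ
      rw [S.GB_neg _ (by lia), tens_bot, Submodule.mem_bot] at h1
      rw [h1, map_zero, map_zero, TensorProduct.tmul_zero, sub_zero]
      exact Submodule.zero_mem _
  | succ n ih =>
    obtain ⟨ξ, hξ, rfl⟩ := hu
    have e : ext S.E (Tot.aug k (Bar k S.E) M) ξ = 0 :=
      S.eq_of_mem_tens (ext S.E (Tot.aug k (Bar k S.E) M)) 0
        (fun e z hz => by rw [ext_tmul, S.aug_GB_succ hz, smul_zero, LinearMap.zero_apply])
        (EF_le_tens (S.GB_mono (n + 1)) hξ)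
    rw [barD_consExt, e, map_zero, TensorProduct.tmul_zero, sub_zero]
    exact Submodule.sub_mem _ hξ (one_tmul_mem_EF (S.consExt_mem_GB
      (ext_mem_EF (S.GB_mono n) _ (fun p u hu => ih hu) hξ)))

lemma psi_mem_EF (n : ℕ) {p : ℤ} {u : S.TotE M} (hu : u ∈ S.GB M n p) :
    S.psi M u ∈ S.EF (S.GX M n) p := by
  induction n generalizing p u with
  | zero =>
    have h : S.GB M 0 p ≤ (S.EF (S.GX M 0) p).comap (S.psi M) := S.GB_zero_le fun hp m => by
      rw [Submodule.mem_comap, psi_nil]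
      exact one_tmul_mem_EF (S.nil_mem_GX hp (Tot.nil_mem_deg _))
    exact h hu
  | succ n ih =>
    obtain ⟨ξ, hξ, rfl⟩ := hu
    rw [psi_consExt]
    exact S.sigma_mem_EF (ext_mem_EF (S.GX_mono n) _ (fun p u hu => ih hu) hξ)

lemma phi_mem_GB (n : ℕ) {p : ℤ} {y : S.TotHA M} (hy : y ∈ S.GX M n p) :
    S.phi M n y ∈ S.GB M n p := by
  induction n generalizing p y with
  | zero =>
    by_cases hp : 0 ≤ p
    · exact S.nil_mem_GB hp _
    · rw [S.GX_neg _ (by lia), Submodule.mem_bot] at hy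
      rw [hy, map_zero]
      exact Submodule.zero_mem _
  | succ n ih =>
    exact S.consExt_mem_GB (lTensor_mem_EF _ (fun p y hy => ih hy) (S.dW_mem_EF hy))

lemma omega_mem_GB (n : ℕ) {p : ℤ} {u : S.TotE M} (hu : u ∈ S.GB M n p) :
    S.omega M n u ∈ S.GB M (n + 1) p := by
  induction n generalizing p u with
  | zero => exact Submodule.zero_mem _
  | succ n ih =>
    refine S.consExt_mem_GB (Submodule.sub_mem _
      (lTensor_mem_EF _ (fun p y hy => S.phi_mem_GB _ hy) (S.psi_mem_EF _ hu))
      (lTensor_mem_EF _ (fun p y hy => ih hy) (S.barD_mem_EF n hu)))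

end FiltrationE

section Homotopy

lemma phi_psi_zero {p : ℤ} {u : S.TotE M} (hu : u ∈ S.GB M 0 p) :
    (S.phi M 0).lTensor S.E (S.psi M u) = 1 ⊗ₜ u := by
  have h : S.GB M 0 p ≤
      LinearMap.ker ((S.phi M 0).lTensor S.E ∘ₗ S.psi M - TensorProduct.mk k S.E _ 1) :=
    S.GB_zero_le fun hp m => by
      rw [LinearMap.mem_ker, LinearMap.sub_apply, LinearMap.comp_apply, psi_nil,
        LinearMap.lTensor_tmul, phi_zero, Tot.aug_nil, Tot.aug_nil, TensorProduct.mk_apply,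
        sub_self]
  exact sub_eq_zero.1 (h hu)

/-- The step common to the start and the continuation of the induction: `hom` is the homotopy
identity one degree lower, applied to `d u`. It says that `ζ`, whose contraction is `ω(u)`, has
differential `d u`, and the contraction of `d u` is `u`. -/
lemma barD_omega_step (hA : ∀ (a : A) (m : M), a • m = S.inA a • m) (n : ℕ) {p : ℤ}
    {u : S.TotE M} (hu : u ∈ S.GB M (n + 1) p)
    (hom : ext S.E (barD k S.E M) ((S.omega M n).lTensor S.E (barD k S.E M u)) =
      (S.phi M n).lTensor S.E (ext S.E (S.psi M) (barD k S.E M u)) - barD k S.E M u) :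
    barD k S.E M (S.omega M (n + 1) u) + (S.omega M n).lTensor S.E (barD k S.E M u) =
      (S.phi M (n + 1)).lTensor S.E (S.psi M u) - 1 ⊗ₜ u := by
  set ζ := (S.phi M (n + 1)).lTensor S.E (S.psi M u) -
      (S.omega M n).lTensor S.E (barD k S.E M u) with hζ
  have haug : ext S.E (Tot.aug k (Bar k S.E) M) ζ = 0 := by
    have e1 : ∀ ξ : S.E ⊗[k] S.TotHA M, ext S.E (Tot.aug k (Bar k S.E) M)
        ((S.phi M (n + 1)).lTensor S.E ξ) = 0 := fun ξ => by
      induction ξ using TensorProduct.induction_on with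
      | zero => simp
      | add x y hx hy => simp only [map_add, hx, hy, add_zero]
      | tmul e u => rw [LinearMap.lTensor_tmul, phi_succ, ext_tmul, aug_consExt, smul_zero]
    have e2 : ∀ ξ : S.E ⊗[k] S.TotE M, ext S.E (Tot.aug k (Bar k S.E) M)
        ((S.omega M n).lTensor S.E ξ) = 0 := fun ξ => by
      induction ξ using TensorProduct.induction_on with
      | zero => simp
      | add x y hx hy => simp only [map_add, hx, hy, add_zero]
      | tmul e u =>
        rw [LinearMap.lTensor_tmul, ext_tmul]
        cases n with
        | zero => rw [omega, LinearMap.zero_apply, map_zero, smul_zero]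
        | succ n => rw [omega_succ, aug_consExt, smul_zero]
    rw [hζ, map_sub, e1, e2, sub_zero]
  have hphi : ext S.E (barD k S.E M) ((S.phi M (n + 1)).lTensor S.E (S.psi M u)) =
      (S.phi M n).lTensor S.E (ext S.E (S.psi M) (barD k S.E M u)) := by
    rw [← S.dE_psi hA]
    refine S.eq_of_mem_tens (ext S.E (barD k S.E M) ∘ₗ (S.phi M (n + 1)).lTensor S.E)
      ((S.phi M n).lTensor S.E ∘ₗ S.dE M) (fun e z hz => ?_)
      (EF_le_tens (S.GX_mono (n + 1)) (S.psi_mem_EF _ hu))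
    rw [LinearMap.comp_apply, LinearMap.lTensor_tmul, ext_tmul, S.barD_phi_succ hA n hz,
      LinearMap.comp_apply, dE_tmul, lTensor_smul]
  have hD : ext S.E (barD k S.E M) ζ = barD k S.E M u := by
    rw [hζ, map_sub, hphi, hom, sub_sub_cancel]
  rw [omega_succ, ← hζ, barD_consExt, haug, hD, map_zero, TensorProduct.tmul_zero, sub_zero,
    eq_sub_of_add_eq (consExt_barD u), S.aug_GB_succ hu, map_zero, sub_zero]
  rw [hζ]
  abel

lemma barD_omega_succ (hA : ∀ (a : A) (m : M), a • m = S.inA a • m) (n : ℕ) {p : ℤ}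
    {u : S.TotE M} (hu : u ∈ S.GB M (n + 1) p) :
    barD k S.E M (S.omega M (n + 1) u) + (S.omega M n).lTensor S.E (barD k S.E M u) =
      (S.phi M (n + 1)).lTensor S.E (S.psi M u) - 1 ⊗ₜ u := by
  induction n generalizing p u with
  | zero =>
    refine S.barD_omega_step hA 0 hu ?_
    refine S.eq_of_mem_tens (ext S.E (barD k S.E M) ∘ₗ (S.omega M 0).lTensor S.E)
      ((S.phi M 0).lTensor S.E ∘ₗ ext S.E (S.psi M) - LinearMap.id) (fun e z hz => ?_)
      (EF_le_tens (S.GB_mono 0) (S.barD_mem_EF _ hu))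
    rw [LinearMap.comp_apply, LinearMap.lTensor_tmul, ext_tmul, omega, LinearMap.zero_apply,
      map_zero, smul_zero, LinearMap.sub_apply, LinearMap.comp_apply, ext_tmul, lTensor_smul,
      S.phi_psi_zero hz, TensorProduct.smul_tmul', smul_eq_mul, _root_.mul_one,
      LinearMap.id_apply, sub_self]
  | succ n ih =>
    refine S.barD_omega_step hA (n + 1) hu ?_
    have e : ext S.E (barD k S.E M) ((S.omega M (n + 1)).lTensor S.E (barD k S.E M u)) =
        (S.phi M (n + 1)).lTensor S.E (ext S.E (S.psi M) (barD k S.E M u)) - barD k S.E M u -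
          (S.omega M n).lTensor S.E (ext S.E (barD k S.E M) (barD k S.E M u)) := by
      refine S.eq_of_mem_tens (ext S.E (barD k S.E M) ∘ₗ (S.omega M (n + 1)).lTensor S.E)
        ((S.phi M (n + 1)).lTensor S.E ∘ₗ ext S.E (S.psi M) - LinearMap.id -
          (S.omega M n).lTensor S.E ∘ₗ ext S.E (barD k S.E M)) (fun e z hz => ?_)
        (EF_le_tens (S.GB_mono (n + 1)) (S.barD_mem_EF _ hu))
      rw [LinearMap.comp_apply, LinearMap.lTensor_tmul, ext_tmul, eq_sub_of_add_eq (ih hz),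
        LinearMap.sub_apply, LinearMap.sub_apply, LinearMap.comp_apply, LinearMap.comp_apply,
        ext_tmul, ext_tmul, lTensor_smul, lTensor_smul, smul_sub, smul_sub,
        TensorProduct.smul_tmul', smul_eq_mul, _root_.mul_one, LinearMap.id_apply]
    rw [e, barD_barD, map_zero, sub_zero]

end Homotopy

end Contraction

end CrossedSystem

end HochschildSerre

namespace HochschildSerre

lemma consExt_map {k : Type*} [CommRing k] {B : Type*} [Ring B] [Algebra k B]
    {M : Type*} [AddCommGroup M] [Module k M] (r : M →ₗ[k] M) (ξ : B ⊗[k] Tot k (Bar k B) M) :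
    consExt k B M ((Tot.map (Bar k B) r).lTensor B ξ) = Tot.map (Bar k B) r (consExt k B M ξ) := by
  induction ξ using TensorProduct.induction_on with
  | zero => simp
  | add x y hx hy => simp only [map_add, hx, hy]
  | tmul b u => simp

/-! ### From resolutions to complexes: the maps `e ⊗ z ↦ z e`. -/

section RightAction

variable {k : Type*} [CommRing k] {B : Type*} [Ring B] [Algebra k B]
  {Z : Type*} [AddCommGroup Z] [Module k Z] {X : Type*} [AddCommGroup X] [Module k X]
  (R : B →ₗ[k] Z →ₗ[k] Z) (R' : B →ₗ[k] X →ₗ[k] X)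

/-- The map `b ⊗ z ↦ z b` for a right action of `B`. -/
noncomputable def actOn : B ⊗[k] Z →ₗ[k] Z := TensorProduct.lift R

@[simp]
lemma actOn_tmul (b : B) (z : Z) : actOn R (b ⊗ₜ z) = R b z := rfl

lemma actOn_smul (hR : ∀ b c z, R (b * c) z = R c (R b z)) (b : B) (ξ : B ⊗[k] Z) :
    actOn R (b • ξ) = actOn R ((R b).lTensor B ξ) := by
  induction ξ using TensorProduct.induction_on with
  | zero => simp
  | add x y hx hy => rw [smul_add, map_add, hx, hy, map_add, map_add]
  | tmul c z => rw [TensorProduct.smul_tmul', smul_eq_mul, actOn_tmul, hR]; rfl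

/-- A `B`-linear map between free modules, given on generators by `f`, induces `z ↦ actOn (f z)`.
This lemma says that composition is respected, provided `f` commutes with the right actions, so
identities between resolutions descend. -/
lemma actOn_ext (hR : ∀ b c z, R' (b * c) z = R' c (R' b z)) (f : Z →ₗ[k] B ⊗[k] X)
    (hf : ∀ b z, f (R b z) = (R' b).lTensor B (f z)) (ξ : B ⊗[k] Z) :
    actOn R' (f (actOn R ξ)) = actOn R' (ext B f ξ) := by
  induction ξ using TensorProduct.induction_on with
  | zero => simp
  | add x y hx hy => simp only [map_add, hx, hy]
  | tmul b z => rw [actOn_tmul, hf, ext_tmul, actOn_smul R' hR]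

lemma apply_actOn (f : Z →ₗ[k] X) (hf : ∀ b z, f (R b z) = R' b (f z)) (ξ : B ⊗[k] Z) :
    f (actOn R ξ) = actOn R' (f.lTensor B ξ) := by
  induction ξ using TensorProduct.induction_on with
  | zero => simp
  | add x y hx hy => simp only [map_add, hx, hy]
  | tmul b z => rw [actOn_tmul, hf]; rfl

end RightAction

namespace CrossedSystem

variable {k A H : Type*} [CommRing k] [Ring A] [Algebra k A] [Ring H] [HopfAlgebra k H]
  (S : CrossedSystem k A H)

/-! ### Naturality of all the maps for endomorphisms of `M`. -/

section Naturality

variable {M : Type*} [AddCommGroup M] [Module k M] (r : M →ₗ[k] M)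

/-- The endomorphism of `W = ⨁ H̄^s ⊗ Ā^r ⊗ M` induced by an endomorphism of `M`. -/
noncomputable abbrev mapW : S.TotHA M →ₗ[k] S.TotHA M :=
  Tot.map (Bar k H) (Tot.map (Bar k A) r)

lemma iotaA_map (ξ : A ⊗[k] S.TotA M) : S.iotaA M ((Tot.map (Bar k A) r).lTensor A ξ) =
    (S.mapW r).lTensor S.E (S.iotaA M ξ) := by
  induction ξ using TensorProduct.induction_on with
  | zero => simp
  | add x y hx hy => simp only [map_add, hx, hy]
  | tmul b u => simp

lemma sMap_map (ξ : S.E ⊗[k] S.TotHA M) : S.sMap M ((S.mapW r).lTensor S.E ξ) =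
    (S.mapW r).lTensor S.E (S.sMap M ξ) := by
  have e : ∀ a h z, S.sMap M (S.toE (a ⊗ₜ h) ⊗ₜ z) =
      S.inA a ⊗ₜ Tot.cons k (Bar k H) _ (bar k H h) z := fun _ _ _ => rfl
  induction ξ using S.E_induction with
  | hadd x y hx hy => simp only [map_add, hx, hy]
  | h a h z => rw [LinearMap.lTensor_tmul, e, e, LinearMap.lTensor_tmul, Tot.map_cons]

lemma GX_map (n : ℕ) {p : ℤ} {y : S.TotHA M} (hy : y ∈ S.GX M n p) :
    S.mapW r y ∈ S.GX M n p := by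
  have hdeg : ∀ n : ℕ, S.degA M n ≤ (S.degA M n).comap (Tot.map (Bar k A) r) := fun n => by
    induction n with
    | zero =>
      rintro _ ⟨m, rfl⟩
      rw [Submodule.mem_comap, Tot.map_nil]
      exact Tot.nil_mem_deg _
    | succ n ih =>
      refine Tot.deg_succ_le fun v y hy => ?_
      rw [Submodule.mem_comap, Tot.map_cons]
      exact Tot.cons_mem_deg _ (ih hy)
  have key : ∀ (n : ℕ) (p : ℤ), S.GX M n p ≤ (S.GX M n p).comap (S.mapW r) := fun n => by
    induction n with
    | zero =>
      refine fun p => S.baseX_le fun hp x hx => ?_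
      rw [Submodule.mem_comap, Tot.map_nil]
      exact S.nil_mem_GX hp (hdeg 0 hx)
    | succ n ih =>
      refine fun p => S.GX_succ_le (fun hp x hx => ?_) fun h y hy => ?_
      · rw [Submodule.mem_comap, Tot.map_nil]
        exact S.nil_mem_GX hp (hdeg _ hx)
      · rw [Submodule.mem_comap, Tot.map_cons]
        exact S.cons_mem_GX rfl h (ih _ hy)
  exact key n p hy

variable [Module S.E M] [IsScalarTower k S.E M]

lemma absorbH_map (hr : ∀ (e : S.E) m, r (e • m) = e • r m) (n : ℕ) (m : M)
    (t : (⨂[k]^n (Bar k A)) ⊗[k] H) :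
    S.absorbH M n (r m) t = Tot.map (Bar k A) r (S.absorbH M n m t) := by
  induction t using TensorProduct.induction_on with
  | zero => simp
  | add x y hx hy => simp only [map_add, hx, hy]
  | tmul w y => simp [hr]

/-- Only the left action touches `M` in the maps `F` and in the action of `H`, so left linear
endomorphisms pass through. -/
lemma actOf_map (hr : ∀ (e : S.E) m, r (e • m) = e • r m) {V : Type*} [AddCommGroup V]
    [Module k V] {e : ℕ → ℕ}
    (g : ∀ r : ℕ, V ⊗[k] (⨂[k]^r (Bar k A)) →ₗ[k] (⨂[k]^(e r) (Bar k A)) ⊗[k] H) (v : V)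
    (p : S.TotA M) : S.actOf g v (Tot.map (Bar k A) r p) = Tot.map (Bar k A) r (S.actOf g v p) := by
  induction p using Tot.induction_inc with
  | h0 => simp
  | hadd x y hx hy => simp only [map_add, hx, hy]
  | h n w m => rw [Tot.map_inc, actOf_inc, actOf_inc, S.absorbH_map r hr]

lemma rhoH_map (hr : ∀ (e : S.E) m, r (e • m) = e • r m) (h : H) (y : S.TotHA M) :
    S.rhoH M h (S.mapW r y) = Tot.map (Bar k A) r (S.rhoH M h y) := by
  have hR : ∀ y : S.TotHA M, S.actR M (S.mapW r y) = Tot.map (Bar k A) r (S.actR M y) := fun y => by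
    induction y using Tot.induction_inc with
    | h0 => simp
    | hadd x y hx hy => simp only [map_add, hx, hy]
    | h n w p =>
      rw [Tot.map_inc]
      match n with
      | 0 => rw [actR_zero, actR_zero, map_zero]
      | 1 => rw [actR_one, actR_one, map_zero]
      | n + 2 => rw [actR_add_two, actR_add_two, map_smul, actK, S.actOf_map r hr]
  rw [rhoH_apply, rhoH_apply, ← Tot.map_cons, hR, Tot.aug_map, actH, S.actOf_map r hr, map_add]

lemma rhoE_map (hr : ∀ (e : S.E) m, r (e • m) = e • r m) (ξ : S.E ⊗[k] S.TotHA M) :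
    S.rhoE M ((S.mapW r).lTensor S.E ξ) = (Tot.map (Bar k A) r).lTensor A (S.rhoE M ξ) := by
  have e : ∀ a h z, S.rhoE M (S.toE (a ⊗ₜ h) ⊗ₜ z) = a ⊗ₜ S.rhoH M h z := fun _ _ _ => rfl
  induction ξ using S.E_induction with
  | hadd x y hx hy => simp only [map_add, hx, hy]
  | h a h z => rw [LinearMap.lTensor_tmul, e, e, LinearMap.lTensor_tmul, S.rhoH_map r hr]

lemma sigma_map (hr : ∀ (e : S.E) m, r (e • m) = e • r m) (ξ : S.E ⊗[k] S.TotHA M) :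
    S.sigma M ((S.mapW r).lTensor S.E ξ) = (S.mapW r).lTensor S.E (S.sigma M ξ) := by
  rw [sigma_apply, sigma_apply, sMap_map, S.rhoE_map r hr, consExt_map, map_add, ← S.iotaA_map,
    LinearMap.lTensor_tmul]

lemma psi_map (hr : ∀ (e : S.E) m, r (e • m) = e • r m) (u : S.TotE M) :
    S.psi M (Tot.map (Bar k S.E) r u) = (S.mapW r).lTensor S.E (S.psi M u) := by
  induction u using Tot.induction with
  | hadd x y hx hy => simp only [map_add, hx, hy]
  | hnil m => rw [Tot.map_nil, psi_nil, psi_nil, LinearMap.lTensor_tmul, Tot.map_nil, Tot.map_nil]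
  | hcons v u hu =>
    obtain ⟨e, rfl⟩ := bar_surjective k S.E v
    rw [Tot.map_cons, psi_cons, psi_cons, hu, ← lTensor_smul, S.sigma_map r hr]

variable [Module A M] [IsScalarTower k A M]

lemma dW_map (hr : ∀ (e : S.E) m, r (e • m) = e • r m) (hrA : ∀ (a : A) m, r (a • m) = a • r m)
    (y : S.TotHA M) : S.dW M (S.mapW r y) = (S.mapW r).lTensor S.E (S.dW M y) := by
  induction y using Tot.induction with
  | hadd x y hx hy => simp only [map_add, hx, hy]
  | hnil p => rw [Tot.map_nil, dW_nil, dW_nil, barD_map r hrA, iotaA_map]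
  | hcons h y hy =>
    obtain ⟨h, rfl⟩ := bar_surjective k H h
    rw [Tot.map_cons, dW_cons, dW_cons, hy, ← lTensor_smul, sMap_map, S.rhoH_map r hr, map_sub,
      map_sub, ← S.iotaA_map, LinearMap.lTensor_tmul, LinearMap.lTensor_tmul]

lemma phi_map (hr : ∀ (e : S.E) m, r (e • m) = e • r m) (hrA : ∀ (a : A) m, r (a • m) = a • r m)
    (n : ℕ) (y : S.TotHA M) :
    S.phi M n (S.mapW r y) = Tot.map (Bar k S.E) r (S.phi M n y) := by
  induction n generalizing y with
  | zero => rw [phi_zero, phi_zero, Tot.aug_map, Tot.aug_map, Tot.map_nil]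
  | succ n ih =>
    rw [phi_succ, phi_succ, S.dW_map r hr hrA, ← consExt_map]
    congr 1
    generalize S.dW M y = ξ
    induction ξ using TensorProduct.induction_on with
    | zero => simp
    | add x y hx hy => simp only [map_add, hx, hy]
    | tmul b u => rw [LinearMap.lTensor_tmul, LinearMap.lTensor_tmul, ih]; rfl

lemma omega_map (hr : ∀ (e : S.E) m, r (e • m) = e • r m) (hrA : ∀ (a : A) m, r (a • m) = a • r m)
    (n : ℕ) (u : S.TotE M) :
    S.omega M n (Tot.map (Bar k S.E) r u) = Tot.map (Bar k S.E) r (S.omega M n u) := by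
  induction n generalizing u with
  | zero => rw [omega, LinearMap.zero_apply, LinearMap.zero_apply, map_zero]
  | succ n ih =>
    have e1 : ∀ ξ : S.E ⊗[k] S.TotHA M, (S.phi M (n + 1)).lTensor S.E ((S.mapW r).lTensor S.E ξ) =
        (Tot.map (Bar k S.E) r).lTensor S.E ((S.phi M (n + 1)).lTensor S.E ξ) := fun ξ => by
      induction ξ using TensorProduct.induction_on with
      | zero => simp
      | add x y hx hy => simp only [map_add, hx, hy]
      | tmul b u => rw [LinearMap.lTensor_tmul, LinearMap.lTensor_tmul, S.phi_map r hr hrA]; rfl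
    have e2 : ∀ ξ : S.E ⊗[k] S.TotE M,
        (S.omega M n).lTensor S.E ((Tot.map (Bar k S.E) r).lTensor S.E ξ) =
        (Tot.map (Bar k S.E) r).lTensor S.E ((S.omega M n).lTensor S.E ξ) := fun ξ => by
      induction ξ using TensorProduct.induction_on with
      | zero => simp
      | add x y hx hy => simp only [map_add, hx, hy]
      | tmul b u => rw [LinearMap.lTensor_tmul, LinearMap.lTensor_tmul, ih]; rfl
    rw [omega_succ, omega_succ, S.psi_map r hr, barD_map r hr, e1, e2, ← map_sub, consExt_map]

end Naturality

/-! ### The filtered homotopy equivalence with coefficients in the bimodule `M`. -/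

section Bimodule

variable {M : Type*} [AddCommGroup M] [Module k M] [Module S.Eᵐᵒᵖ M] [IsScalarTower k S.Eᵐᵒᵖ M]

variable (M) in
/-- The right multiplications on `M`. -/
noncomputable def rmul : S.E →ₗ[k] M →ₗ[k] M :=
  (Algebra.lsmul k k M).toLinearMap ∘ₗ (MulOpposite.opLinearEquiv k : S.E ≃ₗ[k] S.Eᵐᵒᵖ).toLinearMap

@[simp]
lemma rmul_apply (e : S.E) (m : M) : S.rmul M e m = MulOpposite.op e • m := rfl

lemma rmul_mul (e e' : S.E) : S.rmul M (e * e') = S.rmul M e' ∘ₗ S.rmul M e :=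
  LinearMap.ext fun m => by simp [mul_smul]

variable (M) in
/-- The right action of `E` on `W`. -/
noncomputable def rmulW : S.E →ₗ[k] S.TotHA M →ₗ[k] S.TotHA M :=
  Tot.mapLin k (Bar k H) _ _ ∘ₗ Tot.mapLin k (Bar k A) M M ∘ₗ S.rmul M

lemma rmulW_apply (e : S.E) : S.rmulW M e = S.mapW (S.rmul M e) := rfl

variable (M) in
/-- The right action of `E` on the bar construction. -/
noncomputable def rmulU : S.E →ₗ[k] S.TotE M →ₗ[k] S.TotE M :=
  Tot.mapLin k (Bar k S.E) M M ∘ₗ S.rmul M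

lemma rmulU_apply (e : S.E) : S.rmulU M e = Tot.map (Bar k S.E) (S.rmul M e) := rfl

lemma rmulW_mul (e e' : S.E) (y : S.TotHA M) :
    S.rmulW M (e * e') y = S.rmulW M e' (S.rmulW M e y) := by
  have e1 : Tot.map (Bar k A) (S.rmul M (e * e')) =
      Tot.map (Bar k A) (S.rmul M e') ∘ₗ Tot.map (Bar k A) (S.rmul M e) :=
    LinearMap.ext fun p => by rw [rmul_mul, LinearMap.comp_apply, Tot.map_map]
  rw [rmulW_apply, rmulW_apply, rmulW_apply, mapW, mapW, mapW, e1, Tot.map_map]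

lemma rmul_one : S.rmul M 1 = LinearMap.id := LinearMap.ext fun m => by simp

lemma rmulW_one (y : S.TotHA M) : S.rmulW M 1 y = y := by
  have e : Tot.map (Bar k A) (LinearMap.id : M →ₗ[k] M) = LinearMap.id :=
    LinearMap.ext fun p => Tot.map_id p
  rw [rmulW_apply, rmul_one, mapW, e, Tot.map_id]

lemma rmulU_one (u : S.TotE M) : S.rmulU M 1 u = u := by
  rw [rmulU_apply, rmul_one, Tot.map_id]

variable [Module S.E M] [IsScalarTower k S.E M] [SMulCommClass S.E S.Eᵐᵒᵖ M]

lemma rmul_smul (e e' : S.E) (m : M) : S.rmul M e (e' • m) = e' • S.rmul M e m :=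
  (smul_comm e' (MulOpposite.op e) m).symm

variable (M) in
/-- The comparison map from the Hochschild complex to `X̂`. -/
noncomputable def psiM : S.TotE M →ₗ[k] S.TotHA M := actOn (S.rmulW M) ∘ₗ S.psi M

variable (M) in
/-- The differential of the Hochschild complex. -/
noncomputable def bM : S.TotE M →ₗ[k] S.TotE M := actOn (S.rmulU M) ∘ₗ barD k S.E M

variable [Module A M] [IsScalarTower k A M]

variable (M) in
/-- The differential of `X̂`. -/
noncomputable def dM : S.TotHA M →ₗ[k] S.TotHA M := actOn (S.rmulW M) ∘ₗ S.dW M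

lemma rmul_smul_A (hA : ∀ (a : A) (m : M), a • m = S.inA a • m) (e : S.E) (a : A) (m : M) :
    S.rmul M e (a • m) = a • S.rmul M e m := by rw [hA, hA, rmul_smul]

/-- Right multiplications commute with the left action, so naturality gives the hypothesis of
`actOn_ext` and `dE_dW` descends. The other identities of this part are transported likewise. -/
lemma dM_dM (hA : ∀ (a : A) (m : M), a • m = S.inA a • m) (y : S.TotHA M) :
    S.dM M (S.dM M y) = 0 := by
  have e := actOn_ext (S.rmulW M) (S.rmulW M) S.rmulW_mul (S.dW M)
    (fun e y => S.dW_map _ (S.rmul_smul e) (S.rmul_smul_A hA e) y) (S.dW M y)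
  have e' : ext S.E (S.dW M) (S.dW M y) = 0 := S.dE_dW hA y
  rw [e', map_zero] at e
  exact e

lemma dM_psiM (hA : ∀ (a : A) (m : M), a • m = S.inA a • m) (u : S.TotE M) :
    S.dM M (S.psiM M u) = S.psiM M (S.bM M u) := by
  have e := actOn_ext (S.rmulW M) (S.rmulW M) S.rmulW_mul (S.dW M)
    (fun e y => S.dW_map _ (S.rmul_smul e) (S.rmul_smul_A hA e) y) (S.psi M u)
  have e' := actOn_ext (S.rmulU M) (S.rmulW M) S.rmulW_mul (S.psi M)
    (fun e u => S.psi_map _ (S.rmul_smul e) u) (barD k S.E M u)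
  exact e.trans ((congrArg (actOn (S.rmulW M)) (S.dE_psi hA u)).trans e'.symm)

lemma bM_phi (hA : ∀ (a : A) (m : M), a • m = S.inA a • m) (n : ℕ) {p : ℤ} {y : S.TotHA M}
    (hy : y ∈ S.GX M (n + 1) p) : S.bM M (S.phi M (n + 1) y) = S.phi M n (S.dM M y) := by
  rw [bM, LinearMap.comp_apply, S.barD_phi_succ hA n hy, dM, LinearMap.comp_apply]
  exact (apply_actOn (S.rmulW M) (S.rmulU M) (S.phi M n)
    (fun e y => S.phi_map _ (S.rmul_smul e) (S.rmul_smul_A hA e) n y) (S.dW M y)).symm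

lemma psiM_phi (hA : ∀ (a : A) (m : M), a • m = S.inA a • m) (n : ℕ) {p : ℤ} {y : S.TotHA M}
    (hy : y ∈ S.GX M n p) : S.psiM M (S.phi M n y) = y := by
  rw [psiM, LinearMap.comp_apply, S.psi_phi hA n hy, actOn_tmul, rmulW_one]

lemma phi_psiM_zero (hA : ∀ (a : A) (m : M), a • m = S.inA a • m) {p : ℤ} {u : S.TotE M}
    (hu : u ∈ S.GB M 0 p) : S.phi M 0 (S.psiM M u) = u := by
  refine (apply_actOn (S.rmulW M) (S.rmulU M) (S.phi M 0)
    (fun e y => S.phi_map _ (S.rmul_smul e) (S.rmul_smul_A hA e) 0 y) (S.psi M u)).trans ?_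
  rw [S.phi_psi_zero hu, actOn_tmul, rmulU_one]

lemma bM_omega (hA : ∀ (a : A) (m : M), a • m = S.inA a • m) (n : ℕ) {p : ℤ} {u : S.TotE M}
    (hu : u ∈ S.GB M (n + 1) p) :
    S.bM M (S.omega M (n + 1) u) + S.omega M n (S.bM M u) =
      S.phi M (n + 1) (S.psiM M u) - u := by
  have e1 := apply_actOn (S.rmulW M) (S.rmulU M) (S.phi M (n + 1))
    (fun e y => S.phi_map _ (S.rmul_smul e) (S.rmul_smul_A hA e) _ y) (S.psi M u)
  have e2 := apply_actOn (S.rmulU M) (S.rmulU M) (S.omega M n)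
    (fun e y => S.omega_map _ (S.rmul_smul e) (S.rmul_smul_A hA e) _ y) (barD k S.E M u)
  have e3 := congrArg (actOn (S.rmulU M)) (S.barD_omega_succ hA n hu)
  rw [map_add, map_sub, ← e1, ← e2, actOn_tmul, rmulU_one] at e3
  exact e3

lemma actOn_mem_GX {n : ℕ} {p : ℤ} {ξ : S.E ⊗[k] S.TotHA M} (hξ : ξ ∈ S.EF (S.GX M n) p) :
    actOn (S.rmulW M) ξ ∈ S.GX M n p :=
  apply_mem_of_mem_tens _ (fun _ _ hz => S.GX_map _ n hz) (EF_le_tens (S.GX_mono n) hξ)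

lemma psiM_mem_GX {n : ℕ} {p : ℤ} {u : S.TotE M} (hu : u ∈ S.GB M n p) :
    S.psiM M u ∈ S.GX M n p := S.actOn_mem_GX (S.psi_mem_EF n hu)

end Bimodule

end CrossedSystem

end HochschildSerre

namespace HochschildSerre

namespace CrossedSystem

variable {k A H : Type*} [CommRing k] [Ring A] [Algebra k A] [Ring H] [HopfAlgebra k H]
  (S : CrossedSystem k A H)

/-! ### Identification with the filtered Hochschild complex of `E`. -/

section Hochschild

variable (M : Type*) [AddCommGroup M] [Module k M] [Module S.E M] [IsScalarTower k S.E M]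
  [Module A M] [IsScalarTower k A M]

/-- The identification of `M ⊗ Ē^n` with a summand of the total module. -/
noncomputable def ofHoch (n : ℕ) : M ⊗[k] (⨂[k]^n (Bar k S.E)) →ₗ[k] S.TotE M :=
  Tot.inc k (Bar k S.E) M n ∘ₗ (TensorProduct.comm k M _).toLinearMap

/-- The projection of the total module to `M ⊗ Ē^n`. -/
noncomputable def toHoch (n : ℕ) : S.TotE M →ₗ[k] M ⊗[k] (⨂[k]^n (Bar k S.E)) :=
  (TensorProduct.comm k _ M).toLinearMap ∘ₗ Tot.comp k (Bar k S.E) M n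

variable {M}

lemma toHoch_ofHoch (n : ℕ) (x : M ⊗[k] (⨂[k]^n (Bar k S.E))) :
    S.toHoch M n (S.ofHoch M n x) = x := by
  simp [toHoch, ofHoch]

lemma ofHoch_tmul (n : ℕ) (m : M) (w : ⨂[k]^n (Bar k S.E)) :
    S.ofHoch M n (m ⊗ₜ w) = Tot.inc k (Bar k S.E) M n (w ⊗ₜ m) := rfl

/-- Counting entries in `A` is the recursion of `EF`: prepending an entry of `A` keeps `p`,
prepending any other one raises `p` by one. -/
lemma ofHoch_mem_GB (n : ℕ) (p : ℤ) {x : M ⊗[k] (⨂[k]^n (Bar k S.E))}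
    (hx : x ∈ hochFilt (LinearMap.range S.inA) M p n) : S.ofHoch M n x ∈ S.GB M n p := by
  classical
  refine (Submodule.span_le (p := (S.GB M n p).comap (S.ofHoch M n))).2 ?_ hx
  clear hx x
  rintro _ ⟨m, x, hx, rfl⟩
  change Tot.inc k (Bar k S.E) M n (_ ⊗ₜ m) ∈ S.GB M n p
  induction n generalizing p with
  | zero =>
    have e : (PiTensorProduct.tprod k fun j : Fin 0 => bar k S.E (x j)) =
        PiTensorProduct.tprod k ![] := congrArg _ (Subsingleton.elim _ _)
    rw [e, ← Tot.nil_apply]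
    refine S.nil_mem_GB ?_ m
    simp only [countIn] at hx
    simpa using hx
  | succ n ih =>
    rw [← Fin.cons_self_tail x, countIn_cons] at hx
    rw [← Fin.cons_self_tail x, ← cons_bar_tprod, ← Tot.cons_inc, ← consExt_tmul]
    refine S.consExt_mem_GB ?_
    split_ifs at hx with h
    · obtain ⟨a, ha⟩ := h
      rw [← ha]
      exact inA_tmul_mem_EF a (ih p (Fin.tail x) (by push_cast at hx; lia))
    · exact tens_le_EF rfl (tmul_mem_tens _ (ih _ (Fin.tail x) (by push_cast at hx; lia)))

/-- In degree `n` the step `p = n` imposes nothing. This gives every chain a filtration degree, so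
that identities proved on `GB` apply to all chains. -/
lemma mem_hochFilt_top (n : ℕ) (x : M ⊗[k] (⨂[k]^n (Bar k S.E))) :
    x ∈ hochFilt (LinearMap.range S.inA) M n n := by
  induction x using TensorProduct.induction_on with
  | zero => exact Submodule.zero_mem _
  | add x y hx hy => exact Submodule.add_mem _ hx hy
  | tmul m w =>
    refine tmul_mem_hochFilt m ?_
    induction w using PiTensorProduct.induction_on with
    | smul_tprod c v =>
      choose x hx using fun j => bar_surjective k S.E (v j)
      exact Submodule.smul_mem _ _ (Submodule.subset_span ⟨x, by lia, by simp [hx]⟩)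
    | add x y hx hy => exact Submodule.add_mem _ hx hy

lemma GB_le_map (n : ℕ) (p : ℤ) :
    S.GB M n p ≤ (hochFilt (LinearMap.range S.inA) M p n).map (S.ofHoch M n) := by
  classical
  induction n generalizing p with
  | zero =>
    refine S.GB_zero_le fun hp m => ⟨m ⊗ₜ PiTensorProduct.tprod k ![], ?_, rfl⟩
    exact Submodule.subset_span ⟨m, ![], by simpa [countIn] using hp,
      congrArg _ (congrArg _ (Subsingleton.elim _ _))⟩
  | succ n ih =>
    -- The condition on counts treats both kinds of generators at once: `q = p` when the new entry
    -- is in `A`, and `q = p - 1` in general.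
    have key : ∀ (q : ℤ) (e : S.E) (z : S.TotE M), z ∈ S.GB M n q →
        (∀ x : Fin n → S.E, (n : ℤ) - q ≤ countIn (LinearMap.range S.inA) x →
          ((n + 1 : ℕ) : ℤ) - p ≤
            countIn (LinearMap.range S.inA) (Fin.cons e x : Fin (n + 1) → S.E)) →
        consExt k S.E M (e ⊗ₜ z) ∈
          (hochFilt (LinearMap.range S.inA) M p (n + 1)).map (S.ofHoch M (n + 1)) := by
      intro q e z hz hq
      obtain ⟨x, hx, rfl⟩ := ih q hz
      rw [consExt_tmul]
      refine (Submodule.span_le (p := ((hochFilt (LinearMap.range S.inA) M p (n + 1)).map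
        (S.ofHoch M (n + 1))).comap
          (Tot.cons k (Bar k S.E) M (bar k S.E e) ∘ₗ S.ofHoch M n))).2 ?_ hx
      rintro _ ⟨m, x, hx, rfl⟩
      change Tot.cons k (Bar k S.E) M (bar k S.E e) (Tot.inc k (Bar k S.E) M n (_ ⊗ₜ m)) ∈
        (hochFilt (LinearMap.range S.inA) M p (n + 1)).map (S.ofHoch M (n + 1))
      rw [Tot.cons_inc, cons_bar_tprod]
      exact ⟨_, Submodule.subset_span ⟨m, _, hq x hx, rfl⟩, rfl⟩
    rintro _ ⟨ξ, hξ, rfl⟩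
    refine apply_mem_of_mem_EF _ (fun a z hz => key p _ z hz fun x hx => ?_)
      (fun e z hz => key (p - 1) e z hz fun x hx => ?_) hξ
    · rw [countIn_cons, if_pos ⟨a, rfl⟩]; push_cast; lia
    · rw [countIn_cons]; push_cast; split_ifs <;> lia

lemma toHoch_mem {n : ℕ} {p : ℤ} {u : S.TotE M} (hu : u ∈ S.GB M n p) :
    S.toHoch M n u ∈ hochFilt (LinearMap.range S.inA) M p n := by
  obtain ⟨x, hx, rfl⟩ := S.GB_le_map n p hu
  rwa [toHoch_ofHoch]

lemma ofHoch_toHoch {n : ℕ} {p : ℤ} {u : S.TotE M} (hu : u ∈ S.GB M n p) :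
    S.ofHoch M n (S.toHoch M n u) = u := by
  obtain ⟨x, -, rfl⟩ := S.GB_le_map n p hu
  rw [toHoch_ofHoch]

variable [Module S.Eᵐᵒᵖ M] [IsScalarTower k S.Eᵐᵒᵖ M]

/-- In the bar differential of `x ⊗ w ⊗ m` only the first face has a coefficient in `E` other than
`1`; it becomes `m x ⊗ w`, the first Hochschild face. -/
lemma bM_ofHoch (n : ℕ) (x : M ⊗[k] (⨂[k]^(n + 1) (Bar k S.E))) :
    S.bM M (S.ofHoch M (n + 1) x) = S.ofHoch M n (hochDiff k S.E M n x) := by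
  have key : ∀ (m : M) (t : (⨂[k]^n (Bar k S.E)) ⊗[k] S.E),
      S.ofHoch M n (wrap (leftAct k S.E M) (m ⊗ₜ t)) = absorbTail n m t := fun m t => by
    induction t using TensorProduct.induction_on with
    | zero => simp
    | add x y hx hy => simp only [TensorProduct.tmul_add, map_add, hx, hy]
    | tmul w y => simp [ofHoch_tmul]
  induction x using TensorProduct.induction_on with
  | zero => simp
  | add x y hx hy => simp only [map_add, hx, hy]
  | tmul m w =>
    induction w using induction_cons with
    | h0 => simp
    | hadd x y hx hy => simp only [TensorProduct.tmul_add, map_add, hx, hy]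
    | h x w =>
      rw [hochDiff, hochD_tmul, map_sub, key, ofHoch_tmul, ← Tot.cons_inc, bM,
        LinearMap.comp_apply, barD_cons_inc, map_sub, actOn_tmul, actOn_tmul, rmulU_one,
        rmulU_apply, Tot.map_inc, rightAct_tmul, ofHoch_tmul]
      rfl

end Hochschild

end CrossedSystem

end HochschildSerre

/-! ### Naturality of the identification of homology by cycles. -/

section Naturality

variable {k : Type u} [CommRing k]

/-- The isomorphism is built from its inverse, which is explicit on classes. Evaluating that inverse
on the class of `z` gives the value of the isomorphism on a cycle represented by `z`. -/
lemma homologyIsoOfCycles_hom_π (S : ShortComplex (ModuleCat.{w} k)) {P : Type w} [AddCommGroup P]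
    [Module k P] (φ : P →ₗ[k] S.X₂) (hφ : ∀ x, S.g.hom x = 0 ↔ ∃ z, φ z = x) (N : Submodule k P)
    (hN : ∀ z, z ∈ N ↔ ∃ y, S.f.hom y = φ z) (c : S.cycles) (z : P)
    (h : S.iCycles.hom c = φ z) :
    (homologyIsoOfCycles S φ hφ N hN).hom.hom (S.homologyπ.hom c) = Submodule.Quotient.mk z := by
  have e1 : S.moduleCatHomologyIso.hom.hom (S.homologyπ.hom c) =
      S.moduleCatLeftHomologyData.π.hom (S.moduleCatCyclesIso.hom.hom c) :=
    congrArg (fun f => f.hom c) S.π_moduleCatCyclesIso_hom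
  have e2 : (S.moduleCatCyclesIso.hom.hom c).1 = φ z :=
    (congrArg (fun f => f.hom c) S.moduleCatCyclesIso_hom_i).trans h
  have e3 : S.moduleCatCyclesIso.hom.hom c =
      (φ.codRestrict (LinearMap.ker S.g.hom) fun z => (hφ _).2 ⟨z, rfl⟩) z := Subtype.ext e2
  have e4 : (homologyIsoOfCycles S φ hφ N hN).inv.hom (Submodule.Quotient.mk z) =
      S.moduleCatHomologyIso.inv.hom (S.moduleCatLeftHomologyData.π.hom
        ((φ.codRestrict (LinearMap.ker S.g.hom) fun z => (hφ _).2 ⟨z, rfl⟩) z)) := rfl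
  rw [← e3, ← e1] at e4
  have e5 : S.moduleCatHomologyIso.inv.hom (S.moduleCatHomologyIso.hom.hom (S.homologyπ.hom c)) =
      S.homologyπ.hom c := 
    congrArg (fun f => f.hom (S.homologyπ.hom c)) S.moduleCatHomologyIso.hom_inv_id
  rw [← e5, ← e4]
  exact congrArg (fun f => f.hom (Submodule.Quotient.mk z))
    (homologyIsoOfCycles S φ hφ N hN).inv_hom_id

lemma homologyIsoOfCycles_naturality {S S' : ShortComplex (ModuleCat.{w} k)} (τ : S ⟶ S')
    {P P' : Type w} [AddCommGroup P] [Module k P] [AddCommGroup P'] [Module k P']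
    (φ : P →ₗ[k] S.X₂) (hφ : ∀ x, S.g.hom x = 0 ↔ ∃ z, φ z = x) (N : Submodule k P)
    (hN : ∀ z, z ∈ N ↔ ∃ y, S.f.hom y = φ z)
    (φ' : P' →ₗ[k] S'.X₂) (hφ' : ∀ x, S'.g.hom x = 0 ↔ ∃ z, φ' z = x) (N' : Submodule k P')
    (hN' : ∀ z, z ∈ N' ↔ ∃ y, S'.f.hom y = φ' z) (α : P →ₗ[k] P') (hα : N ≤ N'.comap α)
    (h : ∀ z, φ' (α z) = τ.τ₂.hom (φ z)) :
    ShortComplex.homologyMap τ ≫ (homologyIsoOfCycles S' φ' hφ' N' hN').hom =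
      (homologyIsoOfCycles S φ hφ N hN).hom ≫ ModuleCat.ofHom (Submodule.mapQ N N' α hα) := by
  rw [← cancel_epi S.homologyπ]
  refine ModuleCat.hom_ext (LinearMap.ext fun c => ?_)
  obtain ⟨z, hz⟩ := (hφ (S.iCycles.hom c)).1 (congrArg (fun f => f.hom c) S.iCycles_g)
  simp only [ModuleCat.hom_comp, LinearMap.comp_apply]
  have e1 : (ShortComplex.homologyMap τ).hom (S.homologyπ.hom c) =
      S'.homologyπ.hom ((ShortComplex.cyclesMap τ).hom c) :=
    congrArg (fun f => f.hom c) (ShortComplex.homologyπ_naturality τ)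
  have e2 : S'.iCycles.hom ((ShortComplex.cyclesMap τ).hom c) = φ' (α z) := by
    rw [h, hz]
    exact congrArg (fun f => f.hom c) (ShortComplex.cyclesMap_i τ)
  rw [e1, homologyIsoOfCycles_hom_π S' φ' hφ' N' hN' _ _ e2,
    homologyIsoOfCycles_hom_π S φ hφ N hN c z hz.symm]
  rfl

end Naturality

/-! ### Spectral sequences: filtered morphisms and filtered homotopies. -/

namespace FilteredComplex

variable {k : Type u} [CommRing k] {C D D' : FilteredComplex.{u, w} k}

/-- A morphism of complexes preserves the filtrations. -/
def Preserves (f : C.K ⟶ D.K) : Prop := ∀ p n x, x ∈ C.F p n → (f.f n).hom x ∈ D.F p n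

lemma map_d (f : C.K ⟶ D.K) (i j : ℕ) (x : C.K.X i) :
    (f.f j).hom ((C.K.d i j).hom x) = (D.K.d i j).hom ((f.f i).hom x) :=
  (congrArg (fun f => f.hom x) (f.comm i j)).symm

lemma map_mem_Z {f : C.K ⟶ D.K} (hf : Preserves f) {r p : ℤ} {n : ℕ} {x : C.K.X n}
    (hx : x ∈ C.Z r p n) : (f.f n).hom x ∈ D.Z r p n := by
  rw [mem_Z] at hx ⊢
  exact ⟨hf _ _ _ hx.1, fun j => by rw [← map_d]; exact hf _ _ _ (hx.2 j)⟩

lemma map_mem_B {f : C.K ⟶ D.K} (hf : Preserves f) {r p : ℤ} {n : ℕ} {x : C.K.X n}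
    (hx : x ∈ C.B r p n) : (f.f n).hom x ∈ D.B r p n := by
  obtain ⟨z, hz, y, hy, rfl⟩ := mem_B.1 hx
  exact mem_B.2 ⟨_, map_mem_Z hf hz, _, map_mem_Z hf hy, by rw [map_add, map_d]⟩

/-- The map induced on the pages by a filtered morphism. -/
noncomputable def mapE {f : C.K ⟶ D.K} (hf : Preserves f) (r p : ℤ) (n : ℕ) :
    C.E r p n →ₗ[k] D.E r p n :=
  Submodule.mapQ _ _ ((f.f n).hom.restrict fun _ hx => map_mem_Z hf hx)
    fun _ hx => map_mem_B hf hx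

lemma mapE_mk {f : C.K ⟶ D.K} (hf : Preserves f) {r p : ℤ} {n : ℕ} (x : C.Z r p n) :
    mapE hf r p n (Submodule.Quotient.mk x) =
      Submodule.Quotient.mk ⟨(f.f n).hom x.1, map_mem_Z hf x.2⟩ := rfl

/-- The morphism of pages induced by a filtered morphism. -/
noncomputable def pageMap {f : C.K ⟶ D.K} (hf : Preserves f) (r : ℤ) : C.page r ⟶ D.page r where
  f a := ModuleCat.ofHom (mapE hf r a.1 a.2)
  comm' a b h := by
    rw [C.page_d h.1 h.2, D.page_d h.1 h.2]
    refine ModuleCat.hom_ext (LinearMap.ext fun x => ?_)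
    obtain ⟨x, rfl⟩ := Submodule.Quotient.mk_surjective _ x
    refine congrArg Submodule.Quotient.mk (Subtype.ext ?_)
    exact (map_d f a.2 b.2 x.1).symm

lemma mapE_toE {f : C.K ⟶ D.K} (hf : Preserves f) {r p : ℤ} {n : ℕ} (z : C.Z (r + 1) p n) :
    D.toE r p n ⟨(f.f n).hom z.1, map_mem_Z hf z.2⟩ = mapE hf r p n (C.toE r p n z) := by
  rw [toE_apply, toE_apply, mapE_mk]

lemma pageMap_f_hom {f : C.K ⟶ D.K} (hf : Preserves f) (r p : ℤ) (n : ℕ) :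
    (pageMap hf r).f (p, n) = ModuleCat.ofHom (mapE hf r p n) := rfl

lemma shortComplexFunctor_pageMap_τ₂ {f : C.K ⟶ D.K} (hf : Preserves f) (r p : ℤ) (n : ℕ) :
    ((HomologicalComplex.shortComplexFunctor _ _ (p, n)).map (pageMap hf r)).τ₂ =
      (pageMap hf r).f (p, n) := rfl

lemma pageMap_pageIso {f : C.K ⟶ D.K} (hf : Preserves f) (r p : ℤ) (n : ℕ) :
    HomologicalComplex.homologyMap (pageMap hf r) (p, n) ≫ (D.pageIso r p n).hom =
      (C.pageIso r p n).hom ≫ (pageMap hf (r + 1)).f (p, n) := by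
  rw [pageMap_f_hom, mapE]
  refine homologyIsoOfCycles_naturality
    ((HomologicalComplex.shortComplexFunctor _ _ (p, n)).map (pageMap hf r))
    (C.toE r p n) (C.toE_spec r p n) _ (C.toE_boundary r p n)
    (D.toE r p n) (D.toE_spec r p n) _ (D.toE_boundary r p n)
    ((f.f n).hom.restrict fun _ hx => map_mem_Z hf hx) (fun _ hx => map_mem_B hf hx) fun z => ?_
  rw [shortComplexFunctor_pageMap_τ₂, pageMap_f_hom]
  exact mapE_toE hf z

/-- The morphism of spectral sequences induced by a filtered morphism. -/
noncomputable def spectralSequenceMap {f : C.K ⟶ D.K} (hf : Preserves f) :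
    C.spectralSequence ⟶ D.spectralSequence where
  hom r _ := pageMap hf r
  comm r r' pq h _ := by
    subst h
    -- Once `r'` is replaced by `r + 1`, the transport in the definition of the spectral sequence is
    -- an identity.
    have e : ∀ F : FilteredComplex.{u, w} k, F.spectralSequence.iso r (r + 1) pq =
        F.pageIso r pq.1 pq.2 := fun F => by
      simp only [spectralSequence]
      exact Iso.ext (Category.comp_id _)
    rw [e, e]
    exact pageMap_pageIso hf r pq.1 pq.2

/-- An endomorphism is homotopic to the identity by a homotopy that preserves the filtration. -/
def HomotopicToId (f : C.K ⟶ C.K) : Prop :=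
  ∃ h : ∀ n, C.K.X n →ₗ[k] C.K.X (n + 1), (∀ p n x, x ∈ C.F p n → h n x ∈ C.F p (n + 1)) ∧
    (∀ x, (f.f 0).hom x + (C.K.d 1 0).hom (h 0 x) = x) ∧
    ∀ n x, (f.f (n + 1)).hom x + (C.K.d (n + 2) (n + 1)).hom (h (n + 1) x) +
      h n ((C.K.d (n + 1) n).hom x) = x

/-- Takes `y = h x` and `z = h (d x)`. In degree `0` there is no `z`-term, and this uniform
statement spares later case distinctions. -/
lemma HomotopicToId.exists_eq {f : C.K ⟶ C.K} (hf : HomotopicToId f) {p q : ℤ} {n : ℕ}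
    {x : C.K.X n} (hx : x ∈ C.F p n) (hx' : ∀ j, (C.K.d n j).hom x ∈ C.F q j) :
    ∃ y ∈ C.F p (n + 1), ∃ z ∈ C.F q n, x = (f.f n).hom x + (C.K.d (n + 1) n).hom y + z := by
  obtain ⟨h, hF, h0, hs⟩ := hf
  rcases n with _ | n
  · exact ⟨_, hF _ _ _ hx, 0, Submodule.zero_mem _, by rw [h0, add_zero]⟩
  · exact ⟨_, hF _ _ _ hx, _, hF _ _ _ (hx' n), (hs n x).symm⟩

/-- `f x - x = -h(d x) - d(h x)`. Here `h(d x)` lies in `F_{p-r}`, hence in `F_{p-1}`, and `h x` in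
`F_p`, hence in `F_{p+r-1}`; both inclusions need `r ≥ 1`. The conditions on their differentials
follow from the same identity. -/
lemma HomotopicToId.sub_mem_B {f : C.K ⟶ C.K} (hf : HomotopicToId f) (hF : Preserves f)
    {r p : ℤ} (hr : 1 ≤ r) {n : ℕ} {x : C.K.X n} (hx : x ∈ C.Z r p n) :
    (f.f n).hom x - x ∈ C.B r p n := by
  have hx' := mem_Z.1 hx
  obtain ⟨y, hy, z, hz, e⟩ := hf.exists_eq hx'.1 hx'.2
  have hfx := hF _ _ _ hx'.1
  refine mem_B.2 ⟨-z, Submodule.neg_mem _ (mem_Z.2 ⟨C.mono _ _ _ (by lia) hz, fun j => ?_⟩),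
    -y, Submodule.neg_mem _ (mem_Z.2 ⟨C.mono _ _ _ (by lia) hy, fun j => ?_⟩), ?_⟩
  · have e' : z = x - (f.f n).hom x - (C.K.d (n + 1) n).hom y := by nth_rewrite 1 [e]; abel
    rw [e', map_sub, map_sub, dd_apply, sub_zero, ← map_d]
    exact C.mono _ _ _ (by lia) (Submodule.sub_mem _ (hx'.2 j) (hF _ _ _ (hx'.2 j)))
  · by_cases hj : n = j
    · subst hj
      have e' : (C.K.d (n + 1) n).hom y = x - (f.f n).hom x - z := by nth_rewrite 1 [e]; abel
      rw [e']
      exact Submodule.sub_mem _ (Submodule.sub_mem _ (C.mono _ _ _ (by lia) hx'.1)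
        (C.mono _ _ _ (by lia) hfx)) (C.mono _ _ _ (by lia) hz)
    · rw [C.K.shape (n + 1) j fun h => hj (Nat.succ_injective h).symm]
      exact Submodule.zero_mem _
  · nth_rewrite 2 [e]
    rw [map_neg]
    abel

lemma HomotopicToId.homologyMap_eq {f : C.K ⟶ C.K} (hf : HomotopicToId f) (n : ℕ) :
    HomologicalComplex.homologyMap f n = 𝟙 _ := by
  rw [← cancel_epi (C.K.homologyπ n), HomologicalComplex.homologyπ_naturality, Category.comp_id]
  refine ModuleCat.hom_ext (LinearMap.ext fun z => ?_)
  obtain ⟨h, -, h0, hs⟩ := hf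
  have hz : ∀ j, (C.K.d n j).hom ((C.K.iCycles n).hom z) = 0 := fun j =>
    congrArg (fun f => f.hom z) (C.K.iCycles_d n j)
  have key : (f.f n).hom ((C.K.iCycles n).hom z) +
      (C.K.d (n + 1) n).hom (h n ((C.K.iCycles n).hom z)) = (C.K.iCycles n).hom z := by
    rcases n with _ | n
    · exact h0 _
    · have e := hs n ((C.K.iCycles (n + 1)).hom z)
      rwa [hz, map_zero, add_zero] at e
  have e1 : (C.K.iCycles n).hom ((HomologicalComplex.cyclesMap f n).hom z) =
      (f.f n).hom ((C.K.iCycles n).hom z) :=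
    congrArg (fun f => f.hom z) (HomologicalComplex.cyclesMap_i f n)
  have e2 : ∀ y, (C.K.iCycles n).hom ((C.K.toCycles (n + 1) n).hom y) =
      (C.K.d (n + 1) n).hom y := fun y =>
    congrArg (fun f => f.hom y) (C.K.toCycles_i (n + 1) n)
  have e3 : (HomologicalComplex.cyclesMap f n).hom z +
      (C.K.toCycles (n + 1) n).hom (h n ((C.K.iCycles n).hom z)) = z := by
    refine (ModuleCat.mono_iff_injective (C.K.iCycles n)).1 inferInstance ?_
    exact (map_add _ _ _).trans ((congrArg₂ (· + ·) e1 (e2 _)).trans key)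
  have e4 : ∀ y, (C.K.homologyπ n).hom ((C.K.toCycles (n + 1) n).hom y) = 0 := fun y =>
    congrArg (fun f => f.hom y) (C.K.toCycles_comp_homologyπ (n + 1) n)
  simp only [ModuleCat.hom_comp, LinearMap.comp_apply]
  conv_rhs => rw [← e3, map_add, e4, add_zero]

lemma pageMap_comp_eq_id {f : C.K ⟶ D.K} {g : D.K ⟶ C.K} (hf : Preserves f) (hg : Preserves g)
    (h : HomotopicToId (f ≫ g)) {r : ℤ} (hr : 1 ≤ r) : pageMap hf r ≫ pageMap hg r = 𝟙 _ := by
  refine HomologicalComplex.hom_ext _ _ fun a => ModuleCat.hom_ext (LinearMap.ext fun x => ?_)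
  obtain ⟨x, rfl⟩ := Submodule.Quotient.mk_surjective _ x
  exact (Submodule.Quotient.eq _).2
    (h.sub_mem_B (fun p n x hx => hg p n _ (hf p n x hx)) hr x.2)

lemma homologyMap_comp_eq_id {f : C.K ⟶ D.K} {g : D.K ⟶ C.K} (h : HomotopicToId (f ≫ g)) (n : ℕ) :
    HomologicalComplex.homologyMap f n ≫ HomologicalComplex.homologyMap g n = 𝟙 _ := by
  rw [← HomologicalComplex.homologyMap_comp, h.homologyMap_eq]

/-- The image of the cycle serves on all pages and in homology at once, since all the maps are
induced by the same chain map. -/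
lemma exists_compat {f : C.K ⟶ D.K} (hf : Preserves f) (p : ℤ) (n : ℕ) (z : C.K.cycles n)
    (hz : (C.K.iCycles n).hom z ∈ C.F p n) :
    ∃ (y : D.K.cycles n) (hy : (D.K.iCycles n).hom y ∈ D.F p n),
      (HomologicalComplex.homologyMap f n).hom ((C.K.homologyπ n).hom z) =
        (D.K.homologyπ n).hom y ∧
      ∀ r : ℤ, ((pageMap hf r).f (p, n)).hom (cls r p z hz) = cls r p y hy := by
  have e : (D.K.iCycles n).hom ((HomologicalComplex.cyclesMap f n).hom z) =
      (f.f n).hom ((C.K.iCycles n).hom z) :=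
    congrArg (fun f => f.hom z) (HomologicalComplex.cyclesMap_i f n)
  refine ⟨(HomologicalComplex.cyclesMap f n).hom z, by rw [e]; exact hf _ _ _ hz,
    congrArg (fun f => f.hom z) (HomologicalComplex.homologyπ_naturality f n), fun r => ?_⟩
  exact congrArg Submodule.Quotient.mk (Subtype.ext e.symm)

/-- A filtered homotopy equivalence induces an isomorphism of convergent spectral sequences. -/
noncomputable def convergentIsoOfHomotopyEquiv {f : C.K ⟶ D.K} {g : D.K ⟶ C.K} (hf : Preserves f)
    (hg : Preserves g) (hfg : HomotopicToId (f ≫ g)) (hgf : HomotopicToId (g ≫ f)) :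
    C.ConvergentIso D where
  ss :=
    { hom := spectralSequenceMap hf
      inv := spectralSequenceMap hg
      hom_inv_id := SpectralSequence.hom_ext fun _ hr => pageMap_comp_eq_id hf hg hfg hr
      inv_hom_id := SpectralSequence.hom_ext fun _ hr => pageMap_comp_eq_id hg hf hgf hr }
  hom n :=
    { hom := HomologicalComplex.homologyMap f n
      inv := HomologicalComplex.homologyMap g n
      hom_inv_id := homologyMap_comp_eq_id hfg n
      inv_hom_id := homologyMap_comp_eq_id hgf n }
  compat p n z hz := by
    obtain ⟨y, hy, e, e'⟩ := exists_compat hf p n z hz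
    exact ⟨y, hy, e, fun r _ => e' r⟩
  compat_inv p n y hy := by
    obtain ⟨z, hz, e, e'⟩ := exists_compat hg p n y hy
    exact ⟨z, hz, e, fun r _ => e' r⟩

end FilteredComplex

namespace HochschildSerre

/-! ### Splitting `V^t` as `V^s ⊗ V^n`. -/

section Split

variable {k : Type*} [CommRing k] {V : Type*} [AddCommGroup V] [Module k V]

/-- The decomposition `V^t ≃ V^s ⊗ V^n` for `t = s + n`. -/
noncomputable def split {s n t : ℕ} (h : s + n = t) :
    (⨂[k]^t V) ≃ₗ[k] (⨂[k]^s V) ⊗[k] (⨂[k]^n V) :=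
  (TensorPower.cast k V h.symm).trans TensorPower.mulEquiv.symm

lemma split_symm_tprod {s n t : ℕ} (h : s + n = t) (x : Fin s → V) (y : Fin n → V) :
    (split (k := k) h).symm (PiTensorProduct.tprod k x ⊗ₜ PiTensorProduct.tprod k y) =
      PiTensorProduct.tprod k (Fin.append x y ∘ Fin.cast h.symm) := by
  have h1 := TensorPower.tprod_mul_tprod k x y
  rw [TensorPower.gMul_def] at h1
  subst h
  rw [split, LinearEquiv.trans_symm, LinearEquiv.trans_apply, LinearEquiv.symm_symm, h1,
    TensorPower.cast_symm, TensorPower.cast_tprod]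

lemma split_symm_cons {s n t : ℕ} (h : s + n = t) (h' : s + 1 + n = t + 1) (v : V)
    (w : ⨂[k]^s V) (w' : ⨂[k]^n V) :
    (split (k := k) h').symm (cons k V s (v ⊗ₜ w) ⊗ₜ w') =
      cons k V t (v ⊗ₜ (split (k := k) h).symm (w ⊗ₜ w')) := by
  induction w using PiTensorProduct.induction_on with
  | add x y hx hy =>
    simp only [TensorProduct.tmul_add, TensorProduct.add_tmul, map_add] at hx hy ⊢
    rw [hx, hy]
  | smul_tprod c x =>
    simp only [TensorProduct.tmul_smul, ← TensorProduct.smul_tmul', map_smul]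
    congr 1
    induction w' using PiTensorProduct.induction_on with
    | add x y hx hy =>
      simp only [TensorProduct.tmul_add, map_add] at hx hy ⊢
      rw [hx, hy]
    | smul_tprod c y =>
      simp only [TensorProduct.tmul_smul, map_smul]
      congr 1
      rw [cons_tmul_tprod, split_symm_tprod, split_symm_tprod, cons_tmul_tprod, Fin.append_cons]
      congr 1
      subst h
      funext i
      refine Fin.cases ?_ (fun j => ?_) i
      · rfl
      · rfl

/-- A new first factor joins the left block, so the splitting in `d̂^l` can be unrolled factor by
factor. -/
lemma split_cons {s n t : ℕ} (h : s + n = t) (h' : s + 1 + n = t + 1) (v : V) (w : ⨂[k]^t V) :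
    split (k := k) h' (cons k V t (v ⊗ₜ w)) =
      ((cons k V s).toLinearMap ∘ₗ TensorProduct.mk k V _ v).rTensor _ (split h w) := by
  obtain ⟨ξ, rfl⟩ := (split (k := k) h).symm.surjective w
  rw [LinearEquiv.apply_symm_apply]
  induction ξ using TensorProduct.induction_on with
  | zero => simp
  | add x y hx hy => simp only [TensorProduct.tmul_add, map_add, hx, hy]
  | tmul w w' => rw [← split_symm_cons h h', LinearEquiv.apply_symm_apply]; rfl

lemma split_symm_zero {n t : ℕ} (h : 0 + n = t) (h' : n = t) (w : ⨂[k]^n V) :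
    (split (k := k) h).symm (PiTensorProduct.tprod k ![] ⊗ₜ w) = TensorPower.cast k V h' w := by
  induction w using PiTensorProduct.induction_on with
  | add x y hx hy => simp only [TensorProduct.tmul_add, map_add, hx, hy]
  | smul_tprod c x =>
    simp only [TensorProduct.tmul_smul, map_smul]
    congr 1
    subst h'
    rw [split_symm_tprod, TensorPower.cast_tprod]
    congr 1
    funext i
    have : Fin.cast h.symm i = Fin.natAdd 0 i := by ext; simp
    rw [Function.comp_apply, this, Fin.append_right]
    rfl

end Split

namespace CrossedSystem

variable {k A H : Type*} [CommRing k] [Ring A] [Algebra k A] [Ring H] [HopfAlgebra k H]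
  (S : CrossedSystem k A H)

/-! ### The closed form of the recursively defined differential. -/

section Components

variable {M : Type*} [AddCommGroup M] [Module k M]

variable (M) in
/-- `w ⊗ (a ⊗ p) ↦ ∑ a^(w₁) ⊗ (w₂ ⊗ p)`. -/
noncomputable def passH (s : ℕ) : (⨂[k]^s (Bar k H)) ⊗[k] (A ⊗[k] S.TotA M) →ₗ[k]
    S.E ⊗[k] S.TotHA M :=
  S.jA _ ∘ₗ crossPass (iterL S.chiHb s) (Tot.inc k (Bar k H) (S.TotA M) s)

lemma passH_tmul (s : ℕ) (w : ⨂[k]^s (Bar k H)) (a : A) (p : S.TotA M) :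
    S.passH M s (w ⊗ₜ (a ⊗ₜ p)) = S.jA _ ((Tot.inc k (Bar k H) (S.TotA M) s).lTensor A
      (TensorProduct.assoc k A _ _ (iterL S.chiHb s (w ⊗ₜ a) ⊗ₜ p))) := rfl

lemma passH_one (s : ℕ) (w : ⨂[k]^s (Bar k H)) (p : S.TotA M) :
    S.passH M s (w ⊗ₜ (1 ⊗ₜ p)) = 1 ⊗ₜ Tot.inc k (Bar k H) (S.TotA M) s (w ⊗ₜ p) := by
  rw [passH_tmul, iterL_of_comm S.chiHb 1 S.chiHb_tmul_one, TensorProduct.assoc_tmul,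
    LinearMap.lTensor_tmul, jA_tmul, inA_one]

lemma crossPass_iterL_cons {V C Z : Type*} [AddCommGroup V] [Module k V] [AddCommGroup C]
    [Module k C] [AddCommGroup Z] [Module k Z] (β : V ⊗[k] C →ₗ[k] C ⊗[k] V) (s : ℕ) (v : V)
    (w : ⨂[k]^s V) (ζ : C ⊗[k] Z) :
    crossPass (iterL β (s + 1)) (Tot.inc k V Z (s + 1)) (cons k V s (v ⊗ₜ w) ⊗ₜ ζ) =
      crossPass β (TensorProduct.lift (Tot.cons k V Z))
        (v ⊗ₜ crossPass (iterL β s) (Tot.inc k V Z s) (w ⊗ₜ ζ)) := by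
  induction ζ using TensorProduct.induction_on with
  | zero => simp
  | add x y hx hy => simp only [TensorProduct.tmul_add, map_add, hx, hy]
  | tmul c z =>
    rw [crossPass_tmul, crossPass_tmul, iterL_cons]
    generalize iterL β s (w ⊗ₜ c) = t
    induction t using TensorProduct.induction_on with
    | zero => simp
    | add x y hx hy => simp only [TensorProduct.tmul_add, TensorProduct.add_tmul, map_add, hx, hy]
    | tmul c w =>
      rw [crossPass_tmul, TensorProduct.assoc_tmul, LinearMap.lTensor_tmul, crossPass_tmul]
      generalize β (v ⊗ₜ c) = u
      induction u using TensorProduct.induction_on with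
      | zero => simp
      | add x y hx hy => simp only [TensorProduct.add_tmul, map_add, hx, hy]
      | tmul c v => simp

lemma sMap_toE_tmul (u : A ⊗[k] H) (y : S.TotHA M) :
    S.sMap M (S.toE u ⊗ₜ y) = S.jA _ ((S.consF y).lTensor A u) := by
  induction u using TensorProduct.induction_on with
  | zero => simp
  | add x y hx hy => simp only [TensorProduct.add_tmul, map_add, hx, hy]
  | tmul a h => rfl

lemma sMap_inH_smul_jA (h : H) (ξ : A ⊗[k] S.TotHA M) :
    S.sMap M (S.inH h • S.jA _ ξ) = S.jA _ (crossPass S.chiHb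
      (TensorProduct.lift (Tot.cons k (Bar k H) (S.TotA M))) (bar k H h ⊗ₜ ξ)) := by
  induction ξ using TensorProduct.induction_on with
  | zero => simp
  | add x y hx hy => simp only [TensorProduct.tmul_add, smul_add, map_add, hx, hy]
  | tmul a y =>
    rw [jA_tmul, TensorProduct.smul_tmul', smul_eq_mul, inH_mul_inA, sMap_toE_tmul,
      crossPass_tmul, chiHb, liftBar_tmul, LinearMap.comp_apply]
    generalize S.chi (h ⊗ₜ a) = u
    induction u using TensorProduct.induction_on with
    | zero => simp
    | add x y hx hy => simp only [TensorProduct.add_tmul, map_add, hx, hy]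
    | tmul a h => rfl

/-- Multiplying by `1 # h` and applying `s` carries the coefficient in `A` across one more factor.
Iterating the `s`-term of `dW_cons` thus produces the twisted action that occurs in `d̂⁰`. -/
lemma passH_cons (s : ℕ) (h : H) (w : ⨂[k]^s (Bar k H)) (ζ : A ⊗[k] S.TotA M) :
    S.passH M (s + 1) (cons k (Bar k H) s (bar k H h ⊗ₜ w) ⊗ₜ ζ) =
      S.sMap M (S.inH h • S.passH M s (w ⊗ₜ ζ)) := by
  rw [passH, LinearMap.comp_apply, crossPass_iterL_cons, ← sMap_inH_smul_jA]
  rfl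

lemma passH_zero (w : ⨂[k]^0 (Bar k H)) (ζ : A ⊗[k] S.TotA M) :
    S.passH M 0 (w ⊗ₜ ζ) = S.iotaA M
      (PiTensorProduct.isEmptyEquiv (R := k) (s := fun _ => Bar k H) (Fin 0) w • ζ) := by
  induction ζ using TensorProduct.induction_on with
  | zero => simp
  | add x y hx hy => simp only [TensorProduct.tmul_add, smul_add, map_add, hx, hy]
  | tmul a p =>
    have e : iterL S.chiHb 0 (w ⊗ₜ a) = a ⊗ₜ w := rfl
    rw [passH_tmul, e, TensorProduct.assoc_tmul, LinearMap.lTensor_tmul, Tot.inc_zero, jA_tmul,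
      ← TensorProduct.tmul_smul, iotaA_tmul]

variable [Module S.E M] [IsScalarTower k S.E M]

/-- `w ⊗ y ↦ w ⊗ (y · p)`. -/
noncomputable def tailW (s : ℕ) (p : S.TotA M) : (⨂[k]^s (Bar k H)) ⊗[k] H →ₗ[k] S.TotHA M :=
  Tot.inc k (Bar k H) (S.TotA M) s ∘ₗ ((S.actH M).flip p).lTensor _

@[simp]
lemma tailW_tmul (s : ℕ) (p : S.TotA M) (w : ⨂[k]^s (Bar k H)) (y : H) :
    S.tailW s p (w ⊗ₜ y) = Tot.inc k (Bar k H) (S.TotA M) s (w ⊗ₜ S.actH M y p) := rfl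

lemma tailW_consB (s : ℕ) (p : S.TotA M) (v : Bar k H) (t : (⨂[k]^s (Bar k H)) ⊗[k] H) :
    S.tailW (s + 1) p (consB k H s (v ⊗ₜ t)) =
      Tot.cons k (Bar k H) (S.TotA M) v (S.tailW s p t) := by
  induction t using TensorProduct.induction_on with
  | zero => simp
  | add x y hx hy => simp only [TensorProduct.tmul_add, map_add, hx, hy]
  | tmul w y => simp

/-- `a ⊗ (w ⊗ y) ↦ a ⊗ (w ⊗ (y · p))`. -/
noncomputable def tailE (s : ℕ) (p : S.TotA M) :
    A ⊗[k] ((⨂[k]^s (Bar k H)) ⊗[k] H) →ₗ[k] S.E ⊗[k] S.TotHA M :=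
  S.jA _ ∘ₗ (S.tailW s p).lTensor A

@[simp]
lemma tailE_tmul (s : ℕ) (p : S.TotA M) (a : A) (t : (⨂[k]^s (Bar k H)) ⊗[k] H) :
    S.tailE s p (a ⊗ₜ t) = S.inA a ⊗ₜ S.tailW s p t := rfl

lemma tailE_hhA (s : ℕ) (p : S.TotA M) (u : A ⊗[k] H) (w : ⨂[k]^s (Bar k H)) :
    S.tailE (s + 1) p (hhA k A H s (u ⊗ₜ w)) =
      S.sMap M (S.toE u ⊗ₜ Tot.inc k (Bar k H) (S.TotA M) s (w ⊗ₜ p)) := by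
  rw [sMap_toE_tmul]
  induction u using TensorProduct.induction_on with
  | zero => simp
  | add x y hx hy => simp only [TensorProduct.add_tmul, map_add, hx, hy]
  | tmul a h => rw [hhA_tmul, tailE_tmul, tailW_tmul, actH_one, LinearMap.lTensor_tmul, jA_tmul,
      consF_apply, Tot.cons_inc]

lemma tailE_hhB (s : ℕ) (p : S.TotA M) (h : H) (ξ : A ⊗[k] ((⨂[k]^s (Bar k H)) ⊗[k] H)) :
    S.tailE (s + 1) p (hhB k A H s (S.chiT _ (h ⊗ₜ ξ))) =
      S.sMap M (S.inH h • S.tailE s p ξ) := by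
  induction ξ using TensorProduct.induction_on with
  | zero => simp
  | add x y hx hy => simp only [TensorProduct.tmul_add, smul_add, map_add, hx, hy]
  | tmul a t =>
    rw [tailE_tmul, TensorProduct.smul_tmul', smul_eq_mul, inH_mul_inA, sMap_toE_tmul, chiT_tmul]
    generalize S.chi (h ⊗ₜ a) = u
    induction u using TensorProduct.induction_on with
    | zero => simp
    | add x y hx hy => simp only [TensorProduct.add_tmul, map_add, hx, hy]
    | tmul a h => rw [hhB_tmul, tailE_tmul, tailW_consB]; rfl

/-- The recursion of `hhGamma` has the shape of the recursion of `dW`: its new term with `f` is the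
product `(1 # h)(1 # l)` under `s`, its old terms are carried across `h` with a change of sign. -/
lemma tailE_hhGamma_succ (s : ℕ) (p : S.TotA M) (h l : H) (w : ⨂[k]^s (Bar k H)) :
    S.tailE (s + 1) p ((S.hhGamma (s + 1)).1 (h ⊗ₜ cons k (Bar k H) s (bar k H l ⊗ₜ w))) =
      S.sMap M (S.inH h • (S.inH l ⊗ₜ Tot.inc k (Bar k H) (S.TotA M) s (w ⊗ₜ p) -
        S.tailE s p ((S.hhGamma s).1 (l ⊗ₜ w)))) := by
  have e : (S.hhGamma (s + 1)).1 (h ⊗ₜ cons k (Bar k H) s (bar k H l ⊗ₜ w)) =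
      S.hhStep (S.hhGamma s).1 (h ⊗ₜ (l ⊗ₜ w)) := S.hhNext_tmul _ (S.hhGamma s).2 _ _ _
  rw [e, hhStep_tmul, map_sub, tailE_hhA, tailE_hhB, smul_sub, map_sub, TensorProduct.smul_tmul',
    smul_eq_mul, inH_mul_inH]

variable (M) in
/-- The part of the differential that is given by the maps `F`. -/
noncomputable def higher : S.TotHA M →ₗ[k] S.TotHA M :=
  Tot.para 0 (-(Tot.cons k (Bar k H) (S.TotA M)).compr₂
      (Tot.nil k (Bar k H) (S.TotA M) ∘ₗ S.actR M)) (-Tot.cons k (Bar k H) (S.TotA M))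

@[simp]
lemma higher_nil (p : S.TotA M) : S.higher M (Tot.nil k (Bar k H) (S.TotA M) p) = 0 :=
  Tot.para_nil _ _ _ _

lemma higher_cons (v : Bar k H) (y : S.TotHA M) :
    S.higher M (Tot.cons k (Bar k H) (S.TotA M) v y) =
      -Tot.nil k (Bar k H) (S.TotA M) (S.actR M (Tot.cons k (Bar k H) (S.TotA M) v y)) -
        Tot.cons k (Bar k H) (S.TotA M) v (S.higher M y) :=
  (Tot.para_cons _ _ _ _ _).trans (sub_eq_add_neg _ _).symm

lemma higher_inc_zero (w : ⨂[k]^0 (Bar k H)) (p : S.TotA M) :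
    S.higher M (Tot.inc k (Bar k H) (S.TotA M) 0 (w ⊗ₜ p)) = 0 := by
  rw [Tot.inc_zero, higher_nil]

/-- `w ⊗ w' ↦ w ⊗ K (w') p` on `H̄^t = H̄^s ⊗ H̄^(n+2)`. -/
noncomputable def higherTerm (n s t : ℕ) (h : s + (n + 2) = t) (p : S.TotA M) :
    (⨂[k]^t (Bar k H)) →ₗ[k] S.TotHA M :=
  Tot.inc k (Bar k H) (S.TotA M) s ∘ₗ ((S.actK M n).flip p).lTensor _ ∘ₗ (split h).toLinearMap

lemma higherTerm_cons {n s s' t : ℕ} (h : s + (n + 2) = t) (h' : s' + (n + 2) = t + 1)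
    (p : S.TotA M) (v : Bar k H) (w : ⨂[k]^t (Bar k H)) :
    S.higherTerm n s' (t + 1) h' p (cons k (Bar k H) t (v ⊗ₜ w)) =
      Tot.cons k (Bar k H) (S.TotA M) v (S.higherTerm n s t h p w) := by
  obtain rfl : s' = s + 1 := by omega
  simp only [higherTerm, LinearMap.comp_apply, LinearEquiv.coe_coe]
  rw [split_cons h]
  generalize split (k := k) h w = ξ
  induction ξ using TensorProduct.induction_on with
  | zero => simp
  | add x y hx hy => simp only [map_add, hx, hy]
  | tmul w w' => simp

lemma higherTerm_zero {n s : ℕ} (h : s + (n + 2) = n + 2) (p : S.TotA M)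
    (w : ⨂[k]^(n + 2) (Bar k H)) :
    S.higherTerm n s (n + 2) h p w = Tot.nil k (Bar k H) (S.TotA M) (S.actK M n w p) := by
  obtain rfl : s = 0 := by omega
  have e := split_symm_zero (k := k) h rfl w
  rw [TensorPower.cast_refl, LinearEquiv.refl_apply, LinearEquiv.symm_apply_eq] at e
  simp only [higherTerm, LinearMap.comp_apply, LinearEquiv.coe_coe]
  rw [← e]
  rfl

/-- Each step of the recursion of `higher` moves the old terms one factor to the right with a change
of sign, and adds one new term in which the largest `F` acts on all the factors. The signs combine
to the common `(-1)^t`. -/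
lemma higher_inc (t : ℕ) (w : ⨂[k]^t (Bar k H)) (p : S.TotA M) :
    S.higher M (Tot.inc k (Bar k H) (S.TotA M) t (w ⊗ₜ p)) = (-1 : k) ^ t •
      ∑ i : Fin (t - 1), S.higherTerm i (t - (i + 2)) t (by omega) p w := by
  induction t with
  | zero => rw [higher_inc_zero]; exact (smul_zero _).symm
  | succ t ih =>
    induction w using Tot.cons_induction with
    | h0 => simp
    | hadd x y hx hy =>
      simp only [TensorProduct.add_tmul, map_add, Finset.sum_add_distrib, smul_add] at hx hy ⊢
      rw [hx, hy]
    | h v w =>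
      rw [← Tot.cons_inc, higher_cons, Tot.cons_inc]
      rcases t with _ | t
      · rw [actR_one, higher_inc_zero]
        simp
      · rw [actR_add_two, ih]
        change _ = (-1 : k) ^ (t + 1 + 1) • ∑ i : Fin (t + 1), _
        -- The last summand is the new term, with no factor `H̄` left in front; the others are the
        -- terms for `w` preceded by `v`.
        rw [Fin.sum_univ_castSucc, smul_add]
        have e1 : ∀ (i : Fin t) (h1 : t + 1 + 1 - (i.castSucc.1 + 2) + (i.castSucc.1 + 2) = t + 1 + 1)
            (h2 : t + 1 - (i.1 + 2) + (i.1 + 2) = t + 1),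
            S.higherTerm i.castSucc.1 (t + 1 + 1 - (i.castSucc.1 + 2)) (t + 1 + 1) h1 p
              (cons k (Bar k H) (t + 1) (v ⊗ₜ w)) =
            Tot.cons k (Bar k H) (S.TotA M) v
              (S.higherTerm i.1 (t + 1 - (i.1 + 2)) (t + 1) h2 p w) := fun i h1 h2 =>
          S.higherTerm_cons h2 h1 p v w
        have e2 : ∀ h1, S.higherTerm (Fin.last t).1 (t + 1 + 1 - ((Fin.last t).1 + 2)) (t + 1 + 1)
            h1 p (cons k (Bar k H) (t + 1) (v ⊗ₜ w)) =
            Tot.nil k (Bar k H) (S.TotA M) (S.actK M t (cons k (Bar k H) (t + 1) (v ⊗ₜ w)) p) :=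
          fun h1 => S.higherTerm_zero _ p _
        have e4 : Tot.cons k (Bar k H) (S.TotA M) v (∑ i : Fin t,
            S.higherTerm i.1 (t + 1 - (i.1 + 2)) (t + 1) (by omega) p w) = ∑ i : Fin t,
            S.higherTerm i.castSucc.1 (t + 1 + 1 - (i.castSucc.1 + 2)) (t + 1 + 1)
              (by rw [Fin.val_castSucc]; omega) p (cons k (Bar k H) (t + 1) (v ⊗ₜ w)) := by
          rw [map_sum]
          exact Finset.sum_congr rfl fun i _ => (e1 i _ _).symm
        rw [e2, ← e4, sub_eq_add_neg]
        have e3 : (-1 : k) ^ (t + 1 + 1) = -(-1) ^ (t + 1) := by rw [pow_succ, mul_neg_one]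
        rw [e3, map_smul, map_smul, neg_smul, neg_smul]
        exact add_comm _ _

variable [Module A M] [IsScalarTower k A M]

lemma dW_inc_zero (w : ⨂[k]^0 (Bar k H)) (p : S.TotA M) :
    S.dW M (Tot.inc k (Bar k H) (S.TotA M) 0 (w ⊗ₜ p)) = S.passH M 0 (w ⊗ₜ barD k A M p) := by
  rw [Tot.inc_zero, dW_nil, passH_zero, map_smul (barD k A M)]

/-- The three summands will become `d̂⁰`, `d̂¹` and the `d̂^l` with `l ≥ 2`. Each follows the
recursion `dW_cons`: the `s`-term continues all three, `(1 # h) ⊗ y` starts the second, and the `ι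
ρ`-term feeds the third, except for a single factor, where `ρ` is the action of `H` and gives the
last face of `d̂¹`. -/
lemma dW_inc_succ (s : ℕ) (h : H) (w : ⨂[k]^s (Bar k H)) (p : S.TotA M) :
    S.dW M (Tot.inc k (Bar k H) (S.TotA M) (s + 1) (cons k (Bar k H) s (bar k H h ⊗ₜ w) ⊗ₜ p)) =
      (-1 : k) ^ (s + 1) •
        S.passH M (s + 1) (cons k (Bar k H) s (bar k H h ⊗ₜ w) ⊗ₜ barD k A M p) +
      (S.inH h ⊗ₜ Tot.inc k (Bar k H) (S.TotA M) s (w ⊗ₜ p) -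
        S.tailE s p ((S.hhGamma s).1 (h ⊗ₜ w))) +
      1 ⊗ₜ S.higher M (Tot.inc k (Bar k H) (S.TotA M) (s + 1)
        (cons k (Bar k H) s (bar k H h ⊗ₜ w) ⊗ₜ p)) := by
  induction s generalizing h with
  | zero =>
    have e : (S.hhGamma 0).1 (h ⊗ₜ w) = 1 ⊗ₜ (w ⊗ₜ h) := rfl
    rw [passH_cons, ← Tot.cons_inc, dW_cons, higher_cons, Tot.cons_inc, actR_one,
      higher_inc_zero, dW_inc_zero, rhoH_apply, Tot.cons_inc, actR_one, add_zero, e, tailE_tmul,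
      tailW_tmul, Tot.inc_zero, Tot.inc_zero, Tot.aug_nil, iotaA_tmul, map_smul (S.actH M h)]
    have e' : ∀ x : S.E ⊗[k] S.TotHA M, (-1 : k) ^ (0 + 1) • x = -x := fun x => by
      rw [zero_add, pow_one]; exact neg_one_smul k x
    rw [e', inA_one, map_zero, map_zero, neg_zero, sub_zero,
      TensorProduct.tmul_zero]
    abel
  | succ s ih =>
    induction w using induction_cons with
    | h0 => simp
    | hadd x y hx hy =>
      simp only [TensorProduct.add_tmul, TensorProduct.tmul_add, map_add, smul_add] at hx hy ⊢
      rw [hx, hy]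
      abel
    | h l w =>
      have e' : ∀ x : S.E ⊗[k] S.TotHA M, (-1 : k) ^ (s + 1 + 1) • x = -((-1 : k) ^ (s + 1) • x) :=
        fun x => by rw [pow_succ, mul_neg_one]; exact neg_smul _ x
      rw [passH_cons, ← Tot.cons_inc, dW_cons, higher_cons, ih, tailE_hhGamma_succ, rhoH_apply,
        ← Tot.cons_inc (bar k H l), Tot.aug_cons, map_zero, zero_add, iotaA_tmul, inA_one, smul_add,
        smul_add, map_add, map_add, smul_comm (S.inH h) ((-1 : k) ^ (s + 1)),
        LinearMap.map_smul, TensorProduct.smul_tmul' (S.inH h) (1 : S.E), smul_eq_mul, _root_.mul_one,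
        sMap_inH_tmul, TensorProduct.tmul_sub, TensorProduct.tmul_neg,
        e']
      abel

end Components

end CrossedSystem

end HochschildSerre

namespace HochschildSerre

namespace CrossedSystem

variable {k A H : Type*} [CommRing k] [Ring A] [Algebra k A] [Ring H] [HopfAlgebra k H]
  (S : CrossedSystem k A H)

/-! ### `X̂` as a filtered part of the total module. -/

section Arrange

variable (M : Type*) [AddCommGroup M] [Module k M]

/-- `(m ⊗ w) ⊗ v ↦ w ⊗ (v ⊗ m)`. -/
noncomputable def arrange (s r : ℕ) :
    S.X M s r ≃ₗ[k] (⨂[k]^s (Bar k H)) ⊗[k] ((⨂[k]^r (Bar k A)) ⊗[k] M) :=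
  (TensorProduct.assoc k M _ _).trans ((TensorProduct.comm k M _).trans
    (TensorProduct.assoc k _ _ M))

/-- The map `(m ⊗ w) ⊗ v ↦ w ⊗ (v ⊗ m)` to the total module. -/
noncomputable def ofX (s r : ℕ) : S.X M s r →ₗ[k] S.TotHA M :=
  Tot.inc k (Bar k H) (S.TotA M) s ∘ₗ (Tot.inc k (Bar k A) M r).lTensor _ ∘ₗ
    (S.arrange M s r).toLinearMap

variable {M}

lemma ofX_tmul (s r : ℕ) (m : M) (w : ⨂[k]^s (Bar k H)) (v : ⨂[k]^r (Bar k A)) :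
    S.ofX M s r ((m ⊗ₜ w) ⊗ₜ v) =
      Tot.inc k (Bar k H) (S.TotA M) s (w ⊗ₜ Tot.inc k (Bar k A) M r (v ⊗ₜ m)) := rfl

lemma X_induction {s r : ℕ} {p : S.X M s r → Prop} (x : S.X M s r)
    (hadd : ∀ x y, p x → p y → p (x + y)) (h : ∀ m w v, p ((m ⊗ₜ w) ⊗ₜ v)) : p x := by
  have h0 : p 0 := by
    have := h 0 0 0
    rwa [TensorProduct.tmul_zero] at this
  induction x using TensorProduct.induction_on with
  | zero => exact h0
  | add x y hx hy => exact hadd _ _ hx hy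
  | tmul n v =>
    induction n using TensorProduct.induction_on with
    | zero => rwa [TensorProduct.zero_tmul]
    | add x y hx hy => rw [TensorProduct.add_tmul]; exact hadd _ _ hx hy
    | tmul m w => exact h m w v

variable (M) in
/-- The map from `X̂_n` to the total module that is `(-1)^(r s)` times the natural map on
`M ⊗ H̄^s ⊗ Ā^r`. -/
noncomputable def ofXHat (n : ℕ) : S.XHat M n →ₗ[k] S.TotHA M :=
  -- In `dW` the bar differential of `A` carries the sign `(-1)^s` and the part `d̂¹` carries none,
  -- while `X̂` has no sign on `d̂⁰` and `(-1)^r` on `d̂¹`. The factor `(-1)^(rs)` exchanges the two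
  -- conventions.
  DirectSum.toModule k _ _ fun p => (-1 : k) ^ (p.1.1 * p.1.2) • S.ofX M p.1.1 p.1.2

@[simp]
lemma ofXHat_inX (n s r : ℕ) (h : s + r = n) (x : S.X M s r) :
    S.ofXHat M n (S.inX M n s r h x) = (-1 : k) ^ (s * r) • S.ofX M s r x :=
  DirectSum.toModule_lof k (φ := fun p : {p : ℕ × ℕ // p.1 + p.2 = n} =>
    (-1 : k) ^ (p.1.1 * p.1.2) • S.ofX M p.1.1 p.1.2) ⟨(s, r), h⟩ x

variable (M) in
/-- The projection of the component `H̄^s ⊗ P` to `M ⊗ H̄^s ⊗ Ā^r`, with values in `X̂_n`. -/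
noncomputable def toXComponent (n s r : ℕ) (h : s + r = n) :
    (⨂[k]^s (Bar k H)) ⊗[k] S.TotA M →ₗ[k] S.XHat M n :=
  (-1 : k) ^ (s * r) • (S.inX M n s r h ∘ₗ (S.arrange M s r).symm.toLinearMap ∘ₗ
    (Tot.comp k (Bar k A) M r).lTensor _)

variable (M) in
/-- The projection of the total module to `X̂_n`. -/
noncomputable def toXHat (n : ℕ) : S.TotHA M →ₗ[k] S.XHat M n :=
  -- The total degree `n` forces `r = n - s`, and summands with `s > n` have no counterpart in
  -- `X̂_n`.
  Tot.ofFam (X := S.XHat M n) fun s => if h : s ≤ n then S.toXComponent M n s (n - s) (by omega) else 0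

lemma neg_one_pow_smul_self {Z : Type*} [AddCommGroup Z] [Module k Z] (n : ℕ) (z : Z) :
    (-1 : k) ^ n • (-1 : k) ^ n • z = z := by
  rw [smul_smul, ← mul_pow, neg_one_mul, neg_neg, one_pow, one_smul]

lemma toXHat_ofX (n s r : ℕ) (h : s + r = n) (x : S.X M s r) :
    S.toXHat M n (S.ofX M s r x) = (-1 : k) ^ (s * r) • S.inX M n s r h x := by
  have e : ∀ (r' : ℕ) (h' : s + r' = n), S.toXComponent M n s r' h' = S.toXComponent M n s r h := by
    intro r' h'
    obtain rfl : r' = r := by omega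
    rfl
  have hc : ∀ y : (⨂[k]^s (Bar k H)) ⊗[k] ((⨂[k]^r (Bar k A)) ⊗[k] M),
      (Tot.comp k (Bar k A) M r).lTensor _ ((Tot.inc k (Bar k A) M r).lTensor _ y) = y := fun y => by
    induction y using TensorProduct.induction_on with
    | zero => simp
    | add x y hx hy => simp only [map_add, hx, hy]
    | tmul w y => simp
  rw [toXHat, ofX, LinearMap.comp_apply, Tot.ofFam_inc, dif_pos (by omega), e, toXComponent,
    LinearMap.smul_apply, LinearMap.comp_apply, LinearMap.comp_apply, LinearMap.comp_apply, hc,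
    LinearEquiv.coe_coe, LinearEquiv.coe_coe, LinearEquiv.symm_apply_apply]

lemma XHat_induction {n : ℕ} {p : S.XHat M n → Prop} (x : S.XHat M n) (h0 : p 0)
    (hadd : ∀ x y, p x → p y → p (x + y)) (h : ∀ s r e x, p (S.inX M n s r e x)) : p x :=
  DirectSum.induction_on x h0 (fun i x => h i.1.1 i.1.2 i.2 x) hadd

lemma toXHat_ofXHat (n : ℕ) (x : S.XHat M n) : S.toXHat M n (S.ofXHat M n x) = x := by
  induction x using S.XHat_induction with
  | h0 => simp
  | hadd x y hx hy => rw [map_add, map_add, hx, hy]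
  | h s r e x => rw [ofXHat_inX, map_smul, S.toXHat_ofX n s r e, neg_one_pow_smul_self (Z := S.XHat M n)]

lemma filtX_induction {n : ℕ} {q : ℤ} {p : S.XHat M n → Prop} {x : S.XHat M n}
    (hx : x ∈ S.filtX M q n) (h0 : p 0) (hadd : ∀ x y, p x → p y → p (x + y))
    (h : ∀ (s r : ℕ) (e : s + r = n) (x : S.X M s r), (s : ℤ) ≤ q → p (S.inX M n s r e x)) : p x := by
  classical
  rw [← DirectSum.sum_support_of x]
  refine Finset.sum_induction _ p hadd h0 fun i _ => ?_
  by_cases hi : q < (i.1.1 : ℤ)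
  · rw [hx i hi, map_zero]; exact h0
  · exact h i.1.1 i.1.2 i.2 (x i) (not_lt.1 hi)

lemma ofX_mem_map {n s r : ℕ} (h : s + r = n) {q : ℤ} (hs : (s : ℤ) ≤ q) (x : S.X M s r) :
    S.ofX M s r x ∈ (S.filtX M q n).map (S.ofXHat M n) :=
  ⟨(-1 : k) ^ (s * r) • S.inX M n s r h x, Submodule.smul_mem _ _ (S.inX_mem M q n s r h hs x), by
    rw [map_smul, ofXHat_inX, neg_one_pow_smul_self]⟩

variable [Module S.E M] [IsScalarTower k S.E M] [Module A M] [IsScalarTower k A M]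

/-- Together with `ofXHat_mem_GX` this identifies `GX M n q` with `F_q X̂_n`: the number of factors
`H̄` is the filtration degree on both sides. -/
lemma GX_le_map (n : ℕ) (q : ℤ) : S.GX M n q ≤ (S.filtX M q n).map (S.ofXHat M n) := by
  have h1 : ∀ (n : ℕ) (q : ℤ), 0 ≤ q → ∀ x ∈ S.degA M n, Tot.nil k (Bar k H) (S.TotA M) x ∈
      (S.filtX M q n).map (S.ofXHat M n) := by
    intro n q hq x hx
    obtain ⟨x, rfl⟩ := Tot.exists_inc_of_mem_deg hx
    induction x using TensorProduct.induction_on with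
    | zero => simp
    | add x y hx' hy' =>
      rw [map_add, map_add]
      exact Submodule.add_mem _ (hx' (Tot.inc_mem_deg _ _)) (hy' (Tot.inc_mem_deg _ _))
    | tmul v m =>
      exact S.ofX_mem_map (zero_add n) (by simpa using hq) ((m ⊗ₜ PiTensorProduct.tprod k ![]) ⊗ₜ v)
  induction n generalizing q with
  | zero => exact S.baseX_le (h1 0 q)
  | succ n ih =>
    refine S.GX_succ_le (h1 (n + 1) q) fun h y hy => ?_
    obtain ⟨x, hx, rfl⟩ := ih _ hy
    refine S.filtX_induction (p := fun x => Tot.cons k (Bar k H) (S.TotA M) h (S.ofXHat M n x) ∈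
      (S.filtX M q (n + 1)).map (S.ofXHat M (n + 1))) hx (by simp) (fun x y hx hy => ?_)
      fun s r e x hs => ?_
    · rw [map_add, map_add]; exact Submodule.add_mem _ hx hy
    · rw [ofXHat_inX, map_smul]
      refine Submodule.smul_mem _ _ ?_
      induction x using S.X_induction with
      | hadd x y hx hy => rw [map_add, map_add]; exact Submodule.add_mem _ hx hy
      | h m w v =>
        rw [ofX_tmul, Tot.cons_inc, ← ofX_tmul]
        exact S.ofX_mem_map (by omega) (by push_cast; lia) _

lemma toXHat_mem {n : ℕ} {q : ℤ} {y : S.TotHA M} (hy : y ∈ S.GX M n q) :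
    S.toXHat M n y ∈ S.filtX M q n := by
  obtain ⟨x, hx, rfl⟩ := S.GX_le_map n q hy
  rwa [toXHat_ofXHat]

lemma ofXHat_toXHat {n : ℕ} {q : ℤ} {y : S.TotHA M} (hy : y ∈ S.GX M n q) :
    S.ofXHat M n (S.toXHat M n y) = y := by
  obtain ⟨x, -, rfl⟩ := S.GX_le_map n q hy
  rw [toXHat_ofXHat]

lemma ofX_mem_GX (s r : ℕ) {q : ℤ} (hs : (s : ℤ) ≤ q) (x : S.X M s r) :
    S.ofX M s r x ∈ S.GX M (s + r) q := by
  induction x using S.X_induction with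
  | hadd x y hx hy => rw [map_add]; exact Submodule.add_mem _ hx hy
  | h m w v =>
    rw [ofX_tmul]
    induction s generalizing q with
    | zero =>
      rw [Tot.inc_zero]
      refine S.nil_mem_GX (by simpa using hs) ?_
      rw [zero_add]
      exact Submodule.smul_mem _ _ (Tot.inc_mem_deg _ _)
    | succ s ih =>
      induction w using Tot.cons_induction with
      | h0 => simp
      | hadd x y hx hy =>
        rw [TensorProduct.add_tmul, map_add]; exact Submodule.add_mem _ hx hy
      | h h w =>
        rw [← Tot.cons_inc, Nat.add_right_comm]
        exact S.cons_mem_GX rfl h (ih (by push_cast at hs; lia) w)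

lemma ofXHat_mem_GX {n : ℕ} {q : ℤ} {x : S.XHat M n} (hx : x ∈ S.filtX M q n) :
    S.ofXHat M n x ∈ S.GX M n q := by
  refine S.filtX_induction (p := fun x => S.ofXHat M n x ∈ S.GX M n q) hx (by simp)
    (fun x y hx hy => ?_) fun s r e y hs => ?_
  · rw [map_add]; exact Submodule.add_mem _ hx hy
  · subst e
    rw [ofXHat_inX]
    exact Submodule.smul_mem _ _ (S.ofX_mem_GX s r hs y)

lemma mem_filtX_top (n : ℕ) (x : S.XHat M n) : x ∈ S.filtX M n n :=
  fun i hi => absurd hi (by have := i.2; lia)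

end Arrange

/-! ### The maps `d̂^l` are the components of the recursive differential. -/

section Differentials

variable {M : Type*} [AddCommGroup M] [Module k M] [Module S.E M] [IsScalarTower k S.E M]
  [Module S.Eᵐᵒᵖ M] [IsScalarTower k S.Eᵐᵒᵖ M] [SMulCommClass S.E S.Eᵐᵒᵖ M]
  [Module A M] [IsScalarTower k A M]

lemma actOn_tmul_ofX (e : S.E) (s r : ℕ) (m : M) (w : ⨂[k]^s (Bar k H)) (v : ⨂[k]^r (Bar k A)) :
    actOn (S.rmulW M) (e ⊗ₜ Tot.inc k (Bar k H) (S.TotA M) s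
      (w ⊗ₜ Tot.inc k (Bar k A) M r (v ⊗ₜ m))) =
        S.ofX M s r (((MulOpposite.op e • m) ⊗ₜ w) ⊗ₜ v) := by
  rw [actOn_tmul, rmulW_apply, mapW, Tot.map_inc, Tot.map_inc, ofX_tmul, rmul_apply]

lemma actOn_one_tmul (y : S.TotHA M) : actOn (S.rmulW M) (1 ⊗ₜ y) = y := by
  rw [actOn_tmul, rmulW_one]

lemma ofX_absorb (s r : ℕ) (m : M) (w : ⨂[k]^s (Bar k H)) (t : (⨂[k]^r (Bar k A)) ⊗[k] H) :
    S.ofX M s r (S.absorb M s r ((m ⊗ₜ w) ⊗ₜ t)) =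
      Tot.inc k (Bar k H) (S.TotA M) s (w ⊗ₜ S.absorbH M r m t) := by
  induction t using TensorProduct.induction_on with
  | zero => simp
  | add x y hx hy => simp only [TensorProduct.tmul_add, map_add, hx, hy]
  | tmul v y => rfl

lemma ofX_wrap_lamA (hA : ∀ (a : A) (m : M), a • m = S.inA a • m) (s r : ℕ) (m : M)
    (w : ⨂[k]^s (Bar k H)) (t : (⨂[k]^r (Bar k A)) ⊗[k] A) :
    S.ofX M s r (wrap (S.lamA M s) ((m ⊗ₜ w) ⊗ₜ t)) =
      Tot.inc k (Bar k H) (S.TotA M) s (w ⊗ₜ absorbTail r m t) := by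
  induction t using TensorProduct.induction_on with
  | zero => simp
  | add x y hx hy => simp only [TensorProduct.tmul_add, map_add, hx, hy]
  | tmul v y => rw [absorbTail_tmul, hA]; rfl

lemma ofX_rhoA (s r : ℕ) (m : M) (w : ⨂[k]^s (Bar k H)) (a : A) (v : ⨂[k]^r (Bar k A)) :
    S.ofX M s r (S.rhoA M s ((m ⊗ₜ w) ⊗ₜ a) ⊗ₜ v) = actOn (S.rmulW M)
      (S.passH M s (w ⊗ₜ (a ⊗ₜ Tot.inc k (Bar k A) M r (v ⊗ₜ m)))) := by
  rw [passH_tmul]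
  simp only [rhoA, LinearMap.comp_apply, LinearEquiv.coe_coe, TensorProduct.assoc_tmul,
    LinearMap.lTensor_tmul]
  generalize iterL S.chiHb s (w ⊗ₜ a) = u
  induction u using TensorProduct.induction_on with
  | zero => simp
  | add x y hx hy => simp only [TensorProduct.tmul_add, TensorProduct.add_tmul, map_add, hx, hy]
  | tmul c w =>
    rw [TensorProduct.assoc_tmul, LinearMap.lTensor_tmul, jA_tmul, actOn_tmul_ofX]
    rfl

lemma ofX_d0 (hA : ∀ (a : A) (m : M), a • m = S.inA a • m) (s r : ℕ) (m : M)
    (w : ⨂[k]^s (Bar k H)) (v : ⨂[k]^(r + 1) (Bar k A)) :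
    S.ofX M s r (S.d0 M s r ((m ⊗ₜ w) ⊗ₜ v)) = actOn (S.rmulW M)
      (S.passH M s (w ⊗ₜ barD k A M (Tot.inc k (Bar k A) M (r + 1) (v ⊗ₜ m)))) := by
  induction v using induction_cons with
  | h0 => simp
  | hadd x y hx hy => simp only [TensorProduct.tmul_add, TensorProduct.add_tmul, map_add, hx, hy]
  | h a v =>
    rw [d0, hochD_tmul, ← Tot.cons_inc, barD_cons_inc, TensorProduct.tmul_sub, map_sub, map_sub,
      map_sub, ofX_rhoA, S.ofX_wrap_lamA hA, passH_one, actOn_one_tmul]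

lemma d1_tmul (s r : ℕ) (m : M) (h : H) (w : ⨂[k]^s (Bar k H)) (v : ⨂[k]^r (Bar k A)) :
    S.d1 M s r ((m ⊗ₜ cons k (Bar k H) s (bar k H h ⊗ₜ w)) ⊗ₜ v) = (-1 : k) ^ r •
      (S.d1Head M s r (h ⊗ₜ ((m ⊗ₜ w) ⊗ₜ v)) - S.d1Tail M s r (h ⊗ₜ ((m ⊗ₜ w) ⊗ₜ v))) := by
  simp [d1]

lemma ofX_d1 (s r : ℕ) (m : M) (h : H) (w : ⨂[k]^s (Bar k H)) (v : ⨂[k]^r (Bar k A)) :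
    S.ofX M s r (S.d1 M s r ((m ⊗ₜ cons k (Bar k H) s (bar k H h ⊗ₜ w)) ⊗ₜ v)) = (-1 : k) ^ r •
      actOn (S.rmulW M) (S.inH h ⊗ₜ Tot.inc k (Bar k H) (S.TotA M) s
        (w ⊗ₜ Tot.inc k (Bar k A) M r (v ⊗ₜ m)) -
          S.tailE s (Tot.inc k (Bar k A) M r (v ⊗ₜ m)) ((S.hhGamma s).1 (h ⊗ₜ w))) := by
  rw [d1_tmul, map_smul, map_sub, map_sub, d1Head_tmul, d1Tail_tmul, actOn_tmul_ofX]
  congr 2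
  generalize (S.hhGamma s).1 (h ⊗ₜ w) = u
  induction u using TensorProduct.induction_on with
  | zero => simp
  | add x y hx hy => simp only [TensorProduct.tmul_add, TensorProduct.add_tmul, map_add, hx, hy]
  | tmul c t =>
    induction t using TensorProduct.induction_on with
    | zero => simp
    | add x y hx hy => simp only [TensorProduct.tmul_add, TensorProduct.add_tmul, map_add, hx, hy]
    | tmul w y =>
      -- In `d̂¹` the right factor `c` acts before `1 # y`, in the resolution after it; the two
      -- agree because `M` is a bimodule.
      rw [d1TailAux_tmul, ofX_absorb, tailE_tmul, tailW_tmul, actOn_tmul, rmulW_apply, mapW,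
        Tot.map_inc, actH, ← S.actOf_map _ (S.rmul_smul _), Tot.map_inc, actOf_inc, rmul_apply]
      rfl

lemma ofX_dl (n s t r : ℕ) (h : s + (n + 2) = t) (m : M) (w : ⨂[k]^t (Bar k H))
    (v : ⨂[k]^r (Bar k A)) :
    S.ofX M s (r + (n + 1)) (S.dl M n s t r h ((m ⊗ₜ w) ⊗ₜ v)) = (-1 : k) ^ ((n + 2) * (r + t)) •
      S.higherTerm n s t h (Tot.inc k (Bar k A) M r (v ⊗ₜ m)) w := by
  have e : S.dl M n s t r h ((m ⊗ₜ w) ⊗ₜ v) = (-1 : k) ^ ((n + 2) * (r + t)) •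
      S.absorb M s (r + (n + 1)) ((S.gg n r).lTensor _ (TensorProduct.assoc k _ _ _
        ((TensorProduct.assoc k M _ _).symm (m ⊗ₜ split h w) ⊗ₜ v))) := rfl
  rw [e, map_smul, higherTerm]
  simp only [LinearMap.comp_apply, LinearEquiv.coe_coe]
  congr 1
  generalize split (k := k) h w = ξ
  induction ξ using TensorProduct.induction_on with
  | zero => simp
  | add x y hx hy => simp only [TensorProduct.tmul_add, TensorProduct.add_tmul, map_add, hx, hy]
  | tmul w w' =>
    rw [TensorProduct.assoc_symm_tmul, TensorProduct.assoc_tmul, LinearMap.lTensor_tmul,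
      ofX_absorb, LinearMap.lTensor_tmul, LinearMap.flip_apply, actK, actOf_inc]

lemma ofXHat_part0 (hA : ∀ (a : A) (m : M), a • m = S.inA a • m) (n s r : ℕ) (e : s + r = n + 1)
    (m : M) (w : ⨂[k]^s (Bar k H)) (v : ⨂[k]^r (Bar k A)) :
    S.ofXHat M n (S.part0 M n s r e ((m ⊗ₜ w) ⊗ₜ v)) = (-1 : k) ^ (s * r) • (-1 : k) ^ s •
      actOn (S.rmulW M) (S.passH M s (w ⊗ₜ barD k A M (Tot.inc k (Bar k A) M r (v ⊗ₜ m)))) := by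
  rcases r with _ | r
  · rw [Tot.inc_zero, barD_nil, TensorProduct.tmul_zero, map_zero, map_zero, smul_zero, smul_zero]
    exact map_zero _
  · have h : S.part0 M n s (r + 1) e = S.inX M n s r (by omega) ∘ₗ S.d0 M s r := rfl
    rw [h, LinearMap.comp_apply, ofXHat_inX, S.ofX_d0 hA, smul_smul]
    congr 1
    rw [← pow_add, Nat.mul_succ, add_assoc, ← two_mul, pow_add, pow_mul (-1 : k) 2, neg_one_sq,
      one_pow, _root_.mul_one]

lemma ofXHat_part1 (n s r : ℕ) (e : s + 1 + r = n + 1) (m : M) (h : H) (w : ⨂[k]^s (Bar k H))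
    (v : ⨂[k]^r (Bar k A)) :
    S.ofXHat M n (S.part1 M n (s + 1) r e ((m ⊗ₜ cons k (Bar k H) s (bar k H h ⊗ₜ w)) ⊗ₜ v)) =
      (-1 : k) ^ ((s + 1) * r) • actOn (S.rmulW M)
        (S.inH h ⊗ₜ Tot.inc k (Bar k H) (S.TotA M) s (w ⊗ₜ Tot.inc k (Bar k A) M r (v ⊗ₜ m)) -
          S.tailE s (Tot.inc k (Bar k A) M r (v ⊗ₜ m)) ((S.hhGamma s).1 (h ⊗ₜ w))) := by
  have h : S.part1 M n (s + 1) r e = S.inX M n s r (by omega) ∘ₗ S.d1 M s r := rfl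
  rw [h, LinearMap.comp_apply, ofXHat_inX, ofX_d1, smul_smul, ← pow_add, ← Nat.succ_mul]

/-- With `l = n + 2` and `t = s + l`: the left side is the sign of the target summand times that of
`d̂^l`, the right side the sign of the source summand times the `(-1)^t` of `higher_inc`. The
exponents differ by `n (n + 1)` plus an even number. -/
lemma neg_one_pow_higher (s n r : ℕ) :
    (-1 : k) ^ (s * (r + (n + 1))) * (-1) ^ ((n + 2) * (r + (s + (n + 2)))) =
      (-1) ^ ((s + (n + 2)) * r) * (-1) ^ (s + (n + 2)) := by
  have h : Even (n * (n + 1)) := Nat.even_mul_succ_self n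
  have e : s * (r + (n + 1)) + (n + 2) * (r + (s + (n + 2))) =
      ((s + (n + 2)) * r + (s + (n + 2))) + (n * (n + 1) + 2 * (s * n + s + n + 1)) := by ring
  rw [← pow_add, ← pow_add, e, pow_add _ _ (n * (n + 1) + _),
    (h.add (even_two_mul _)).neg_one_pow, _root_.mul_one]

lemma ofXHat_part2 (n s r : ℕ) (e : s + r = n + 1) (m : M) (w : ⨂[k]^s (Bar k H))
    (v : ⨂[k]^r (Bar k A)) :
    S.ofXHat M n (S.part2 M n s r e ((m ⊗ₜ w) ⊗ₜ v)) = (-1 : k) ^ (s * r) •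
      S.higher M (Tot.inc k (Bar k H) (S.TotA M) s (w ⊗ₜ Tot.inc k (Bar k A) M r (v ⊗ₜ m))) := by
  rw [part2, LinearMap.sum_apply, map_sum, higher_inc, smul_smul, Finset.smul_sum]
  refine Finset.sum_congr rfl fun i _ => ?_
  rw [LinearMap.comp_apply, ofXHat_inX, ofX_dl, smul_smul]
  congr 1
  have hs : s - (i.1 + 2) + (i.1 + 2) = s := by omega
  have e := neg_one_pow_higher (k := k) (s - (i.1 + 2)) i.1 r
  rwa [hs] at e

lemma dHat_inX (n s r : ℕ) (e : s + r = n + 1) (x : S.X M s r) :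
    S.dHat M n (S.inX M (n + 1) s r e x) =
      S.part0 M n s r e x + S.part1 M n s r e x + S.part2 M n s r e x :=
  DirectSum.toModule_lof k (φ := fun p : {p : ℕ × ℕ // p.1 + p.2 = n + 1} =>
    S.part0 M n p.1.1 p.1.2 p.2 + S.part1 M n p.1.1 p.1.2 p.2 + S.part2 M n p.1.1 p.1.2 p.2)
    ⟨(s, r), e⟩ x

/-- The map from `X̂` to the total module commutes with the differentials. -/
lemma ofXHat_dHat (hA : ∀ (a : A) (m : M), a • m = S.inA a • m) (n : ℕ) (x : S.XHat M (n + 1)) :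
    S.ofXHat M n (S.dHat M n x) = S.dM M (S.ofXHat M (n + 1) x) := by
  induction x using S.XHat_induction with
  | h0 => simp
  | hadd x y hx hy => simp only [map_add, hx, hy]
  | h s r e x =>
    rw [dHat_inX, ofXHat_inX, map_add, map_add, map_smul]
    induction x using S.X_induction with
    | hadd x y hx hy =>
      simp only [map_add, smul_add] at hx hy ⊢
      rw [← hx, ← hy]
      abel
    | h m w v =>
      rw [S.ofXHat_part0 hA, ofXHat_part2, ofX_tmul, dM, LinearMap.comp_apply]
      rcases s with _ | s
      · have h : S.part1 M n 0 r e ((m ⊗ₜ w) ⊗ₜ v) = 0 := rfl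
        rw [h, map_zero, higher_inc_zero, dW_inc_zero, smul_zero, add_zero, add_zero, pow_zero,
          one_smul]
      · induction w using induction_cons with
        | h0 => simp
        | hadd x y hx hy =>
          simp only [map_add, smul_add, TensorProduct.tmul_add, TensorProduct.add_tmul]
            at hx hy ⊢
          rw [← hx, ← hy]
          abel
        | h h w =>
          rw [ofXHat_part1, dW_inc_succ, map_add, map_add, map_smul, actOn_one_tmul, smul_add,
            smul_add]

/-- The differential of `X̂` squares to zero. -/
lemma dHat_comp (hA : ∀ (a : A) (m : M), a • m = S.inA a • m) (n : ℕ) :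
    S.dHat M n ∘ₗ S.dHat M (n + 1) = 0 :=
  LinearMap.ext fun x => by
    rw [LinearMap.comp_apply, ← S.toXHat_ofXHat n (S.dHat M n _), S.ofXHat_dHat hA,
      S.ofXHat_dHat hA, S.dM_dM hA, map_zero, LinearMap.zero_apply]

end Differentials

end CrossedSystem

end HochschildSerre

namespace FilteredComplex

/-! ### The first page of a filtered complex, in terms of modules. -/

section OfModules

variable {k : Type u} [CommRing k] (X : ℕ → Type w) [∀ n, AddCommGroup (X n)] [∀ n, Module k (X n)]
    (d : ∀ n, X (n + 1) →ₗ[k] X n) (hd : ∀ n, d n ∘ₗ d (n + 1) = 0)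
    (F : ℤ → ∀ n, Submodule k (X n)) (mono : ∀ (p q : ℤ) (n : ℕ), p ≤ q → F p n ≤ F q n)
    (hF : ∀ (p : ℤ) (n : ℕ) (x : X (n + 1)), x ∈ F p (n + 1) → d n x ∈ F p n)

lemma ofModules_d (n : ℕ) : (ofModules X d hd F mono hF).K.d (n + 1) n = ModuleCat.ofHom (d n) :=
  ChainComplex.of_d (fun n => ModuleCat.of k (X n)) (fun n => ModuleCat.ofHom (d n)) n

lemma ofModules_d_apply (n : ℕ) (x : X (n + 1)) :
    ((ofModules X d hd F mono hF).K.d (n + 1) n).hom x = d n x := by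
  rw [ofModules_d]; rfl

lemma mem_Z_ofModules_zero (r p : ℤ) (x : X 0) :
    x ∈ (ofModules X d hd F mono hF).Z r p 0 ↔ x ∈ F p 0 := by
  refine mem_Z.trans (and_iff_left fun j => ?_)
  rw [HomologicalComplex.shape _ 0 j fun h => Nat.succ_ne_zero _ h]
  exact Submodule.zero_mem _

lemma mem_Z_ofModules_succ (r p : ℤ) (n : ℕ) (x : X (n + 1)) :
    x ∈ (ofModules X d hd F mono hF).Z r p (n + 1) ↔ x ∈ F p (n + 1) ∧ d n x ∈ F (p - r) n := by
  refine mem_Z.trans (and_congr_right fun _ => ⟨fun h => ?_, fun h j => ?_⟩)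
  · have := h n
    rwa [ofModules_d_apply] at this
  · by_cases hj : n = j
    · subst hj
      rw [ofModules_d_apply]
      exact h
    · rw [HomologicalComplex.shape _ (n + 1) j fun h => hj (Nat.succ_injective h).symm]
      exact Submodule.zero_mem _

lemma mem_Z_ofModules_of_nonpos {r : ℤ} (hr : r ≤ 0) (p : ℤ) (n : ℕ) (x : X n) :
    x ∈ (ofModules X d hd F mono hF).Z r p n ↔ x ∈ F p n := by
  rcases n with _ | n
  · exact mem_Z_ofModules_zero X d hd F mono hF r p x
  · exact (mem_Z_ofModules_succ X d hd F mono hF r p n x).trans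
      (and_iff_left_of_imp fun h => mono _ _ _ (by lia) (hF p n x h))

/-- For `r = 1` the definition of `B` involves `Z` with index `0`, where the condition on the
differential is automatic. -/
lemma mem_B_one_ofModules (p : ℤ) (n : ℕ) (x : X n) :
    x ∈ (ofModules X d hd F mono hF).B 1 p n ↔
      ∃ z ∈ F (p - 1) n, ∃ y ∈ F p (n + 1), x = z + d n y := by
  refine mem_B.trans ⟨?_, ?_⟩
  · rintro ⟨z, hz, y, hy, e⟩
    refine ⟨z, (mem_Z.1 hz).1, y, ?_, ?_⟩
    · have := (mem_Z.1 hy).1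
      rwa [add_sub_cancel_right] at this
    · exact e.trans (congrArg (z + ·) (ofModules_d_apply X d hd F mono hF n y))
  · rintro ⟨z, hz, y, hy, e⟩
    refine ⟨z, (mem_Z_ofModules_of_nonpos X d hd F mono hF (by norm_num) _ n z).2 hz, y, ?_, ?_⟩
    · rw [add_sub_cancel_right]
      exact (mem_Z_ofModules_of_nonpos X d hd F mono hF (by norm_num) _ (n + 1) y).2 hy
    · exact e.trans (congrArg (z + ·) (ofModules_d_apply X d hd F mono hF n y).symm)

end OfModules

section FirstPage

variable {k : Type u} [CommRing k] (C : FilteredComplex.{u, w} k)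

/-- A term of a page is a subquotient of a module on which its filtration quotient maps. -/
noncomputable def equivOfMap {r p : ℤ} {n : ℕ} {Q : Type*} [AddCommGroup Q] [Module k Q]
    (φ : C.K.X n →ₗ[k] Q) (Zc Bd : Submodule k Q) (h1 : ∀ x ∈ C.Z r p n, φ x ∈ Zc)
    (h2 : ∀ c ∈ Zc, ∃ x ∈ C.Z r p n, φ x = c) (h3 : ∀ x ∈ C.Z r p n, x ∈ C.B r p n ↔ φ x ∈ Bd) :
    C.E r p n ≃ₗ[k] Zc ⧸ Bd.comap Zc.subtype :=
  let ψ : C.Z r p n →ₗ[k] Zc ⧸ Bd.comap Zc.subtype :=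
    (Bd.comap Zc.subtype).mkQ ∘ₗ φ.restrict h1
  have hψ : Function.Surjective ψ := fun c => by
    obtain ⟨c, rfl⟩ := Submodule.Quotient.mk_surjective _ c
    obtain ⟨x, hx, e⟩ := h2 c c.2
    exact ⟨⟨x, hx⟩, congrArg Submodule.Quotient.mk (Subtype.ext e)⟩
  have hker : (C.B r p n).comap (C.Z r p n).subtype = LinearMap.ker ψ := by
    ext x
    exact (h3 x x.2).trans
      (Submodule.Quotient.mk_eq_zero (Bd.comap Zc.subtype) (x := φ.restrict h1 x)).symm
  (Submodule.quotEquivOfEq _ _ hker).trans (ψ.quotKerEquivOfSurjective hψ)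

end FirstPage

end FilteredComplex

namespace HochschildSerre

namespace CrossedSystem

variable {k A H : Type*} [CommRing k] [Ring A] [Algebra k A] [Ring H] [HopfAlgebra k H]
  (S : CrossedSystem k A H)

/-! ### The first page of `X̂`: Hochschild homology of `A`. -/

section FirstPage

variable (M : Type*) [AddCommGroup M] [Module k M]

/-- The projection of `X̂_n` to the summand `M ⊗ H̄^s ⊗ Ā^r`. -/
noncomputable def compX (n s r : ℕ) (h : s + r = n) : S.XHat M n →ₗ[k] S.X M s r :=
  DirectSum.component k {p : ℕ × ℕ // p.1 + p.2 = n} (fun p => S.X M p.1.1 p.1.2) ⟨(s, r), h⟩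

variable {M}

@[simp]
lemma compX_inX (n s r : ℕ) (h : s + r = n) (x : S.X M s r) :
    S.compX M n s r h (S.inX M n s r h x) = x :=
  DirectSum.component.lof_self k (M := fun p : {p : ℕ × ℕ // p.1 + p.2 = n} => S.X M p.1.1 p.1.2)
    ⟨(s, r), h⟩ x

lemma compX_of_mem {n s r : ℕ} (h : s + r = n) {p : ℤ} (hp : p < s) {x : S.XHat M n}
    (hx : x ∈ S.filtX M p n) : S.compX M n s r h x = 0 := hx ⟨(s, r), h⟩ hp

/-- The total degree determines `r`, so the quantifier over `r` ranges over at most one value; it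
covers the case `s > n` without a separate argument. -/
lemma mem_filtX_sub_one {n s : ℕ} {x : S.XHat M n} (hx : x ∈ S.filtX M s n)
    (h : ∀ (r : ℕ) (e : s + r = n), S.compX M n s r e x = 0) : x ∈ S.filtX M ((s : ℤ) - 1) n := by
  rintro ⟨⟨t, r⟩, e⟩ hi
  rcases (show s ≤ t by simp only at hi; lia).eq_or_lt with rfl | hlt
  · exact h r e
  · exact hx _ (by simpa using hlt)

variable [Module S.E M] [IsScalarTower k S.E M] [Module S.Eᵐᵒᵖ M] [IsScalarTower k S.Eᵐᵒᵖ M]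

lemma part1_mem_sub_one (p : ℤ) (n s r : ℕ) (h : s + r = n + 1) (hs : (s : ℤ) ≤ p + 1)
    (x : S.X M s r) : S.part1 M n s r h x ∈ S.filtX M p n := by
  cases s with
  | zero => exact Submodule.zero_mem _
  | succ s => exact S.inX_mem M p n s r _ (by push_cast at hs; lia) _

lemma part2_mem_sub_one (p : ℤ) (n s r : ℕ) (h : s + r = n + 1) (hs : (s : ℤ) ≤ p + 1)
    (x : S.X M s r) : S.part2 M n s r h x ∈ S.filtX M p n := by
  rw [part2, LinearMap.sum_apply]
  exact Submodule.sum_mem _ fun i _ => S.inX_mem M p n _ _ _ (by have := i.2; lia) _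

variable [SMulCommClass S.E S.Eᵐᵒᵖ M] [Module A M] [IsScalarTower k A M]

/-- `d̂^l` lowers the filtration degree by `l`, so on the graded piece of degree `s` only `d̂⁰`
remains; summands below `s` do not reach degree `s`. -/
lemma compX_dHat (s r n : ℕ) (e : s + r = n) (e' : s + (r + 1) = n + 1) {x : S.XHat M (n + 1)}
    (hx : x ∈ S.filtX M s (n + 1)) :
    S.compX M n s r e (S.dHat M n x) = S.d0 M s r (S.compX M (n + 1) s (r + 1) e' x) := by
  refine S.filtX_induction (p := fun x => S.compX M n s r e (S.dHat M n x) =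
    S.d0 M s r (S.compX M (n + 1) s (r + 1) e' x)) hx (by simp)
      (fun x y hx hy => by simp only [map_add, hx, hy]) fun t q h x ht => ?_
  rcases (Int.ofNat_le.1 ht).eq_or_lt with rfl | hlt
  · obtain rfl : q = r + 1 := by omega
    have h0 : S.part0 M n t (r + 1) h x = S.inX M n t r e (S.d0 M t r x) := rfl
    rw [dHat_inX, map_add, map_add, compX_inX, h0, compX_inX,
      S.compX_of_mem e (show (t : ℤ) - 1 < t by lia) (S.part1_mem_sub_one _ n t _ h (by lia) x),
      S.compX_of_mem e (show (t : ℤ) - 1 < t by lia) (S.part2_mem_sub_one _ n t _ h (by lia) x),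
      add_zero, add_zero]
  · have hlt' : (t : ℤ) < s := by exact_mod_cast hlt
    have h1 := S.inX_mem M t (n + 1) t q h le_rfl x
    rw [S.compX_of_mem e hlt' (S.dHat_mem M _ _ _ h1), S.compX_of_mem e' hlt' h1, map_zero]

variable (hd : ∀ n, S.dHat M n ∘ₗ S.dHat M (n + 1) = 0)

lemma mem_Z_filteredXHat_zero (r p : ℤ) (x : S.XHat M 0) :
    x ∈ (S.filteredXHat M hd).Z r p 0 ↔ x ∈ S.filtX M p 0 :=
  FilteredComplex.mem_Z_ofModules_zero _ _ _ _ _ _ r p x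

lemma mem_Z_filteredXHat_succ (r p : ℤ) (n : ℕ) (x : S.XHat M (n + 1)) :
    x ∈ (S.filteredXHat M hd).Z r p (n + 1) ↔
      x ∈ S.filtX M p (n + 1) ∧ S.dHat M n x ∈ S.filtX M (p - r) n :=
  FilteredComplex.mem_Z_ofModules_succ _ _ _ _ _ _ r p n x

lemma mem_filtX_of_mem_Z {r p : ℤ} {n : ℕ} {x : S.XHat M n}
    (hx : x ∈ (S.filteredXHat M hd).Z r p n) : x ∈ S.filtX M p n :=
  (FilteredComplex.mem_Z.1 hx).1

lemma mem_B_one_filteredXHat (p : ℤ) (n : ℕ) (x : S.XHat M n) :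
    x ∈ (S.filteredXHat M hd).B 1 p n ↔
      ∃ z ∈ S.filtX M (p - 1) n, ∃ y ∈ S.filtX M p (n + 1), x = z + S.dHat M n y :=
  FilteredComplex.mem_B_one_ofModules _ _ _ _ _ _ p n x

lemma compX_mem_cycles {n s r : ℕ} (e : s + r = n) {x : S.XHat M n}
    (hx : x ∈ (S.filteredXHat M hd).Z 1 s n) :
    S.compX M n s r e x ∈ cyclesOf (X := fun r => S.X M s r) (fun r => S.d0 M s r) r := by
  rcases r with _ | r
  · trivial
  · rcases n with _ | n
    · omega
    · have e' : s + r = n := by omega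
      obtain ⟨hx, hx'⟩ := (S.mem_Z_filteredXHat_succ hd 1 s n x).1 hx
      refine LinearMap.mem_ker.2 ?_
      rw [← S.compX_dHat s r n e' e hx]
      exact S.compX_of_mem e' (by lia) hx'

lemma inX_mem_Z {n s r : ℕ} (e : s + r = n) {c : S.X M s r}
    (hc : c ∈ cyclesOf (X := fun r => S.X M s r) (fun r => S.d0 M s r) r) :
    S.inX M n s r e c ∈ (S.filteredXHat M hd).Z 1 s n := by
  have h1 := S.inX_mem M s n s r e le_rfl c
  rcases n with _ | n
  · exact (S.mem_Z_filteredXHat_zero hd 1 s _).2 h1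
  · refine (S.mem_Z_filteredXHat_succ hd 1 s n _).2 ⟨h1, ?_⟩
    refine S.mem_filtX_sub_one (S.dHat_mem M _ _ _ h1) fun q e' => ?_
    obtain rfl : r = q + 1 := by omega
    rw [S.compX_dHat s q n e' e h1, compX_inX]
    exact hc

/-- Modulo `F_{s-1}`, elements are determined by their component on `M ⊗ H̄^s ⊗ Ā^r`, and there `d̂`
acts as `d̂⁰` by `compX_dHat`. -/
lemma mem_B_iff {n s r : ℕ} (e : s + r = n) {x : S.XHat M n} (hx : x ∈ S.filtX M s n) :
    x ∈ (S.filteredXHat M hd).B 1 s n ↔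
      S.compX M n s r e x ∈ LinearMap.range (S.d0 M s r) := by
  have e' : s + (r + 1) = n + 1 := by omega
  refine (S.mem_B_one_filteredXHat hd s n x).trans ⟨?_, ?_⟩
  · rintro ⟨z, hz, y, hy, rfl⟩
    rw [map_add, S.compX_of_mem e (by lia) hz, zero_add, S.compX_dHat s r n e e' hy]
    exact ⟨_, rfl⟩
  · rintro ⟨y, hy⟩
    -- The decomposition is `x = (x - d̂ y) + d̂ y`, with `-y` and `y` written as multiples of `y`
    -- by `-1` and `1`. The bracket has no component of filtration degree `s`.
    have h1 (c : k) := S.inX_mem M s (n + 1) s (r + 1) e' le_rfl (c • y)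
    refine ⟨x + S.dHat M n (S.inX M (n + 1) s (r + 1) e' ((-1 : k) • y)),
      S.mem_filtX_sub_one (Submodule.add_mem _ hx (S.dHat_mem M _ _ _ (h1 _))) fun q e1 => ?_,
      _, h1 1, ?_⟩
    · obtain rfl : q = r := by omega
      rw [map_add, S.compX_dHat s q n e1 e' (h1 _), compX_inX, ← hy, ← map_add,
        ← one_smul k y, smul_smul, _root_.mul_one, ← add_smul, add_neg_cancel, zero_smul, map_zero]
    · rw [add_assoc, ← map_add, ← map_add, ← add_smul, neg_add_cancel, zero_smul, map_zero,
        map_zero, add_zero]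

variable (M) in
/-- The first page of the spectral sequence of `X̂`. -/
noncomputable def firstPageEquiv (s r : ℕ) :
    (S.filteredXHat M hd).E 1 s (s + r) ≃ₗ[k] S.HochA M s r :=
  (S.filteredXHat M hd).equivOfMap (S.compX M (s + r) s r rfl)
    (cyclesOf (X := fun r => S.X M s r) (fun r => S.d0 M s r) r) (LinearMap.range (S.d0 M s r))
    (fun _ hx => S.compX_mem_cycles hd rfl hx)
    (fun c hc => ⟨_, S.inX_mem_Z hd rfl hc, S.compX_inX _ _ _ _ c⟩)
    (fun _ hx => S.mem_B_iff hd rfl (S.mem_filtX_of_mem_Z hd hx))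

end FirstPage

end CrossedSystem

end HochschildSerre

namespace FilteredComplex

variable {k : Type u} [CommRing k] (X : ℕ → Type w) [∀ n, AddCommGroup (X n)] [∀ n, Module k (X n)]
    (d : ∀ n, X (n + 1) →ₗ[k] X n) (hd : ∀ n, d n ∘ₗ d (n + 1) = 0)
    (F : ℤ → ∀ n, Submodule k (X n)) (mono : ∀ (p q : ℤ) (n : ℕ), p ≤ q → F p n ≤ F q n)
    (hF : ∀ (p : ℤ) (n : ℕ) (x : X (n + 1)), x ∈ F p (n + 1) → d n x ∈ F p n)

/-! ### Morphisms and homotopies given by families of linear maps. -/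

section Hom

variable (X' : ℕ → Type w) [∀ n, AddCommGroup (X' n)] [∀ n, Module k (X' n)]
    (d' : ∀ n, X' (n + 1) →ₗ[k] X' n) (hd' : ∀ n, d' n ∘ₗ d' (n + 1) = 0)
    (F' : ℤ → ∀ n, Submodule k (X' n)) (mono' : ∀ (p q : ℤ) (n : ℕ), p ≤ q → F' p n ≤ F' q n)
    (hF' : ∀ (p : ℤ) (n : ℕ) (x : X' (n + 1)), x ∈ F' p (n + 1) → d' n x ∈ F' p n)

/-- A sequence of linear maps which commute with the differentials is a morphism of complexes. -/
noncomputable def ofModulesHom (f : ∀ n, X n →ₗ[k] X' n)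
    (hf : ∀ n x, d' n (f (n + 1) x) = f n (d n x)) :
    (ofModules X d hd F mono hF).K ⟶ (ofModules X' d' hd' F' mono' hF').K where
  f n := ModuleCat.ofHom (f n)
  comm' i j h := by
    obtain rfl : j + 1 = i := h
    rw [ofModules_d, ofModules_d]
    exact ModuleCat.hom_ext (LinearMap.ext fun x => hf j x)

end Hom

lemma homotopicToId_ofModules
    (g : (ofModules X d hd F mono hF).K ⟶ (ofModules X d hd F mono hF).K) (f : ∀ n, X n →ₗ[k] X n)
    (hg : ∀ n x, (g.f n).hom x = f n x) (h : ∀ n, X n →ₗ[k] X (n + 1))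
    (hh : ∀ p n x, x ∈ F p n → h n x ∈ F p (n + 1)) (h0 : ∀ x, f 0 x + d 0 (h 0 x) = x)
    (h1 : ∀ n x, f (n + 1) x + d (n + 1) (h (n + 1) x) + h n (d n x) = x) : HomotopicToId g := by
  refine ⟨h, hh, fun x => ?_, fun n x => ?_⟩
  · rw [hg, ofModules_d]
    exact h0 x
  · rw [hg, ofModules_d, ofModules_d]
    exact h1 n x

end FilteredComplex

/-! ### The filtered homotopy equivalence between the Hochschild complex and `X̂`. -/

namespace HochschildSerre

namespace CrossedSystem

universe uk uA uH uM

variable {k : Type uk} {A : Type uA} {H : Type uH} [CommRing k] [Ring A] [Algebra k A] [Ring H]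
  [HopfAlgebra k H] (S : CrossedSystem k A H) (M : Type uM) [AddCommGroup M] [Module k M]
  [Module S.E M] [IsScalarTower k S.E M] [Module S.Eᵐᵒᵖ M] [IsScalarTower k S.Eᵐᵒᵖ M]
  [SMulCommClass S.E S.Eᵐᵒᵖ M] [Module A M] [IsScalarTower k A M]

/-- The component of degree `n` of the comparison map from the Hochschild complex to `X̂`. -/
noncomputable def toXHatMap (n : ℕ) : M ⊗[k] (⨂[k]^n (Bar k S.E)) →ₗ[k] S.XHat M n :=
  S.toXHat M n ∘ₗ S.psiM M ∘ₗ S.ofHoch M n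

/-- The component of degree `n` of the comparison map from `X̂` to the Hochschild complex. -/
noncomputable def toHochMap (n : ℕ) : S.XHat M n →ₗ[k] M ⊗[k] (⨂[k]^n (Bar k S.E)) :=
  S.toHoch M n ∘ₗ S.phi M n ∘ₗ S.ofXHat M n

/-- The component of degree `n` of the homotopy on the Hochschild complex. -/
noncomputable def hochHomotopy (n : ℕ) :
    M ⊗[k] (⨂[k]^n (Bar k S.E)) →ₗ[k] M ⊗[k] (⨂[k]^(n + 1) (Bar k S.E)) :=
  -- `ω` satisfies `d ω + ω d = φ ψ - 1`, whereas `HomotopicToId` asks for `φ ψ + d h + h d = 1`.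
  -(S.toHoch M (n + 1) ∘ₗ S.omega M n ∘ₗ S.ofHoch M n)

variable {M}

lemma toXHatMap_mem {n : ℕ} {p : ℤ} {x : M ⊗[k] (⨂[k]^n (Bar k S.E))}
    (hx : x ∈ hochFilt (LinearMap.range S.inA) M p n) : S.toXHatMap M n x ∈ S.filtX M p n :=
  S.toXHat_mem (S.psiM_mem_GX (S.ofHoch_mem_GB n p hx))

lemma toHochMap_mem {n : ℕ} {p : ℤ} {x : S.XHat M n} (hx : x ∈ S.filtX M p n) :
    S.toHochMap M n x ∈ hochFilt (LinearMap.range S.inA) M p n :=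
  S.toHoch_mem (S.phi_mem_GB n (S.ofXHat_mem_GX hx))

lemma hochHomotopy_mem {n : ℕ} {p : ℤ} {x : M ⊗[k] (⨂[k]^n (Bar k S.E))}
    (hx : x ∈ hochFilt (LinearMap.range S.inA) M p n) :
    S.hochHomotopy M n x ∈ hochFilt (LinearMap.range S.inA) M p (n + 1) :=
  neg_mem (S.toHoch_mem (S.omega_mem_GB n (S.ofHoch_mem_GB n p hx)))

lemma ofXHat_toXHatMap (n : ℕ) (x : M ⊗[k] (⨂[k]^n (Bar k S.E))) :
    S.ofXHat M n (S.toXHatMap M n x) = S.psiM M (S.ofHoch M n x) :=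
  S.ofXHat_toXHat (S.psiM_mem_GX (S.ofHoch_mem_GB n n (S.mem_hochFilt_top n x)))

lemma ofHoch_toHochMap (n : ℕ) (x : S.XHat M n) :
    S.ofHoch M n (S.toHochMap M n x) = S.phi M n (S.ofXHat M n x) :=
  S.ofHoch_toHoch (S.phi_mem_GB n (S.ofXHat_mem_GX (S.mem_filtX_top n x)))

lemma ofHoch_hochHomotopy (n : ℕ) (x : M ⊗[k] (⨂[k]^n (Bar k S.E))) :
    S.ofHoch M (n + 1) (S.hochHomotopy M n x) = -S.omega M n (S.ofHoch M n x) :=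
  (map_neg _ _).trans (congrArg Neg.neg
    (S.ofHoch_toHoch (S.omega_mem_GB n (S.ofHoch_mem_GB n n (S.mem_hochFilt_top n x)))))

/-- Identities between maps of the concrete complexes are checked after this embedding, or after
`ofXHat`, in the total modules, where they are already known. -/
lemma ofHoch_injective (n : ℕ) : Function.Injective (S.ofHoch M n) :=
  Function.LeftInverse.injective (S.toHoch_ofHoch n)

lemma ofXHat_injective (n : ℕ) : Function.Injective (S.ofXHat M n) :=
  Function.LeftInverse.injective (S.toXHat_ofXHat n)

lemma dHat_toXHatMap (hA : ∀ (a : A) (m : M), a • m = S.inA a • m) (n : ℕ)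
    (x : M ⊗[k] (⨂[k]^(n + 1) (Bar k S.E))) :
    S.dHat M n (S.toXHatMap M (n + 1) x) = S.toXHatMap M n (hochDiff k S.E M n x) :=
  S.ofXHat_injective n (by
    rw [S.ofXHat_dHat hA, ofXHat_toXHatMap, ofXHat_toXHatMap, S.dM_psiM hA, bM_ofHoch])

lemma hochDiff_toHochMap (hA : ∀ (a : A) (m : M), a • m = S.inA a • m) (n : ℕ)
    (x : S.XHat M (n + 1)) :
    hochDiff k S.E M n (S.toHochMap M (n + 1) x) = S.toHochMap M n (S.dHat M n x) :=
  S.ofHoch_injective n (by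
    rw [← bM_ofHoch, ofHoch_toHochMap, ofHoch_toHochMap,
      S.bM_phi hA n (S.ofXHat_mem_GX (S.mem_filtX_top _ x)), S.ofXHat_dHat hA])

lemma toXHatMap_toHochMap (hA : ∀ (a : A) (m : M), a • m = S.inA a • m) (n : ℕ)
    (x : S.XHat M n) : S.toXHatMap M n (S.toHochMap M n x) = x :=
  S.ofXHat_injective n (by
    rw [ofXHat_toXHatMap, ofHoch_toHochMap,
      S.psiM_phi hA n (S.ofXHat_mem_GX (S.mem_filtX_top _ x))])

lemma toHochMap_toXHatMap_zero (hA : ∀ (a : A) (m : M), a • m = S.inA a • m)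
    (x : M ⊗[k] (⨂[k]^0 (Bar k S.E))) :
    S.toHochMap M 0 (S.toXHatMap M 0 x) + hochDiff k S.E M 0 (S.hochHomotopy M 0 x) = x :=
  S.ofHoch_injective 0 (by
    have h : S.omega M 0 = 0 := rfl
    rw [map_add, ← bM_ofHoch, ofHoch_hochHomotopy, ofHoch_toHochMap, ofXHat_toXHatMap,
      S.phi_psiM_zero hA (S.ofHoch_mem_GB 0 0 (S.mem_hochFilt_top 0 x)), h, LinearMap.zero_apply,
      neg_zero, map_zero, add_zero])

lemma toHochMap_toXHatMap_succ (hA : ∀ (a : A) (m : M), a • m = S.inA a • m) (n : ℕ)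
    (x : M ⊗[k] (⨂[k]^(n + 1) (Bar k S.E))) :
    S.toHochMap M (n + 1) (S.toXHatMap M (n + 1) x) +
      hochDiff k S.E M (n + 1) (S.hochHomotopy M (n + 1) x) +
        S.hochHomotopy M n (hochDiff k S.E M n x) = x :=
  S.ofHoch_injective (n + 1) (by
    have h := S.bM_omega hA n (S.ofHoch_mem_GB (n + 1) _ (S.mem_hochFilt_top (n + 1) x))
    rw [map_add, map_add, ← bM_ofHoch, ofHoch_hochHomotopy, ofHoch_hochHomotopy, ofHoch_toHochMap,
      ofXHat_toXHatMap, ← bM_ofHoch, map_neg, add_assoc, ← neg_add, h]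
    abel)

/-- The comparison map from the Hochschild complex to `X̂`. -/
noncomputable def toXHatHom (hA : ∀ (a : A) (m : M), a • m = S.inA a • m) :
    (S.filteredHochschild M).K ⟶ (S.filteredXHat M (S.dHat_comp hA)).K :=
  FilteredComplex.ofModulesHom _ _ _ _ _ _ _ _ _ _ _ _ (S.toXHatMap M) (S.dHat_toXHatMap hA)

/-- The comparison map from `X̂` to the Hochschild complex. -/
noncomputable def toHochHom (hA : ∀ (a : A) (m : M), a • m = S.inA a • m) :
    (S.filteredXHat M (S.dHat_comp hA)).K ⟶ (S.filteredHochschild M).K :=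
  FilteredComplex.ofModulesHom _ _ _ _ _ _ _ _ _ _ _ _ (S.toHochMap M) (S.hochDiff_toHochMap hA)

variable (M) in
/-- The Hochschild complex and `X̂` are filtered homotopy equivalent, hence have isomorphic
convergent spectral sequences. -/
noncomputable def convergentIso (hA : ∀ (a : A) (m : M), a • m = S.inA a • m) :
    (S.filteredHochschild M).ConvergentIso (S.filteredXHat M (S.dHat_comp hA)) :=
  FilteredComplex.convergentIsoOfHomotopyEquiv (f := S.toXHatHom hA) (g := S.toHochHom hA)
    (fun _ _ _ hx => S.toXHatMap_mem hx) (fun _ _ _ hx => S.toHochMap_mem hx)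
    (FilteredComplex.homotopicToId_ofModules _ _ _ _ _ _ _ (fun n => S.toHochMap M n ∘ₗ S.toXHatMap M n)
      (fun _ _ => rfl) (S.hochHomotopy M) (fun _ _ _ hx => S.hochHomotopy_mem hx)
      (S.toHochMap_toXHatMap_zero hA) (S.toHochMap_toXHatMap_succ hA))
    -- On `X̂` the zero homotopy suffices, since `ψ φ = 1` strictly.
    (FilteredComplex.homotopicToId_ofModules _ _ _ _ _ _ _ (fun n => S.toXHatMap M n ∘ₗ S.toHochMap M n)
      (fun _ _ => rfl) 0 (fun _ _ _ _ => Submodule.zero_mem _)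
      (fun x => (congrArg₂ (· + ·) (S.toXHatMap_toHochMap hA 0 x) (map_zero _)).trans (add_zero x))
      (fun n x => by
        simp only [LinearMap.comp_apply, S.toXHatMap_toHochMap hA, Pi.zero_apply,
          LinearMap.zero_apply, map_zero, add_zero]))

end CrossedSystem

end HochschildSerre

theorem theorem2p1p2p2 {k A H M : Type*} [CommRing k] [Ring A] [Algebra k A] [Ring H]
    [HopfAlgebra k H] (S : HochschildSerre.CrossedSystem k A H)
    [AddCommGroup M] [Module k M] [Module S.E M] [IsScalarTower k S.E M]
    [Module S.Eᵐᵒᵖ M] [IsScalarTower k S.Eᵐᵒᵖ M] [SMulCommClass S.E S.Eᵐᵒᵖ M] :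
    ∃ hd : ∀ n, S.dHat M n ∘ₗ S.dHat M (n + 1) = 0,
      (∀ s r : ℕ, Nonempty ((S.filteredXHat M hd).E 1 s (s + r) ≃ₗ[k] S.HochA M s r)) ∧
      Nonempty ((S.filteredHochschild M).ConvergentIso (S.filteredXHat M hd)) := by
  let φ : A →+* S.E :=
    { toFun := S.inA
      map_one' := S.inA_one
      map_mul' := fun a b => (S.inA_mul a b).symm
      map_zero' := map_zero _
      map_add' := map_add _ }
  -- The bar complex of `A` needs `M` as an `A`-module. Restriction along `a ↦ a # 1` provides it,
  -- and `hA` then holds by definition.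
  let _ : Module A M := Module.compHom M φ
  have hA : ∀ (a : A) (m : M), a • m = S.inA a • m := fun _ _ => rfl
  have : IsScalarTower k A M := ⟨fun c a m => by rw [hA, hA, map_smul, smul_assoc]⟩
  exact ⟨S.dHat_comp hA, fun s r => ⟨S.firstPageEquiv M _ s r⟩, ⟨S.convergentIso M hA⟩⟩
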